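/- Let $d\ge 3$ and $\langle v\rangle=\sqrt{1+|v|^2}$. Let $\mu:\mathbb{R}^d\to\mathbb{R}$ satisfy the following two assumptions. (H1) $\mu\in L^1(\mathbb{R}^d)$ is smooth, $\langle v\rangle^{k}\nabla_v\mu\in W^{2,\infty}$ for some real $k>d$, and $\langle v\rangle^{4d+6}\nabla_v\mu\in W^{2d+5,1}$. (H2) (Penrose stability criterion) There is $\kappa>0$ such that $$\inf_{\gamma\ge 0}\ \inf_{\tau\in\mathbb{R},\,\xi\in\mathbb{R}^d}\left|1-\int_0^{+\infty}e^{-(\gamma+i\tau)s}\,\frac{1}{1+|\xi|^2}\,i\xi\cdot\widehat{\nabla_v\mu}(s\xi)\,ds\right|\ge\kappa,\qquad \widehat g(\xi)=\int_{\mathbb{R}^d}e^{-ix\cdot\xi}g(x)\,dx .$$ Then there exists $M>0$ (depending only on $d$ and $\mu$) such that for every $S\in L^1(\mathbb{R},L^1(\mathbb{R}^d)\cap L^\infty(\mathbb{R}^d))$ vanishing for $t<0$, the linear equation $$\rho(t,x)=\int_0^t\int_{\mathbb{R}^d}[\nabla_x(1-\Delta_x)^{-1}\rho](s,x-(t-s)v)\cdot\nabla_v\mu(v)\,dv\,ds+S(t,x),\qquad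 t\ge 0,$$ has a solution $\rho\in L^1_{loc}(\mathbb{R},L^2(\mathbb{R}^d))$ vanishing for $t<0$, unique up to null sets, and this solution satisfies, for (almost every) $t\ge1$, $$\|\rho(t)\|_{L^1}+t^d\|\rho(t)\|_{L^\infty}\le M\log(1+t)\,\|S\|_{Y^0_t},$$ $$t\,\|\nabla\rho(t)\|_{L^1}+t^{d+1}\|\nabla\rho(t)\|_{L^\infty}\le M\log(1+t)\,\|S\|_{Y^1_t},$$ where $$\|S\|_{Y^0_t}=\sup_{[0,t]}\left(\|S(s)\|_{L^1}+(1+s)^d\|S(s)\|_{L^\infty}\right),$$ $$\|S\|_{Y^1_t}=\sup_{[0,t]}\left(\|S(s)\|_{L^1}+(1+s)\|\nabla S(s)\|_{L^1}+(1+s)^{d+1}\|\nabla S(s)\|_{L^\infty}\right).$$ Here $\nabla$ is the weak gradient, norms are $+\infty$ where they are not finite (or where there is no weak gradient), and the suprema over time are essential suprema. -/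

import Mathlib

open MeasureTheory
open scoped ENNReal ContDiff

noncomputable section

namespace ScreenedVlasov

/-- The Euclidean space `ℝ^d`. -/
abbrev Sp (d : ℕ) : Type := EuclideanSpace ℝ (Fin d)

/-- The Japanese bracket `⟨v⟩ = (1 + |v|²)^{1/2}`. -/
def japanese {d : ℕ} (v : Sp d) : ℝ := Real.sqrt (1 + ‖v‖ ^ 2)

/-- Membership in `W^{m,p}` for smooth vector fields: all classical derivatives of order at most
`m` (which for smooth fields are the weak ones) belong to `L^p`. -/
def MemSobolevSmooth {d : ℕ} (m : ℕ) (p : ℝ≥0∞) (g : Sp d → Sp d) : Prop :=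
  ContDiff ℝ ∞ g ∧ ∀ j ≤ m, MemLp (iteratedFDeriv ℝ j g) p volume

/-- The assumption (H1): `μ ∈ L¹` is smooth, `⟨v⟩^k ∇μ ∈ W^{2,∞}` for some real `k > d`, and
`⟨v⟩^{4d+6} ∇μ ∈ W^{2d+5,1}`. -/
structure HypH1 {d : ℕ} (μ : Sp d → ℝ) : Prop where
  smooth : ContDiff ℝ ∞ μ
  integrable : Integrable μ volume
  bounded_weighted : ∃ k : ℝ, (d : ℝ) < k ∧
    MemSobolevSmooth 2 ∞ (fun v : Sp d => (japanese v ^ k) • gradient μ v)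
  integrable_weighted :
    MemSobolevSmooth (2 * d + 5) 1 (fun v : Sp d => (japanese v ^ (4 * d + 6)) • gradient μ v)

/-- The Fourier transform with the convention `ĝ(ξ) = ∫ e^{-i x·ξ} g(x) dx`. -/
def fourierHat {d : ℕ} (g : Sp d → ℂ) (ξ : Sp d) : ℂ :=
  ∫ x : Sp d, Complex.exp (-(Complex.I * ((inner ℝ x ξ : ℝ) : ℂ))) * g x

/-- The bilinear product `ξ · (∇μ)^(η) = ∑ⱼ ξⱼ (∂ⱼμ)^(η)`. -/
def dotFourierGrad {d : ℕ} (μ : Sp d → ℝ) (ξ η : Sp d) : ℂ :=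
  ∑ j : Fin d, ((ξ j : ℝ) : ℂ) * fourierHat (fun v : Sp d => ((gradient μ v j : ℝ) : ℂ)) η

/-- The assumption (H2), the Penrose stability criterion: for some `κ > 0`, the quantity
`|1 - ∫₀^∞ e^{-(γ+iτ)s} (1+|ξ|²)⁻¹ iξ·(∇μ)^(sξ) ds|` is at least `κ` for all `γ ≥ 0`, `τ ∈ ℝ`,
`ξ ∈ ℝ^d`. -/
def HypH2 {d : ℕ} (μ : Sp d → ℝ) : Prop :=
  ∃ κ : ℝ, 0 < κ ∧ ∀ γ : ℝ, 0 ≤ γ → ∀ (τ : ℝ) (ξ : Sp d),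
    κ ≤ ‖1 - ∫ s in Set.Ioi (0 : ℝ),
      Complex.exp (-(((γ : ℂ) + Complex.I * (τ : ℂ)) * (s : ℂ))) *
        ((1 / (1 + ‖ξ‖ ^ 2) : ℝ) : ℂ) * (Complex.I * dotFourierGrad μ ξ (s • ξ))‖

/-- `g` is the weak (distributional) gradient of `u`:
`∫ u ∇ψ = - ∫ ψ g` for all smooth compactly supported `ψ`. -/
structure IsWeakGradient {d : ℕ} (u : Sp d → ℝ) (g : Sp d → Sp d) : Prop where
  locallyIntegrable : LocallyIntegrable u volume
  locallyIntegrable_grad : LocallyIntegrable g volume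
  integral_eq : ∀ ψ : Sp d → ℝ, ContDiff ℝ ∞ ψ → HasCompactSupport ψ →
    ∫ x : Sp d, u x • gradient ψ x = -∫ x : Sp d, ψ x • g x

/-- The norm `‖∇u‖_{L^p}` of the weak gradient. Weak gradients are unique up to null sets, so the
infimum ranges over at most one class; it is `∞` if `u` has no weak gradient. -/
def gradNorm {d : ℕ} (u : Sp d → ℝ) (p : ℝ≥0∞) : ℝ≥0∞ :=
  ⨅ (g : Sp d → Sp d) (_ : IsWeakGradient u g), eLpNorm g p volume

/-- `g = ∇(1-Δ)⁻¹ u` for `u ∈ L²(ℝ^d)`: there is `φ ∈ H¹(ℝ^d)` with weak gradient `g` which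
solves `φ - Δφ = u` weakly. -/
def IsGradResolvent {d : ℕ} (u : Sp d → ℝ) (g : Sp d → Sp d) : Prop :=
  MemLp u 2 volume ∧ ∃ φ : Sp d → ℝ,
    MemLp φ 2 volume ∧ MemLp g 2 volume ∧ IsWeakGradient φ g ∧
    ∀ ψ : Sp d → ℝ, ContDiff ℝ ∞ ψ → HasCompactSupport ψ →
      (∫ x : Sp d, φ x * ψ x) + (∫ x : Sp d, (inner ℝ (g x) (gradient ψ x) : ℝ)) =
        ∫ x : Sp d, u x * ψ x

/-- Source terms: `S ∈ L¹(ℝ, L¹(ℝ^d) ∩ L^∞(ℝ^d))`, extended by zero to negative times. -/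
structure IsSource {d : ℕ} (S : ℝ → Sp d → ℝ) : Prop where
  measurable : AEStronglyMeasurable (fun z : ℝ × Sp d => S z.1 z.2) volume
  integrable : ∫⁻ t : ℝ, (eLpNorm (S t) 1 volume + eLpNorm (S t) ∞ volume) < ⊤
  eq_zero_of_neg : ∀ t < 0, S t = 0

/-- `ρ ∈ L¹_loc(ℝ, L²(ℝ^d))`, extended by zero to negative times, solves
`ρ(t,x) = ∫₀ᵗ ∫ [∇(1-Δ)⁻¹ρ](s, x-(t-s)v) · ∇μ(v) dv ds + S(t,x)` for almost all `t ≥ 0` and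
almost all `x`. -/
structure IsSolution {d : ℕ} (μ : Sp d → ℝ) (S ρ : ℝ → Sp d → ℝ) : Prop where
  measurable : AEStronglyMeasurable (fun z : ℝ × Sp d => ρ z.1 z.2) volume
  locallyIntegrable : ∀ T : ℝ, ∫⁻ t in Set.Icc (-T) T, eLpNorm (ρ t) 2 volume < ⊤
  eq_zero_of_neg : ∀ t < 0, ρ t = 0
  equation : ∃ F : ℝ → Sp d → Sp d,
    AEStronglyMeasurable (fun z : ℝ × Sp d => F z.1 z.2) volume ∧
    (∀ᵐ s : ℝ, IsGradResolvent (ρ s) (F s)) ∧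
    ∀ᵐ t : ℝ, 0 ≤ t → ∀ᵐ x : Sp d,
      ρ t x = (∫ s in (0 : ℝ)..t, ∫ v : Sp d,
        (inner ℝ (F s (x - (t - s) • v)) (gradient μ v) : ℝ)) + S t x

/-- `‖S‖_{Y⁰_t} = sup_{[0,t]} (‖S(s)‖_{L¹} + (1+s)^d ‖S(s)‖_{L^∞})`. -/
def normY0 {d : ℕ} (S : ℝ → Sp d → ℝ) (t : ℝ) : ℝ≥0∞ :=
  essSup (fun s : ℝ => eLpNorm (S s) 1 volume +
    ENNReal.ofReal ((1 + s) ^ d) * eLpNorm (S s) ∞ volume)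
    (volume.restrict (Set.Icc 0 t))

/-- `‖S‖_{Y¹_t} = sup_{[0,t]} (‖S(s)‖_{L¹} + (1+s) ‖∇S(s)‖_{L¹} + (1+s)^{d+1} ‖∇S(s)‖_{L^∞})`. -/
def normY1 {d : ℕ} (S : ℝ → Sp d → ℝ) (t : ℝ) : ℝ≥0∞ :=
  essSup (fun s : ℝ => eLpNorm (S s) 1 volume +
    ENNReal.ofReal (1 + s) * gradNorm (S s) 1 +
    ENNReal.ofReal ((1 + s) ^ (d + 1)) * gradNorm (S s) ∞)
    (volume.restrict (Set.Icc 0 t))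

end ScreenedVlasov

end

/-! Take the Fourier transform in x. At a fixed frequency w ≠ 0 the equation becomes a scalar
Volterra equation in time, ρ̂(t) = Ŝ(t) + ∫₀ᵗ V(t-s) ρ̂(s) ds with V = `volterraHat`. The Laplace
transform of V in time is m(z,w) = `dispersion`, and the Penrose criterion says that 1 - m stays
away from 0 on Re z ≥ 0. So m/(1-m) = `resolventSymbol` is holomorphic in the open right half plane,
its inverse transform `greenHat` vanishes for t ≤ 0 (`greenHat_of_nonpos`), and ρ = S + G * S, a
space-time convolution with the Green function G = `green` (`duhamel`).

The quantitative content is the decay of G. On the imaginary axis m is built from integrals ∫₀^∞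
e^{-2πiθs} p(sw) ds, which are homogeneous of degree -1 in (θ,w), so that each derivative costs a
factor 1/|w|. Since p, the transform of a derivative of μ, vanishes at 0, two integrations by parts
in s give decay θ⁻². Hence m, and by Penrose also m/(1-m), is a symbol of size |w|² /
((1+4π²|w|²)(θ²+|w|²)) with d+3 derivatives (`isSymbol_dispersion`, `isSymbol_resolvent`). Splitting
frequencies at |w| ~ 1/|(t,x)| (`norm_oscillatory_le`, `norm_fourierInv_le_of_symbol`) bounds G by
both |(t,x)|^{-d} and |(t,x)|^{-d-1}, and ∇G by |(t,x)|^{-d-2}. Consequently ‖G(t)‖_{L¹} is at most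
of order 1/t and is integrable near t = 0; its integral over [0,t] is the logarithm of the theorem
(`lintegral_green_le`).

The decay of ρ follows by cutting the time convolution at t/2. For s < t/2 the kernel is evaluated
at times of order t, so its pointwise decay is used against the L¹ norm of S, and derivatives fall
on G. For s ≥ t/2 the L¹ norm of G is used against the decay of S(s) in the relevant norm, and
derivatives fall on S. See `density_estimate_at`, `weakPartial_duhamel` and `partial_estimate_at`.

That the Duhamel formula solves the equation is checked on the Fourier side (`stConv_eq_transport`)
from the resolvent identity G = V + V * G in time (`greenHat_eq`). Uniqueness is an L² Grönwall
argument (`IsSolution.unique`), resting on the bound ‖∇(1-Δ)⁻¹u‖₂ ≤ d‖u‖₂ for every weak solution of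
the elliptic equation (`IsGradResolvent.eLpNorm_le`). -/

noncomputable section

namespace ScreenedVlasov

open scoped FourierTransform

variable {d : ℕ}

/-! ### Calculus of symbols of finite order -/

/-- `f` is a symbol on `U` up to order `N` with weight `κ` relative to the length scale `ℓ`. -/
structure SymbolBound {E : Type*} [NormedAddCommGroup E] [NormedSpace ℝ E] (U : Set E) (ℓ : E → ℝ)
    (N : ℕ) (κ : E → ℝ) (C : ℝ) (f : E → ℂ) : Prop where
  contDiffOn : ContDiffOn ℝ N f U
  bound : ∀ n ≤ N, ∀ z ∈ U, ‖iteratedFDeriv ℝ n f z‖ * ℓ z ^ n ≤ C * κ z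

namespace SymbolBound

variable {E : Type*} [NormedAddCommGroup E] [NormedSpace ℝ E] {U : Set E} {ℓ : E → ℝ}
  {N : ℕ} {κ κ₁ κ₂ : E → ℝ} {C C₁ C₂ : ℝ} {f g : E → ℂ}

theorem mono_order (hf : SymbolBound U ℓ N κ C f) {M : ℕ} (h : M ≤ N) : SymbolBound U ℓ M κ C f :=
  ⟨hf.contDiffOn.of_le (by exact_mod_cast h), fun n hn => hf.bound n (hn.trans h)⟩

theorem mono (hf : SymbolBound U ℓ N κ₁ C₁ f) (h : ∀ z ∈ U, C₁ * κ₁ z ≤ C₂ * κ₂ z) :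
    SymbolBound U ℓ N κ₂ C₂ f :=
  ⟨hf.contDiffOn, fun n hn z hz => (hf.bound n hn z hz).trans (h z hz)⟩

theorem congr (hU : IsOpen U) (hf : SymbolBound U ℓ N κ C f) (h : ∀ z ∈ U, g z = f z) :
    SymbolBound U ℓ N κ C g := by
  refine ⟨hf.contDiffOn.congr h, fun n hn z hz => ?_⟩
  have : g =ᶠ[nhds z] f := by
    filter_upwards [hU.mem_nhds hz] with y hy using h y hy
  rw [this.iteratedFDeriv ℝ n |>.eq_of_nhds]
  exact hf.bound n hn z hz

theorem norm_le (hf : SymbolBound U ℓ N κ C f) {z : E} (hz : z ∈ U) : ‖f z‖ ≤ C * κ z := by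
  simpa using hf.bound 0 (Nat.zero_le _) z hz

theorem const (c : ℂ) :
    SymbolBound U ℓ N (fun _ => 1) ‖c‖ (fun _ => c) := by
  refine ⟨contDiffOn_const, fun n _ z _ => ?_⟩
  rcases n with _ | n
  · simp
  · simp [iteratedFDeriv_succ_const]

/-- Leibniz rule: the power of the scale splits as ℓ^i ℓ^(n-i), and the binomial coefficients add up
to 2^n ≤ 2^N. -/
theorem mul (hU : IsOpen U) (hℓ : ∀ z ∈ U, 0 < ℓ z)
    (hf : SymbolBound U ℓ N κ₁ C₁ f) (hg : SymbolBound U ℓ N κ₂ C₂ g) :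
    SymbolBound U ℓ N (fun z => κ₁ z * κ₂ z) (2 ^ N * C₁ * C₂) (fun z => f z * g z) := by
  refine ⟨hf.contDiffOn.mul hg.contDiffOn, fun n hn z hz => ?_⟩
  have h1 := norm_iteratedFDerivWithin_mul_le (𝕜 := ℝ) hf.contDiffOn hg.contDiffOn
    hU.uniqueDiffOn hz (n := n) (by exact_mod_cast hn)
  simp only [iteratedFDerivWithin_of_isOpen _ hU hz] at h1
  have hz0 := hℓ z hz
  have hC1 : 0 ≤ C₁ * κ₁ z := (norm_nonneg _).trans (hf.norm_le hz)
  have hC2 : 0 ≤ C₂ * κ₂ z := (norm_nonneg _).trans (hg.norm_le hz)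
  calc _ ≤ (∑ i ∈ Finset.range (n + 1), (n.choose i : ℝ) * ‖iteratedFDeriv ℝ i f z‖ *
        ‖iteratedFDeriv ℝ (n - i) g z‖) * ℓ z ^ n := by gcongr
    _ = ∑ i ∈ Finset.range (n + 1), (n.choose i : ℝ) * ((‖iteratedFDeriv ℝ i f z‖ * ℓ z ^ i) *
        (‖iteratedFDeriv ℝ (n - i) g z‖ * ℓ z ^ (n - i))) := by
      rw [Finset.sum_mul]
      refine Finset.sum_congr rfl fun i hi => ?_
      have : i + (n - i) = n := by have := Finset.mem_range.1 hi; omega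
      conv_lhs => rw [← this, pow_add, this]
      ring
    _ ≤ ∑ i ∈ Finset.range (n + 1), (n.choose i : ℝ) * ((C₁ * κ₁ z) * (C₂ * κ₂ z)) := by
      refine Finset.sum_le_sum fun i hi => ?_
      have hi' := Finset.mem_range.1 hi
      refine mul_le_mul_of_nonneg_left ?_ (Nat.cast_nonneg _)
      exact mul_le_mul (hf.bound i (by omega) z hz) (hg.bound (n - i) (by omega) z hz)
        (by positivity) hC1
    _ = 2 ^ n * ((C₁ * κ₁ z) * (C₂ * κ₂ z)) := by
      rw [← Finset.sum_mul]
      congr 1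
      exact_mod_cast Nat.sum_range_choose n
    _ ≤ 2 ^ N * ((C₁ * κ₁ z) * (C₂ * κ₂ z)) := by
      gcongr
      norm_num
    _ = _ := by ring

theorem add (hU : IsOpen U) (hℓ : ∀ z ∈ U, 0 < ℓ z)
    (hf : SymbolBound U ℓ N κ C₁ f) (hg : SymbolBound U ℓ N κ C₂ g) :
    SymbolBound U ℓ N κ (C₁ + C₂) (fun z => f z + g z) := by
  refine ⟨hf.contDiffOn.add hg.contDiffOn, fun n hn z hz => ?_⟩
  have hz0 := hℓ z hz
  have e : iteratedFDeriv ℝ n (fun z => f z + g z) z =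
      iteratedFDeriv ℝ n f z + iteratedFDeriv ℝ n g z := by
    refine iteratedFDeriv_add_apply ?_ ?_
    · exact ((hf.contDiffOn.contDiffAt (hU.mem_nhds hz))).of_le (by exact_mod_cast hn)
    · exact ((hg.contDiffOn.contDiffAt (hU.mem_nhds hz))).of_le (by exact_mod_cast hn)
  rw [e]
  calc _ ≤ (‖iteratedFDeriv ℝ n f z‖ + ‖iteratedFDeriv ℝ n g z‖) * ℓ z ^ n := by
        gcongr; exact norm_add_le _ _
    _ = ‖iteratedFDeriv ℝ n f z‖ * ℓ z ^ n + ‖iteratedFDeriv ℝ n g z‖ * ℓ z ^ n := by ring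
    _ ≤ _ := by linarith [hf.bound n hn z hz, hg.bound n hn z hz]

theorem sum (hU : IsOpen U) (hℓ : ∀ z ∈ U, 0 < ℓ z) {ι : Type*} (s : Finset ι)
    {F : ι → E → ℂ} {Ci : ι → ℝ} (hF : ∀ i ∈ s, SymbolBound U ℓ N κ (Ci i) (F i)) :
    SymbolBound U ℓ N κ (∑ i ∈ s, Ci i) (fun z => ∑ i ∈ s, F i z) := by
  classical
  induction s using Finset.induction_on with
  | empty =>
    simpa using (const (U := U) (ℓ := ℓ) (N := N) (0 : ℂ)).mono (C₂ := 0) (κ₂ := κ) (by simp)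
  | insert a s ha ih =>
    simp only [Finset.sum_insert ha]
    exact add hU hℓ (hF a (by simp)) (ih fun i hi => hF i (by simp [hi]))

/-- Derivatives of order two and more vanish, so only the value and the operator norm have to be
compared with the weight. -/
theorem clm (L : E →L[ℝ] ℂ) (h0 : ∀ z ∈ U, ‖L z‖ ≤ C * κ z)
    (h1 : ∀ z ∈ U, ‖L‖ * ℓ z ≤ C * κ z) : SymbolBound U ℓ N κ C L := by
  refine ⟨L.contDiff.contDiffOn, fun n _ z hz => ?_⟩
  rcases n with _ | _ | n
  · simpa using h0 z hz
  · have : ‖iteratedFDeriv ℝ 1 L z‖ = ‖L‖ := by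
      rw [← norm_iteratedFDeriv_fderiv]; simp
    simpa [this] using h1 z hz
  · have : iteratedFDeriv ℝ (n + 2) L z = 0 := by
      rw [← norm_eq_zero, ← norm_iteratedFDeriv_fderiv]
      have : fderiv ℝ L = fun _ => L := by ext1 z; simp
      rw [this, iteratedFDeriv_succ_const]
      simp
    simp only [this, norm_zero, zero_mul]
    exact (norm_nonneg _).trans (h0 z hz)

/-- Faà di Bruno after normalisation. Dividing f by the number κ z at the point z under
consideration moves the value f z into a compact annulus c ≤ |y| ≤ D, on which all derivatives of
inversion are bounded; the factor 1/κ z returns once at the end. -/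
theorem inv (hU : IsOpen U) (hℓ : ∀ z ∈ U, 0 < ℓ z) (hκ : ∀ z ∈ U, 0 < κ z) {c : ℝ} (hc : 0 < c)
    (hf : SymbolBound U ℓ N κ C f) (hlow : ∀ z ∈ U, c * κ z ≤ ‖f z‖) :
    ∃ C', 0 ≤ C' ∧ SymbolBound U ℓ N (fun z => (κ z)⁻¹) C' (fun z => (f z)⁻¹) := by
  -- The maximum with 1 gives D ≤ D ^ i for i ≥ 1, the shape in which the composition estimate wants
  -- the derivative bounds.
  set D : ℝ := max C 1 with hD
  obtain ⟨K, hK⟩ : ∃ K : ℝ, ∀ i ≤ N, ∀ y : ℂ, c ≤ ‖y‖ → ‖y‖ ≤ D →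
      ‖iteratedFDeriv ℝ i (fun y : ℂ => y⁻¹) y‖ ≤ K := by
    have hopen : IsOpen ({0}ᶜ : Set ℂ) := isOpen_compl_singleton
    have hcd : ContDiffOn ℝ ω (fun y : ℂ => y⁻¹) ({0}ᶜ) :=
      (contDiffOn_inv ℂ).restrict_scalars ℝ
    have hcomp : IsCompact {y : ℂ | c ≤ ‖y‖ ∧ ‖y‖ ≤ D} := by
      refine Metric.isCompact_of_isClosed_isBounded ?_ ?_
      · exact (isClosed_le continuous_const continuous_norm).inter
          (isClosed_le continuous_norm continuous_const)
      · exact (Metric.isBounded_closedBall (x := (0 : ℂ)) (r := D)).subset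
          fun y hy => by simpa using hy.2
    have hsub : {y : ℂ | c ≤ ‖y‖ ∧ ‖y‖ ≤ D} ⊆ ({0}ᶜ : Set ℂ) := by
      intro y hy h0
      simp only [Set.mem_singleton_iff] at h0
      have := hy.1
      simp [h0] at this
      linarith
    have : ∀ i : ℕ, ∃ K : ℝ, ∀ y ∈ {y : ℂ | c ≤ ‖y‖ ∧ ‖y‖ ≤ D},
        ‖iteratedFDeriv ℝ i (fun y : ℂ => y⁻¹) y‖ ≤ K := by
      intro i
      refine hcomp.exists_bound_of_continuousOn ?_
      have h1 := hcd.continuousOn_iteratedFDerivWithin (m := i) (by simp) hopen.uniqueDiffOn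
      refine (h1.congr fun y hy => ?_).mono hsub
      rw [iteratedFDerivWithin_of_isOpen _ hopen hy]
    choose K hK using this
    refine ⟨∑ i ∈ Finset.range (N + 1), |K i|, fun i hi y h1 h2 => ?_⟩
    refine (hK i y ⟨h1, h2⟩).trans ((le_abs_self _).trans ?_)
    exact Finset.single_le_sum (f := fun i => |K i|) (fun _ _ => abs_nonneg _)
      (Finset.mem_range.2 (by omega))
  refine ⟨N.factorial * |K| * D ^ N, by positivity, ?_, ?_⟩
  · refine hf.contDiffOn.inv fun z hz h0 => ?_
    have := hlow z hz
    rw [h0, norm_zero] at this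
    have := mul_pos hc (hκ z hz)
    linarith
  · intro n hn z hz
    have hz0 := hκ z hz
    have hl := hℓ z hz
    set a : ℝ := (κ z)⁻¹ with ha
    have ha0 : 0 < a := inv_pos.2 hz0
    have hne : ∀ y ∈ U, f y ≠ 0 := fun y hy h0 => by
      have := hlow y hy
      rw [h0, norm_zero] at this
      have := mul_pos hc (hκ y hy)
      linarith
    have e : (fun z => (f z)⁻¹) = a • ((fun y : ℂ => y⁻¹) ∘ (a • f)) := by
      ext y
      simp only [Pi.smul_apply, Function.comp, Complex.real_smul, mul_inv]
      rw [← mul_assoc, mul_inv_cancel₀ (by exact_mod_cast ha0.ne'), one_mul]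
    have hopen : IsOpen ({0}ᶜ : Set ℂ) := isOpen_compl_singleton
    have hmaps : Set.MapsTo (a • f) U ({0}ᶜ : Set ℂ) := by
      intro y hy
      simp [ha0.ne', hne y hy]
    have hcd : ContDiffOn ℝ N (fun y : ℂ => y⁻¹) ({0}ᶜ) :=
      ((contDiffOn_inv ℂ).restrict_scalars ℝ)
    have hfa : ContDiffOn ℝ N (a • f) U := hf.contDiffOn.const_smul a
    have hat : ContDiffAt ℝ n f z := (hf.contDiffOn.contDiffAt (hU.mem_nhds hz)).of_le
      (by exact_mod_cast hn)
    have key := norm_iteratedFDerivWithin_comp_le (𝕜 := ℝ) hcd hfa (n := n) (by exact_mod_cast hn)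
      hopen.uniqueDiffOn hU.uniqueDiffOn hmaps hz (C := |K|) (D := D / ℓ z) ?_ ?_
    · rw [iteratedFDerivWithin_of_isOpen _ hU hz] at key
      rw [e, iteratedFDeriv_const_smul_apply, norm_smul, Real.norm_of_nonneg ha0.le]
      · calc _ ≤ a * (n.factorial * |K| * (D / ℓ z) ^ n) * ℓ z ^ n := by gcongr
          _ = n.factorial * |K| * D ^ n * a := by
            rw [div_pow]; field_simp
          _ ≤ _ := by
            gcongr
            · exact le_max_right _ _
      · refine (ContDiffOn.comp hcd hfa hmaps).contDiffAt (hU.mem_nhds hz) |>.of_le ?_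
        exact_mod_cast hn
    · intro i hi
      rw [iteratedFDerivWithin_of_isOpen _ hopen (hmaps hz)]
      refine (hK i (hi.trans hn) _ ?_ ?_).trans (le_abs_self _)
      · simp only [Pi.smul_apply, norm_smul, Real.norm_of_nonneg ha0.le]
        have := hlow z hz
        rw [ha, inv_mul_eq_div, le_div_iff₀ hz0]
        exact this
      · simp only [Pi.smul_apply, norm_smul, Real.norm_of_nonneg ha0.le]
        rw [ha, inv_mul_eq_div, div_le_iff₀ hz0]
        refine (hf.norm_le hz).trans ?_
        gcongr
        exact le_max_left _ _
    · intro i h1 hi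
      rw [iteratedFDerivWithin_of_isOpen _ hU hz, iteratedFDeriv_const_smul_apply
        (hat.of_le (by exact_mod_cast hi)), norm_smul, Real.norm_of_nonneg ha0.le, div_pow,
        le_div_iff₀ (by positivity), ha, mul_assoc, inv_mul_eq_div, div_le_iff₀ hz0]
      refine (hf.bound i (hi.trans hn) z hz).trans ?_
      gcongr
      calc C ≤ D := le_max_left _ _
        _ = D ^ 1 := (pow_one _).symm
        _ ≤ D ^ i := pow_le_pow_right₀ (le_max_right _ _) h1

end SymbolBound

/-! ### Homogeneous integrals along rays -/

section HomogeneousIntegral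

theorem integrableOn_inv_one_add_mul_sq {r : ℝ} (hr : 0 < r) :
    IntegrableOn (fun s : ℝ => ((1 + s * r) ^ 2)⁻¹) (Set.Ioi 0) ∧
      ∫ s in Set.Ioi (0 : ℝ), ((1 + s * r) ^ 2)⁻¹ = r⁻¹ := by
  have hpos : ∀ s ∈ Set.Ici (0 : ℝ), 0 < 1 + s * r := fun s hs => by
    have : 0 ≤ s * r := mul_nonneg hs hr.le
    linarith
  have hd : ∀ s ∈ Set.Ici (0 : ℝ), HasDerivAt (fun s : ℝ => -(r⁻¹ * (1 + s * r)⁻¹))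
      (((1 + s * r) ^ 2)⁻¹) s := by
    intro s hs
    have h1 : HasDerivAt (fun s : ℝ => 1 + s * r) r s := by
      simpa using ((hasDerivAt_id s).mul_const r).const_add 1
    have := ((h1.inv (hpos s hs).ne').const_mul r⁻¹).neg
    refine this.congr_deriv ?_
    have h2 := (hpos s hs).ne'
    field_simp
  have ht : Filter.Tendsto (fun s : ℝ => -(r⁻¹ * (1 + s * r)⁻¹)) Filter.atTop (nhds 0) := by
    have h1 : Filter.Tendsto (fun s : ℝ => 1 + s * r) Filter.atTop Filter.atTop :=
      Filter.tendsto_atTop_add_const_left _ _ (Filter.tendsto_id.atTop_mul_const hr)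
    have := (h1.inv_tendsto_atTop.const_mul r⁻¹).neg
    simpa using this
  have h0 : ∀ s ∈ Set.Ioi (0 : ℝ), 0 ≤ ((1 + s * r) ^ 2)⁻¹ := fun s _ => by positivity
  refine ⟨integrableOn_Ioi_deriv_of_nonneg' hd h0 ht, ?_⟩
  rw [integral_Ioi_of_hasDerivAt_of_nonneg' hd h0 ht]
  simp

universe u

variable {V F : Type u} [NormedAddCommGroup V] [NormedSpace ℝ V] [NormedAddCommGroup F]
  [NormedSpace ℝ F]

/-- The integral `∫₀^∞ s^k Q(s z) ds`, homogeneous of degree `-(k+1)`. -/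
def homInt (k : ℕ) (Q : ℝ × V → F) (z : ℝ × V) : F :=
  ∫ s in Set.Ioi (0 : ℝ), s ^ k • Q (s • z)

/-- Of the k + 2 powers of decay, two are kept for integrability in s and k absorb s^k at the price
of r^{-k}. Only the lower bound r for |w| enters, which makes the bound uniform near a given point.
-/
theorem norm_pow_smul_le {k : ℕ} {Q : ℝ × V → F} {C : ℝ}
    (hQ : ∀ z, ‖Q z‖ * (1 + ‖z.2‖) ^ (k + 2) ≤ C) {r s : ℝ} (hr : 0 < r) (hs : 0 < s)
    {z : ℝ × V} (hz : r ≤ ‖z.2‖) :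
    ‖s ^ k • Q (s • z)‖ ≤ C * (r⁻¹) ^ k * ((1 + s * r) ^ 2)⁻¹ := by
  have hsr : 0 < s * r := mul_pos hs hr
  have h1 := hQ (s • z)
  rw [Prod.smul_snd, norm_smul, Real.norm_of_nonneg hs.le] at h1
  have h2 : ‖Q (s • z)‖ * (1 + s * r) ^ (k + 2) ≤ C := by
    refine le_trans ?_ h1
    gcongr
  rw [norm_smul, norm_pow, Real.norm_of_nonneg hs.le, ← div_eq_mul_inv,
    le_div_iff₀ (by positivity)]
  calc s ^ k * ‖Q (s • z)‖ * (1 + s * r) ^ 2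
      = (r⁻¹) ^ k * (‖Q (s • z)‖ * ((s * r) ^ k * (1 + s * r) ^ 2)) := by
        rw [mul_pow, inv_pow]; field_simp
    _ ≤ (r⁻¹) ^ k * (‖Q (s • z)‖ * ((1 + s * r) ^ k * (1 + s * r) ^ 2)) := by
        gcongr; linarith
    _ = (r⁻¹) ^ k * (‖Q (s • z)‖ * (1 + s * r) ^ (k + 2)) := by ring
    _ ≤ (r⁻¹) ^ k * C := by gcongr
    _ = _ := by ring

theorem integrableOn_pow_smul {k : ℕ} {Q : ℝ × V → F} (hc : Continuous Q) {C : ℝ}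
    (hQ : ∀ z, ‖Q z‖ * (1 + ‖z.2‖) ^ (k + 2) ≤ C) {z : ℝ × V} (hz : z.2 ≠ 0) :
    IntegrableOn (fun s : ℝ => s ^ k • Q (s • z)) (Set.Ioi 0) := by
  have hr : 0 < ‖z.2‖ := norm_pos_iff.2 hz
  refine Integrable.mono' (((integrableOn_inv_one_add_mul_sq hr).1).const_mul (C * (‖z.2‖⁻¹) ^ k))
    ?_ ?_
  · exact (by fun_prop : Continuous fun s : ℝ => s ^ k • Q (s • z)).aestronglyMeasurable
  · filter_upwards [ae_restrict_mem measurableSet_Ioi] with s hs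
    exact norm_pow_smul_le hQ hr hs le_rfl

theorem norm_homInt_le {k : ℕ} {Q : ℝ × V → F} {C : ℝ}
    (hQ : ∀ z, ‖Q z‖ * (1 + ‖z.2‖) ^ (k + 2) ≤ C) {z : ℝ × V} (hz : z.2 ≠ 0) :
    ‖homInt k Q z‖ * ‖z.2‖ ^ (k + 1) ≤ C := by
  have hr : 0 < ‖z.2‖ := norm_pos_iff.2 hz
  have h1 : ‖homInt k Q z‖ ≤ ∫ s in Set.Ioi (0 : ℝ),
      C * (‖z.2‖⁻¹) ^ k * ((1 + s * ‖z.2‖) ^ 2)⁻¹ := by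
    refine norm_integral_le_of_norm_le ((integrableOn_inv_one_add_mul_sq hr).1.const_mul _) ?_
    filter_upwards [ae_restrict_mem measurableSet_Ioi] with s hs
    exact norm_pow_smul_le hQ hr hs le_rfl
  rw [integral_const_mul, (integrableOn_inv_one_add_mul_sq hr).2] at h1
  calc _ ≤ (C * (‖z.2‖⁻¹) ^ k * ‖z.2‖⁻¹) * ‖z.2‖ ^ (k + 1) := by gcongr
    _ = C := by rw [inv_pow, pow_succ]; field_simp

/-- The chain rule brings down one factor s, so differentiating raises k by one; this is how
homogeneity turns each derivative into a factor 1/|w|. Domination holds on the ball of radius |w|/2.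
-/
theorem hasFDerivAt_homInt [CompleteSpace F] {k : ℕ} {Q : ℝ × V → F} (hc : ContDiff ℝ 1 Q) {C : ℝ}
    (hQ : ∀ z, ‖Q z‖ * (1 + ‖z.2‖) ^ (k + 2) ≤ C)
    (hQ' : ∀ z, ‖fderiv ℝ Q z‖ * (1 + ‖z.2‖) ^ (k + 3) ≤ C) {z : ℝ × V} (hz : z.2 ≠ 0) :
    HasFDerivAt (homInt k Q) (homInt (k + 1) (fderiv ℝ Q) z) z := by
  have hr : 0 < ‖z.2‖ / 2 := half_pos (norm_pos_iff.2 hz)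
  have hball : ∀ y ∈ Metric.ball z (‖z.2‖ / 2), ‖z.2‖ / 2 ≤ ‖y.2‖ := by
    intro y hy
    have h1 : ‖y.2 - z.2‖ < ‖z.2‖ / 2 := 
      (norm_snd_le (y - z)).trans_lt (by simpa [dist_eq_norm] using hy)
    have := norm_sub_norm_le z.2 y.2
    rw [norm_sub_rev] at this
    linarith
  have hcf : Continuous (fderiv ℝ Q) := hc.continuous_fderiv (by norm_num)
  have hcQ := hc.continuous
  refine hasFDerivAt_integral_of_dominated_of_fderiv_le
    (F' := fun y s => s ^ (k + 1) • fderiv ℝ Q (s • y))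
    (bound := fun s => C * ((‖z.2‖ / 2)⁻¹) ^ (k + 1) * ((1 + s * (‖z.2‖ / 2)) ^ 2)⁻¹)
    (Metric.ball_mem_nhds z hr) ?_ ?_ ?_ ?_ ?_ ?_
  · refine Filter.Eventually.of_forall fun y => Continuous.aestronglyMeasurable ?_
    fun_prop
  · exact integrableOn_pow_smul hcQ hQ hz
  · exact Continuous.aestronglyMeasurable (by fun_prop)
  · filter_upwards [ae_restrict_mem measurableSet_Ioi] with s hs y hy
    exact norm_pow_smul_le hQ' hr hs (hball y hy)
  · exact ((integrableOn_inv_one_add_mul_sq hr).1).const_mul _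
  · refine Filter.Eventually.of_forall fun s y _ => ?_
    have h1 : HasFDerivAt (fun y : ℝ × V => s • y) (s • ContinuousLinearMap.id ℝ (ℝ × V)) y :=
      (ContinuousLinearMap.hasFDerivAt (ContinuousLinearMap.id ℝ (ℝ × V))).const_smul s
    have h2 := (((hc.differentiable (by norm_num)) (s • y)).hasFDerivAt.comp y h1).const_smul (s ^ k)
    refine h2.congr_fderiv (ContinuousLinearMap.ext fun v => ?_)
    simp [pow_succ, mul_smul]

-- Induction on N with the target space generalised, because the derivative is again such an
-- integral, with values in linear maps. `V` and `F` share a universe so that this new target stays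
-- in it.
omit [NormedAddCommGroup F] [NormedSpace ℝ F] in
theorem contDiffOn_homInt (N : ℕ) : ∀ {F : Type u} [NormedAddCommGroup F]
    [NormedSpace ℝ F] [CompleteSpace F] (k : ℕ) (Q : ℝ × V → F) (_ : ContDiff ℝ N Q) (C : ℝ)
    (_ : ∀ i ≤ N, ∀ z, ‖iteratedFDeriv ℝ i Q z‖ * (1 + ‖z.2‖) ^ (k + i + 2) ≤ C),
    ContDiffOn ℝ N (homInt k Q) {z | z.2 ≠ 0} ∧
      ∀ n ≤ N, ∀ z : ℝ × V, z.2 ≠ 0 →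
        ‖iteratedFDeriv ℝ n (homInt k Q) z‖ * ‖z.2‖ ^ (k + n + 1) ≤ C := by
  have hU : IsOpen {z : ℝ × V | z.2 ≠ 0} := isOpen_ne_fun continuous_snd continuous_const
  induction N with
  | zero =>
    intro F _ _ _ k Q hc C hQ
    have h0 : ∀ z, ‖Q z‖ * (1 + ‖z.2‖) ^ (k + 2) ≤ C := fun z => by simpa using hQ 0 le_rfl z
    have hcQ := hc.continuous
    refine ⟨?_, ?_⟩
    · simp only [CharP.cast_eq_zero, contDiffOn_zero]
      intro z hz
      refine ContinuousAt.continuousWithinAt ?_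
      have hr : 0 < ‖z.2‖ / 2 := half_pos (norm_pos_iff.2 hz)
      refine continuousAt_of_dominated
        (bound := fun s => C * ((‖z.2‖ / 2)⁻¹) ^ k * ((1 + s * (‖z.2‖ / 2)) ^ 2)⁻¹) ?_ ?_ ?_ ?_
      · exact Filter.Eventually.of_forall fun y => Continuous.aestronglyMeasurable (by fun_prop)
      · filter_upwards [Metric.ball_mem_nhds z hr] with y hy
        have h1 : ‖y.2 - z.2‖ < ‖z.2‖ / 2 := 
          (norm_snd_le (y - z)).trans_lt (by simpa [dist_eq_norm] using hy)
        have := norm_sub_norm_le z.2 y.2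
        rw [norm_sub_rev] at this
        filter_upwards [ae_restrict_mem measurableSet_Ioi] with s hs
        exact norm_pow_smul_le h0 hr hs (by linarith)
      · exact ((integrableOn_inv_one_add_mul_sq hr).1).const_mul _
      · exact Filter.Eventually.of_forall fun s => Continuous.continuousAt (by fun_prop)
    · intro n hn z hz
      obtain rfl : n = 0 := by omega
      simpa using norm_homInt_le h0 hz
  | succ N ih =>
    intro F _ _ _ k Q hc C hQ
    have h0 : ∀ z, ‖Q z‖ * (1 + ‖z.2‖) ^ (k + 2) ≤ C := fun z => by simpa using hQ 0 (by omega) z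
    have h1 : ∀ z, ‖fderiv ℝ Q z‖ * (1 + ‖z.2‖) ^ (k + 3) ≤ C := fun z => by
      have := hQ 1 (by omega) z
      rw [← norm_iteratedFDeriv_fderiv] at this
      simpa using this
    have hc1 : ContDiff ℝ 1 Q := hc.of_le (by norm_num)
    have hd : ∀ z : ℝ × V, z.2 ≠ 0 → HasFDerivAt (homInt k Q) (homInt (k + 1) (fderiv ℝ Q) z) z :=
      fun z hz => hasFDerivAt_homInt hc1 h0 h1 hz
    have hcd : ContDiff ℝ N (fderiv ℝ Q) := by
      refine hc.fderiv_right ?_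
      norm_cast
    obtain ⟨ihc, ihb⟩ := ih (k + 1) (fderiv ℝ Q) hcd C (fun i hi z => by
      rw [norm_iteratedFDeriv_fderiv, show k + 1 + i + 2 = k + (i + 1) + 2 by ring]
      exact hQ (i + 1) (by omega) z)
    have heq : ∀ z ∈ {z : ℝ × V | z.2 ≠ 0}, fderiv ℝ (homInt k Q) z =
        homInt (k + 1) (fderiv ℝ Q) z := fun z hz => (hd z hz).fderiv
    refine ⟨?_, ?_⟩
    · rw [Nat.cast_add, Nat.cast_one, contDiffOn_succ_iff_fderiv_of_isOpen hU]
      refine ⟨fun z hz => (hd z hz).differentiableAt.differentiableWithinAt, by simp, ?_⟩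
      exact ihc.congr heq
    · intro n hn z hz
      rcases n with _ | n
      · simpa using norm_homInt_le h0 hz
      · rw [← norm_iteratedFDeriv_fderiv]
        have : fderiv ℝ (homInt k Q) =ᶠ[nhds z] homInt (k + 1) (fderiv ℝ Q) := by
          filter_upwards [hU.mem_nhds hz] with y hy using heq y hy
        rw [(this.iteratedFDeriv ℝ n).eq_of_nhds, show k + (n + 1) + 1 = k + 1 + n + 1 by ring]
        exact ihb n (by omega) z hz

end HomogeneousIntegral

/-! ### Laplace transforms of decaying profiles along rays -/

section Profile

variable {d : ℕ}

/-- All derivatives of order at most `N` decay at least like `(1 + |w|)^{-K}`. -/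
structure DecayBound (N K : ℕ) (C : ℝ) (p : Sp d → ℂ) : Prop where
  contDiff : ContDiff ℝ N p
  bound : ∀ n ≤ N, ∀ w, ‖iteratedFDeriv ℝ n p w‖ * (1 + ‖w‖) ^ K ≤ C

/-- The `k`-th partial derivative. -/
def pd (k : Fin d) (p : Sp d → ℂ) (w : Sp d) : ℂ := fderiv ℝ p w (EuclideanSpace.single k 1)

theorem DecayBound.pd {N K : ℕ} {C : ℝ} {p : Sp d → ℂ} (hp : DecayBound (N + 1) K C p)
    (k : Fin d) : DecayBound N K C (pd k p) := by
  have h1 : ContDiff ℝ N (fderiv ℝ p) := hp.contDiff.fderiv_right (by norm_cast)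
  set L : (Sp d →L[ℝ] ℂ) →L[ℝ] ℂ := ContinuousLinearMap.apply ℝ ℂ (EuclideanSpace.single k 1)
  have hL : ‖L‖ ≤ 1 := by
    refine ContinuousLinearMap.opNorm_le_bound _ zero_le_one fun f => ?_
    refine (f.le_opNorm _).trans ?_
    simp
  have e : ScreenedVlasov.pd k p = L ∘ fderiv ℝ p := rfl
  refine ⟨e ▸ L.contDiff.comp h1, fun n hn w => ?_⟩
  have h2 : ‖iteratedFDeriv ℝ n (ScreenedVlasov.pd k p) w‖ ≤ ‖iteratedFDeriv ℝ (n + 1) p w‖ := by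
    rw [e, ← norm_iteratedFDeriv_fderiv]
    refine (L.norm_iteratedFDeriv_comp_left h1.contDiffAt (by exact_mod_cast hn)).trans ?_
    exact mul_le_of_le_one_left (norm_nonneg _) hL
  refine le_trans ?_ (hp.bound (n + 1) (by omega) w)
  gcongr

theorem DecayBound.norm_le {N K : ℕ} {C : ℝ} {p : Sp d → ℂ} (hp : DecayBound N K C p) (w : Sp d) :
    ‖p w‖ * (1 + ‖w‖) ^ K ≤ C := by
  simpa using hp.bound 0 (Nat.zero_le _) w

theorem DecayBound.mono {N K : ℕ} {C : ℝ} {p : Sp d → ℂ} (hp : DecayBound N K C p) {N' K' : ℕ}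
    (hN : N' ≤ N) (hK : K' ≤ K) : DecayBound N' K' C p := by
  refine ⟨hp.contDiff.of_le (by exact_mod_cast hN), fun n hn w => ?_⟩
  refine le_trans ?_ (hp.bound n (hn.trans hN) w)
  gcongr
  linarith [norm_nonneg w]

/-- The Laplace transform of `p` along the ray through `w`. -/
def rayLaplace (p : Sp d → ℂ) (z : ℂ) (w : Sp d) : ℂ :=
  ∫ s in Set.Ioi (0 : ℝ), Complex.exp (-(z * s)) * p (s • w)

theorem norm_exp_neg_mul_le {z : ℂ} (hz : 0 ≤ z.re) {s : ℝ} (hs : 0 ≤ s) :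
    ‖Complex.exp (-(z * s))‖ ≤ 1 := by
  rw [Complex.norm_exp, Real.exp_le_one_iff]
  simp only [Complex.neg_re, Complex.mul_re, Complex.ofReal_re, Complex.ofReal_im, mul_zero,
    sub_zero]
  nlinarith [mul_nonneg hz hs]

theorem norm_ray_le {N : ℕ} {C : ℝ} {p : Sp d → ℂ} (hp : DecayBound N 2 C p) (w : Sp d)
    {s : ℝ} (hs : 0 < s) : ‖p (s • w)‖ ≤ C * ((1 + s * ‖w‖) ^ 2)⁻¹ := by
  have h1 := hp.norm_le (s • w)
  rw [norm_smul, Real.norm_of_nonneg hs.le] at h1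
  rw [← div_eq_mul_inv, le_div_iff₀ (by positivity)]
  exact h1

theorem integrableOn_ray {N : ℕ} {C : ℝ} {p : Sp d → ℂ} (hp : DecayBound N 2 C p) {w : Sp d}
    (hw : w ≠ 0) : IntegrableOn (fun s : ℝ => p (s • w)) (Set.Ioi 0) := by
  have hr : 0 < ‖w‖ := norm_pos_iff.2 hw
  have hc := hp.contDiff.continuous
  refine Integrable.mono' ((integrableOn_inv_one_add_mul_sq hr).1.const_mul C)
    (Continuous.aestronglyMeasurable (by fun_prop)) ?_
  filter_upwards [ae_restrict_mem measurableSet_Ioi] with s hs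
  exact norm_ray_le hp w hs

theorem integrableOn_rayLaplace {N : ℕ} {C : ℝ} {p : Sp d → ℂ} (hp : DecayBound N 2 C p) {w : Sp d}
    (hw : w ≠ 0) {z : ℂ} (hz : 0 ≤ z.re) :
    IntegrableOn (fun s : ℝ => Complex.exp (-(z * s)) * p (s • w)) (Set.Ioi 0) := by
  refine (integrableOn_ray hp hw).bdd_mul (c := 1) (Continuous.aestronglyMeasurable (by fun_prop)) ?_
  filter_upwards [ae_restrict_mem measurableSet_Ioi] with s hs
  exact norm_exp_neg_mul_le hz (le_of_lt hs)

theorem norm_rayLaplace_le {N : ℕ} {C : ℝ} {p : Sp d → ℂ} (hp : DecayBound N 2 C p) {w : Sp d}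
    (hw : w ≠ 0) {z : ℂ} (hz : 0 ≤ z.re) : ‖rayLaplace p z w‖ ≤ C * ‖w‖⁻¹ := by
  have hr : 0 < ‖w‖ := norm_pos_iff.2 hw
  refine (norm_integral_le_of_norm_le ((integrableOn_inv_one_add_mul_sq hr).1.const_mul C)
    ?_).trans_eq ?_
  · filter_upwards [ae_restrict_mem measurableSet_Ioi] with s hs
    rw [norm_mul]
    exact (mul_le_of_le_one_left (norm_nonneg _) (norm_exp_neg_mul_le hz (le_of_lt hs))).trans
      (norm_ray_le hp w hs)
  · rw [integral_const_mul, (integrableOn_inv_one_add_mul_sq hr).2]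

theorem fderiv_eq_sum_pd (p : Sp d → ℂ) (y w : Sp d) :
    fderiv ℝ p y w = ∑ k, (w k : ℂ) * pd k p y := by
  conv_lhs => rw [← (EuclideanSpace.basisFun (Fin d) ℝ).sum_repr w]
  simp [pd]

/-- Integration by parts in s, using d/ds p(sw) = Σ w_k ∂_k p(sw). The boundary term at infinity
vanishes by decay, the one at 0 is p 0. -/
theorem mul_rayLaplace {N : ℕ} {C : ℝ} {p : Sp d → ℂ} (hp : DecayBound (N + 1) 2 C p) {w : Sp d}
    (hw : w ≠ 0) {z : ℂ} (hz : 0 ≤ z.re) :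
    z * rayLaplace p z w = p 0 + ∑ k, (w k : ℂ) * rayLaplace (pd k p) z w := by
  have hr : 0 < ‖w‖ := norm_pos_iff.2 hw
  have hI := integrableOn_rayLaplace hp hw hz
  have hIk := fun k => integrableOn_rayLaplace (hp.pd k) hw hz
  have hd : ∀ s : ℝ, HasDerivAt (fun s : ℝ => Complex.exp (-(z * s)) * p (s • w))
      (∑ k, (w k : ℂ) * (Complex.exp (-(z * s)) * pd k p (s • w)) -
        z * (Complex.exp (-(z * s)) * p (s • w))) s := by
    intro s
    have h1 : HasDerivAt (fun s : ℝ => Complex.exp (-(z * s)))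
        (Complex.exp (-(z * s)) * (-z)) s := by
      have : HasDerivAt (fun s : ℝ => -(z * (s : ℂ))) (-z) s := by
        have h := ((Complex.ofRealCLM.hasDerivAt (x := s)).const_mul z).neg
        exact h.congr_deriv (by simp)
      exact this.cexp
    have h2 : HasDerivAt (fun s : ℝ => p (s • w)) (fderiv ℝ p (s • w) w) s := by
      have h3 : HasDerivAt (fun s : ℝ => s • w) w s := by
        simpa using (hasDerivAt_id s).smul_const w
      have h4 : HasFDerivAt p (fderiv ℝ p (s • w)) (s • w) :=
        ((hp.contDiff.differentiable (by norm_cast)) _).hasFDerivAt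
      exact h4.comp_hasDerivAt s h3
    refine (h1.mul h2).congr_deriv ?_
    rw [fderiv_eq_sum_pd, Finset.mul_sum]
    have : ∀ k, Complex.exp (-(z * s)) * ((w k : ℂ) * pd k p (s • w)) =
      (w k : ℂ) * (Complex.exp (-(z * s)) * pd k p (s • w)) := fun k => by ring
    simp only [this]
    ring
  have hint : IntegrableOn (fun s : ℝ => ∑ k, (w k : ℂ) * (Complex.exp (-(z * s)) * pd k p (s • w)))
      (Set.Ioi 0) := integrable_finsetSum _ fun k _ => (hIk k).const_mul _
  have hlim : Filter.Tendsto (fun s : ℝ => Complex.exp (-(z * s)) * p (s • w)) Filter.atTop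
      (nhds 0) := by
    refine squeeze_zero_norm' (a := fun s => C * ((1 + s * ‖w‖) ^ 2)⁻¹) ?_ ?_
    · filter_upwards [Filter.eventually_gt_atTop 0] with s hs
      rw [norm_mul]
      exact (mul_le_of_le_one_left (norm_nonneg _) (norm_exp_neg_mul_le hz (le_of_lt hs))).trans
        (norm_ray_le hp w hs)
    · have h1 : Filter.Tendsto (fun s : ℝ => (1 + s * ‖w‖) ^ 2) Filter.atTop Filter.atTop :=
        (Filter.tendsto_pow_atTop (by norm_num)).comp
          (Filter.tendsto_atTop_add_const_left _ _ (Filter.tendsto_id.atTop_mul_const hr))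
      simpa using h1.inv_tendsto_atTop.const_mul C
  have key := integral_Ioi_of_hasDerivAt_of_tendsto (a := 0)
    (hd 0).continuousAt.continuousWithinAt (fun s _ => hd s) (hint.sub (hI.const_mul z)) hlim
  rw [integral_sub hint (hI.const_mul z), integral_const_mul,
    integral_finsetSum _ (fun k _ => (hIk k).const_mul _)] at key
  simp only [integral_const_mul, Complex.ofReal_zero, mul_zero, neg_zero, Complex.exp_zero,
    zero_smul, one_mul, zero_sub] at key
  simp only [rayLaplace]
  linear_combination -key

/-- Second integration by parts. As p 0 = 0, no term of size 1/z remains, so the transform decays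
like |z|⁻² at fixed w. -/
theorem sq_mul_rayLaplace {N : ℕ} {C : ℝ} {p : Sp d → ℂ} (hp : DecayBound (N + 2) 2 C p)
    (h0 : p 0 = 0) {w : Sp d} (hw : w ≠ 0) {z : ℂ} (hz : 0 ≤ z.re) :
    z ^ 2 * rayLaplace p z w = ∑ k, (w k : ℂ) * (pd k p 0 +
      ∑ l, (w l : ℂ) * rayLaplace (pd l (pd k p)) z w) := by
  have h1 := mul_rayLaplace (N := N + 1) hp hw hz
  rw [h0, zero_add] at h1
  rw [sq, mul_assoc, h1, Finset.mul_sum]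
  refine Finset.sum_congr rfl fun k _ => ?_
  rw [← mul_rayLaplace (N := N) (hp.pd k) hw hz]
  ring

end Profile

/-! ### The Laplace transform on the imaginary axis as a symbol in (θ, w) -/

section Frequency

variable {d : ℕ}

theorem isOpen_snd_ne_zero : IsOpen {z : ℝ × Sp d | z.2 ≠ 0} :=
  isOpen_ne_fun continuous_snd continuous_const

theorem iteratedFDeriv_phase_norm_le (c : ℂ) (n : ℕ) (θ : ℝ) :
    ‖iteratedFDeriv ℝ n (fun θ : ℝ => Complex.exp (c * θ)) θ‖ =
      ‖c‖ ^ n * ‖Complex.exp (c * θ)‖ := by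
  have : ∀ n : ℕ, iteratedDeriv n (fun θ : ℝ => Complex.exp (c * θ)) =
      fun θ : ℝ => c ^ n * Complex.exp (c * θ) := by
    intro n
    induction n with
    | zero => simp
    | succ n ih =>
      rw [iteratedDeriv_succ, ih]
      ext θ
      have h1 : HasDerivAt (fun θ : ℝ => c * (θ : ℂ)) c θ := by
        simpa using (Complex.ofRealCLM.hasDerivAt (x := θ)).const_mul c
      rw [(h1.cexp.const_mul (c ^ n)).deriv]
      ring
  rw [norm_iteratedFDeriv_eq_norm_iteratedDeriv, this, norm_mul, norm_pow]

theorem norm_compContinuousLinearMap_le_of_le_one {E F G : Type*} [NormedAddCommGroup E]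
    [NormedSpace ℝ E] [NormedAddCommGroup F] [NormedSpace ℝ F] [NormedAddCommGroup G]
    [NormedSpace ℝ G] {N : ℕ} {f : F → G} (hf : ContDiff ℝ N f) (L : E →L[ℝ] F) (hL : ‖L‖ ≤ 1)
    {n : ℕ} (hn : n ≤ N) (x : E) :
    ‖iteratedFDeriv ℝ n (f ∘ L) x‖ ≤ ‖iteratedFDeriv ℝ n f (L x)‖ := by
  rw [L.iteratedFDeriv_comp_right hf x (by exact_mod_cast hn)]
  refine (ContinuousMultilinearMap.norm_compContinuousLinearMap_le _ _).trans ?_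
  refine mul_le_of_le_one_right (norm_nonneg _) (Finset.prod_le_one (fun _ _ => norm_nonneg _) ?_)
  exact fun _ _ => hL

/-- The function `(θ, w) ↦ e^{-2πiθ} p(w)`. -/
def phased (p : Sp d → ℂ) (z : ℝ × Sp d) : ℂ :=
  Complex.exp (-(2 * Real.pi * Complex.I) * z.1) * p z.2

theorem symbolBound_phase (N : ℕ) : SymbolBound (Set.univ : Set (ℝ × Sp d)) (fun _ => 1) N
    (fun _ => 1) ((2 * Real.pi + 1) ^ N)
    (fun z => Complex.exp (-(2 * Real.pi * Complex.I) * z.1)) := by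
  have hcd : ContDiff ℝ N (fun θ : ℝ => Complex.exp (-(2 * Real.pi * Complex.I) * θ)) :=
    (contDiff_const.mul Complex.ofRealCLM.contDiff).cexp
  refine ⟨(hcd.comp contDiff_fst).contDiffOn, fun n hn z _ => ?_⟩
  have h := norm_compContinuousLinearMap_le_of_le_one hcd (ContinuousLinearMap.fst ℝ ℝ (Sp d))
    (ContinuousLinearMap.norm_fst_le ℝ ℝ (Sp d)) hn z
  simp only [one_pow, mul_one]
  refine h.trans ?_
  rw [iteratedFDeriv_phase_norm_le]
  have h1 : ‖Complex.exp (-(2 * Real.pi * Complex.I) * z.1)‖ = 1 := by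
    rw [Complex.norm_exp]; simp
  have h2 : ‖-(2 * (Real.pi : ℂ) * Complex.I)‖ = 2 * Real.pi := by
    simp [abs_of_pos Real.pi_pos]
  simp only [ContinuousLinearMap.coe_fst', h1, h2, mul_one]
  have := Real.pi_pos
  calc (2 * Real.pi) ^ n ≤ (2 * Real.pi + 1) ^ n := by gcongr; linarith
    _ ≤ _ := pow_le_pow_right₀ (by linarith) hn

theorem contDiff_phased {N K : ℕ} {C : ℝ} {p : Sp d → ℂ} (hp : DecayBound N K C p) :
    ContDiff ℝ N (phased p) := by
  exact ((contDiff_const.mul (Complex.ofRealCLM.contDiff.comp contDiff_fst)).cexp).mul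
    (hp.contDiff.comp contDiff_snd)

theorem phased_bound {N K : ℕ} {C : ℝ} {p : Sp d → ℂ} (hp : DecayBound N K C p) :
    ∀ n ≤ N, ∀ z : ℝ × Sp d, ‖iteratedFDeriv ℝ n (phased p) z‖ * (1 + ‖z.2‖) ^ K ≤
      2 ^ N * (2 * Real.pi + 1) ^ N * C := by
  have h1 : SymbolBound (Set.univ : Set (ℝ × Sp d)) (fun _ => 1) N
      (fun z => ((1 + ‖z.2‖) ^ K)⁻¹) C (fun z => p z.2) := by
    refine ⟨(hp.contDiff.comp contDiff_snd).contDiffOn, fun n hn z _ => ?_⟩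
    have h := norm_compContinuousLinearMap_le_of_le_one hp.contDiff
      (ContinuousLinearMap.snd ℝ ℝ (Sp d)) (ContinuousLinearMap.norm_snd_le ℝ ℝ (Sp d)) hn z
    simp only [one_pow, mul_one]
    refine h.trans ?_
    rw [← div_eq_mul_inv, le_div_iff₀ (by positivity)]
    exact hp.bound n hn z.2
  intro n hn z
  have := (SymbolBound.mul isOpen_univ (fun _ _ => one_pos) (symbolBound_phase N) h1).bound n hn z
    (Set.mem_univ _)
  simp only [one_pow, mul_one, one_mul] at this
  rwa [← div_eq_mul_inv, le_div_iff₀ (by positivity)] at this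

/-- The point `2πiθ` of the imaginary axis. -/
def freq (θ : ℝ) : ℂ := 2 * Real.pi * Complex.I * θ

theorem freq_re (θ : ℝ) : (freq θ).re = 0 := by simp [freq]

/-- Once the oscillating factor is part of the profile, time frequency and space frequency scale
together, and the joint homogeneity in (θ, w) becomes visible. -/
theorem rayLaplace_eq_homInt (p : Sp d → ℂ) (z : ℝ × Sp d) :
    rayLaplace p (freq z.1) z.2 = homInt 0 (phased p) z := by
  simp only [rayLaplace, homInt, phased, freq, pow_zero, one_smul, Prod.smul_fst, Prod.smul_snd,
    smul_eq_mul, Complex.ofReal_mul]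
  congr 1
  ext s
  ring_nf

/-- The phase has bounded derivatives and no decay, so all decay is in w. After i ≤ N
differentiations the homogeneous integral needs i + 2 powers of it, whence the N + 2 in the
hypothesis. -/
theorem symbolBound_rayLaplace {N : ℕ} {C : ℝ} {p : Sp d → ℂ} (hp : DecayBound N (N + 2) C p) :
    ∃ C', SymbolBound {z : ℝ × Sp d | z.2 ≠ 0} (fun z => ‖z.2‖) N (fun z => ‖z.2‖⁻¹) C'
      (fun z => rayLaplace p (freq z.1) z.2) := by
  refine ⟨2 ^ N * (2 * Real.pi + 1) ^ N * C, ?_⟩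
  obtain ⟨h1, h2⟩ := contDiffOn_homInt N 0 (phased p) (contDiff_phased hp)
    (2 ^ N * (2 * Real.pi + 1) ^ N * C) (fun i hi z => by
      refine le_trans ?_ (phased_bound hp i hi z)
      gcongr
      · linarith [norm_nonneg z.2]
      · omega)
  simp only [rayLaplace_eq_homInt]
  refine ⟨h1, fun n hn z hz => ?_⟩
  have hr : 0 < ‖z.2‖ := norm_pos_iff.2 hz
  rw [← div_eq_mul_inv, le_div_iff₀ hr, mul_assoc, ← pow_succ]
  simpa using h2 n hn z hz

end Frequency

theorem natCast_le_smooth (n : ℕ) : (n : WithTop ℕ∞) ≤ (∞ : WithTop ℕ∞) := by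
  exact_mod_cast (le_top : (n : ℕ∞) ≤ ⊤)

/-! ### Negative powers of the Japanese bracket -/

section Bracket

variable {d : ℕ}

/-- The `j`-th coordinate as a complex-valued linear form. -/
def coordL (j : Fin d) : Sp d →L[ℝ] ℂ := Complex.ofRealCLM ∘L (EuclideanSpace.proj j)

@[simp] theorem coordL_apply (j : Fin d) (v : Sp d) : coordL j v = (v j : ℂ) := rfl

theorem norm_coordL_le (j : Fin d) : ‖coordL j‖ ≤ 1 := by
  refine ContinuousLinearMap.opNorm_le_bound _ zero_le_one fun v => ?_
  simpa using PiLp.norm_apply_le v j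

theorem norm_coord_le (j : Fin d) (v : Sp d) : ‖(v j : ℂ)‖ ≤ ‖v‖ := by
  simpa using PiLp.norm_apply_le v j

theorem ofReal_norm_sq (v : Sp d) : ((‖v‖ ^ 2 : ℝ) : ℂ) = ∑ j, (v j : ℂ) * (v j : ℂ) := by
  rw [EuclideanSpace.norm_sq_eq]
  push_cast
  refine Finset.sum_congr rfl fun j _ => ?_
  rw [← Complex.ofReal_pow, ← Complex.ofReal_mul]
  norm_cast
  rw [Real.norm_eq_abs, sq_abs, sq]

theorem symbolBound_one_add_norm_sq (N : ℕ) : ∃ C, SymbolBound (Set.univ : Set (Sp d))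
    (fun _ => 1) N (fun v => 1 + ‖v‖ ^ 2) C (fun v => ((1 + ‖v‖ ^ 2 : ℝ) : ℂ)) := by
  have hU : IsOpen (Set.univ : Set (Sp d)) := isOpen_univ
  have hl : ∀ v ∈ (Set.univ : Set (Sp d)), (0 : ℝ) < (fun _ => 1) v := fun _ _ => one_pos
  have h1 : ∀ j : Fin d, SymbolBound (Set.univ : Set (Sp d)) (fun _ => 1) N
      (fun v => Real.sqrt (1 + ‖v‖ ^ 2)) 1 (coordL j) := fun j => by
    have hs : ∀ v : Sp d, ‖v‖ ≤ Real.sqrt (1 + ‖v‖ ^ 2) := fun v =>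
      Real.le_sqrt_of_sq_le (by linarith)
    have hs1 : ∀ v : Sp d, 1 ≤ Real.sqrt (1 + ‖v‖ ^ 2) := fun v =>
      Real.le_sqrt_of_sq_le (by nlinarith [sq_nonneg ‖v‖])
    refine SymbolBound.clm _ (fun v _ => ?_) (fun v _ => ?_)
    · rw [one_mul]; exact (norm_coord_le j v).trans (hs v)
    · rw [mul_one, one_mul]; exact (norm_coordL_le j).trans (hs1 v)
  have h2 : ∀ j : Fin d, SymbolBound (Set.univ : Set (Sp d)) (fun _ => 1) N
      (fun v => 1 + ‖v‖ ^ 2) (2 ^ N * 1 * 1) (fun v => coordL j v * coordL j v) := fun j =>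
    (SymbolBound.mul hU hl (h1 j) (h1 j)).mono fun v _ => by
      rw [Real.mul_self_sqrt (by positivity)]
  have h3 := SymbolBound.sum hU hl Finset.univ (fun j _ => h2 j)
  have h4 : SymbolBound (Set.univ : Set (Sp d)) (fun _ => 1) N
      (fun v => 1 + ‖v‖ ^ 2) 1 (fun _ => (1 : ℂ)) :=
    (SymbolBound.const (1 : ℂ)).mono fun v _ => by
      simp
  refine ⟨_, SymbolBound.congr hU (SymbolBound.add hU hl h4 h3) fun v _ => ?_⟩
  rw [Complex.ofReal_add, ofReal_norm_sq]
  simp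

theorem symbolBound_bracket_inv_pow (N K : ℕ) : ∃ C, SymbolBound (Set.univ : Set (Sp d))
    (fun _ => 1) N (fun v => ((1 + ‖v‖ ^ 2)⁻¹) ^ K) C
    (fun v => (((1 + ‖v‖ ^ 2 : ℝ) : ℂ)⁻¹) ^ K) := by
  obtain ⟨C, h⟩ := symbolBound_one_add_norm_sq (d := d) N
  obtain ⟨C', -, h'⟩ := SymbolBound.inv isOpen_univ (fun _ _ => one_pos)
    (fun v _ => by positivity) one_pos h (fun v _ => by
      rw [one_mul, Complex.norm_real, Real.norm_of_nonneg (by positivity)])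
  induction K with
  | zero => exact ⟨‖(1 : ℂ)‖, by simpa using SymbolBound.const (1 : ℂ)⟩
  | succ K ih =>
    obtain ⟨C₂, h₂⟩ := ih
    simp only [pow_succ]
    exact ⟨_, SymbolBound.mul isOpen_univ (fun _ _ => one_pos) h₂ h'⟩

end Bracket

/-! ### The Fourier transform of the gradient of μ -/

section GradHat

variable {d : ℕ}

/-- The `j`-th partial derivative of `μ` as a complex-valued function. -/
def gradC (μ : Sp d → ℝ) (j : Fin d) (v : Sp d) : ℂ := ((gradient μ v j : ℝ) : ℂ)

/-- The Fourier transform of `∂_j μ`. -/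
def gradHat (μ : Sp d → ℝ) (j : Fin d) : Sp d → ℂ := 𝓕 (gradC μ j)

theorem contDiff_gradient {μ : Sp d → ℝ} (h : ContDiff ℝ ∞ μ) : ContDiff ℝ ∞ (gradient μ) := by
  have h1 : ContDiff ℝ ∞ (fderiv ℝ μ) := h.fderiv_right (by norm_cast)
  exact (InnerProductSpace.toDual ℝ (Sp d)).symm.contDiff.comp h1

theorem contDiff_gradC {μ : Sp d → ℝ} (h : ContDiff ℝ ∞ μ) (j : Fin d) :
    ContDiff ℝ ∞ (gradC μ j) :=
  (coordL j).contDiff.comp (contDiff_gradient h)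

/-- Write ∂_jμ as (1+|v|²)^{-(2d+3)} times the weighted field of (H1) and apply the product rule for
symbols at length scale 1. The weight `ϖ` of the second factor is the sum of the norms of its
derivatives, an L¹ function, so the symbol bound is a domination by an integrable function. -/
theorem gradC_moment_integrable {μ : Sp d → ℝ} (h : HypH1 μ) (j : Fin d) {k n : ℕ}
    (hk : k ≤ 4 * d + 6) (hn : n ≤ 2 * d + 5) :
    Integrable (fun v => ‖v‖ ^ k * ‖iteratedFDeriv ℝ n (gradC μ j) v‖) := by
  set Wf : Sp d → Sp d := fun v => (japanese v ^ (4 * d + 6)) • gradient μ v with hWf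
  obtain ⟨hWc, hWi⟩ := h.integrable_weighted
  obtain ⟨C, hb⟩ := symbolBound_bracket_inv_pow (d := d) (2 * d + 5) (2 * d + 3)
  set ϖ : Sp d → ℝ := fun v => ∑ l ∈ Finset.range (2 * d + 6), ‖iteratedFDeriv ℝ l Wf v‖ with hw0
  have hw0i : Integrable ϖ := integrable_finsetSum _ fun l hl =>
    (memLp_one_iff_integrable.1 (hWi l (by have := Finset.mem_range.1 hl; omega))).norm
  have hG : SymbolBound (Set.univ : Set (Sp d)) (fun _ => 1) (2 * d + 5) ϖ 1
      (fun v => coordL j (Wf v)) := by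
    refine ⟨((coordL j).contDiff.comp (hWc.of_le (natCast_le_smooth _))).contDiffOn,
      fun l hl v _ => ?_⟩
    rw [one_pow, mul_one, one_mul]
    refine ((coordL j).norm_iteratedFDeriv_comp_left (f := Wf) (N := ∞) hWc.contDiffAt
      (by exact_mod_cast le_top)).trans ?_
    refine (mul_le_of_le_one_left (norm_nonneg _) (norm_coordL_le j)).trans ?_
    exact Finset.single_le_sum (f := fun l => ‖iteratedFDeriv ℝ l Wf v‖)
      (fun _ _ => norm_nonneg _) (Finset.mem_range.2 (by omega))
  have hmul := SymbolBound.congr isOpen_univ (SymbolBound.mul isOpen_univ (fun _ _ => one_pos) hb hG)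
    (g := gradC μ j) (fun v _ => by
      have e : (japanese v ^ (4 * d + 6) : ℝ) = (1 + ‖v‖ ^ 2) ^ (2 * d + 3) := by
        rw [japanese, show 4 * d + 6 = 2 * (2 * d + 3) by ring, pow_mul,
          Real.sq_sqrt (by positivity)]
      have hne : ((1 + ‖v‖ ^ 2 : ℝ) : ℂ) ≠ 0 := by
        norm_cast
        positivity
      simp only [hWf, e, coordL_apply, PiLp.smul_apply, smul_eq_mul, gradC]
      rw [Complex.ofReal_mul, Complex.ofReal_pow, ← mul_assoc, ← mul_pow, inv_mul_cancel₀ hne,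
        one_pow, one_mul])
  refine Integrable.mono' (hw0i.const_mul (2 ^ (2 * d + 5) * C * 1)) ?_ ?_
  · refine Continuous.aestronglyMeasurable ?_
    have := (contDiff_gradC h.smooth j).continuous_iteratedFDeriv (m := n)
      (by exact_mod_cast le_top)
    fun_prop
  · refine Filter.Eventually.of_forall fun v => ?_
    have hv := hmul.bound n hn v (Set.mem_univ _)
    simp only [one_pow, mul_one] at hv
    have hpos : (0 : ℝ) < (1 + ‖v‖ ^ 2) ^ (2 * d + 3) := by positivity
    have hw00 : 0 ≤ ϖ v := Finset.sum_nonneg fun _ _ => norm_nonneg _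
    rw [Real.norm_of_nonneg (by positivity)]
    have hvk : ‖v‖ ^ k ≤ (1 + ‖v‖ ^ 2) ^ (2 * d + 3) := by
      rcases le_or_gt ‖v‖ 1 with h1 | h1
      · exact (pow_le_one₀ (norm_nonneg _) h1).trans (one_le_pow₀ (by nlinarith [norm_nonneg v]))
      · calc ‖v‖ ^ k ≤ ‖v‖ ^ (4 * d + 6) := pow_le_pow_right₀ h1.le hk
          _ = (‖v‖ ^ 2) ^ (2 * d + 3) := by rw [← pow_mul]; ring_nf
          _ ≤ _ := by gcongr; linarith
    calc _ ≤ (1 + ‖v‖ ^ 2) ^ (2 * d + 3) * (2 ^ (2 * d + 5) * C *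
          (((1 + ‖v‖ ^ 2)⁻¹) ^ (2 * d + 3) * ϖ v)) := by gcongr
      _ = _ := by rw [inv_pow]; field_simp

theorem integrable_gradC {μ : Sp d → ℝ} (h : HypH1 μ) (j : Fin d) : Integrable (gradC μ j) := by
  have := gradC_moment_integrable h j (k := 0) (n := 0) (by omega) (by omega)
  simp only [pow_zero, one_mul, norm_iteratedFDeriv_zero] at this
  exact (integrable_norm_iff (contDiff_gradC h.smooth j).continuous.aestronglyMeasurable).1 this

/-- Moments of ∂_jμ give derivatives of its transform, derivatives give decay. The symbol needs d +
3 derivatives; the two integrations by parts cost two more, and integrability in s needs two powers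
of decay beyond d + 3. -/
theorem gradHat_decay {μ : Sp d → ℝ} (h : HypH1 μ) :
    ∃ C, ∀ j, DecayBound (d + 5) (d + 5) C (gradHat μ j) := by
  have key : ∀ j, ∃ C, DecayBound (d + 5) (d + 5) C (gradHat μ j) := by
    intro j
    have hcd : ContDiff ℝ ((d + 5 : ℕ) : ℕ∞) (gradC μ j) :=
      (contDiff_gradC h.smooth j).of_le (by exact_mod_cast le_top)
    have hint : ∀ k n : ℕ, (k : ℕ∞) ≤ ((d + 5 : ℕ) : ℕ∞) → (n : ℕ∞) ≤ ((d + 5 : ℕ) : ℕ∞) →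
        Integrable (fun v => ‖v‖ ^ k * ‖iteratedFDeriv ℝ n (gradC μ j) v‖) := fun k n hk hn => by
      have hk' : k ≤ d + 5 := by exact_mod_cast hk
      have hn' : n ≤ d + 5 := by exact_mod_cast hn
      exact gradC_moment_integrable h j (by omega) (by omega)
    have hcf : ContDiff ℝ ((d + 5 : ℕ) : ℕ∞) (gradHat μ j) :=
      Real.contDiff_fourier fun n hn => by
        simpa using hint n 0 hn (by simp)
    have hb : ∀ m : ℕ, ∃ C : ℝ, ∀ k ≤ d + 5, m ≤ d + 5 → ∀ w,
        ‖w‖ ^ m * ‖iteratedFDeriv ℝ k (gradHat μ j) w‖ ≤ C := by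
      intro m
      refine ⟨∑ k ∈ Finset.range (d + 6), |(2 * Real.pi) ^ k * (2 * k + 2) ^ m *
        ∑ p ∈ Finset.range (k + 1) ×ˢ Finset.range (m + 1),
          ∫ v, ‖v‖ ^ p.1 * ‖iteratedFDeriv ℝ p.2 (gradC μ j) v‖|, fun k hk hm w => ?_⟩
      refine (Real.pow_mul_norm_iteratedFDeriv_fourier_le hcd hint
        (by exact_mod_cast hk) (by exact_mod_cast hm) w).trans ((le_abs_self _).trans ?_)
      exact Finset.single_le_sum (f := fun k : ℕ => |(2 * Real.pi) ^ k * (2 * k + 2) ^ m *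
        ∑ p ∈ Finset.range (k + 1) ×ˢ Finset.range (m + 1),
          ∫ v, ‖v‖ ^ p.1 * ‖iteratedFDeriv ℝ p.2 (gradC μ j) v‖|) (fun _ _ => abs_nonneg _)
        (Finset.mem_range.2 (by omega))
    obtain ⟨C₀, h₀⟩ := hb 0
    obtain ⟨C₁, h₁⟩ := hb (d + 5)
    refine ⟨2 ^ (d + 5) * (C₀ + C₁), hcf, fun n hn w => ?_⟩
    have e0 := h₀ n hn (by omega) w
    have e1 := h₁ n hn le_rfl w
    have hw : (1 + ‖w‖) ^ (d + 5) ≤ 2 ^ (d + 5) * (1 + ‖w‖ ^ (d + 5)) := by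
      rcases le_or_gt ‖w‖ 1 with h1 | h1
      · calc (1 + ‖w‖) ^ (d + 5) ≤ 2 ^ (d + 5) := by gcongr; linarith
          _ ≤ _ := by
            have : 0 ≤ ‖w‖ ^ (d + 5) := by positivity
            nlinarith [pow_pos (two_pos : (0 : ℝ) < 2) (d + 5)]
      · calc (1 + ‖w‖) ^ (d + 5) ≤ (2 * ‖w‖) ^ (d + 5) := by gcongr; linarith
          _ = 2 ^ (d + 5) * ‖w‖ ^ (d + 5) := by ring
          _ ≤ _ := by gcongr; linarith
    calc _ ≤ ‖iteratedFDeriv ℝ n (gradHat μ j) w‖ * (2 ^ (d + 5) * (1 + ‖w‖ ^ (d + 5))) := by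
          gcongr
      _ = 2 ^ (d + 5) * (‖w‖ ^ 0 * ‖iteratedFDeriv ℝ n (gradHat μ j) w‖ +
          ‖w‖ ^ (d + 5) * ‖iteratedFDeriv ℝ n (gradHat μ j) w‖) := by ring
      _ ≤ _ := by gcongr
  choose C hC using key
  refine ⟨∑ j, |C j|, fun j => ⟨(hC j).contDiff, fun n hn w => ?_⟩⟩
  refine ((hC j).bound n hn w).trans ((le_abs_self _).trans ?_)
  exact Finset.single_le_sum (f := fun j => |C j|) (fun _ _ => abs_nonneg _) (Finset.mem_univ j)

/-- The value at 0 is the integral of a derivative of the integrable function μ, which vanishes by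
integration by parts against the constant 1. This cancellation is the source of the second-order
decay in the time frequency. -/
theorem gradHat_zero {μ : Sp d → ℝ} (h : HypH1 μ) (j : Fin d) : gradHat μ j 0 = 0 := by
  set f : Sp d → ℂ := fun v => (μ v : ℂ) with hf
  have hfc : ContDiff ℝ ∞ f := Complex.ofRealCLM.contDiff.comp h.smooth
  have hd : ∀ v, gradC μ j v = fderiv ℝ f v (EuclideanSpace.single j 1) := by
    intro v
    have h1 : HasFDerivAt μ (fderiv ℝ μ v) v :=
      ((h.smooth.differentiable (by simp)) v).hasFDerivAt
    have h2 : HasFDerivAt f (Complex.ofRealCLM ∘L fderiv ℝ μ v) v :=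
      Complex.ofRealCLM.hasFDerivAt.comp v h1
    rw [h2.fderiv]
    have h3 : fderiv ℝ μ v (EuclideanSpace.single j 1) = gradient μ v j := by
      conv_lhs => rw [← (InnerProductSpace.toDual ℝ (Sp d)).apply_symm_apply (fderiv ℝ μ v)]
      rw [InnerProductSpace.toDual_apply_apply, EuclideanSpace.inner_single_right]
      simp [gradient]
    simp [gradC, h3]
  have h0 : gradHat μ j 0 = ∫ v, gradC μ j v := by
    simp [gradHat, Real.fourier_eq']
  have h1 := integral_bilinear_hasLineDerivAt_right_eq_neg_left_of_integrable
    (μ := (volume : Measure (Sp d))) (B := ContinuousLinearMap.mul ℝ ℂ)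
    (f := fun _ => (1 : ℂ)) (f' := fun _ => 0) (g := f) (g' := gradC μ j)
    (v := EuclideanSpace.single j 1) (by simp) (by simpa using integrable_gradC h j)
    (by simpa [hf] using h.integrable.ofReal (𝕜 := ℂ))
    (fun v _ => (hasFDerivAt_const (1 : ℂ) v).hasLineDerivAt _)
    (fun v _ => by
      rw [hd]
      exact ((hfc.differentiable (by simp)) v).hasFDerivAt.hasLineDerivAt _)
  rw [h0]
  simpa using h1

theorem gradHat_neg (μ : Sp d → ℝ) (j : Fin d) (w : Sp d) :
    gradHat μ j (-w) = (starRingEnd ℂ) (gradHat μ j w) := by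
  simp only [gradHat, Real.fourier_eq']
  rw [← integral_conj]
  congr 1
  ext v
  simp only [gradC, smul_eq_mul, map_mul, ← Complex.exp_conj, Complex.conj_ofReal, Complex.conj_I,
    inner_neg_right]
  congr 2
  push_cast
  ring

end GradHat

/-! ### The dispersion function and the Penrose bound -/

section Penrose

/-- The multiplier of `(1 - Δ)⁻¹`. -/
def besselMult (w : Sp d) : ℝ := (1 + 4 * Real.pi ^ 2 * ‖w‖ ^ 2)⁻¹

theorem besselMult_pos (w : Sp d) : 0 < besselMult w := by unfold besselMult; positivity

theorem besselMult_le_one (w : Sp d) : besselMult w ≤ 1 := by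
  unfold besselMult
  exact inv_le_one_of_one_le₀ (by nlinarith [sq_nonneg (Real.pi * ‖w‖)])

/-- The Fourier-Laplace transform of the Volterra kernel. -/
def dispersion (μ : Sp d → ℝ) (z : ℂ) (w : Sp d) : ℂ :=
  besselMult w * (2 * Real.pi * Complex.I) * ∑ j, (w j : ℂ) * rayLaplace (gradHat μ j) z w

theorem fourierHat_two_pi (g : Sp d → ℂ) (u : Sp d) :
    fourierHat g ((2 * Real.pi) • u) = 𝓕 g u := by
  rw [fourierHat, Real.fourier_eq']
  congr 1
  ext v
  rw [inner_smul_right, smul_eq_mul]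
  congr 2
  push_cast
  ring

/-- Change of conventions only: z = γ + iτ and ξ = 2πw, so that 1 + |ξ|² becomes 1 + 4π²|w|² and
`fourierHat` at 2πw is the unitary transform at w. -/
theorem penrose_bound {μ : Sp d → ℝ} (h1 : HypH1 μ) (h2 : HypH2 μ) : ∃ κ : ℝ, 0 < κ ∧
    ∀ z : ℂ, 0 ≤ z.re → ∀ w : Sp d, w ≠ 0 → κ ≤ ‖1 - dispersion μ z w‖ := by
  obtain ⟨κ, hκ, h⟩ := h2
  obtain ⟨C, hC⟩ := gradHat_decay h1
  refine ⟨κ, hκ, fun z hz w hw => ?_⟩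
  have key := h z.re hz z.im ((2 * Real.pi) • w)
  convert key using 3
  have hI : ∀ j, IntegrableOn (fun s : ℝ => Complex.exp (-(z * s)) * gradHat μ j (s • w))
      (Set.Ioi 0) := fun j => integrableOn_rayLaplace ((hC j).mono le_rfl (by omega)) hw hz
  have e1 : ∀ s : ℝ, Complex.exp (-(((z.re : ℂ) + Complex.I * (z.im : ℂ)) * (s : ℂ))) *
        ((1 / (1 + ‖(2 * Real.pi) • w‖ ^ 2) : ℝ) : ℂ) *
        (Complex.I * dotFourierGrad μ ((2 * Real.pi) • w) (s • (2 * Real.pi) • w)) =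
      ∑ j, (besselMult w * (2 * Real.pi * Complex.I) * (w j : ℂ)) *
        (Complex.exp (-(z * s)) * gradHat μ j (s • w)) := by
    intro s
    have hb : (1 / (1 + ‖(2 * Real.pi) • w‖ ^ 2) : ℝ) = besselMult w := by
      rw [norm_smul, besselMult, one_div, mul_pow, Real.norm_of_nonneg (by positivity)]
      ring_nf
    have hz' : (z.re : ℂ) + Complex.I * (z.im : ℂ) = z := by
      rw [mul_comm]; exact Complex.re_add_im z
    rw [hb, hz', dotFourierGrad, smul_comm s (2 * Real.pi) w]
    simp only [fourierHat_two_pi, Finset.mul_sum]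
    refine Finset.sum_congr rfl fun j _ => ?_
    simp only [PiLp.smul_apply, smul_eq_mul, Complex.ofReal_mul, Complex.ofReal_ofNat]
    change _ * _ * (Complex.I * (_ * gradHat μ j (s • w))) = _
    ring
  simp_rw [e1]
  rw [integral_finsetSum _ fun j _ => (hI j).const_mul _]
  simp only [integral_const_mul, dispersion, Finset.mul_sum, rayLaplace, mul_assoc]

end Penrose

/-! ### Symbol bounds for the dispersion function and the resolvent -/

section Symbols

/-- Symbols on `ℝ × ℝ^d` away from `w = 0`, of finite order, relative to the scale `|w|`. -/
def IsSymbol (N : ℕ) (κ : ℝ × Sp d → ℝ) (f : ℝ × Sp d → ℂ) : Prop :=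
  ∃ C, SymbolBound {z : ℝ × Sp d | z.2 ≠ 0} (fun z => ‖z.2‖) N κ C f

theorem norm_snd_pos : ∀ z ∈ {z : ℝ × Sp d | z.2 ≠ 0}, 0 < (fun z : ℝ × Sp d => ‖z.2‖) z :=
  fun _ hz => norm_pos_iff.2 hz

namespace IsSymbol

variable {N : ℕ} {κ κ₁ κ₂ : ℝ × Sp d → ℝ} {f g : ℝ × Sp d → ℂ}

theorem congr (hf : IsSymbol N κ f) (h : ∀ z : ℝ × Sp d, z.2 ≠ 0 → g z = f z) :
    IsSymbol N κ g :=
  let ⟨C, hC⟩ := hf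
  ⟨C, hC.congr isOpen_snd_ne_zero h⟩

theorem mul (hf : IsSymbol N κ₁ f) (hg : IsSymbol N κ₂ g) :
    IsSymbol N (fun z => κ₁ z * κ₂ z) (fun z => f z * g z) :=
  let ⟨_, hC⟩ := hf
  let ⟨_, hD⟩ := hg
  ⟨_, hC.mul isOpen_snd_ne_zero norm_snd_pos hD⟩

theorem add (hf : IsSymbol N κ f) (hg : IsSymbol N κ g) : IsSymbol N κ (fun z => f z + g z) :=
  let ⟨_, hC⟩ := hf
  let ⟨_, hD⟩ := hg
  ⟨_, hC.add isOpen_snd_ne_zero norm_snd_pos hD⟩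

theorem sum {ι : Type*} (s : Finset ι) {F : ι → ℝ × Sp d → ℂ} (hF : ∀ i, IsSymbol N κ (F i)) :
    IsSymbol N κ (fun z => ∑ i ∈ s, F i z) := by
  choose C hC using hF
  exact ⟨_, SymbolBound.sum isOpen_snd_ne_zero norm_snd_pos s fun i _ => hC i⟩

theorem const (c : ℂ) : IsSymbol N (fun _ : ℝ × Sp d => 1) (fun _ => c) := ⟨_, SymbolBound.const c⟩

theorem mono (hf : IsSymbol N κ₁ f) (c : ℝ) (h0 : ∀ z : ℝ × Sp d, z.2 ≠ 0 → 0 ≤ κ₁ z)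
    (h : ∀ z : ℝ × Sp d, z.2 ≠ 0 → κ₁ z ≤ c * κ₂ z) : IsSymbol N κ₂ f := by
  obtain ⟨C, hC⟩ := hf
  refine ⟨|C| * c, hC.mono fun z hz => ?_⟩
  calc C * κ₁ z ≤ |C| * κ₁ z := by
        have := h0 z hz
        gcongr
        exact le_abs_self _
    _ ≤ |C| * (c * κ₂ z) := by gcongr; exact h z hz
    _ = _ := by ring

theorem const_mul (c : ℂ) (hf : IsSymbol N κ f) : IsSymbol N κ (fun z => c * f z) := by
  simpa using (IsSymbol.const c).mul hf

theorem inv (hf : IsSymbol N κ f) (hκ : ∀ z : ℝ × Sp d, z.2 ≠ 0 → 0 < κ z) {c : ℝ} (hc : 0 < c)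
    (h : ∀ z : ℝ × Sp d, z.2 ≠ 0 → c * κ z ≤ ‖f z‖) :
    IsSymbol N (fun z => (κ z)⁻¹) (fun z => (f z)⁻¹) :=
  let ⟨_, hC⟩ := hf
  let ⟨C', _, h'⟩ := hC.inv isOpen_snd_ne_zero norm_snd_pos hκ hc h
  ⟨C', h'⟩

theorem coord (N : ℕ) (j : Fin d) : IsSymbol N (fun z => ‖z.2‖) (fun z => (z.2 j : ℂ)) := by
  refine ⟨1, SymbolBound.clm (coordL j ∘L ContinuousLinearMap.snd ℝ ℝ (Sp d)) (fun z _ => ?_)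
    (fun z _ => ?_)⟩
  · rw [one_mul]; exact norm_coord_le j z.2
  · refine mul_le_mul_of_nonneg_right ?_ (norm_nonneg _)
    refine (ContinuousLinearMap.opNorm_comp_le _ _).trans ?_
    exact mul_le_one₀ (norm_coordL_le j) (norm_nonneg _)
      (ContinuousLinearMap.norm_snd_le ℝ ℝ (Sp d))

theorem time (N : ℕ) : IsSymbol N (fun z : ℝ × Sp d => |z.1| + ‖z.2‖) (fun z => (z.1 : ℂ)) := by
  refine ⟨1, SymbolBound.clm (Complex.ofRealCLM ∘L ContinuousLinearMap.fst ℝ ℝ (Sp d))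
    (fun z _ => ?_) (fun z _ => ?_)⟩
  · simp
  · have : ‖Complex.ofRealCLM ∘L ContinuousLinearMap.fst ℝ ℝ (Sp d)‖ ≤ 1 := by
      refine (ContinuousLinearMap.opNorm_comp_le _ _).trans ?_
      exact mul_le_one₀ (by simp) (norm_nonneg _) (ContinuousLinearMap.norm_fst_le ℝ ℝ (Sp d))
    nlinarith [norm_nonneg z.2, abs_nonneg z.1]

theorem norm_sq (N : ℕ) :
    IsSymbol N (fun z : ℝ × Sp d => ‖z.2‖ ^ 2) (fun z => ((‖z.2‖ ^ 2 : ℝ) : ℂ)) := by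
  simp only [ofReal_norm_sq]
  refine IsSymbol.sum _ fun j => ?_
  simpa only [sq] using (coord N j).mul (coord N j)

end IsSymbol

theorem isSymbol_besselMult (N : ℕ) :
    IsSymbol N (fun z : ℝ × Sp d => besselMult z.2) (fun z => (besselMult z.2 : ℂ)) := by
  have h1 : IsSymbol N (fun z : ℝ × Sp d => 1 + 4 * Real.pi ^ 2 * ‖z.2‖ ^ 2)
      (fun z => ((1 + 4 * Real.pi ^ 2 * ‖z.2‖ ^ 2 : ℝ) : ℂ)) := by
    have ha : IsSymbol N (fun z : ℝ × Sp d => 1 + 4 * Real.pi ^ 2 * ‖z.2‖ ^ 2)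
        (fun _ => (1 : ℂ)) := (IsSymbol.const 1).mono 1 (fun _ _ => zero_le_one) fun z _ => by
      nlinarith [sq_nonneg (Real.pi * ‖z.2‖)]
    have hb : IsSymbol N (fun z : ℝ × Sp d => 1 + 4 * Real.pi ^ 2 * ‖z.2‖ ^ 2)
        (fun z => ((4 * Real.pi ^ 2 : ℝ) : ℂ) * ((‖z.2‖ ^ 2 : ℝ) : ℂ)) :=
      ((IsSymbol.norm_sq N).mono 1 (fun _ _ => by positivity) fun z _ => by
        nlinarith [sq_nonneg (Real.pi * ‖z.2‖), sq_nonneg ‖z.2‖,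
          mul_le_mul_of_nonneg_right (show (1 : ℝ) ≤ 4 * Real.pi ^ 2 by
            nlinarith [Real.pi_gt_three]) (sq_nonneg ‖z.2‖)]).const_mul _
    refine (ha.add hb).congr fun z _ => ?_
    push_cast
    ring
  have h2 := h1.inv (fun z _ => by positivity) one_pos (fun z _ => by
    rw [one_mul, Complex.norm_real, Real.norm_of_nonneg (by positivity)])
  refine h2.congr fun z _ => ?_
  rw [besselMult]
  push_cast
  rfl

theorem isSymbol_wave (N : ℕ) : IsSymbol N (fun z : ℝ × Sp d => (z.1 ^ 2 + ‖z.2‖ ^ 2)⁻¹)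
    (fun z => ((z.1 ^ 2 + ‖z.2‖ ^ 2 : ℝ) : ℂ)⁻¹) := by
  have h1 : IsSymbol N (fun z : ℝ × Sp d => z.1 ^ 2 + ‖z.2‖ ^ 2)
      (fun z => ((z.1 ^ 2 + ‖z.2‖ ^ 2 : ℝ) : ℂ)) := by
    have ha := ((IsSymbol.time (d := d) N).mul (IsSymbol.time N)).mono
      (κ₂ := fun z : ℝ × Sp d => z.1 ^ 2 + ‖z.2‖ ^ 2) 2 (fun z _ => by positivity) (fun z _ => by
        nlinarith [sq_nonneg (|z.1| - ‖z.2‖), sq_abs z.1])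
    have hb := (IsSymbol.norm_sq (d := d) N).mono
      (κ₂ := fun z : ℝ × Sp d => z.1 ^ 2 + ‖z.2‖ ^ 2) 1 (fun z _ => by positivity) (fun z _ => by
        nlinarith [sq_nonneg z.1])
    refine (ha.add hb).congr fun z _ => ?_
    push_cast
    ring
  refine h1.inv (fun z hz => ?_) one_pos (fun z _ => ?_)
  · have : 0 < ‖z.2‖ := norm_pos_iff.2 hz
    positivity
  · rw [one_mul, Complex.norm_real, Real.norm_of_nonneg (by positivity)]

/-- The size of the dispersion relation. -/
def dispWeight (z : ℝ × Sp d) : ℝ := besselMult z.2 * ‖z.2‖ ^ 2 * (z.1 ^ 2 + ‖z.2‖ ^ 2)⁻¹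

theorem dispWeight_nonneg (z : ℝ × Sp d) : 0 ≤ dispWeight z := by
  have := (besselMult_pos z.2).le
  unfold dispWeight
  positivity

theorem dispWeight_le_one {z : ℝ × Sp d} (hz : z.2 ≠ 0) : dispWeight z ≤ 1 := by
  have h : 0 < ‖z.2‖ := norm_pos_iff.2 hz
  have h0 := besselMult_le_one z.2
  have h1 := besselMult_pos z.2
  rw [dispWeight, ← div_eq_mul_inv, div_le_one (by positivity)]
  nlinarith [sq_nonneg z.1, sq_nonneg ‖z.2‖]

theorem isSymbol_rayLaplace {N : ℕ} {C : ℝ} {p : Sp d → ℂ} (hp : DecayBound N (N + 2) C p) :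
    IsSymbol N (fun z => ‖z.2‖⁻¹) (fun z => rayLaplace p (freq z.1) z.2) :=
  symbolBound_rayLaplace hp

/-- The sum A = Σ w_j L_j of ray transforms has order zero. Then |w|² A is trivially of size |w|²,
and z² A is so by two integrations by parts; adding the two and dividing by θ² + |w|² gives the
weight without distinguishing regions. All this happens with d + 3 derivatives, the most that the
smoothness and decay of `gradHat_decay` allow here. -/
theorem isSymbol_dispersion {μ : Sp d → ℝ} (h : HypH1 μ) :
    IsSymbol (d + 3) dispWeight (fun z => dispersion μ (freq z.1) z.2) := by
  obtain ⟨C, hC⟩ := gradHat_decay h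
  set N := d + 3 with hN
  set A : ℝ × Sp d → ℂ := fun z => ∑ j, (z.2 j : ℂ) * rayLaplace (gradHat μ j) (freq z.1) z.2
    with hA
  have hA1 : IsSymbol N (fun z => ‖z.2‖ ^ 2) (fun z => ((‖z.2‖ ^ 2 : ℝ) : ℂ) * A z) := by
    have h1 : IsSymbol N (fun _ => 1) A := IsSymbol.sum _ fun j =>
      ((IsSymbol.coord N j).mul (isSymbol_rayLaplace ((hC j).mono (by omega) (by omega)))).mono 1
        (fun z _ => by positivity) (fun z hz => by
          have : ‖z.2‖ ≠ 0 := norm_ne_zero_iff.2 hz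
          rw [mul_inv_cancel₀ this, one_mul])
    simpa using (IsSymbol.norm_sq N).mul h1
  have hA2 : IsSymbol N (fun z => ‖z.2‖ ^ 2) (fun z => freq z.1 ^ 2 * A z) := by
    have h1 : IsSymbol N (fun z => ‖z.2‖ ^ 2) (fun z : ℝ × Sp d => ∑ j, (z.2 j : ℂ) *
        ∑ k, (z.2 k : ℂ) * (pd k (gradHat μ j) 0 + ∑ l, (z.2 l : ℂ) *
          rayLaplace (pd l (pd k (gradHat μ j))) (freq z.1) z.2)) := by
      refine IsSymbol.sum _ fun j => ?_
      simp only [sq]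
      refine (IsSymbol.coord N j).mul (IsSymbol.sum _ fun k => ?_)
      suffices hs : IsSymbol N (fun _ => 1) (fun z : ℝ × Sp d => (pd k (gradHat μ j) 0 +
          ∑ l, (z.2 l : ℂ) * rayLaplace (pd l (pd k (gradHat μ j))) (freq z.1) z.2)) by
        simpa using (IsSymbol.coord N k).mul hs
      refine (IsSymbol.const _).add (IsSymbol.sum _ fun l => ?_)
      have hdec : DecayBound N (N + 2) C (pd l (pd k (gradHat μ j))) := by
        have h5 : DecayBound (N + 1 + 1) (N + 2) C (gradHat μ j) :=
          (hC j).mono (by omega) (by omega)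
        exact (h5.pd k).pd l
      refine ((IsSymbol.coord N l).mul (isSymbol_rayLaplace hdec)).mono 1
        (fun z _ => by positivity) (fun z hz => ?_)
      have : ‖z.2‖ ≠ 0 := norm_ne_zero_iff.2 hz
      rw [mul_inv_cancel₀ this, one_mul]
    refine h1.congr fun z hz => ?_
    simp only [hA, Finset.mul_sum]
    refine Finset.sum_congr rfl fun j _ => ?_
    have := sq_mul_rayLaplace (N := 0) ((hC j).mono (by omega) (by omega)) (gradHat_zero h j) hz
      (freq_re z.1).ge
    rw [← mul_assoc, mul_comm (freq z.1 ^ 2), mul_assoc, this]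
    simp only [Finset.mul_sum]
  have h3 : IsSymbol N (fun z => ‖z.2‖ ^ 2) (fun z => ((z.1 ^ 2 + ‖z.2‖ ^ 2 : ℝ) : ℂ) * A z) := by
    -- On the imaginary axis z² = (2πiθ)² = -4π²θ², so a constant multiple turns z² A into θ² A.
    refine (hA1.add (hA2.const_mul (-(4 * Real.pi ^ 2 : ℂ)⁻¹))).congr fun z _ => ?_
    have hpi : (Real.pi : ℂ) ≠ 0 := by exact_mod_cast Real.pi_ne_zero
    have : freq z.1 ^ 2 = -(4 * Real.pi ^ 2) * (z.1 : ℂ) ^ 2 := by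
      rw [freq]; ring_nf; rw [Complex.I_sq]; ring
    rw [this]
    push_cast
    field_simp
    ring
  have h4 := (((isSymbol_besselMult N).const_mul (2 * Real.pi * Complex.I)).mul
    ((isSymbol_wave N).mul h3))
  refine (h4.mono 1 (fun z _ => ?_) (fun z _ => ?_)).congr fun z hz => ?_
  · have := (besselMult_pos z.2).le
    positivity
  · rw [dispWeight]; apply le_of_eq; ring
  · have h0 : 0 < ‖z.2‖ := norm_pos_iff.2 hz
    have h6 : ((z.1 ^ 2 + ‖z.2‖ ^ 2 : ℝ) : ℂ) ≠ 0 := by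
      norm_cast
      positivity
    rw [inv_mul_cancel_left₀ h6, dispersion]
    ring

/-- The Fourier-Laplace transform of the resolvent kernel. -/
def resolventSymbol (μ : Sp d → ℝ) (z : ℂ) (w : Sp d) : ℂ :=
  dispersion μ z w * (1 - dispersion μ z w)⁻¹

/-- The Penrose bound makes 1 - m elliptic of order zero, so its inverse is again of order zero and
m/(1-m) inherits the weight of m. -/
theorem isSymbol_resolvent {μ : Sp d → ℝ} (h1 : HypH1 μ) (h2 : HypH2 μ) :
    IsSymbol (d + 3) dispWeight (fun z => resolventSymbol μ (freq z.1) z.2) := by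
  obtain ⟨κ, hκ, h⟩ := penrose_bound h1 h2
  have hm := isSymbol_dispersion h1
  have hm1 : IsSymbol (d + 3) (fun _ => 1) (fun z => 1 - dispersion μ (freq z.1) z.2) := by
    refine ((IsSymbol.const (1 : ℂ)).add ((hm.mono 1 (fun z _ => dispWeight_nonneg z)
      (fun z hz => ?_)).const_mul (-1))).congr fun z _ => ?_
    · rw [one_mul]; exact dispWeight_le_one hz
    · ring
  simpa [resolventSymbol] using hm.mul (hm1.inv (fun _ _ => one_pos) hκ fun z hz => by
    rw [mul_one]; exact h _ (freq_re z.1).ge z.2 hz)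

end Symbols

/-! ### Holomorphy in the right half plane and causality -/

section HalfPlane

theorem continuousOn_rayLaplace {N : ℕ} {C : ℝ} {p : Sp d → ℂ} (hp : DecayBound N 2 C p) {w : Sp d}
    (hw : w ≠ 0) : ContinuousOn (fun z => rayLaplace p z w) {z : ℂ | 0 ≤ z.re} := by
  intro z hz
  have hc := hp.contDiff.continuous
  refine continuousWithinAt_of_dominated (bound := fun s => ‖p (s • w)‖) ?_ ?_
    (integrableOn_ray hp hw).norm ?_
  · exact Filter.Eventually.of_forall fun y => Continuous.aestronglyMeasurable (by fun_prop)
  · filter_upwards [self_mem_nhdsWithin] with y hy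
    filter_upwards [ae_restrict_mem measurableSet_Ioi] with s hs
    rw [norm_mul]
    exact mul_le_of_le_one_left (norm_nonneg _) (norm_exp_neg_mul_le hy (le_of_lt hs))
  · exact Filter.Eventually.of_forall fun s => Continuous.continuousWithinAt (by fun_prop)

/-- Differentiating in z brings down -s, which is paid for by the third power of decay. -/
theorem differentiableAt_rayLaplace {N : ℕ} {C : ℝ} {p : Sp d → ℂ} (hp : DecayBound N 3 C p)
    {w : Sp d} (hw : w ≠ 0) {z : ℂ} (hz : 0 < z.re) :
    DifferentiableAt ℂ (fun z => rayLaplace p z w) z := by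
  have hc := hp.contDiff.continuous
  have hr : 0 < ‖w‖ := norm_pos_iff.2 hw
  have hp2 : DecayBound N 2 C p := hp.mono le_rfl (by norm_num)
  have hopen : {y : ℂ | 0 < y.re} ∈ nhds z :=
    (isOpen_lt continuous_const Complex.continuous_re).mem_nhds hz
  refine (hasDerivAt_integral_of_dominated_loc_of_deriv_le
    (F := fun (z : ℂ) (s : ℝ) => Complex.exp (-(z * s)) * p (s • w))
    (F' := fun (z : ℂ) (s : ℝ) => Complex.exp (-(z * s)) * (-(s : ℂ)) * p (s • w))
    (bound := fun s => C * ‖w‖⁻¹ * ((1 + s * ‖w‖) ^ 2)⁻¹) hopen ?_ ?_ ?_ ?_ ?_ ?_).2.differentiableAt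
  · exact Filter.Eventually.of_forall fun y => Continuous.aestronglyMeasurable (by fun_prop)
  · exact integrableOn_rayLaplace hp2 hw hz.le
  · exact Continuous.aestronglyMeasurable (by fun_prop)
  · filter_upwards [ae_restrict_mem measurableSet_Ioi] with s hs y hy
    have hs0 : 0 < s := hs
    have h1 := hp.norm_le (s • w)
    rw [norm_smul, Real.norm_of_nonneg hs0.le] at h1
    rw [norm_mul, norm_mul, norm_neg, Complex.norm_real, Real.norm_of_nonneg hs0.le]
    have h2 := norm_exp_neg_mul_le (le_of_lt hy) hs0.le
    calc _ ≤ 1 * s * ‖p (s • w)‖ := by gcongr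
      _ = ‖w‖⁻¹ * ((s * ‖w‖) * ‖p (s • w)‖) := by field_simp
      _ ≤ ‖w‖⁻¹ * ((1 + s * ‖w‖) * ‖p (s • w)‖) := by gcongr; linarith
      _ = ‖w‖⁻¹ * (‖p (s • w)‖ * (1 + s * ‖w‖) ^ 3) * ((1 + s * ‖w‖) ^ 2)⁻¹ := by
        field_simp
      _ ≤ ‖w‖⁻¹ * C * ((1 + s * ‖w‖) ^ 2)⁻¹ := by gcongr
      _ = _ := by ring
  · exact ((integrableOn_inv_one_add_mul_sq hr).1).const_mul _
  · refine Filter.Eventually.of_forall fun s y _ => ?_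
    have h1 : HasDerivAt (fun y : ℂ => -(y * s)) (-(s : ℂ)) y := by
      have := ((hasDerivAt_id y).mul_const (s : ℂ)).neg
      exact this.congr_deriv (by simp)
    exact (h1.cexp).mul_const _

theorem sq_mul_rayLaplace_bound {N : ℕ} {C : ℝ} {p : Sp d → ℂ} (hp : DecayBound (N + 2) 2 C p)
    (h0 : p 0 = 0) {w : Sp d} (hw : w ≠ 0) :
    ∃ D, ∀ z : ℂ, 0 ≤ z.re → ‖rayLaplace p z w‖ * (1 + ‖z‖ ^ 2) ≤ D := by
  refine ⟨C * ‖w‖⁻¹ + ∑ k, ‖(w k : ℂ)‖ * (‖pd k p 0‖ + ∑ l, ‖(w l : ℂ)‖ * (C * ‖w‖⁻¹)),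
    fun z hz => ?_⟩
  have h1 := norm_rayLaplace_le (hp.mono (le_refl _) le_rfl) hw hz
  have h2 := congrArg norm (sq_mul_rayLaplace hp h0 hw hz)
  rw [norm_mul, norm_pow] at h2
  have h3 : ‖∑ k, (w k : ℂ) * (pd k p 0 + ∑ l, (w l : ℂ) * rayLaplace (pd l (pd k p)) z w)‖ ≤
      ∑ k, ‖(w k : ℂ)‖ * (‖pd k p 0‖ + ∑ l, ‖(w l : ℂ)‖ * (C * ‖w‖⁻¹)) := by
    refine norm_sum_le_of_le _ fun k _ => ?_
    rw [norm_mul]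
    gcongr
    refine (norm_add_le _ _).trans ?_
    gcongr
    refine norm_sum_le_of_le _ fun l _ => ?_
    rw [norm_mul]
    gcongr
    exact norm_rayLaplace_le ((DecayBound.pd (N := N + 1) hp k).pd l) hw hz
  nlinarith

theorem continuousOn_dispersion {μ : Sp d → ℝ} (h : HypH1 μ) {w : Sp d} (hw : w ≠ 0) :
    ContinuousOn (fun z => dispersion μ z w) {z : ℂ | 0 ≤ z.re} := by
  obtain ⟨C, hC⟩ := gradHat_decay h
  exact continuousOn_const.mul (continuousOn_finsetSum _ fun j _ => continuousOn_const.mul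
    (continuousOn_rayLaplace ((hC j).mono le_rfl (by omega)) hw))

theorem differentiableAt_dispersion {μ : Sp d → ℝ} (h : HypH1 μ) {w : Sp d} (hw : w ≠ 0) {z : ℂ}
    (hz : 0 < z.re) : DifferentiableAt ℂ (fun z => dispersion μ z w) z := by
  obtain ⟨C, hC⟩ := gradHat_decay h
  refine (differentiableAt_const _).mul ?_
  refine DifferentiableAt.fun_sum fun j _ => (differentiableAt_const _).mul ?_
  exact differentiableAt_rayLaplace ((hC j).mono le_rfl (by omega)) hw hz

theorem dispersion_bound {μ : Sp d → ℝ} (h : HypH1 μ) {w : Sp d} (hw : w ≠ 0) :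
    ∃ D, ∀ z : ℂ, 0 ≤ z.re → ‖dispersion μ z w‖ * (1 + ‖z‖ ^ 2) ≤ D := by
  obtain ⟨C, hC⟩ := gradHat_decay h
  have := fun j => sq_mul_rayLaplace_bound (N := 0) ((hC j).mono (by omega) (by omega))
    (gradHat_zero h j) hw
  choose D hD using this
  refine ⟨‖(besselMult w : ℂ) * (2 * Real.pi * Complex.I)‖ * ∑ j, ‖(w j : ℂ)‖ * D j,
    fun z hz => ?_⟩
  rw [dispersion, norm_mul, mul_assoc]
  gcongr
  refine (mul_le_mul_of_nonneg_right (norm_sum_le _ _) (by positivity)).trans ?_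
  rw [Finset.sum_mul]
  refine Finset.sum_le_sum fun j _ => ?_
  rw [norm_mul, mul_assoc]
  gcongr
  exact hD j z hz

theorem one_sub_dispersion_ne_zero {μ : Sp d → ℝ} (h1 : HypH1 μ) (h2 : HypH2 μ) {w : Sp d}
    (hw : w ≠ 0) {z : ℂ} (hz : 0 ≤ z.re) : 1 - dispersion μ z w ≠ 0 := by
  obtain ⟨κ, hκ, h⟩ := penrose_bound h1 h2
  intro h0
  have := h z hz w hw
  rw [h0, norm_zero] at this
  linarith

theorem continuousOn_resolventSymbol {μ : Sp d → ℝ} (h1 : HypH1 μ) (h2 : HypH2 μ) {w : Sp d}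
    (hw : w ≠ 0) : ContinuousOn (fun z => resolventSymbol μ z w) {z : ℂ | 0 ≤ z.re} :=
  (continuousOn_dispersion h1 hw).mul ((continuousOn_const.sub (continuousOn_dispersion h1 hw)).inv₀
    fun _ hz => one_sub_dispersion_ne_zero h1 h2 hw hz)

theorem differentiableAt_resolventSymbol {μ : Sp d → ℝ} (h1 : HypH1 μ) (h2 : HypH2 μ) {w : Sp d}
    (hw : w ≠ 0) {z : ℂ} (hz : 0 < z.re) :
    DifferentiableAt ℂ (fun z => resolventSymbol μ z w) z :=
  (differentiableAt_dispersion h1 hw hz).mul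
    (((differentiableAt_const _).sub (differentiableAt_dispersion h1 hw hz)).inv
      (one_sub_dispersion_ne_zero h1 h2 hw hz.le))

theorem resolventSymbol_bound {μ : Sp d → ℝ} (h1 : HypH1 μ) (h2 : HypH2 μ) {w : Sp d}
    (hw : w ≠ 0) : ∃ D, ∀ z : ℂ, 0 ≤ z.re → ‖resolventSymbol μ z w‖ * (1 + ‖z‖ ^ 2) ≤ D := by
  obtain ⟨κ, hκ, h⟩ := penrose_bound h1 h2
  obtain ⟨D, hD⟩ := dispersion_bound h1 hw
  refine ⟨D * κ⁻¹, fun z hz => ?_⟩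
  rw [resolventSymbol, norm_mul, norm_inv, mul_right_comm]
  have h3 := h z hz w hw
  have h4 := hD z hz
  have : 0 ≤ ‖dispersion μ z w‖ * (1 + ‖z‖ ^ 2) := by positivity
  gcongr
  exact this.trans h4

/-- The spatial Fourier transform of the resolvent kernel at time `t`. -/
def greenHat (μ : Sp d → ℝ) (t : ℝ) (w : Sp d) : ℂ :=
  ∫ θ : ℝ, Complex.exp (freq θ * t) * resolventSymbol μ (freq θ) w

theorem norm_exp_freq (θ t : ℝ) : ‖Complex.exp (freq θ * t)‖ = 1 := by
  rw [Complex.norm_exp]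
  simp [freq]

theorem continuous_freq : Continuous freq := by unfold freq; fun_prop

theorem continuous_resolventSymbol_freq {μ : Sp d → ℝ} (h1 : HypH1 μ) (h2 : HypH2 μ) {w : Sp d}
    (hw : w ≠ 0) : Continuous (fun θ => resolventSymbol μ (freq θ) w) :=
  (continuousOn_resolventSymbol h1 h2 hw).comp_continuous continuous_freq
    fun θ => (freq_re θ).ge

/-- Cauchy's theorem on the rectangle [0,T] × [-T,T]: the three sides off the imaginary axis have
total length 4T, and |f| ≤ C/T² on them, so their contribution is at most 4C/T. -/
theorem integral_imaginary_eq_zero {f : ℂ → ℂ} {C : ℝ} (hc : ContinuousOn f {z : ℂ | 0 ≤ z.re})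
    (hd : ∀ z : ℂ, 0 < z.re → DifferentiableAt ℂ f z)
    (hb : ∀ z : ℂ, 0 ≤ z.re → ‖f z‖ * (1 + ‖z‖ ^ 2) ≤ C) :
    ∫ y : ℝ, f (y * Complex.I) = 0 := by
  have hC : 0 ≤ C := le_trans (by positivity) (hb 0 (by simp))
  have hle : ∀ z : ℂ, 0 ≤ z.re → ‖f z‖ ≤ C * (1 + ‖z‖ ^ 2)⁻¹ := fun z hz => by
    rw [← div_eq_mul_inv, le_div_iff₀ (by positivity)]
    exact hb z hz
  have hcI : Continuous fun y : ℝ => f (y * Complex.I) :=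
    hc.comp_continuous (by fun_prop) fun y => by simp
  have hint : Integrable fun y : ℝ => f (y * Complex.I) := by
    refine Integrable.mono' (integrable_inv_one_add_sq.const_mul C) hcI.aestronglyMeasurable ?_
    refine Filter.Eventually.of_forall fun y => (hle _ (by simp)).trans_eq ?_
    simp
  have hlim := intervalIntegral_tendsto_integral hint Filter.tendsto_neg_atTop_atBot
    Filter.tendsto_id
  refine tendsto_nhds_unique hlim ?_
  refine squeeze_zero_norm' (a := fun T : ℝ => 4 * C * T⁻¹) ?_ ?_
  · filter_upwards [Filter.eventually_gt_atTop 0] with T hT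
    have hrect := Complex.integral_boundary_rect_eq_zero_of_continuousOn_of_differentiableOn f
      (-(T * Complex.I)) (T + T * Complex.I)
      (hc.mono fun z hz => by
        have := hz.1
        simp only [Complex.neg_re, Complex.mul_re, Complex.ofReal_re, Complex.I_re, mul_zero,
          Complex.ofReal_im, Complex.I_im, mul_one, sub_self, neg_zero, Complex.add_re,
          add_zero, Set.uIcc_of_le hT.le] at this
        exact this.1)
      (fun z hz => by
        have := hz.1
        simp only [Complex.neg_re, Complex.mul_re, Complex.ofReal_re, Complex.I_re, mul_zero,
          Complex.ofReal_im, Complex.I_im, mul_one, sub_self, neg_zero, Complex.add_re,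
          add_zero, min_eq_left hT.le] at this
        exact (hd z this.1).differentiableWithinAt)
    simp only [Complex.neg_re, Complex.mul_re, Complex.ofReal_re, Complex.I_re, mul_zero,
      Complex.ofReal_im, Complex.I_im, mul_one, sub_self, neg_zero, Complex.add_re, add_zero,
      Complex.neg_im, Complex.mul_im, Complex.add_im, zero_add, Complex.ofReal_zero,
      smul_eq_mul, Complex.ofReal_neg] at hrect
    have hT2 : ∀ z : ℂ, 0 ≤ z.re → T ^ 2 ≤ ‖z‖ ^ 2 → ‖f z‖ ≤ C * (T ^ 2)⁻¹ := fun z hz h => by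
      refine (hle z hz).trans ?_
      gcongr
      linarith
    have hn : ∀ a b : ℝ, ‖(a : ℂ) + b * Complex.I‖ ^ 2 = a ^ 2 + b ^ 2 := fun a b => by
      rw [← Complex.normSq_eq_norm_sq, Complex.normSq_add_mul_I]
    have e1 : ‖∫ x in (0 : ℝ)..T, f (x + -T * Complex.I)‖ ≤ C * (T ^ 2)⁻¹ * |T - 0| := by
      refine intervalIntegral.norm_integral_le_of_norm_le_const fun x hx => hT2 _ ?_ ?_
      · rw [Set.uIoc_of_le hT.le] at hx
        simpa using hx.1.le
      · have := hn x (-T)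
        push_cast at this
        rw [this]; nlinarith [sq_nonneg x]
    have e2 : ‖∫ x in (0 : ℝ)..T, f (x + T * Complex.I)‖ ≤ C * (T ^ 2)⁻¹ * |T - 0| := by
      refine intervalIntegral.norm_integral_le_of_norm_le_const fun x hx => hT2 _ ?_ ?_
      · rw [Set.uIoc_of_le hT.le] at hx
        simpa using hx.1.le
      · rw [hn]; nlinarith [sq_nonneg x]
    have e3 : ‖∫ y in (-T)..T, f (T + y * Complex.I)‖ ≤ C * (T ^ 2)⁻¹ * |T - -T| := by
      refine intervalIntegral.norm_integral_le_of_norm_le_const fun x hx => hT2 _ ?_ ?_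
      · simpa using hT.le
      · rw [hn]; nlinarith [sq_nonneg x]
    have e4 : ∫ y in (-T)..T, f (y * Complex.I) = -Complex.I *
        ((∫ x in (0 : ℝ)..T, f (x + -T * Complex.I)) - (∫ x in (0 : ℝ)..T, f (x + T * Complex.I)))
        + ∫ y in (-T)..T, f (T + y * Complex.I) := by
      linear_combination Complex.I * hrect + ((∫ y in (-T)..T, f (y * Complex.I)) -
        ∫ y in (-T)..T, f (T + y * Complex.I)) * Complex.I_sq
    rw [sub_zero, abs_of_pos hT] at e1 e2
    rw [sub_neg_eq_add, abs_of_pos (by linarith)] at e3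
    simp only [id]
    rw [e4]
    refine (norm_add_le _ _).trans ?_
    rw [norm_mul, norm_neg, Complex.norm_I, one_mul]
    refine (add_le_add ((norm_sub_le _ _).trans (add_le_add e1 e2)) e3).trans_eq ?_
    field_simp
    ring
  · simpa using tendsto_inv_atTop_zero.const_mul (4 * C)

/-- For t ≤ 0 the factor e^{zt} is bounded on Re z ≥ 0, where the resolvent symbol decays like |z|⁻²
and, by Penrose, has no pole; the contour closes to the right. -/
theorem greenHat_of_nonpos {μ : Sp d → ℝ} (h1 : HypH1 μ) (h2 : HypH2 μ) {w : Sp d} (hw : w ≠ 0)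
    {t : ℝ} (ht : t ≤ 0) : greenHat μ t w = 0 := by
  obtain ⟨D, hD⟩ := resolventSymbol_bound h1 h2 hw
  have h := integral_imaginary_eq_zero (f := fun z => Complex.exp (z * t) * resolventSymbol μ z w)
    (C := D) ((by fun_prop : Continuous fun z : ℂ => Complex.exp (z * t)).continuousOn.mul
      (continuousOn_resolventSymbol h1 h2 hw))
    (fun z hz => (by fun_prop : Differentiable ℂ fun z : ℂ => Complex.exp (z * t)).differentiableAt.mul
      (differentiableAt_resolventSymbol h1 h2 hw hz))
    (fun z hz => by
      have h1 : ‖Complex.exp (z * t)‖ ≤ 1 := by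
        rw [Complex.norm_exp, Real.exp_le_one_iff]
        simp only [Complex.mul_re, Complex.ofReal_re, Complex.ofReal_im, mul_zero, sub_zero]
        exact mul_nonpos_of_nonneg_of_nonpos hz ht
      rw [norm_mul]
      refine le_trans ?_ (hD z hz)
      gcongr
      exact mul_le_of_le_one_left (norm_nonneg _) h1)
  have h3 := Measure.integral_comp_mul_left
    (fun y : ℝ => Complex.exp (y * Complex.I * t) * resolventSymbol μ (y * Complex.I) w)
    (2 * Real.pi)
  rw [h, smul_zero] at h3
  rw [greenHat, ← h3]
  congr 1
  ext θ
  have : freq θ = ((2 * Real.pi * θ : ℝ) : ℂ) * Complex.I := by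
    rw [freq]; push_cast; ring
  rw [this]

end HalfPlane

/-! ### Time decay of the Green function at fixed frequency -/

section Decay

/-- N integrations by parts in the direction v. The phase is a general bilinear form, so that the
estimate serves both for θ alone and for (θ, w) jointly. -/
theorem pow_mul_norm_fourierIntegral_le {V W : Type*} [NormedAddCommGroup V] [NormedSpace ℝ V]
    [NormedAddCommGroup W] [NormedSpace ℝ W] [MeasurableSpace V] [BorelSpace V]
    [FiniteDimensional ℝ V] {ν : Measure V} [ν.IsAddHaarMeasure] (L : V →L[ℝ] W →L[ℝ] ℝ)
    {N : ℕ} {f : V → ℂ} (hf : ContDiff ℝ N f)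
    (hi : ∀ n ≤ N, Integrable (iteratedFDeriv ℝ n f) ν) (x : W) (v : V) :
    (2 * Real.pi * |L v x|) ^ N * ‖∫ y, Real.fourierChar (-L y x) • f y ∂ν‖ ≤
      ‖v‖ ^ N * ∫ y, ‖iteratedFDeriv ℝ N f y‖ ∂ν := by
  have h1 := VectorFourier.fourierIntegral_iteratedFDeriv (L := L) (μ := ν) (N := (N : ℕ∞))
    (f := f) (by exact_mod_cast hf) (fun n hn => hi n (by exact_mod_cast hn)) (n := N) le_rfl
  have h2 := congrArg (fun F => ‖F x (fun _ => v)‖) h1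
  simp only at h2
  rw [VectorFourier.fourierPowSMulRight_apply, norm_smul, norm_smul] at h2
  have h3 : ‖(-(2 * (Real.pi : ℂ) * Complex.I)) ^ N‖ * ‖∏ _i : Fin N, (-L.flip) x v‖ =
      (2 * Real.pi * |L v x|) ^ N := by
    simp [mul_pow, abs_of_pos Real.pi_pos]
  rw [← mul_assoc, h3] at h2
  refine le_trans (le_of_eq h2.symm) ?_
  refine (ContinuousMultilinearMap.le_opNorm _ _).trans ?_
  rw [Finset.prod_const, Finset.card_univ, Fintype.card_fin, mul_comm]
  gcongr
  exact VectorFourier.norm_fourierIntegral_le_integral_norm _ _ _ _ _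

theorem slice_contDiff {N : ℕ} {κ : ℝ × Sp d → ℝ} {C : ℝ} {f : ℝ × Sp d → ℂ}
    (hf : SymbolBound {z : ℝ × Sp d | z.2 ≠ 0} (fun z => ‖z.2‖) N κ C f) {w : Sp d} (hw : w ≠ 0) :
    ContDiff ℝ N (fun θ : ℝ => f (θ, w)) ∧
      ∀ n ≤ N, ∀ θ, ‖iteratedFDeriv ℝ n (fun θ : ℝ => f (θ, w)) θ‖ ≤
        ‖iteratedFDeriv ℝ n f (θ, w)‖ := by
  set f₁ : ℝ × Sp d → ℂ := fun y => f (y + (0, w)) with hf₁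
  set U₁ : Set (ℝ × Sp d) := {y | y.2 + w ≠ 0} with hU₁
  have hU₁o : IsOpen U₁ := isOpen_ne_fun (by fun_prop) continuous_const
  have hf₁c : ContDiffOn ℝ N f₁ U₁ := hf.contDiffOn.comp (by fun_prop) fun y hy => hy
  set L := ContinuousLinearMap.inl ℝ ℝ (Sp d)
  have hpre : L ⁻¹' U₁ = Set.univ := by
    ext θ; simp [L, hU₁, hw]
  have heq : (fun θ : ℝ => f (θ, w)) = f₁ ∘ L := by
    ext θ; simp [hf₁, L]
  refine ⟨?_, fun n hn θ => ?_⟩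
  · rw [← contDiffOn_univ, heq, ← hpre]
    exact hf₁c.comp L.contDiff.contDiffOn (Set.mapsTo_preimage _ _)
  · have h1 := L.iteratedFDerivWithin_comp_right hf₁c hU₁o.uniqueDiffOn
      (by rw [hpre]; exact uniqueDiffOn_univ) (x := θ) (by simp [L, hU₁, hw])
      (i := n) (by exact_mod_cast hn)
    rw [hpre, iteratedFDerivWithin_univ, ← heq,
      iteratedFDerivWithin_of_isOpen _ hU₁o (by simp [L, hU₁, hw])] at h1
    rw [h1]
    refine (ContinuousMultilinearMap.norm_compContinuousLinearMap_le _ _).trans ?_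
    have h2 : ∏ _i : Fin n, ‖L‖ ≤ 1 := Finset.prod_le_one (fun _ _ => norm_nonneg _) fun _ _ =>
      ContinuousLinearMap.norm_inl_le_one ℝ ℝ (Sp d)
    refine (mul_le_of_le_one_right (norm_nonneg _) h2).trans_eq ?_
    rw [hf₁, iteratedFDeriv_comp_add_right]
    simp [L]

theorem integral_inv_sq_add_sq {r : ℝ} (hr : 0 < r) :
    Integrable (fun θ : ℝ => (θ ^ 2 + r ^ 2)⁻¹) ∧
      ∫ θ : ℝ, (θ ^ 2 + r ^ 2)⁻¹ = Real.pi * r⁻¹ := by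
  have e : (fun θ : ℝ => (θ ^ 2 + r ^ 2)⁻¹) = fun θ => (r ^ 2)⁻¹ * (1 + (θ / r) ^ 2)⁻¹ := by
    ext θ
    field_simp
    ring
  rw [e]
  refine ⟨(integrable_inv_one_add_sq.comp_div hr.ne').const_mul _, ?_⟩
  rw [integral_const_mul, Measure.integral_comp_div (fun x : ℝ => (1 + x ^ 2)⁻¹),
    integral_univ_inv_one_add_sq, abs_of_pos hr, smul_eq_mul]
  field_simp

theorem integral_dispWeight {w : Sp d} (hw : w ≠ 0) :
    Integrable (fun θ : ℝ => dispWeight (θ, w)) ∧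
      ∫ θ : ℝ, dispWeight (θ, w) = besselMult w * ‖w‖ * Real.pi := by
  have hr : 0 < ‖w‖ := norm_pos_iff.2 hw
  obtain ⟨h1, h2⟩ := integral_inv_sq_add_sq hr
  refine ⟨h1.const_mul (besselMult w * ‖w‖ ^ 2), ?_⟩
  simp only [dispWeight]
  rw [integral_const_mul, h2]
  field_simp

theorem greenHat_eq_fourier (μ : Sp d → ℝ) (t : ℝ) (w : Sp d) :
    greenHat μ t w = ∫ θ : ℝ, Real.fourierChar (-(-ContinuousLinearMap.mul ℝ ℝ) θ t) •
      resolventSymbol μ (freq θ) w := by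
  rw [greenHat]
  congr 1
  ext θ
  rw [Circle.smul_def, smul_eq_mul, Real.fourierChar_apply]
  congr 2
  simp [freq]
  ring

theorem symbol_slice_integrable {N : ℕ} {C : ℝ} {f : ℝ × Sp d → ℂ}
    (hf : SymbolBound {z : ℝ × Sp d | z.2 ≠ 0} (fun z => ‖z.2‖) N dispWeight C f) {w : Sp d}
    (hw : w ≠ 0) {n : ℕ} (hn : n ≤ N) :
    Integrable (fun θ : ℝ => iteratedFDeriv ℝ n f (θ, w)) ∧
      ∫ θ : ℝ, ‖iteratedFDeriv ℝ n f (θ, w)‖ ≤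
        C * (besselMult w * ‖w‖ * Real.pi) * (‖w‖⁻¹) ^ n := by
  have hr : 0 < ‖w‖ := norm_pos_iff.2 hw
  have hb : ∀ θ : ℝ, ‖iteratedFDeriv ℝ n f (θ, w)‖ ≤ (‖w‖⁻¹) ^ n * (C * dispWeight (θ, w)) := by
    intro θ
    have := hf.bound n hn (θ, w) hw
    rw [inv_pow, ← div_eq_inv_mul, le_div_iff₀ (by positivity)]
    exact this
  have hc : Continuous (fun θ : ℝ => iteratedFDeriv ℝ n f (θ, w)) := by
    have h1 := hf.contDiffOn.continuousOn_iteratedFDerivWithin (m := n) (by exact_mod_cast hn)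
      isOpen_snd_ne_zero.uniqueDiffOn
    have h2 : ContinuousOn (iteratedFDeriv ℝ n f) {z : ℝ × Sp d | z.2 ≠ 0} :=
      h1.congr fun y hy => (iteratedFDerivWithin_of_isOpen n isOpen_snd_ne_zero hy).symm
    exact h2.comp_continuous (by fun_prop) fun θ => hw
  obtain ⟨h1, h2⟩ := integral_dispWeight hw
  have hint : Integrable (fun θ : ℝ => iteratedFDeriv ℝ n f (θ, w)) :=
    Integrable.mono' ((h1.const_mul C).const_mul ((‖w‖⁻¹) ^ n)) hc.aestronglyMeasurable
      (Filter.Eventually.of_forall hb)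
  refine ⟨hint, ?_⟩
  refine (integral_mono hint.norm ((h1.const_mul C).const_mul ((‖w‖⁻¹) ^ n)) hb).trans_eq ?_
  rw [integral_const_mul, integral_const_mul, h2]
  ring

/-- J integrations by parts in θ: every θ-derivative of the symbol costs 1/|w|, and the weight
integrates in θ to π |w| times the Bessel multiplier. -/
theorem greenHat_bound {μ : Sp d → ℝ} (h1 : HypH1 μ) (h2 : HypH2 μ) : ∃ C, 0 ≤ C ∧
    ∀ w : Sp d, w ≠ 0 → ∀ J ≤ d + 3, ∀ t : ℝ,
      |t| ^ J * ‖greenHat μ t w‖ ≤ C * (besselMult w * ‖w‖) * (‖w‖⁻¹) ^ J := by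
  obtain ⟨C, hC⟩ := isSymbol_resolvent h1 h2
  refine ⟨|C| * Real.pi, by positivity, fun w hw J hJ t => ?_⟩
  obtain ⟨hcd, hle⟩ := slice_contDiff hC hw
  have hcd' : ContDiff ℝ J (fun θ : ℝ => resolventSymbol μ (freq θ) w) :=
    hcd.of_le (by exact_mod_cast hJ)
  have hint : ∀ n ≤ J, Integrable
      (iteratedFDeriv ℝ n (fun θ : ℝ => resolventSymbol μ (freq θ) w)) := fun n hn =>
    (symbol_slice_integrable hC hw (hn.trans hJ)).1.mono
      (hcd'.continuous_iteratedFDeriv (by exact_mod_cast hn)).aestronglyMeasurable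
      (Filter.Eventually.of_forall fun θ => hle n (hn.trans hJ) θ)
  have key := pow_mul_norm_fourierIntegral_le (-ContinuousLinearMap.mul ℝ ℝ) hcd' hint t 1
  have e1 : |(-ContinuousLinearMap.mul ℝ ℝ) (1 : ℝ) t| = |t| := by simp
  rw [e1, norm_one, one_pow, one_mul] at key
  simp only [neg_apply, neg_neg] at key
  have e2 := greenHat_eq_fourier μ t w
  simp only [neg_apply, neg_neg] at e2
  rw [← e2] at key
  have h5 := (symbol_slice_integrable hC hw hJ)
  calc |t| ^ J * ‖greenHat μ t w‖ ≤ (2 * Real.pi * |t|) ^ J * ‖greenHat μ t w‖ := by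
        gcongr
        nlinarith [Real.pi_gt_three, abs_nonneg t]
    _ ≤ _ := key
    _ ≤ ∫ θ : ℝ, ‖iteratedFDeriv ℝ J (fun z : ℝ × Sp d => resolventSymbol μ (freq z.1) z.2)
          (θ, w)‖ :=
      integral_mono (hint J le_rfl).norm h5.1.norm fun θ => hle J hJ θ
    _ ≤ _ := h5.2
    _ ≤ |C| * (besselMult w * ‖w‖ * Real.pi) * (‖w‖⁻¹) ^ J := by
      have := besselMult_pos w
      gcongr
      exact le_abs_self _
    _ = _ := by ring

end Decay

/-! ### The resolvent identity in time -/

section Resolvent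

/-- The spatial Fourier transform of the Volterra kernel, extended by zero to `t ≤ 0`. -/
def volterraHat (μ : Sp d → ℝ) (t : ℝ) (w : Sp d) : ℂ :=
  besselMult w * (2 * Real.pi * Complex.I) * ∑ j, (w j : ℂ) * gradHat μ j (max t 0 • w)

theorem fourier_add_apply {V : Type*} [NormedAddCommGroup V] [InnerProductSpace ℝ V]
    [MeasurableSpace V] [BorelSpace V] [FiniteDimensional ℝ V] {f g : V → ℂ} (hf : Integrable f)
    (hg : Integrable g) (w : V) : 𝓕 (f + g) w = 𝓕 f w + 𝓕 g w := by
  simp only [Real.fourier_eq, Pi.add_apply, smul_add]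
  exact integral_add ((Real.fourierIntegral_convergent_iff w).2 hf)
    ((Real.fourierIntegral_convergent_iff w).2 hg)

/-- Truncation by `max t 0` freezes the profile at 0, where the transform of the gradient vanishes.
So the extension by zero to negative times is continuous in t. -/
theorem volterraHat_of_nonpos {μ : Sp d → ℝ} (h : HypH1 μ) {t : ℝ} (ht : t ≤ 0) (w : Sp d) :
    volterraHat μ t w = 0 := by
  simp [volterraHat, max_eq_right ht, gradHat_zero h]

theorem continuous_gradHat {μ : Sp d → ℝ} (h : HypH1 μ) (j : Fin d) : Continuous (gradHat μ j) := by
  obtain ⟨C, hC⟩ := gradHat_decay h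
  exact (hC j).contDiff.continuous

theorem norm_volterraHat_le {μ : Sp d → ℝ} (h : HypH1 μ) :
    ∃ C, ∀ t w, ‖volterraHat μ t w‖ ≤ C * ‖w‖ := by
  obtain ⟨C, hC⟩ := gradHat_decay h
  have hC' : ∀ j y, ‖gradHat μ j y‖ ≤ |C| := fun j y => by
    refine le_trans ?_ (((hC j).norm_le y).trans (le_abs_self C))
    exact le_mul_of_one_le_right (norm_nonneg _) (one_le_pow₀ (by linarith [norm_nonneg y]))
  refine ⟨2 * Real.pi * ∑ _j : Fin d, |C|, fun t w => ?_⟩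
  rw [volterraHat, norm_mul, norm_mul, Complex.norm_real, Real.norm_of_nonneg (besselMult_pos w).le]
  have e : ‖2 * (Real.pi : ℂ) * Complex.I‖ = 2 * Real.pi := by simp [abs_of_pos Real.pi_pos]
  rw [e, mul_assoc _ _ ‖w‖, Finset.sum_mul]
  have hs : ‖∑ j, (w j : ℂ) * gradHat μ j (max t 0 • w)‖ ≤ ∑ _j : Fin d, |C| * ‖w‖ := by
    refine norm_sum_le_of_le _ fun j _ => ?_
    rw [norm_mul, mul_comm]
    exact mul_le_mul (hC' _ _) (norm_coord_le j w) (norm_nonneg _) (abs_nonneg _)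
  exact mul_le_mul (mul_le_of_le_one_left Real.two_pi_pos.le (besselMult_le_one w)) hs
    (norm_nonneg _) Real.two_pi_pos.le

theorem volterraHat_fourier {μ : Sp d → ℝ} (h : HypH1 μ) {w : Sp d} (hw : w ≠ 0) :
    Integrable (fun t => volterraHat μ t w) ∧
      ∀ θ : ℝ, 𝓕 (fun t => volterraHat μ t w) θ = dispersion μ (freq θ) w := by
  obtain ⟨C, hC⟩ := gradHat_decay h
  have hp := fun j => (hC j).mono (N' := 0) (K' := 2) (by omega) (by omega)
  have hsupp : Function.support (fun t => volterraHat μ t w) ⊆ Set.Ioi 0 := by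
    intro t ht
    by_contra h0
    exact ht (volterraHat_of_nonpos h (not_lt.1 h0) w)
  have hE : ∀ t ∈ Set.Ioi (0 : ℝ), volterraHat μ t w =
      besselMult w * (2 * Real.pi * Complex.I) * ∑ j, (w j : ℂ) * gradHat μ j (t • w) := by
    intro t ht
    rw [volterraHat, max_eq_left (le_of_lt ht)]
  refine ⟨?_, fun θ => ?_⟩
  · rw [← integrableOn_iff_integrable_of_support_subset hsupp]
    refine IntegrableOn.congr_fun ?_ (fun t ht => (hE t ht).symm) measurableSet_Ioi
    exact (integrable_finsetSum _ fun j _ => (integrableOn_ray (hp j) hw).const_mul _).const_mul _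
  · rw [Real.fourier_eq']
    have hs2 : Function.support (fun v : ℝ => Complex.exp (↑(-2 * Real.pi * inner ℝ v θ) *
        Complex.I) • volterraHat μ v w) ⊆ Set.Ioi 0 := by
      refine Set.Subset.trans (fun t ht => ?_) hsupp
      intro h0
      exact ht (by simp [h0])
    rw [← setIntegral_eq_integral_of_forall_compl_eq_zero
      (fun x hx => Function.notMem_support.1 fun h0 => hx (hs2 h0))]
    rw [dispersion]
    simp only [rayLaplace, ← integral_const_mul]
    rw [← integral_finsetSum _ fun j _ =>
      (integrableOn_rayLaplace (hp j) hw (freq_re θ).ge).const_mul _, ← integral_const_mul]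
    refine setIntegral_congr_fun measurableSet_Ioi fun t ht => ?_
    rw [hE t ht, smul_eq_mul]
    simp only [Finset.mul_sum]
    refine Finset.sum_congr rfl fun j _ => ?_
    have : Complex.exp (↑(-2 * Real.pi * inner ℝ t θ) * Complex.I) =
        Complex.exp (-(freq θ * t)) := by
      congr 1
      simp [freq]
      ring
    rw [this]
    ring

theorem integrable_resolventSymbol {μ : Sp d → ℝ} (h1 : HypH1 μ) (h2 : HypH2 μ) {w : Sp d}
    (hw : w ≠ 0) : Integrable (fun θ => resolventSymbol μ (freq θ) w) := by
  obtain ⟨D, hD⟩ := isSymbol_resolvent h1 h2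
  have := (symbol_slice_integrable hD hw (n := 0) (by omega)).1.norm
  simp only [norm_iteratedFDeriv_zero] at this
  exact (integrable_norm_iff
    (continuous_resolventSymbol_freq h1 h2 hw).aestronglyMeasurable).1 this

/-- The cases J = 0 and J = 2 of `greenHat_bound` give decay (1+t²)⁻¹, and with it Fourier inversion
in time holds at every θ. -/
theorem integrable_greenHat {μ : Sp d → ℝ} (h1 : HypH1 μ) (h2 : HypH2 μ) {w : Sp d}
    (hw : w ≠ 0) : Continuous (fun t => greenHat μ t w) ∧ Integrable (fun t => greenHat μ t w) ∧
      ∀ θ : ℝ, 𝓕 (fun t => greenHat μ t w) θ = resolventSymbol μ (freq θ) w := by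
  obtain ⟨C, hC0, hC⟩ := greenHat_bound h1 h2
  have hr : Continuous (fun θ => resolventSymbol μ (freq θ) w) :=
    continuous_resolventSymbol_freq h1 h2 hw
  have hri := integrable_resolventSymbol h1 h2 hw
  have hinv : 𝓕⁻ (fun θ => resolventSymbol μ (freq θ) w) = fun t => greenHat μ t w := by
    ext t
    rw [Real.fourierInv_eq', greenHat]
    congr 1
    ext θ
    rw [smul_eq_mul]
    congr 2
    simp [freq]
    ring
  have hc : Continuous (fun t => greenHat μ t w) := by
    refine continuous_of_dominated (bound := fun θ => ‖resolventSymbol μ (freq θ) w‖) ?_ ?_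
      hri.norm ?_
    · intro t
      have := continuous_freq
      exact Continuous.aestronglyMeasurable (by fun_prop)
    · intro t
      refine Filter.Eventually.of_forall fun θ => ?_
      rw [norm_mul, norm_exp_freq, one_mul]
    · exact Filter.Eventually.of_forall fun θ => by fun_prop
  have hi : Integrable (fun t => greenHat μ t w) := by
    set K := C * (besselMult w * ‖w‖) * (‖w‖⁻¹) ^ 0 + C * (besselMult w * ‖w‖) * (‖w‖⁻¹) ^ 2
    refine Integrable.mono' (integrable_inv_one_add_sq.const_mul K) hc.aestronglyMeasurable ?_
    refine Filter.Eventually.of_forall fun t => ?_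
    rw [← div_eq_mul_inv, le_div_iff₀ (by positivity)]
    have e0 := hC w hw 0 (by omega) t
    have e2 := hC w hw 2 (by omega) t
    rw [sq_abs] at e2
    calc _ = |t| ^ 0 * ‖greenHat μ t w‖ + t ^ 2 * ‖greenHat μ t w‖ := by ring
      _ ≤ _ := add_le_add e0 e2
  refine ⟨hc, hi, fun θ => ?_⟩
  have hi' : Integrable (𝓕 (fun θ => resolventSymbol μ (freq θ) w)) := by
    have e : 𝓕 (fun θ => resolventSymbol μ (freq θ) w) = fun t => greenHat μ (-t) w := by
      ext t
      rw [← congrFun hinv (-t), Real.fourierInv_eq_fourier_neg, neg_neg]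
    rw [e]
    exact hi.comp_neg
  rw [← hinv]
  exact congrFun (hr.fourier_fourierInv_eq hri hi') θ

/-- Both sides are continuous integrable functions of time with the same Fourier transform; its
integrability makes the inversion formula, hence the equality, hold at every t. -/
theorem eq_add_integral_of_fourier {k G : ℝ → ℂ} (hkc : Continuous k) (hki : Integrable k)
    (hkb : BddAbove (Set.range fun t => ‖k t‖)) (hGc : Continuous G) (hGi : Integrable G)
    (hf : ∀ θ, 𝓕 k θ + 𝓕 G θ * 𝓕 k θ = 𝓕 G θ) (hFi : Integrable (𝓕 G)) (t : ℝ) :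
    G t = k t + ∫ s, k (t - s) * G s := by
  obtain ⟨cv, hcv⟩ : ∃ cv : ℝ → ℂ, cv = MeasureTheory.convolution G k
    (ContinuousLinearMap.mul ℂ ℂ) volume := ⟨_, rfl⟩
  have hcvc : Continuous cv := by
    rw [hcv]
    exact hkb.continuous_convolution_right_of_integrable (ContinuousLinearMap.mul ℂ ℂ) hGi hkc
  have hcvi : Integrable cv := by
    rw [hcv]
    exact hGi.integrable_convolution (ContinuousLinearMap.mul ℂ ℂ) hki
  have hcvf : ∀ θ, 𝓕 cv θ = 𝓕 G θ * 𝓕 k θ := by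
    intro θ
    rw [hcv, Real.fourier_mul_convolution_eq hGi hki]
  obtain ⟨H, hH⟩ : ∃ H : ℝ → ℂ, H = k + cv := ⟨_, rfl⟩
  have hHf : 𝓕 H = 𝓕 G := by
    ext θ
    rw [hH]
    exact (fourier_add_apply hki hcvi θ).trans (by rw [hcvf, hf])
  have hHc : Continuous H := hH ▸ hkc.add hcvc
  have hHi : Integrable H := hH ▸ hki.add hcvi
  have h3 := hHc.fourierInv_fourier_eq hHi (hHf ▸ hFi)
  have h4 := hGc.fourierInv_fourier_eq hGi hFi
  have h5 : G = H := by rw [← h4, ← h3, hHf]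
  have h6 : cv t = ∫ s, k (t - s) * G s := by
    rw [hcv, convolution]
    refine integral_congr_ae (Filter.Eventually.of_forall fun s => ?_)
    exact mul_comm _ _
  calc G t = H t := congrFun h5 t
    _ = k t + cv t := by rw [hH]; rfl
    _ = _ := by rw [h6]

theorem resolventSymbol_eq {μ : Sp d → ℝ} (h1 : HypH1 μ) (h2 : HypH2 μ) {w : Sp d} (hw : w ≠ 0)
    (θ : ℝ) : dispersion μ (freq θ) w + resolventSymbol μ (freq θ) w * dispersion μ (freq θ) w =
      resolventSymbol μ (freq θ) w := by
  have h := one_sub_dispersion_ne_zero h1 h2 hw (freq_re θ).ge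
  rw [resolventSymbol]
  generalize dispersion μ (freq θ) w = m at h ⊢
  field_simp
  ring

theorem continuous_volterraHat_time {μ : Sp d → ℝ} (h : HypH1 μ) (w : Sp d) :
    Continuous (fun t => volterraHat μ t w) := by
  have := continuous_gradHat h
  unfold volterraHat
  fun_prop

theorem bdd_volterraHat {μ : Sp d → ℝ} (h : HypH1 μ) (w : Sp d) :
    BddAbove (Set.range fun t => ‖volterraHat μ t w‖) := by
  obtain ⟨C, hC⟩ := norm_volterraHat_le h
  refine ⟨C * ‖w‖, ?_⟩
  rintro _ ⟨t, rfl⟩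
  exact hC t w

/-- Inverse Fourier transform in time of the algebraic identity m + r m = r for r = m/(1-m). -/
theorem greenHat_eq {μ : Sp d → ℝ} (h1 : HypH1 μ) (h2 : HypH2 μ) {w : Sp d} (hw : w ≠ 0) (t : ℝ) :
    greenHat μ t w = volterraHat μ t w + ∫ s, volterraHat μ (t - s) w * greenHat μ s w := by
  have hk := volterraHat_fourier h1 hw
  have hG := integrable_greenHat h1 h2 hw
  have hF : 𝓕 (fun t => greenHat μ t w) = fun θ => resolventSymbol μ (freq θ) w := funext hG.2.2
  have hf : ∀ θ, 𝓕 (fun t => volterraHat μ t w) θ +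
      𝓕 (fun t => greenHat μ t w) θ * 𝓕 (fun t => volterraHat μ t w) θ =
        𝓕 (fun t => greenHat μ t w) θ := fun θ => by
    rw [hk.2 θ, hG.2.2 θ]
    exact resolventSymbol_eq h1 h2 hw θ
  have hFi : Integrable (𝓕 (fun t => greenHat μ t w)) := by
    rw [hF]
    exact integrable_resolventSymbol h1 h2 hw
  exact eq_add_integral_of_fourier (continuous_volterraHat_time h1 w) hk.1 (bdd_volterraHat h1 w)
    hG.1 hG.2.1 hf hFi t

end Resolvent

/-! ### Radial power weights -/

section Radial

theorem ae_ne_zero (hd : 0 < d) : ∀ᵐ w : Sp d, w ≠ 0 := by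
  have : Nonempty (Fin d) := ⟨⟨0, hd⟩⟩
  exact compl_mem_ae_iff.2 (measure_singleton (0 : Sp d))

theorem ae_snd_ne_zero (hd : 0 < d) : ∀ᵐ z : ℝ × Sp d, z.2 ≠ 0 :=
  Measure.quasiMeasurePreserving_snd.ae (ae_ne_zero hd)

/-- The integral of `max(1, |x|)^{-(d+s)}` over `ℝ^d`. -/
def radialMass (d : ℕ) (s : ℝ) : ℝ≥0∞ :=
  ∫⁻ x : Sp d, ENNReal.ofReal ((max 1 ‖x‖) ^ (-((d : ℝ) + s)))

theorem radialMass_lt_top {s : ℝ} (hs : 0 < s) : radialMass d s < ⊤ := by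
  have h1 : ∀ x : Sp d, (max 1 ‖x‖) ^ (-((d : ℝ) + s)) ≤
      (2 : ℝ) ^ ((d : ℝ) + s) * (1 + ‖x‖) ^ (-((d : ℝ) + s)) := by
    intro x
    have hp : 0 < (d : ℝ) + s := by positivity
    have h2 : (1 + ‖x‖) / 2 ≤ max 1 ‖x‖ := by
      rcases le_total 1 ‖x‖ with h | h
      · rw [max_eq_right h]; linarith
      · rw [max_eq_left h]; linarith
    have h3 : (max 1 ‖x‖) ^ (-((d : ℝ) + s)) ≤ ((1 + ‖x‖) / 2) ^ (-((d : ℝ) + s)) :=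
      Real.rpow_le_rpow_of_nonpos (by positivity) h2 (by linarith)
    refine h3.trans_eq ?_
    rw [Real.div_rpow (by positivity) (by norm_num), Real.rpow_neg (by norm_num : (0 : ℝ) ≤ 2),
      div_inv_eq_mul, mul_comm]
  have h2 := (integrable_one_add_norm (E := Sp d) (μ := volume) (r := (d : ℝ) + s)
    (by simpa using hs)).const_mul ((2 : ℝ) ^ ((d : ℝ) + s))
  refine lt_of_le_of_lt (lintegral_mono fun x => ?_) h2.2
  rw [← ofReal_norm]
  exact ENNReal.ofReal_le_ofReal ((h1 x).trans (le_abs_self _))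

theorem lintegral_max_rpow {r : ℝ} (hr : 0 < r) (s : ℝ) :
    ∫⁻ x : Sp d, ENNReal.ofReal ((max r ‖x‖) ^ (-((d : ℝ) + s))) =
      ENNReal.ofReal (r ^ (-s)) * radialMass d s := by
  have h1 : ∀ x : Sp d, ENNReal.ofReal ((max r ‖x‖) ^ (-((d : ℝ) + s))) =
      ENNReal.ofReal (r ^ (-((d : ℝ) + s))) *
        ENNReal.ofReal ((max 1 ‖r⁻¹ • x‖) ^ (-((d : ℝ) + s))) := by
    intro x
    rw [← ENNReal.ofReal_mul (by positivity), ← Real.mul_rpow hr.le (by positivity)]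
    congr 2
    rw [norm_smul, norm_inv, Real.norm_of_nonneg hr.le, mul_max_of_nonneg _ _ hr.le, mul_one,
      ← mul_assoc, mul_inv_cancel₀ hr.ne', one_mul]
  have hm : Measurable fun y : Sp d => ENNReal.ofReal ((max 1 ‖y‖) ^ (-((d : ℝ) + s))) := by
    fun_prop
  simp only [h1]
  rw [lintegral_const_mul _ (by fun_prop)]
  have h2 : ∫⁻ x : Sp d, ENNReal.ofReal ((max 1 ‖r⁻¹ • x‖) ^ (-((d : ℝ) + s))) =
      ENNReal.ofReal (r ^ d) * radialMass d s := by
    rw [← lintegral_map (μ := volume) (g := fun x : Sp d => r⁻¹ • x) hm (by fun_prop),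
      Measure.map_addHaar_smul _ (inv_ne_zero hr.ne'), lintegral_smul_measure, radialMass]
    congr 2
    simp [abs_of_pos hr]
  rw [h2, ← mul_assoc, ← ENNReal.ofReal_mul (by positivity), ← Real.rpow_natCast,
    ← Real.rpow_add hr]
  congr 3
  ring

end Radial

/-! ### Dilated frequency cutoffs -/

section Cutoff

/-- A smooth bump function equal to one on the unit ball and vanishing for `|w| ≥ 2`. -/
def cutoff (w : Sp d) : ℝ := (⟨1, 2, one_pos, one_lt_two⟩ : ContDiffBump (0 : Sp d)) w

theorem contDiff_cutoff : ContDiff ℝ ∞ (cutoff (d := d)) := ContDiffBump.contDiff _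

theorem hasCompactSupport_cutoff : HasCompactSupport (cutoff (d := d)) :=
  ContDiffBump.hasCompactSupport _

theorem cutoff_eq_one {w : Sp d} (h : ‖w‖ ≤ 1) : cutoff w = 1 :=
  ContDiffBump.one_of_mem_closedBall _ (by simpa using h)

theorem cutoff_eq_zero {w : Sp d} (h : 2 ≤ ‖w‖) : cutoff w = 0 :=
  ContDiffBump.zero_of_le_dist _ (by simpa using h)

theorem cutoff_nonneg (w : Sp d) : 0 ≤ cutoff w := ContDiffBump.nonneg _

theorem cutoff_le_one (w : Sp d) : cutoff w ≤ 1 := ContDiffBump.le_one _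

/-- The quantity |w|^n |∂^n χ(r·)(w)| is invariant under dilation, so the constant is independent of
r. This uniformity is used twice: with r = |(t,x)| to separate frequencies, and with r → 0 to remove
a truncation. -/
theorem symbolBound_cutoff (N : ℕ) : ∃ C, 0 ≤ C ∧ ∀ r : ℝ, 0 < r →
    SymbolBound {z : ℝ × Sp d | z.2 ≠ 0} (fun z => ‖z.2‖) N (fun _ => 1) C
      (fun z => (cutoff (r • z.2) : ℂ)) := by
  set f : Sp d → ℂ := fun w => (cutoff w : ℂ) with hf
  have hfc : ContDiff ℝ ∞ f := Complex.ofRealCLM.contDiff.comp contDiff_cutoff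
  have hfs : HasCompactSupport f := hasCompactSupport_cutoff.comp_left (g := fun x : ℝ => (x : ℂ))
    (by simp)
  have hb : ∀ n : ℕ, ∃ B, ∀ w, ‖w‖ ^ n * ‖iteratedFDeriv ℝ n f w‖ ≤ B := by
    intro n
    have hc : Continuous (iteratedFDeriv ℝ n f) :=
      hfc.continuous_iteratedFDeriv (natCast_le_smooth n)
    have hs : HasCompactSupport (fun w => ‖w‖ ^ n * ‖iteratedFDeriv ℝ n f w‖) := by
      refine (hfs.iteratedFDeriv (𝕜 := ℝ) n).mono fun w hw h0 => hw ?_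
      simp only
      rw [h0, norm_zero, mul_zero]
    obtain ⟨B, hB⟩ := hs.exists_bound_of_continuous (by fun_prop)
    exact ⟨B, fun w => (le_abs_self _).trans (hB w)⟩
  choose B hB using hb
  refine ⟨∑ n ∈ Finset.range (N + 1), |B n|, Finset.sum_nonneg fun _ _ => abs_nonneg _,
    fun r hr => ?_⟩
  set L : ℝ × Sp d →L[ℝ] Sp d := r • ContinuousLinearMap.snd ℝ ℝ (Sp d) with hL
  have hcomp : (fun z : ℝ × Sp d => (cutoff (r • z.2) : ℂ)) = f ∘ L := by
    ext z; simp [hf, hL]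
  have hLn : ‖L‖ ≤ r := by
    rw [hL, norm_smul, Real.norm_of_nonneg hr.le]
    exact mul_le_of_le_one_right hr.le (ContinuousLinearMap.norm_snd_le ℝ ℝ (Sp d))
  refine ⟨?_, fun n hn z _ => ?_⟩
  · rw [hcomp]
    exact ((hfc.comp L.contDiff).of_le (natCast_le_smooth N)).contDiffOn
  · rw [hcomp, ContinuousLinearMap.iteratedFDeriv_comp_right L hfc z (natCast_le_smooth n)]
    have h1 : ‖(iteratedFDeriv ℝ n f (L z)).compContinuousLinearMap fun _ => L‖ ≤
        ‖iteratedFDeriv ℝ n f (L z)‖ * r ^ n := by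
      refine (ContinuousMultilinearMap.norm_compContinuousLinearMap_le _ _).trans ?_
      rw [Finset.prod_const, Finset.card_univ, Fintype.card_fin]
      gcongr
    have h2 : ‖L z‖ = r * ‖z.2‖ := by
      simp [hL, norm_smul, abs_of_pos hr]
    have h3 := hB n (L z)
    rw [h2, mul_pow] at h3
    calc _ ≤ ‖iteratedFDeriv ℝ n f (L z)‖ * r ^ n * ‖z.2‖ ^ n := by gcongr
      _ = r ^ n * ‖z.2‖ ^ n * ‖iteratedFDeriv ℝ n f (L z)‖ := by ring
      _ ≤ |B n| := h3.trans (le_abs_self _)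
      _ ≤ _ := by
        rw [mul_one]
        exact Finset.single_le_sum (f := fun n => |B n|) (fun _ _ => abs_nonneg _)
          (Finset.mem_range.2 (by omega))

end Cutoff

/-! ### Oscillatory integrals in space-time -/

section Oscillatory

/-- The inner product of `ℝ^d` as a bilinear form. -/
def innerForm (d : ℕ) : Sp d →L[ℝ] Sp d →L[ℝ] ℝ := innerSL ℝ

theorem innerForm_apply (x y : Sp d) : innerForm d x y = inner ℝ x y := rfl

/-- The phase `-(θ t + w · x)` as a bilinear form on `ℝ × ℝ^d`. -/
def phaseForm (d : ℕ) : (ℝ × Sp d) →L[ℝ] (ℝ × Sp d) →L[ℝ] ℝ :=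
  -((ContinuousLinearMap.mul ℝ ℝ).bilinearComp (ContinuousLinearMap.fst ℝ ℝ (Sp d))
      (ContinuousLinearMap.fst ℝ ℝ (Sp d)) +
    (innerForm d).bilinearComp (ContinuousLinearMap.snd ℝ ℝ (Sp d))
      (ContinuousLinearMap.snd ℝ ℝ (Sp d)))

theorem phaseForm_apply (z y : ℝ × Sp d) :
    phaseForm d z y = -(z.1 * y.1 + inner ℝ z.2 y.2) := by
  simp [phaseForm, innerForm_apply]

/-- The norm of ℝ × ℝ^d is the maximum norm, so one integrates by parts in θ or along the space
component, whichever of |t| and |x| is larger. -/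
theorem exists_phaseForm_eq_norm (y : ℝ × Sp d) : ∃ v : ℝ × Sp d, ‖v‖ ≤ 1 ∧
    |phaseForm d v y| = ‖y‖ := by
  rcases le_total ‖y.1‖ ‖y.2‖ with h | h
  · refine ⟨(0, ‖y.2‖⁻¹ • y.2), ?_, ?_⟩
    · rw [Prod.norm_mk, norm_zero, norm_smul, norm_inv, norm_norm]
      exact max_le zero_le_one inv_mul_le_one
    · rw [phaseForm_apply, abs_neg, Prod.norm_def, max_eq_right h]
      simp only [zero_mul, zero_add, inner_smul_left, real_inner_self_eq_norm_sq, conj_trivial]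
      rcases eq_or_ne ‖y.2‖ 0 with h0 | h0
      · simp [h0]
      · rw [sq, ← mul_assoc, inv_mul_cancel₀ h0, one_mul, abs_norm]
  · refine ⟨(1, 0), by simp, ?_⟩
    rw [phaseForm_apply, abs_neg, Prod.norm_def, max_eq_left h]
    simp

/-- Integration in θ comes first and replaces κ by K|w|^σ; what remains is compared with
max(ρ,|w|)^{-(d+1)}, whose mass is a multiple of 1/ρ. The three L¹ bounds that follow (compact
frequency support, low and high frequencies) are instances with different φ. -/
theorem lintegral_weight_le (hd : 0 < d) {X : Type*} [NormedAddCommGroup X] {κ : ℝ × Sp d → ℝ}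
    {φ : Sp d → ℝ} {F : ℝ × Sp d → X} {A B K ρ : ℝ} {σ : ℕ} (hA : 0 ≤ A) (hB0 : 0 ≤ B)
    (hρ : 0 < ρ) (hκm : Measurable κ) (hφm : Measurable φ)
    (hκ : ∀ w : Sp d, w ≠ 0 → ∫⁻ θ : ℝ, ENNReal.ofReal (κ (θ, w)) ≤ ENNReal.ofReal (K * ‖w‖ ^ σ))
    (hφ : ∀ w, 0 ≤ φ w)
    (hB : ∀ w : Sp d, w ≠ 0 → φ w * (K * ‖w‖ ^ σ) ≤ B * (max ρ ‖w‖) ^ (-((d : ℝ) + 1)))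
    (hF : ∀ z : ℝ × Sp d, z.2 ≠ 0 → ‖F z‖ ≤ A * (φ z.2 * κ z)) :
    ∫⁻ z, ‖F z‖ₑ ≤ ENNReal.ofReal (A * B * ρ⁻¹ * (radialMass d 1).toReal) := by
  calc ∫⁻ z, ‖F z‖ₑ ≤ ∫⁻ z : ℝ × Sp d, ENNReal.ofReal A *
        (ENNReal.ofReal (φ z.2) * ENNReal.ofReal (κ z)) := by
        refine lintegral_mono_ae ?_
        filter_upwards [ae_snd_ne_zero hd] with z hz
        rw [← ofReal_norm, ← ENNReal.ofReal_mul (hφ _), ← ENNReal.ofReal_mul hA]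
        exact ENNReal.ofReal_le_ofReal (hF z hz)
    _ = ENNReal.ofReal A * ∫⁻ w : Sp d, ENNReal.ofReal (φ w) *
        ∫⁻ θ : ℝ, ENNReal.ofReal (κ (θ, w)) := by
        rw [lintegral_const_mul _ (by fun_prop), Measure.volume_eq_prod,
          lintegral_prod_symm _ (by fun_prop)]
        congr 1
        refine lintegral_congr fun w => ?_
        exact lintegral_const_mul (ENNReal.ofReal (φ w))
          (f := fun θ : ℝ => ENNReal.ofReal (κ (θ, w))) (by fun_prop)
    _ ≤ ENNReal.ofReal A * ∫⁻ w : Sp d, ENNReal.ofReal B *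
        ENNReal.ofReal ((max ρ ‖w‖) ^ (-((d : ℝ) + 1))) := by
        refine mul_le_mul' le_rfl (lintegral_mono_ae ?_)
        filter_upwards [ae_ne_zero hd] with w hw
        calc _ ≤ ENNReal.ofReal (φ w) * ENNReal.ofReal (K * ‖w‖ ^ σ) := by
              gcongr
              exact hκ w hw
          _ ≤ _ := by
              rw [← ENNReal.ofReal_mul (hφ _), ← ENNReal.ofReal_mul hB0]
              exact ENNReal.ofReal_le_ofReal (hB w hw)
    _ = _ := by
        rw [lintegral_const_mul _ (by fun_prop), lintegral_max_rpow hρ,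
          ENNReal.ofReal_mul (by positivity), ENNReal.ofReal_mul (by positivity),
          ENNReal.ofReal_mul hA, ENNReal.ofReal_toReal (radialMass_lt_top one_pos).ne,
          Real.rpow_neg_one]
        ring

theorem support_high {f : ℝ × Sp d → ℂ} {r : ℝ} {n : ℕ} {z : ℝ × Sp d} (hz : ‖r • z.2‖ < 1) :
    iteratedFDeriv ℝ n (fun z : ℝ × Sp d => f z * (1 - (cutoff (r • z.2) : ℂ))) z = 0 := by
  have h : (fun z : ℝ × Sp d => f z * (1 - (cutoff (r • z.2) : ℂ))) =ᶠ[nhds z] fun _ => 0 := by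
    have ho : IsOpen {z : ℝ × Sp d | ‖r • z.2‖ < 1} :=
      isOpen_lt (by fun_prop) continuous_const
    filter_upwards [ho.mem_nhds hz] with y hy
    rw [cutoff_eq_one (le_of_lt hy)]
    simp
  rw [(h.iteratedFDeriv ℝ n).eq_of_nhds]
  exact congrFun (iteratedFDeriv_fun_zero (𝕜 := ℝ) (n := n)) z

theorem rpow_neg_add_one {x : ℝ} (hx : 0 ≤ x) : x ^ (-((d : ℝ) + 1)) = (x ^ (d + 1))⁻¹ := by
  rw [Real.rpow_neg hx, ← Real.rpow_natCast]
  push_cast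
  rfl

theorem integrable_of_weight (hd : 0 < d) {X : Type*} [NormedAddCommGroup X] {κ : ℝ × Sp d → ℝ}
    {F : ℝ × Sp d → X} {A K R : ℝ} {σ : ℕ} (hA : 0 ≤ A) (hK : 0 ≤ K) (hκm : Measurable κ)
    (hκ : ∀ w : Sp d, w ≠ 0 → ∫⁻ θ : ℝ, ENNReal.ofReal (κ (θ, w)) ≤ ENNReal.ofReal (K * ‖w‖ ^ σ))
    (hFm : AEStronglyMeasurable F volume)
    (hR : ∀ z : ℝ × Sp d, z.2 ≠ 0 → R < ‖z.2‖ → F z = 0)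
    (hF : ∀ z : ℝ × Sp d, z.2 ≠ 0 → ‖F z‖ ≤ A * κ z) : Integrable F := by
  refine ⟨hFm, lt_of_le_of_lt (lintegral_weight_le (φ := {w | ‖w‖ ≤ R}.indicator fun _ => 1)
    (B := K * max 1 R ^ σ * max 1 R ^ (d + 1)) (ρ := 1) hd hA (by positivity) one_pos hκm
    (measurable_const.indicator (measurableSet_le (by fun_prop) (by fun_prop))) hκ
    (fun w => Set.indicator_nonneg (fun _ _ => zero_le_one) _) (fun w hw => ?_) fun z hz => ?_)
    ENNReal.ofReal_lt_top⟩
  · rw [rpow_neg_add_one (by positivity)]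
    by_cases h : ‖w‖ ≤ R
    · rw [Set.indicator_of_mem (by exact h), one_mul, ← div_eq_mul_inv, le_div_iff₀ (by positivity)]
      have h1 : max 1 ‖w‖ ≤ max 1 R := max_le_max le_rfl h
      have h2 : ‖w‖ ≤ max 1 R := h.trans (le_max_right _ _)
      gcongr
    · rw [Set.indicator_of_notMem (by exact h), zero_mul]
      positivity
  · by_cases h : ‖z.2‖ ≤ R
    · rw [Set.indicator_of_mem (by exact h), one_mul]
      exact hF z hz
    · rw [hR z hz (not_le.1 h), Set.indicator_of_notMem (by exact h)]
      simp

theorem norm_integral_phase_le {F : ℝ × Sp d → ℂ} {B : ℝ} (hB : 0 ≤ B)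
    (h : ∫⁻ z, ‖F z‖ₑ ≤ ENNReal.ofReal B) (y : ℝ × Sp d) :
    ‖∫ z, Real.fourierChar (-phaseForm d z y) • F z‖ ≤ B := by
  have h1 : ‖∫ z, Real.fourierChar (-phaseForm d z y) • F z‖ₑ ≤ ENNReal.ofReal B := by
    refine (enorm_integral_le_lintegral_enorm _).trans (le_trans (lintegral_mono fun z => ?_) h)
    rw [← ofReal_norm, ← ofReal_norm, Circle.norm_smul]
  rw [← ofReal_norm] at h1
  exact (ENNReal.ofReal_le_ofReal_iff hB).1 h1

/-- No oscillation is needed: the integral of |w|^σ over |w| ≤ 2/r is of order r^{-(d+σ)}. -/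
theorem norm_oscillatory_low_le (hd : 0 < d) {κ : ℝ × Sp d → ℝ} (hκm : Measurable κ)
    {K : ℝ} (hK : 0 ≤ K) {σ : ℕ}
    (hκ : ∀ w : Sp d, w ≠ 0 → ∫⁻ θ : ℝ, ENNReal.ofReal (κ (θ, w)) ≤ ENNReal.ofReal (K * ‖w‖ ^ σ))
    {C : ℝ} (hC : 0 ≤ C) {f : ℝ × Sp d → ℂ} (hf : ∀ z : ℝ × Sp d, z.2 ≠ 0 → ‖f z‖ ≤ C * κ z)
    {r : ℝ} (hr : 0 < r) (y : ℝ × Sp d) :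
    ‖∫ z, Real.fourierChar (-phaseForm d z y) • (f z * (cutoff (r • z.2) : ℂ))‖ ≤
      C * (K * 2 ^ (d + σ)) * (radialMass d 1).toReal * (r ^ (d + σ))⁻¹ := by
  have hM0 : 0 ≤ (radialMass d 1).toReal := ENNReal.toReal_nonneg
  refine norm_integral_phase_le (by positivity) ((lintegral_weight_le
    (φ := {w | ‖w‖ ≤ 2 / r}.indicator fun _ => 1)
    (B := K * (2 / r) ^ (σ + d + 1)) (ρ := 2 / r) (A := C) hd hC (by positivity) (by positivity) hκm
    (measurable_const.indicator (measurableSet_le (by fun_prop) (by fun_prop))) hκ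
    (fun w => Set.indicator_nonneg (fun _ _ => zero_le_one) _) (fun w hw => ?_)
    fun z hz => ?_).trans (le_of_eq ?_)) y
  · rw [rpow_neg_add_one (by positivity)]
    by_cases h : ‖w‖ ≤ 2 / r
    · rw [Set.indicator_of_mem (by exact h), one_mul, max_eq_left h, mul_assoc, add_assoc, pow_add,
        mul_assoc, mul_inv_cancel₀ (by positivity), mul_one]
      gcongr
    · rw [Set.indicator_of_notMem (by exact h), zero_mul]
      positivity
  · by_cases h : ‖z.2‖ ≤ 2 / r
    · rw [Set.indicator_of_mem (by exact h), one_mul, norm_mul, Complex.norm_real,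
        Real.norm_of_nonneg (cutoff_nonneg _)]
      exact (mul_le_of_le_one_right (norm_nonneg _) (cutoff_le_one _)).trans (hf z hz)
    · rw [cutoff_eq_zero, Set.indicator_of_notMem (by exact h)]
      · simp
      · rw [norm_smul, Real.norm_of_nonneg hr.le]
        rw [not_le, div_lt_iff₀ hr] at h
        linarith
  · congr 1
    rw [show σ + d + 1 = (d + σ) + 1 by ring, pow_succ (2 / r) (d + σ), div_pow]
    field_simp

/-- After d + 1 + σ integrations by parts the integrand is of size |w|^{-(d+1)} on |w| ≥ 1/r, with
integral of order r, and the gain is r^{-(d+1+σ)}. The support radius R enters only through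
integrability, not through the constant. -/
theorem norm_oscillatory_high_le (hd : 0 < d) {κ : ℝ × Sp d → ℝ} (hκm : Measurable κ)
    {K : ℝ} (hK : 0 ≤ K) {σ : ℕ}
    (hκ : ∀ w : Sp d, w ≠ 0 → ∫⁻ θ : ℝ, ENNReal.ofReal (κ (θ, w)) ≤ ENNReal.ofReal (K * ‖w‖ ^ σ))
    {C : ℝ} (hC : 0 ≤ C) {g : ℝ × Sp d → ℂ}
    (hg : SymbolBound {z : ℝ × Sp d | z.2 ≠ 0} (fun z => ‖z.2‖) (d + 1 + σ) κ C g) {r R : ℝ}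
    (hlow : ∀ n (z : ℝ × Sp d), ‖r • z.2‖ < 1 → iteratedFDeriv ℝ n g z = 0)
    (hhigh : ∀ z : ℝ × Sp d, R < ‖z.2‖ → g z = 0)
    (hgc : ContDiff ℝ ((d + 1 + σ : ℕ) : WithTop ℕ∞) g) {y : ℝ × Sp d} (hr : 0 < r) (hy : ‖y‖ = r) :
    ‖∫ z, Real.fourierChar (-phaseForm d z y) • g z‖ ≤
      C * K * (radialMass d 1).toReal * (r ^ (d + σ))⁻¹ := by
  have hM0 : 0 ≤ (radialMass d 1).toReal := ENNReal.toReal_nonneg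
  have hb : ∀ n ≤ d + 1 + σ, ∀ z : ℝ × Sp d, z.2 ≠ 0 →
      ‖iteratedFDeriv ℝ n g z‖ ≤ C * ((‖z.2‖ ^ n)⁻¹ * κ z) := by
    intro n hn z hz
    have h0 : 0 < ‖z.2‖ := norm_pos_iff.2 hz
    have := hg.bound n hn z hz
    rw [mul_left_comm, ← div_eq_inv_mul, le_div_iff₀ (by positivity)]
    exact this
  have hint : ∀ n ≤ d + 1 + σ, Integrable (iteratedFDeriv ℝ n g) := by
    intro n hn
    refine integrable_of_weight (A := C * r ^ n) hd (by positivity) hK hκm hκ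
      (hgc.continuous_iteratedFDeriv (by exact_mod_cast hn)).aestronglyMeasurable
      (R := R) (fun z _ hz => ?_) fun z hz => ?_
    · have h : g =ᶠ[nhds z] fun _ => 0 := by
        have ho : IsOpen {z : ℝ × Sp d | R < ‖z.2‖} := isOpen_lt continuous_const (by fun_prop)
        filter_upwards [ho.mem_nhds hz] with y hy using hhigh y hy
      rw [(h.iteratedFDeriv ℝ n).eq_of_nhds]
      exact congrFun (iteratedFDeriv_fun_zero (𝕜 := ℝ) (n := n)) z
    · have h0 : 0 < ‖z.2‖ := norm_pos_iff.2 hz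
      have h5 := hb n hn z hz
      have hκz : 0 ≤ C * κ z := (mul_nonneg (norm_nonneg _) (by positivity)).trans
        (hg.bound 0 (Nat.zero_le _) z hz)
      rcases lt_or_ge ‖r • z.2‖ 1 with h | h
      · rw [hlow n z h, norm_zero]
        calc 0 ≤ r ^ n * (C * κ z) := by positivity
          _ = _ := by ring
      · rw [norm_smul, Real.norm_of_nonneg hr.le] at h
        have h6 : (‖z.2‖ ^ n)⁻¹ ≤ r ^ n := by
          rw [inv_le_iff_one_le_mul₀ (by positivity), ← mul_pow]
          exact one_le_pow₀ h
        calc _ ≤ (‖z.2‖ ^ n)⁻¹ * (C * κ z) := h5.trans_eq (by ring)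
          _ ≤ r ^ n * (C * κ z) := mul_le_mul_of_nonneg_right h6 hκz
          _ = _ := by ring
  have hL1 : ∫⁻ z, ‖iteratedFDeriv ℝ (d + 1 + σ) g z‖ₑ ≤
      ENNReal.ofReal (C * K * r⁻¹⁻¹ * (radialMass d 1).toReal) := by
    refine lintegral_weight_le (φ := {w | r⁻¹ ≤ ‖w‖}.indicator fun w => (‖w‖ ^ (d + 1 + σ))⁻¹)
      hd hC hK (by positivity) hκm (Measurable.indicator (by fun_prop)
        (measurableSet_le (by fun_prop) (by fun_prop))) hκ
      (fun w => Set.indicator_nonneg (fun _ _ => by positivity) _) (fun w hw => ?_) fun z hz => ?_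
    · rw [rpow_neg_add_one (by positivity)]
      have h0 : 0 < ‖w‖ := norm_pos_iff.2 hw
      by_cases h : r⁻¹ ≤ ‖w‖
      · rw [Set.indicator_of_mem (by exact h), max_eq_right h, pow_add ‖w‖ (d + 1) σ]
        exact le_of_eq (by field_simp)
      · rw [Set.indicator_of_notMem (by exact h), zero_mul]
        positivity
    · by_cases h : r⁻¹ ≤ ‖z.2‖
      · rw [Set.indicator_of_mem (by exact h)]
        exact hb _ le_rfl z hz
      · rw [Set.indicator_of_notMem (by exact h), hlow _ z]
        · simp
        · rw [norm_smul, Real.norm_of_nonneg hr.le]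
          rw [not_le, inv_eq_one_div, lt_div_iff₀ hr] at h
          linarith
  have hL2 : ∫ z, ‖iteratedFDeriv ℝ (d + 1 + σ) g z‖ ≤ C * K * r * (radialMass d 1).toReal := by
    rw [inv_inv] at hL1
    rw [integral_norm_eq_lintegral_enorm (hint _ le_rfl).1]
    exact ENNReal.toReal_le_of_le_ofReal (by positivity) hL1
  obtain ⟨v, hv, hvy⟩ := exists_phaseForm_eq_norm y
  have hHaar : (volume : Measure (ℝ × Sp d)).IsAddHaarMeasure :=
    inferInstanceAs ((volume : Measure ℝ).prod (volume : Measure (Sp d))).IsAddHaarMeasure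
  have key := pow_mul_norm_fourierIntegral_le (ν := volume) (phaseForm d) hgc hint y v
  rw [hvy, hy] at key
  have h7 : r ^ (d + 1 + σ) * ‖∫ z, Real.fourierChar (-phaseForm d z y) • g z‖ ≤
      C * K * r * (radialMass d 1).toReal := by
    calc _ ≤ (2 * Real.pi * r) ^ (d + 1 + σ) *
          ‖∫ z, Real.fourierChar (-phaseForm d z y) • g z‖ := by
          gcongr
          nlinarith [Real.pi_gt_three]
      _ ≤ _ := key
      _ ≤ 1 * ∫ z, ‖iteratedFDeriv ℝ (d + 1 + σ) g z‖ := by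
          refine mul_le_mul_of_nonneg_right (pow_le_one₀ (norm_nonneg _) hv)
            (integral_nonneg fun _ => norm_nonneg _)
      _ ≤ _ := by rw [one_mul]; exact hL2
  rw [← div_eq_mul_inv, le_div_iff₀ (by positivity)]
  rw [show d + 1 + σ = (d + σ) + 1 by ring, pow_succ] at h7
  refine le_of_mul_le_mul_right ?_ hr
  linarith

/-- Cutting at |w| ~ 1/|y| balances the low and high parts. The constant is chosen before f and R,
so that truncations in frequency can be removed afterwards. -/
theorem norm_oscillatory_le (hd : 0 < d) {κ : ℝ × Sp d → ℝ} (hκm : Measurable κ)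
    {K : ℝ} (hK : 0 ≤ K) {σ : ℕ}
    (hκ : ∀ w : Sp d, w ≠ 0 → ∫⁻ θ : ℝ, ENNReal.ofReal (κ (θ, w)) ≤ ENNReal.ofReal (K * ‖w‖ ^ σ))
    {C : ℝ} (hC : 0 ≤ C) : ∃ C', 0 ≤ C' ∧ ∀ (f : ℝ × Sp d → ℂ) (R : ℝ),
      SymbolBound {z : ℝ × Sp d | z.2 ≠ 0} (fun z => ‖z.2‖) (d + 1 + σ) κ C f →
      (∀ z : ℝ × Sp d, R < ‖z.2‖ → f z = 0) → Integrable f ∧ ∀ y : ℝ × Sp d, y ≠ 0 →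
        ‖∫ z, Real.fourierChar (-phaseForm d z y) • f z‖ ≤ C' * (‖y‖ ^ (d + σ))⁻¹ := by
  obtain ⟨Cχ, hCχ0, hχ⟩ := symbolBound_cutoff (d := d) (d + 1 + σ)
  have hM0 : 0 ≤ (radialMass d 1).toReal := ENNReal.toReal_nonneg
  set A : ℝ := 2 ^ (d + 1 + σ) * C * (1 + 2 ^ (d + 1 + σ) * 1 * Cχ) with hA
  refine ⟨C * (K * 2 ^ (d + σ)) * (radialMass d 1).toReal + A * K * (radialMass d 1).toReal,
    by positivity, fun f R hf hR => ?_⟩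
  have hfm : AEStronglyMeasurable f volume := by
    have h1 := hf.contDiffOn.continuousOn.aestronglyMeasurable (μ := volume)
      isOpen_snd_ne_zero.measurableSet
    have h2 : volume.restrict {z : ℝ × Sp d | z.2 ≠ 0} = volume :=
      Measure.restrict_eq_self_of_ae_mem (ae_snd_ne_zero hd)
    rwa [h2] at h1
  have hfi : Integrable f := integrable_of_weight hd hC hK hκm hκ hfm (fun z _ => hR z)
    fun z hz => hf.norm_le hz
  refine ⟨hfi, fun y hy => ?_⟩
  have hr : 0 < ‖y‖ := norm_pos_iff.2 hy
  set r := ‖y‖ with hrdef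
  set g : ℝ × Sp d → ℂ := fun z => f z * (1 - (cutoff (r • z.2) : ℂ)) with hg
  have hcc : Continuous (cutoff (d := d)) := contDiff_cutoff.continuous
  have hχb : ∀ z : ℝ × Sp d, ‖((cutoff (r • z.2) : ℝ) : ℂ)‖ ≤ 1 := fun z => by
    rw [Complex.norm_real, Real.norm_of_nonneg (cutoff_nonneg _)]
    exact cutoff_le_one _
  have hlowi : Integrable (fun z : ℝ × Sp d => f z * (cutoff (r • z.2) : ℂ)) :=
    hfi.mul_bdd (c := 1) (Continuous.aestronglyMeasurable (by fun_prop))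
      (Filter.Eventually.of_forall hχb)
  have hgi : Integrable g := by
    refine hfi.mul_bdd (c := 2) (Continuous.aestronglyMeasurable (by fun_prop))
      (Filter.Eventually.of_forall fun z => ?_)
    refine (norm_sub_le _ _).trans ?_
    rw [norm_one]
    linarith [hχb z]
  have hphase : ∀ F : ℝ × Sp d → ℂ, Integrable F →
      Integrable fun z => Real.fourierChar (-phaseForm d z y) • F z := by
    intro F hF
    refine hF.mono ?_ (Filter.Eventually.of_forall fun z => (Circle.norm_smul _ _).le)
    simp only [Circle.smul_def]
    have : Continuous fun z => (Real.fourierChar (-phaseForm d z y) : ℂ) := by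
      have := Real.continuous_fourierChar
      fun_prop
    exact this.aestronglyMeasurable.smul hF.1
  have hsplit : ∫ z, Real.fourierChar (-phaseForm d z y) • f z =
      (∫ z, Real.fourierChar (-phaseForm d z y) • (f z * (cutoff (r • z.2) : ℂ))) +
        ∫ z, Real.fourierChar (-phaseForm d z y) • g z := by
    rw [← integral_add (hphase _ hlowi) (hphase _ hgi)]
    congr 1
    ext z
    rw [← smul_add]
    congr 1
    simp only [hg]
    ring
  have hgs : SymbolBound {z : ℝ × Sp d | z.2 ≠ 0} (fun z => ‖z.2‖) (d + 1 + σ) κ A g := by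
    have h1 : SymbolBound {z : ℝ × Sp d | z.2 ≠ 0} (fun z => ‖z.2‖) (d + 1 + σ) (fun _ => 1)
        (1 + 2 ^ (d + 1 + σ) * 1 * Cχ) (fun z => 1 - (cutoff (r • z.2) : ℂ)) := by
      have h2 := (SymbolBound.const (-1 : ℂ)).mul isOpen_snd_ne_zero norm_snd_pos (hχ r hr)
      have h3 := (SymbolBound.const (1 : ℂ)).add isOpen_snd_ne_zero norm_snd_pos
        (h2.mono (κ₂ := fun _ => 1) (C₂ := 2 ^ (d + 1 + σ) * 1 * Cχ) (fun z _ => by simp))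
      refine (h3.congr isOpen_snd_ne_zero fun z _ => ?_).mono fun z _ => ?_
      · ring
      · simp
    have h4 := hf.mul isOpen_snd_ne_zero norm_snd_pos h1
    exact h4.mono fun z _ => by rw [mul_one (κ z)]
  -- The symbol f may be singular on w = 0, but the high-frequency part vanishes identically near
  -- that set.
  have hgc : ContDiff ℝ ((d + 1 + σ : ℕ) : WithTop ℕ∞) g := by
    rw [contDiff_iff_contDiffAt]
    intro z
    by_cases hz : z.2 = 0
    · have h : g =ᶠ[nhds z] fun _ => 0 := by
        have ho : IsOpen {z : ℝ × Sp d | ‖r • z.2‖ < 1} :=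
          isOpen_lt (by fun_prop) continuous_const
        filter_upwards [ho.mem_nhds (by simp [hz])] with y hy
        simp only [hg]
        rw [cutoff_eq_one (le_of_lt hy)]
        simp
      exact contDiffAt_const.congr_of_eventuallyEq h
    · exact hgs.contDiffOn.contDiffAt (isOpen_snd_ne_zero.mem_nhds hz)
  rw [hsplit, add_mul]
  refine (norm_add_le _ _).trans (add_le_add ?_ ?_)
  · exact norm_oscillatory_low_le hd hκm hK hκ hC (fun z hz => hf.norm_le hz) hr y
  · exact norm_oscillatory_high_le hd hκm hK hκ (by positivity) (R := R) hgs
      (fun n z hz => support_high hz) (fun z hz => by simp [hg, hR z hz]) hgc hr hrdef.symm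

end Oscillatory

/-! ### From symbols to pointwise bounds in physical space -/

section Synthesis

theorem fourierChar_phaseForm (z y : ℝ × Sp d) :
    (Real.fourierChar (-phaseForm d z y) : ℂ) =
      Real.fourierChar (inner ℝ z.2 y.2) * Complex.exp (freq z.1 * y.1) := by
  rw [phaseForm_apply, neg_neg, Real.fourierChar_apply, Real.fourierChar_apply, ← Complex.exp_add]
  congr 1
  simp only [freq]
  push_cast
  ring

/-- A symbol need not be integrable in (θ, w), so it is truncated by χ(δw). The bounds are uniform
in δ, Fubini identifies the truncated integral with that of a χ(δ·), and δ → 0 by dominated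
convergence since a is integrable. -/
theorem norm_fourierInv_le_of_symbol (hd : 0 < d) {κ : ℝ × Sp d → ℝ} (hκm : Measurable κ)
    {K : ℝ} (hK : 0 ≤ K) {σ : ℕ}
    (hκ : ∀ w : Sp d, w ≠ 0 → ∫⁻ θ : ℝ, ENNReal.ofReal (κ (θ, w)) ≤ ENNReal.ofReal (K * ‖w‖ ^ σ))
    (hκ0 : ∀ z, 0 ≤ κ z) {f : ℝ × Sp d → ℂ} (hf : IsSymbol (d + 1 + σ) κ f) :
    ∃ C', 0 ≤ C' ∧ ∀ (t : ℝ) (x : Sp d) (a : Sp d → ℂ), (t, x) ≠ 0 → Integrable a →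
      (∀ w, w ≠ 0 → a w = ∫ θ : ℝ, Complex.exp (freq θ * t) * f (θ, w)) →
        ‖𝓕⁻ a x‖ ≤ C' * (‖(t, x)‖ ^ (d + σ))⁻¹ := by
  obtain ⟨C₀, hC₀⟩ := hf
  have hC₁ : SymbolBound {z : ℝ × Sp d | z.2 ≠ 0} (fun z => ‖z.2‖) (d + 1 + σ) κ |C₀| f :=
    hC₀.mono fun z _ => mul_le_mul_of_nonneg_right (le_abs_self _) (hκ0 z)
  obtain ⟨Cχ, hCχ0, hχ⟩ := symbolBound_cutoff (d := d) (d + 1 + σ)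
  obtain ⟨C', hC'0, hC'⟩ := norm_oscillatory_le hd hκm hK hκ
    (C := 2 ^ (d + 1 + σ) * |C₀| * Cχ) (by positivity)
  refine ⟨C', hC'0, fun t x a hy ha hae => ?_⟩
  have hcc : Continuous (cutoff (d := d)) := contDiff_cutoff.continuous
  have hbound : ∀ δ : ℝ, 0 < δ →
      ‖∫ w, Real.fourierChar (inner ℝ w x) • (a w * (cutoff (δ • w) : ℂ))‖ ≤
        C' * (‖(t, x)‖ ^ (d + σ))⁻¹ := by
    intro δ hδ
    obtain ⟨hi, hb⟩ := hC' (fun z => f z * (cutoff (δ • z.2) : ℂ)) (2 / δ)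
      (((hC₁.mul isOpen_snd_ne_zero norm_snd_pos (hχ δ hδ))).mono fun z _ => by rw [mul_one (κ z)])
      (fun z hz => by
        rw [cutoff_eq_zero]
        · simp
        · rw [norm_smul, Real.norm_of_nonneg hδ.le]
          rw [div_lt_iff₀ hδ] at hz
          linarith)
    have hphase : Integrable fun z : ℝ × Sp d => Real.fourierChar (-phaseForm d z (t, x)) •
        (f z * (cutoff (δ • z.2) : ℂ)) := by
      refine hi.mono ?_ (Filter.Eventually.of_forall fun z => (Circle.norm_smul _ _).le)
      simp only [Circle.smul_def]
      have : Continuous fun z => (Real.fourierChar (-phaseForm d z (t, x)) : ℂ) := by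
        have := Real.continuous_fourierChar
        fun_prop
      exact this.aestronglyMeasurable.smul hi.1
    refine le_trans (le_of_eq ?_) (hb (t, x) hy)
    rw [Measure.volume_eq_prod] at hphase ⊢
    rw [integral_prod_symm _ hphase]
    congr 1
    refine integral_congr_ae ?_
    filter_upwards [ae_ne_zero hd] with w hw
    rw [hae w hw, Circle.smul_def, smul_eq_mul, mul_comm (∫ θ : ℝ, _) _, ← mul_assoc,
      ← integral_const_mul]
    refine integral_congr_ae (Filter.Eventually.of_forall fun θ => ?_)
    simp only [Circle.smul_def, smul_eq_mul, fourierChar_phaseForm]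
    ring
  have hlim : Filter.Tendsto (fun n : ℕ => ∫ w, Real.fourierChar (inner ℝ w x) •
      (a w * (cutoff (((n : ℝ) + 1)⁻¹ • w) : ℂ))) Filter.atTop (nhds (𝓕⁻ a x)) := by
    rw [Real.fourierInv_eq]
    have hch : Continuous fun w : Sp d => (Real.fourierChar (inner ℝ w x) : ℂ) := by
      have := Real.continuous_fourierChar
      fun_prop
    refine tendsto_integral_of_dominated_convergence (fun w => ‖a w‖) (fun n => ?_) ha.norm
      (fun n => ?_) ?_
    · simp only [Circle.smul_def]
      refine hch.aestronglyMeasurable.smul (ha.1.mul (Continuous.aestronglyMeasurable ?_))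
      fun_prop
    · refine Filter.Eventually.of_forall fun w => ?_
      rw [Circle.norm_smul, norm_mul, Complex.norm_real, Real.norm_of_nonneg (cutoff_nonneg _)]
      exact mul_le_of_le_one_right (norm_nonneg _) (cutoff_le_one _)
    · refine Filter.Eventually.of_forall fun w => ?_
      refine tendsto_nhds_of_eventually_eq ?_
      obtain ⟨N, hN⟩ := exists_nat_ge ‖w‖
      filter_upwards [Filter.eventually_ge_atTop N] with n hn
      rw [cutoff_eq_one]
      · simp
      · rw [norm_smul, Real.norm_of_nonneg (by positivity)]
        refine inv_mul_le_one_of_le₀ ?_ (by positivity)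
        have : (N : ℝ) ≤ n := by exact_mod_cast hn
        linarith
  exact le_of_tendsto hlim.norm (Filter.Eventually.of_forall fun n => hbound _ (by positivity))

theorem continuousOn_fourierInv {a : ℝ → Sp d → ℂ} (hd : 0 < d)
    (hm : ∀ t, AEStronglyMeasurable (a t) volume) (hc : ∀ w, w ≠ 0 → Continuous fun t => a t w)
    {B : ℝ → ℝ} (hb : ∀ t₀ > 0, ∀ t ≥ t₀, ∀ w, w ≠ 0 →
      ‖a t w‖ ≤ B t₀ * (1 + ‖w‖) ^ (-((d : ℝ) + 1))) :
    ContinuousOn (fun z : ℝ × Sp d => 𝓕⁻ (a z.1) z.2) {z | 0 < z.1} := by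
  intro z hz
  have ho : IsOpen {y : ℝ × Sp d | z.1 / 2 < y.1} := isOpen_lt continuous_const continuous_fst
  have hz' : z ∈ {y : ℝ × Sp d | z.1 / 2 < y.1} := by
    have : 0 < z.1 := hz
    simp only [Set.mem_ofPred_eq]
    linarith
  simp only [Real.fourierInv_eq]
  refine ContinuousAt.continuousWithinAt ?_
  refine continuousAt_of_dominated
    (bound := fun w => B (z.1 / 2) * (1 + ‖w‖) ^ (-((d : ℝ) + 1))) ?_ ?_
    ((integrable_one_add_norm (by simp)).const_mul _) ?_
  · refine Filter.Eventually.of_forall fun y => ?_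
    simp only [Circle.smul_def]
    have hch : Continuous fun w : Sp d => (Real.fourierChar (inner ℝ w y.2) : ℂ) := by
      have := Real.continuous_fourierChar
      fun_prop
    exact hch.aestronglyMeasurable.smul (hm y.1)
  · filter_upwards [ho.mem_nhds hz'] with y hy
    filter_upwards [ae_ne_zero hd] with w hw
    rw [Circle.norm_smul]
    exact hb (z.1 / 2) (half_pos hz) y.1 (le_of_lt hy) w hw
  · filter_upwards [ae_ne_zero hd] with w hw
    have h1 := (hc w hw).comp continuous_fst (X := ℝ × Sp d)
    simp only [Circle.smul_def]
    have hch : Continuous fun y : ℝ × Sp d => (Real.fourierChar (inner ℝ w y.2) : ℂ) := by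
      have := Real.continuous_fourierChar
      fun_prop
    exact (hch.smul h1).continuousAt

theorem fourierInv_im_eq_zero {a : Sp d → ℂ} (ha : ∀ w, w ≠ 0 → a (-w) = (starRingEnd ℂ) (a w))
    (hd : 0 < d) (x : Sp d) : ((𝓕⁻ a x).re : ℂ) = 𝓕⁻ a x := by
  rw [← Complex.conj_eq_iff_re, Real.fourierInv_eq', ← integral_conj,
    ← integral_neg_eq_self (fun w => Complex.exp (↑(2 * Real.pi * inner ℝ w x) * Complex.I) • a w)]
  refine integral_congr_ae ?_
  filter_upwards [ae_ne_zero hd] with w hw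
  rw [ha w hw]
  simp only [smul_eq_mul, map_mul, ← Complex.exp_conj, Complex.conj_ofReal, Complex.conj_I,
    inner_neg_left]
  congr 2
  push_cast
  ring

end Synthesis

/-! ### Hermitian symmetry, hence reality of the Green function -/

section Symmetry

theorem rayLaplace_conj (μ : Sp d → ℝ) (j : Fin d) (θ : ℝ) (w : Sp d) :
    rayLaplace (gradHat μ j) (freq (-θ)) (-w) =
      (starRingEnd ℂ) (rayLaplace (gradHat μ j) (freq θ) w) := by
  simp only [rayLaplace]
  rw [← integral_conj]
  congr 1
  ext s
  rw [smul_neg, gradHat_neg, map_mul, ← Complex.exp_conj]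
  congr 2
  simp [freq]
  exact Or.inl (Or.inl (map_ofNat _ 2).symm)

theorem dispersion_conj (μ : Sp d → ℝ) (θ : ℝ) (w : Sp d) :
    dispersion μ (freq (-θ)) (-w) = (starRingEnd ℂ) (dispersion μ (freq θ) w) := by
  have hb : besselMult (-w) = besselMult w := by simp [besselMult]
  simp only [dispersion, rayLaplace_conj, hb, map_mul, map_sum, Complex.conj_ofReal,
    Complex.conj_I, map_ofNat]
  simp only [PiLp.neg_apply, Complex.ofReal_neg, neg_mul, Finset.sum_neg_distrib]
  ring

theorem greenHat_conj (μ : Sp d → ℝ) (t : ℝ) (w : Sp d) :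
    greenHat μ t (-w) = (starRingEnd ℂ) (greenHat μ t w) := by
  simp only [greenHat]
  rw [← integral_conj, ← integral_neg_eq_self]
  congr 1
  ext θ
  rw [resolventSymbol, resolventSymbol, dispersion_conj]
  simp only [map_mul, map_inv₀, map_sub, map_one, ← Complex.exp_conj]
  congr 2
  simp [freq]
  exact Or.inl (Or.inl (map_ofNat _ 2).symm)

end Symmetry

/-! ### Decay and continuity of the Green function in frequency -/

section GreenHat

theorem besselMult_mul_norm_le_one (w : Sp d) : besselMult w * ‖w‖ ≤ 1 := by
  have h0 : 0 ≤ ‖w‖ := norm_nonneg w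
  rw [besselMult, inv_mul_le_one₀ (by positivity)]
  nlinarith [Real.pi_gt_three, sq_nonneg (‖w‖ - 1), mul_nonneg (sq_nonneg Real.pi) (sq_nonneg ‖w‖),
    mul_le_mul_of_nonneg_right (show (9 : ℝ) ≤ Real.pi ^ 2 by nlinarith [Real.pi_gt_three])
      (sq_nonneg ‖w‖)]

theorem one_add_pow_le {x : ℝ} (hx : 0 ≤ x) (m : ℕ) : (1 + x) ^ m ≤ 2 ^ m * (1 + x ^ m) := by
  rcases le_total x 1 with h | h
  · calc (1 + x) ^ m ≤ 2 ^ m := by gcongr; linarith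
      _ ≤ _ := le_mul_of_one_le_right (by positivity) (by linarith [pow_nonneg hx m])
  · calc (1 + x) ^ m ≤ (2 * x) ^ m := by gcongr; linarith
      _ = 2 ^ m * x ^ m := mul_pow _ _ _
      _ ≤ _ := by gcongr; linarith

/-- Combines J = 0 and J = d + 2 in `greenHat_bound`. One power more than the d + 1 used for
integrability of `greenHat` is kept, because the gradient contributes a factor |w|. -/
theorem greenHat_decay {μ : Sp d → ℝ} (h1 : HypH1 μ) (h2 : HypH2 μ) : ∃ B : ℝ → ℝ,
    ∀ t₀ > 0, 0 ≤ B t₀ ∧ ∀ t ≥ t₀, ∀ w : Sp d, w ≠ 0 →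
      ‖greenHat μ t w‖ * (1 + ‖w‖) ^ (d + 2) ≤ B t₀ := by
  obtain ⟨C, hC0, hC⟩ := greenHat_bound h1 h2
  refine ⟨fun t₀ => 2 ^ (d + 2) * (C + (t₀ ^ (d + 2))⁻¹ * C), fun t₀ ht₀ =>
    ⟨by positivity, fun t ht w hw => ?_⟩⟩
  have h0 : 0 < ‖w‖ := norm_pos_iff.2 hw
  have ht0 : 0 < t := lt_of_lt_of_le ht₀ ht
  have hb := besselMult_mul_norm_le_one w
  have e0 : ‖greenHat μ t w‖ ≤ C := by
    have := hC w hw 0 (by omega) t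
    rw [pow_zero, pow_zero, one_mul, mul_one] at this
    exact this.trans (mul_le_of_le_one_right hC0 hb)
  have e1 : ‖greenHat μ t w‖ * ‖w‖ ^ (d + 2) ≤ (t₀ ^ (d + 2))⁻¹ * C := by
    have h3 := hC w hw (d + 2) (by omega) t
    rw [inv_pow, ← div_eq_mul_inv, le_div_iff₀ (by positivity), abs_of_pos ht0] at h3
    rw [← div_eq_inv_mul, le_div_iff₀ (by positivity)]
    calc _ ≤ ‖greenHat μ t w‖ * ‖w‖ ^ (d + 2) * t ^ (d + 2) := by gcongr
      _ = t ^ (d + 2) * ‖greenHat μ t w‖ * ‖w‖ ^ (d + 2) := by ring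
      _ ≤ C * (besselMult w * ‖w‖) := h3
      _ ≤ C := mul_le_of_le_one_right hC0 hb
  calc _ ≤ ‖greenHat μ t w‖ * (2 ^ (d + 2) * (1 + ‖w‖ ^ (d + 2))) := by
        gcongr
        exact one_add_pow_le h0.le _
    _ = 2 ^ (d + 2) * (‖greenHat μ t w‖ + ‖greenHat μ t w‖ * ‖w‖ ^ (d + 2)) := by ring
    _ ≤ _ := mul_le_mul_of_nonneg_left (add_le_add e0 e1) (by positivity)

theorem continuousOn_resolventSymbol_joint {μ : Sp d → ℝ} (h1 : HypH1 μ) (h2 : HypH2 μ) :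
    ContinuousOn (fun z : ℝ × Sp d => resolventSymbol μ (freq z.1) z.2) {z | z.2 ≠ 0} := by
  obtain ⟨C, hC⟩ := isSymbol_resolvent h1 h2
  exact hC.contDiffOn.continuousOn

theorem aestronglyMeasurable_resolventSymbol (hd : 0 < d) {μ : Sp d → ℝ} (h1 : HypH1 μ)
    (h2 : HypH2 μ) : AEStronglyMeasurable
      (fun z : ℝ × Sp d => resolventSymbol μ (freq z.1) z.2) volume := by
  have h := (continuousOn_resolventSymbol_joint h1 h2).aestronglyMeasurable (μ := volume)
    isOpen_snd_ne_zero.measurableSet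
  have h3 : volume.restrict {z : ℝ × Sp d | z.2 ≠ 0} = volume :=
    Measure.restrict_eq_self_of_ae_mem (ae_snd_ne_zero hd)
  rwa [h3] at h

theorem aestronglyMeasurable_greenHat (hd : 0 < d) {μ : Sp d → ℝ} (h1 : HypH1 μ)
    (h2 : HypH2 μ) (t : ℝ) : AEStronglyMeasurable (greenHat μ t) volume := by
  have h := aestronglyMeasurable_resolventSymbol hd h1 h2
  rw [Measure.volume_eq_prod] at h
  have hc := continuous_freq
  have he : Continuous fun z : Sp d × ℝ => Complex.exp (freq z.2 * t) := by fun_prop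
  exact AEStronglyMeasurable.integral_prod_right'
    (f := fun z : Sp d × ℝ => Complex.exp (freq z.2 * t) * resolventSymbol μ (freq z.2) z.1)
    (he.aestronglyMeasurable.mul h.prod_swap)

/-- Pointwise Fourier inversion in x asks for continuity. It is proved on an annulus around w, where
the weight is dominated by a fixed multiple of (θ² + |w|²/4)⁻¹. -/
theorem continuousAt_greenHat {μ : Sp d → ℝ} (h1 : HypH1 μ) (h2 : HypH2 μ) (t : ℝ) {w : Sp d}
    (hw : w ≠ 0) : ContinuousAt (greenHat μ t) w := by
  obtain ⟨C, hC⟩ := isSymbol_resolvent h1 h2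
  have h0 : 0 < ‖w‖ := norm_pos_iff.2 hw
  have ho : IsOpen {u : Sp d | ‖w‖ / 2 < ‖u‖ ∧ ‖u‖ < 2 * ‖w‖} :=
    (isOpen_lt continuous_const continuous_norm).inter (isOpen_lt continuous_norm continuous_const)
  have hmem : w ∈ {u : Sp d | ‖w‖ / 2 < ‖u‖ ∧ ‖u‖ < 2 * ‖w‖} := ⟨by linarith, by linarith⟩
  have hne : ∀ u ∈ {u : Sp d | ‖w‖ / 2 < ‖u‖ ∧ ‖u‖ < 2 * ‖w‖}, u ≠ 0 := fun u hu =>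
    norm_pos_iff.1 (lt_trans (half_pos h0) hu.1)
  have hc := continuous_freq
  refine continuousAt_of_dominated
    (bound := fun θ => |C| * (2 * ‖w‖) ^ 2 * (θ ^ 2 + (‖w‖ / 2) ^ 2)⁻¹) ?_ ?_
    ((integral_inv_sq_add_sq (half_pos h0)).1.const_mul _) ?_
  · filter_upwards [ho.mem_nhds hmem] with u hu
    have := continuous_resolventSymbol_freq h1 h2 (hne u hu)
    exact Continuous.aestronglyMeasurable (by fun_prop)
  · filter_upwards [ho.mem_nhds hmem] with u hu
    refine Filter.Eventually.of_forall fun θ => ?_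
    rw [norm_mul, norm_exp_freq, one_mul]
    have hb := hC.norm_le (z := (θ, u)) (hne u hu)
    refine hb.trans ?_
    have hκ : dispWeight (θ, u) ≤ (2 * ‖w‖) ^ 2 * (θ ^ 2 + (‖w‖ / 2) ^ 2)⁻¹ := by
      have := besselMult_le_one u
      have := (besselMult_pos u).le
      have hp : 0 < θ ^ 2 + (‖w‖ / 2) ^ 2 := by positivity
      rw [dispWeight]
      refine mul_le_mul ?_ (inv_anti₀ hp ?_) (by positivity) (by positivity)
      · calc besselMult u * ‖u‖ ^ 2 ≤ 1 * (2 * ‖w‖) ^ 2 := by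
              gcongr
              exact hu.2.le
          _ = _ := one_mul _
      · have := hu.1.le
        simp only
        gcongr
    calc _ ≤ |C| * dispWeight (θ, u) := by
          have := dispWeight_nonneg (θ, u)
          gcongr
          exact le_abs_self C
      _ ≤ |C| * ((2 * ‖w‖) ^ 2 * (θ ^ 2 + (‖w‖ / 2) ^ 2)⁻¹) := by gcongr
      _ = _ := by ring
  · refine Filter.Eventually.of_forall fun θ => ?_
    have h3 := (continuousOn_resolventSymbol_joint h1 h2).continuousAt
      (isOpen_snd_ne_zero.mem_nhds (x := (θ, w)) hw)
    have h4 : ContinuousAt (fun u : Sp d => resolventSymbol μ (freq θ) u) w :=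
      ContinuousAt.comp (f := fun u : Sp d => (θ, u))
        (g := fun z : ℝ × Sp d => resolventSymbol μ (freq z.1) z.2) h3
        (by fun_prop : ContinuousAt (fun u : Sp d => (θ, u)) w)
    exact continuousAt_const.mul h4

end GreenHat

/-! ### Real kernels with power decay -/

section Kernel

/-- A kernel vanishing for `t ≤ 0` with `‖A(t)‖_{L¹} ≲ t^{-m}` and `‖A(t)‖_{L^∞} ≲ t^{-d-m}`. -/
structure KernelBound (m : ℕ) (C : ℝ) (A : ℝ → Sp d → ℝ) : Prop where
  nonneg : 0 ≤ C
  measurable : Measurable fun z : ℝ × Sp d => A z.1 z.2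
  of_nonpos : ∀ t ≤ 0, ∀ x, A t x = 0
  lintegral_le : ∀ t > 0, ∫⁻ x, ‖A t x‖ₑ ≤ ENNReal.ofReal (C * (t ^ m)⁻¹)
  norm_le : ∀ t > 0, ∀ x, ‖A t x‖ ≤ C * (t ^ (d + m))⁻¹

/-- The real kernel with spatial Fourier transform `a(t)`, extended by zero to `t ≤ 0`. -/
def realKernel (a : ℝ → Sp d → ℂ) (t : ℝ) (x : Sp d) : ℝ := if 0 < t then (𝓕⁻ (a t) x).re else 0

theorem norm_realKernel_le (a : ℝ → Sp d → ℂ) (t : ℝ) (x : Sp d) :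
    ‖realKernel a t x‖ ≤ ‖𝓕⁻ (a t) x‖ := by
  rw [realKernel]
  split_ifs
  · exact Complex.abs_re_le_norm _
  · simp

theorem measurable_realKernel (hd : 0 < d) {a : ℝ → Sp d → ℂ}
    (hm : ∀ t, AEStronglyMeasurable (a t) volume) (hc : ∀ w, w ≠ 0 → Continuous fun t => a t w)
    {B : ℝ → ℝ} (hb : ∀ t₀ > 0, ∀ t ≥ t₀, ∀ w, w ≠ 0 →
      ‖a t w‖ ≤ B t₀ * (1 + ‖w‖) ^ (-((d : ℝ) + 1))) :
    Measurable fun z : ℝ × Sp d => realKernel a z.1 z.2 := by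
  classical
  have h := continuousOn_fourierInv hd hm hc hb
  have h2 := ContinuousOn.measurable_piecewise (Complex.continuous_re.comp_continuousOn h)
    (continuousOn_const (c := (0 : ℝ))) (isOpen_lt continuous_const continuous_fst).measurableSet
  have h3 : (fun z : ℝ × Sp d => realKernel a z.1 z.2) = {z : ℝ × Sp d | 0 < z.1}.piecewise
      (Complex.re ∘ fun z => 𝓕⁻ (a z.1) z.2) fun _ => 0 := by
    ext z
    by_cases h0 : 0 < z.1
    · rw [Set.piecewise_eq_of_mem _ _ _ (by exact h0), realKernel, if_pos h0]
      rfl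
    · rw [Set.piecewise_eq_of_notMem _ _ _ (by exact h0), realKernel, if_neg h0]
  rw [h3]
  exact h2

theorem integrable_of_decay (hd : 0 < d) {a : Sp d → ℂ} (hm : AEStronglyMeasurable a volume)
    {B : ℝ} (hb : ∀ w, w ≠ 0 → ‖a w‖ ≤ B * (1 + ‖w‖) ^ (-((d : ℝ) + 1))) : Integrable a := by
  refine Integrable.mono' ((integrable_one_add_norm (r := (d : ℝ) + 1) (by simp)).const_mul B) hm ?_
  filter_upwards [ae_ne_zero hd] with w hw using hb w hw

theorem lintegral_norm_pow_inv_le {σ : ℝ} {C : ℝ} (hC : 0 ≤ C) (hσ : 0 < σ) {A : Sp d → ℝ} {t : ℝ}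
    (ht : 0 < t) (h : ∀ x, ‖A x‖ ≤ C * ‖(t, x)‖ ^ (-((d : ℝ) + σ))) :
    ∫⁻ x, ‖A x‖ₑ ≤ ENNReal.ofReal (C * (radialMass d σ).toReal * t ^ (-σ)) := by
  calc ∫⁻ x, ‖A x‖ₑ ≤ ∫⁻ x : Sp d, ENNReal.ofReal C *
        ENNReal.ofReal ((max t ‖x‖) ^ (-((d : ℝ) + σ))) := by
        refine lintegral_mono fun x => ?_
        rw [← ofReal_norm, ← ENNReal.ofReal_mul hC]
        refine ENNReal.ofReal_le_ofReal ((h x).trans_eq ?_)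
        rw [Prod.norm_mk, Real.norm_of_nonneg ht.le]
    _ = _ := by
        rw [lintegral_const_mul _ (by fun_prop), lintegral_max_rpow ht, ENNReal.ofReal_mul
          (by positivity), ENNReal.ofReal_mul hC,
          ENNReal.ofReal_toReal (radialMass_lt_top hσ).ne]
        ring

/-- The norm of (t,x) is max(t,|x|), and for m > 0 the function max(t,|x|)^{-(d+m)} has integral in
x of order t^{-m}. -/
theorem kernelBound_of_norm_le {a : ℝ → Sp d → ℂ} {C : ℝ} (hC : 0 ≤ C) {m : ℕ} (hm : 0 < m)
    (hmeas : Measurable fun z : ℝ × Sp d => realKernel a z.1 z.2)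
    (h : ∀ t > 0, ∀ x, ‖𝓕⁻ (a t) x‖ ≤ C * (‖(t, x)‖ ^ (d + m))⁻¹) :
    KernelBound m (C * (1 + (radialMass d m).toReal)) (realKernel a) := by
  have hM : 0 ≤ (radialMass d m).toReal := ENNReal.toReal_nonneg
  refine ⟨by positivity, hmeas, fun t ht x => by rw [realKernel, if_neg (not_lt.2 ht)],
    fun t ht => ?_, fun t ht x => ?_⟩
  · refine (lintegral_norm_pow_inv_le (σ := m) hC (by exact_mod_cast hm) ht fun x => ?_).trans ?_
    · refine (norm_realKernel_le _ _ _).trans ((h t ht x).trans_eq ?_)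
      rw [Real.rpow_neg (norm_nonneg _), ← Real.rpow_natCast]
      push_cast
      rfl
    · refine ENNReal.ofReal_le_ofReal ?_
      rw [Real.rpow_neg ht.le, Real.rpow_natCast]
      gcongr
      linarith
  · refine (norm_realKernel_le _ _ _).trans ((h t ht x).trans ?_)
    have h2 : t ≤ ‖(t, x)‖ := by
      rw [Prod.norm_mk, Real.norm_of_nonneg ht.le]
      exact le_max_left _ _
    gcongr
    exact le_mul_of_one_le_right hC (by linarith)

theorem fourier_realKernel (hd : 0 < d) {a : ℝ → Sp d → ℂ} {t : ℝ} (ht : 0 < t)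
    (ha : Integrable (a t)) (hc : ∀ w, w ≠ 0 → ContinuousAt (a t) w)
    (hsymm : ∀ w, w ≠ 0 → a t (-w) = (starRingEnd ℂ) (a t w))
    (hi : Integrable (fun x => (realKernel a t x : ℂ))) {w : Sp d} (hw : w ≠ 0) :
    𝓕 (fun x => (realKernel a t x : ℂ)) w = a t w := by
  have h1 : (fun x => (realKernel a t x : ℂ)) = 𝓕⁻ (a t) := by
    ext x
    rw [realKernel, if_pos ht, fourierInv_im_eq_zero hsymm hd]
  rw [h1] at hi ⊢
  refine ha.fourier_fourierInv_eq ?_ (hc w hw)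
  have h2 : 𝓕 (a t) = fun x => 𝓕⁻ (a t) (-x) := by
    ext x
    rw [Real.fourierInv_eq_fourier_neg, neg_neg]
  rw [h2]
  exact hi.comp_neg

end Kernel

/-! ### The Green function and its gradient -/

section Green

theorem lintegral_dispWeight {w : Sp d} (hw : w ≠ 0) :
    ∫⁻ θ : ℝ, ENNReal.ofReal (dispWeight (θ, w)) =
      ENNReal.ofReal (besselMult w * ‖w‖ * Real.pi) := by
  obtain ⟨h1, h2⟩ := integral_dispWeight hw
  rw [← ofReal_integral_eq_lintegral_ofReal h1
    (Filter.Eventually.of_forall fun θ => dispWeight_nonneg _), h2]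

theorem measurable_besselMult : Measurable (besselMult (d := d)) := by
  unfold besselMult
  fun_prop

theorem measurable_dispWeight : Measurable (dispWeight (d := d)) := by
  have := measurable_besselMult (d := d)
  unfold dispWeight
  fun_prop

/-- The spatial Fourier transform of the `j`-th derivative of the Green function. -/
def dGreenHat (μ : Sp d → ℝ) (j : Fin d) (t : ℝ) (w : Sp d) : ℂ :=
  2 * Real.pi * Complex.I * w j * greenHat μ t w

/-- The Green function of the linearized equation. -/
def green (μ : Sp d → ℝ) : ℝ → Sp d → ℝ := realKernel (greenHat μ)

/-- The `j`-th spatial derivative of the Green function. -/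
def dGreen (μ : Sp d → ℝ) (j : Fin d) : ℝ → Sp d → ℝ := realKernel (dGreenHat μ j)

theorem norm_two_pi_I_coord_le (w : Sp d) (j : Fin d) :
    ‖2 * (Real.pi : ℂ) * Complex.I * w j‖ ≤ 2 * Real.pi * ‖w‖ := by
  rw [norm_mul]
  have e : ‖2 * (Real.pi : ℂ) * Complex.I‖ = 2 * Real.pi := by simp [abs_of_pos Real.pi_pos]
  rw [e]
  have := Real.pi_pos
  gcongr
  exact norm_coord_le j w

theorem greenHat_family {μ : Sp d → ℝ} (hd : 0 < d) (h1 : HypH1 μ) (h2 : HypH2 μ) :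
    (∀ t, AEStronglyMeasurable (greenHat μ t) volume) ∧
    (∀ w, w ≠ 0 → Continuous fun t => greenHat μ t w) ∧
    ∃ B : ℝ → ℝ, ∀ t₀ > 0, ∀ t ≥ t₀, ∀ w, w ≠ 0 →
      ‖greenHat μ t w‖ ≤ B t₀ * (1 + ‖w‖) ^ (-((d : ℝ) + 1)) := by
  refine ⟨aestronglyMeasurable_greenHat hd h1 h2,
    fun w hw => (integrable_greenHat h1 h2 hw).1, ?_⟩
  obtain ⟨B, hB⟩ := greenHat_decay h1 h2
  refine ⟨B, fun t₀ ht₀ t ht w hw => ?_⟩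
  have h3 := (hB t₀ ht₀).2 t ht w hw
  have h0 := norm_nonneg w
  rw [rpow_neg_add_one (by positivity), ← div_eq_mul_inv, le_div_iff₀ (by positivity)]
  refine le_trans ?_ h3
  gcongr
  · linarith
  · norm_num

theorem dGreenHat_family {μ : Sp d → ℝ} (hd : 0 < d) (h1 : HypH1 μ) (h2 : HypH2 μ) (j : Fin d) :
    (∀ t, AEStronglyMeasurable (dGreenHat μ j t) volume) ∧
    (∀ w, w ≠ 0 → Continuous fun t => dGreenHat μ j t w) ∧
    ∃ B : ℝ → ℝ, ∀ t₀ > 0, ∀ t ≥ t₀, ∀ w, w ≠ 0 →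
      ‖dGreenHat μ j t w‖ ≤ B t₀ * (1 + ‖w‖) ^ (-((d : ℝ) + 1)) := by
  refine ⟨fun t => ?_, fun w hw => continuous_const.mul (integrable_greenHat h1 h2 hw).1, ?_⟩
  · have hc : Continuous fun w : Sp d => 2 * (Real.pi : ℂ) * Complex.I * w j := by fun_prop
    exact hc.aestronglyMeasurable.mul (aestronglyMeasurable_greenHat hd h1 h2 t)
  obtain ⟨B, hB⟩ := greenHat_decay h1 h2
  refine ⟨fun t₀ => 2 * Real.pi * B t₀, fun t₀ ht₀ t ht w hw => ?_⟩
  have h3 := (hB t₀ ht₀).2 t ht w hw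
  have h0 := norm_nonneg w
  have hpi := Real.pi_pos
  rw [rpow_neg_add_one (by positivity), ← div_eq_mul_inv, le_div_iff₀ (by positivity), dGreenHat,
    norm_mul]
  calc _ ≤ 2 * Real.pi * (1 + ‖w‖) * ‖greenHat μ t w‖ * (1 + ‖w‖) ^ (d + 1) := by
        gcongr
        refine (norm_two_pi_I_coord_le w j).trans ?_
        gcongr
        linarith
    _ = 2 * Real.pi * (‖greenHat μ t w‖ * (1 + ‖w‖) ^ (d + 2)) := by ring
    _ ≤ _ := mul_le_mul_of_nonneg_left h3 (by positivity)

theorem dGreenHat_conj (μ : Sp d → ℝ) (j : Fin d) (t : ℝ) (w : Sp d) :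
    dGreenHat μ j t (-w) = (starRingEnd ℂ) (dGreenHat μ j t w) := by
  simp only [dGreenHat, greenHat_conj, map_mul, Complex.conj_ofReal, Complex.conj_I, map_ofNat,
    PiLp.neg_apply, Complex.ofReal_neg]
  ring

/-- The θ-integral of the weight is π |w| times the Bessel multiplier b. The bound b|w| ≤ 1 gives σ
= 0, the less singular estimate near the origin; b|w| ≤ |w| gives σ = 1, the better one far away. -/
theorem green_norm_le {μ : Sp d → ℝ} (hd : 0 < d) (h1 : HypH1 μ) (h2 : HypH2 μ) {σ : ℕ}
    (hσ : σ ≤ 1) : ∃ C, 0 ≤ C ∧ ∀ t > 0, ∀ x,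
      ‖𝓕⁻ (greenHat μ t) x‖ ≤ C * (‖(t, x)‖ ^ (d + σ))⁻¹ := by
  obtain ⟨hm, -, B, hB⟩ := greenHat_family hd h1 h2
  obtain ⟨C, hC0, hC⟩ := norm_fourierInv_le_of_symbol hd measurable_dispWeight Real.pi_pos.le
    (σ := σ) (κ := dispWeight) (fun w hw => by
      rw [lintegral_dispWeight hw, mul_comm Real.pi]
      refine ENNReal.ofReal_le_ofReal (mul_le_mul_of_nonneg_right ?_ Real.pi_pos.le)
      interval_cases σ
      · simpa using besselMult_mul_norm_le_one w
      · rw [pow_one]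
        exact mul_le_of_le_one_left (norm_nonneg _) (besselMult_le_one w)) dispWeight_nonneg
    (f := fun z => resolventSymbol μ (freq z.1) z.2)
    (let ⟨C, h⟩ := isSymbol_resolvent h1 h2; ⟨C, h.mono_order (by omega)⟩)
  refine ⟨C, hC0, fun t ht x => hC t x _ (fun h => ht.ne' (congrArg Prod.fst h))
    (integrable_of_decay hd (hm t) (hB t ht t le_rfl)) fun w _ => rfl⟩

/-- The additional factor |w| raises σ to 2, and this uses all d + 1 + 2 derivatives of the
resolvent symbol. -/
theorem dGreen_norm_le {μ : Sp d → ℝ} (hd : 0 < d) (h1 : HypH1 μ) (h2 : HypH2 μ) (j : Fin d) :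
    ∃ C, 0 ≤ C ∧ ∀ t > 0, ∀ x, ‖𝓕⁻ (dGreenHat μ j t) x‖ ≤ C * (‖(t, x)‖ ^ (d + 2))⁻¹ := by
  obtain ⟨hm, -, B, hB⟩ := dGreenHat_family hd h1 h2 j
  have hsym : IsSymbol (d + 1 + 2) (fun z : ℝ × Sp d => ‖z.2‖ * dispWeight z)
      (fun z => 2 * Real.pi * Complex.I * ((z.2 j : ℂ) * resolventSymbol μ (freq z.1) z.2)) :=
    ((IsSymbol.coord (d + 3) j).mul (isSymbol_resolvent h1 h2)).const_mul _
  obtain ⟨C, hC0, hC⟩ := norm_fourierInv_le_of_symbol hd (κ := fun z => ‖z.2‖ * dispWeight z)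
    (by have := measurable_dispWeight (d := d); fun_prop) Real.pi_pos.le (fun w hw => by
      have e : ∀ θ : ℝ, ENNReal.ofReal (‖((θ, w) : ℝ × Sp d).2‖ * dispWeight (θ, w)) =
          ENNReal.ofReal ‖w‖ * ENNReal.ofReal (dispWeight (θ, w)) := fun θ =>
        ENNReal.ofReal_mul (norm_nonneg _)
      have hmm := measurable_dispWeight (d := d)
      rw [lintegral_congr e, lintegral_const_mul _ (by fun_prop), lintegral_dispWeight hw,
        ← ENNReal.ofReal_mul (norm_nonneg _)]
      refine ENNReal.ofReal_le_ofReal ?_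
      calc ‖w‖ * (besselMult w * ‖w‖ * Real.pi) = besselMult w * (Real.pi * ‖w‖ ^ 2) := by ring
        _ ≤ _ := mul_le_of_le_one_left (mul_nonneg Real.pi_pos.le (sq_nonneg _))
          (besselMult_le_one w))
    (fun z => mul_nonneg (norm_nonneg _) (dispWeight_nonneg z)) hsym
  refine ⟨C, hC0, fun t ht x => hC t x _ (fun h => ht.ne' (congrArg Prod.fst h))
    (integrable_of_decay hd (hm t) (hB t ht t le_rfl)) fun w _ => ?_⟩
  rw [dGreenHat, greenHat, ← integral_const_mul]
  congr 1
  ext θ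
  ring

/-- The L¹ rate 1/t from σ = 1 is not integrable at t = 0, and |(t,x)|^{-d} is not integrable in x.
The intermediate power |(t,x)|^{-(d+1/2)} dominates the σ = 0 bound when |(t,x)| ≤ 1 and the σ = 1
bound otherwise, and yields the rate t^{-1/2}, integrable near 0. -/
theorem green_kernelBound {μ : Sp d → ℝ} (hd : 0 < d) (h1 : HypH1 μ) (h2 : HypH2 μ) :
    ∃ C, KernelBound 1 C (green μ) ∧
      ∀ t > 0, ∫⁻ x, ‖green μ t x‖ₑ ≤ ENNReal.ofReal (C * t ^ (-(1 / 2) : ℝ)) := by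
  obtain ⟨hm, hc, B, hB⟩ := greenHat_family hd h1 h2
  obtain ⟨C₀, hC₀, h₀⟩ := green_norm_le hd h1 h2 (σ := 0) (by norm_num)
  obtain ⟨C₁, hC₁, h₁⟩ := green_norm_le hd h1 h2 (σ := 1) le_rfl
  have hK := kernelBound_of_norm_le hC₁ one_pos (measurable_realKernel hd hm hc hB) h₁
  set M : ℝ := (radialMass d ((1 : ℕ) : ℝ)).toReal
  set M' := (radialMass d (1 / 2)).toReal
  have hM : 0 ≤ M := ENNReal.toReal_nonneg
  have hM' : 0 ≤ M' := ENNReal.toReal_nonneg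
  have hle : C₁ * (1 + M) ≤ C₁ * (1 + M) + (C₀ + C₁) * M' := le_add_of_nonneg_right (by positivity)
  refine ⟨C₁ * (1 + M) + (C₀ + C₁) * M', ⟨by positivity, hK.measurable, hK.of_nonpos,
    fun t ht => (hK.lintegral_le t ht).trans (ENNReal.ofReal_le_ofReal (by gcongr)),
    fun t ht x => (hK.norm_le t ht x).trans (by gcongr)⟩, fun t ht => ?_⟩
  refine (lintegral_norm_pow_inv_le (σ := 1 / 2) (C := C₀ + C₁) (by positivity) (by norm_num) ht
    fun x => ?_).trans (ENNReal.ofReal_le_ofReal ?_)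
  · refine (norm_realKernel_le _ _ _).trans ?_
    have hr : 0 < ‖(t, x)‖ := norm_pos_iff.2 fun h => ht.ne' (congrArg Prod.fst h)
    have e0 := h₀ t ht x
    have e1 := h₁ t ht x
    generalize ‖(t, x)‖ = r at hr e0 e1
    rcases le_total r 1 with h | h
    · refine e0.trans ?_
      have : (r ^ (d + 0))⁻¹ ≤ r ^ (-((d : ℝ) + 1 / 2)) := by
        rw [add_zero, ← Real.rpow_natCast, ← Real.rpow_neg hr.le]
        exact Real.rpow_le_rpow_of_exponent_ge hr h (by linarith)
      gcongr
      linarith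
    · refine e1.trans ?_
      have : (r ^ (d + 1))⁻¹ ≤ r ^ (-((d : ℝ) + 1 / 2)) := by
        rw [← Real.rpow_natCast, ← Real.rpow_neg hr.le]
        refine Real.rpow_le_rpow_of_exponent_le h ?_
        push_cast
        linarith
      gcongr
      linarith
  · have : 0 ≤ C₁ * (1 + M) := by positivity
    gcongr
    linarith

theorem dGreen_kernelBound {μ : Sp d → ℝ} (hd : 0 < d) (h1 : HypH1 μ) (h2 : HypH2 μ) (j : Fin d) :
    ∃ C, KernelBound 2 C (dGreen μ j) := by
  obtain ⟨hm, hc, B, hB⟩ := dGreenHat_family hd h1 h2 j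
  obtain ⟨C, hC, h⟩ := dGreen_norm_le hd h1 h2 j
  exact ⟨_, kernelBound_of_norm_le hC two_pos (measurable_realKernel hd hm hc hB) h⟩

theorem KernelBound.integrable {m : ℕ} {C : ℝ} {A : ℝ → Sp d → ℝ} (h : KernelBound m C A) (t : ℝ) :
    Integrable (A t) := by
  have hm : Measurable (A t) := h.measurable.comp measurable_prodMk_left
  refine ⟨hm.aestronglyMeasurable, ?_⟩
  rcases le_or_gt t 0 with ht | ht
  · have : A t = 0 := funext fun x => h.of_nonpos t ht x
    simp [this, HasFiniteIntegral]
  · exact lt_of_le_of_lt (h.lintegral_le t ht) ENNReal.ofReal_lt_top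

theorem fourier_green {μ : Sp d → ℝ} (hd : 0 < d) (h1 : HypH1 μ) (h2 : HypH2 μ) (t : ℝ)
    {w : Sp d} (hw : w ≠ 0) : 𝓕 (fun x => (green μ t x : ℂ)) w = greenHat μ t w := by
  obtain ⟨hm, -, B, hB⟩ := greenHat_family hd h1 h2
  obtain ⟨C, hC, -⟩ := green_kernelBound hd h1 h2
  rcases le_or_gt t 0 with ht | ht
  · simp only [hC.of_nonpos t ht, greenHat_of_nonpos h1 h2 hw ht, Real.fourier_eq']
    simp
  · exact fourier_realKernel hd ht (integrable_of_decay hd (hm t) (hB t ht t le_rfl))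
      (fun w hw => continuousAt_greenHat h1 h2 t hw) (fun w _ => greenHat_conj μ t w)
      (hC.integrable t).ofReal hw

theorem fourier_dGreen {μ : Sp d → ℝ} (hd : 0 < d) (h1 : HypH1 μ) (h2 : HypH2 μ) (j : Fin d)
    (t : ℝ) {w : Sp d} (hw : w ≠ 0) :
    𝓕 (fun x => (dGreen μ j t x : ℂ)) w =
      2 * Real.pi * Complex.I * w j * 𝓕 (fun x => (green μ t x : ℂ)) w := by
  rw [fourier_green hd h1 h2 t hw]
  obtain ⟨hm, -, B, hB⟩ := dGreenHat_family hd h1 h2 j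
  obtain ⟨C, hC⟩ := dGreen_kernelBound hd h1 h2 j
  rcases le_or_gt t 0 with ht | ht
  · simp only [hC.of_nonpos t ht, greenHat_of_nonpos h1 h2 hw ht, Real.fourier_eq']
    simp
  · exact fourier_realKernel hd ht (integrable_of_decay hd (hm t) (hB t ht t le_rfl))
      (fun w hw => (by fun_prop : ContinuousAt
        (fun w : Sp d => 2 * (Real.pi : ℂ) * Complex.I * w j) w).mul
          (continuousAt_greenHat h1 h2 t hw)) (fun w _ => dGreenHat_conj μ j t w)
      (hC.integrable t).ofReal hw

end Green

/-! ### Weak derivatives and the elliptic equation on the Fourier side -/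

section WeakDerivative

/-- The classical `j`-th partial derivative. -/
def pdv (j : Fin d) (ψ : Sp d → ℝ) (x : Sp d) : ℝ := fderiv ℝ ψ x (EuclideanSpace.single j 1)

theorem gradient_coord (ψ : Sp d → ℝ) (x : Sp d) (j : Fin d) : gradient ψ x j = pdv j ψ x := by
  have h : inner ℝ (gradient ψ x) (EuclideanSpace.single j (1 : ℝ)) =
      fderiv ℝ ψ x (EuclideanSpace.single j 1) := by
    rw [gradient, InnerProductSpace.toDual_symm_apply]
  rw [pdv, ← h, EuclideanSpace.inner_single_right]
  simp

theorem contDiff_pdv {ψ : Sp d → ℝ} (h : ContDiff ℝ ∞ ψ) (j : Fin d) : ContDiff ℝ ∞ (pdv j ψ) :=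
  (h.fderiv_right (m := ∞) (by norm_cast)).clm_apply contDiff_const

theorem hasCompactSupport_pdv {ψ : Sp d → ℝ} (h : HasCompactSupport ψ) (j : Fin d) :
    HasCompactSupport (pdv j ψ) :=
  h.fderiv_apply (𝕜 := ℝ) _

/-- Parseval, in the form of the self-adjointness of the Fourier transform applied to u and 𝓕⁻ f. It
reduces every weak identity against a test function to an identity of Fourier transforms. -/
theorem integral_mul_schwartz {u : Sp d → ℂ} (hu : Integrable u) (f : SchwartzMap (Sp d) ℂ) :
    ∫ x, u x * f x = ∫ w, 𝓕 u w * 𝓕 f (-w) := by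
  have h := VectorFourier.integral_fourierIntegral_smul_eq_flip (L := innerₗ (Sp d))
    (e := Real.fourierChar) (μ := volume) (ν := volume) Real.continuous_fourierChar
    (by simpa using continuous_inner) hu (𝓕⁻ f).integrable
  have e1 : ∀ w, (𝓕⁻ f : SchwartzMap (Sp d) ℂ) w = 𝓕 f (-w) := fun w => by
    rw [SchwartzMap.fourierInv_coe, Real.fourierInv_eq_fourier_neg, SchwartzMap.fourier_coe]
  have e2 : ∀ x, VectorFourier.fourierIntegral Real.fourierChar volume (innerₗ (Sp d)).flip
      (𝓕⁻ f : SchwartzMap (Sp d) ℂ) x = f x := fun x => by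
    rw [flip_innerₗ]
    have : 𝓕 (𝓕⁻ f : SchwartzMap (Sp d) ℂ) x = f x := by rw [FourierTransform.fourier_fourierInv_eq]
    rw [SchwartzMap.fourier_coe] at this
    exact this
  simp only [e2, e1, smul_eq_mul] at h
  exact h.symm

theorem fourier_lineDeriv_neg (f : SchwartzMap (Sp d) ℂ) (j : Fin d) (w : Sp d) :
    𝓕 (LineDeriv.lineDerivOp (EuclideanSpace.single j (1 : ℝ)) f) (-w) =
      -(2 * Real.pi * Complex.I * w j * 𝓕 f (-w)) := by
  rw [SchwartzMap.fourier_lineDerivOp_eq, smul_apply,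
    SchwartzMap.smulLeftCLM_apply_apply (by fun_prop), EuclideanSpace.inner_single_right]
  simp
  ring

/-- A real test function as a complex Schwartz function. -/
def testSchwartz {ψ : Sp d → ℝ} (h1 : ContDiff ℝ ∞ ψ) (h2 : HasCompactSupport ψ) :
    SchwartzMap (Sp d) ℂ :=
  HasCompactSupport.toSchwartzMap (f := fun x => (ψ x : ℂ))
    (h2.comp_left (g := fun x : ℝ => (x : ℂ)) (by simp)) (Complex.ofRealCLM.contDiff.comp h1)

theorem testSchwartz_apply {ψ : Sp d → ℝ} (h1 : ContDiff ℝ ∞ ψ) (h2 : HasCompactSupport ψ)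
    (x : Sp d) : testSchwartz h1 h2 x = (ψ x : ℂ) := rfl

theorem lineDeriv_testSchwartz {ψ : Sp d → ℝ} (h1 : ContDiff ℝ ∞ ψ) (h2 : HasCompactSupport ψ)
    (j : Fin d) (x : Sp d) :
    LineDeriv.lineDerivOp (EuclideanSpace.single j (1 : ℝ)) (testSchwartz h1 h2) x =
      (pdv j ψ x : ℂ) := by
  rw [SchwartzMap.lineDerivOp_apply_eq_fderiv]
  have h : HasFDerivAt (fun x => (ψ x : ℂ)) (Complex.ofRealCLM ∘L fderiv ℝ ψ x) x :=
    Complex.ofRealCLM.hasFDerivAt.comp x ((h1.differentiable (by simp)) x).hasFDerivAt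
  have e : fderiv ℝ (testSchwartz h1 h2) x = Complex.ofRealCLM ∘L fderiv ℝ ψ x := h.fderiv
  rw [e]
  rfl

theorem integral_ofReal_mul (u v : Sp d → ℝ) :
    ((∫ x, u x * v x : ℝ) : ℂ) = ∫ x, (u x : ℂ) * (v x : ℂ) := by
  rw [← integral_complex_ofReal]
  congr 1
  ext x
  push_cast
  rfl

theorem integral_mul_test {u ψ : Sp d → ℝ} (hu : Integrable u) (h1 : ContDiff ℝ ∞ ψ)
    (h2 : HasCompactSupport ψ) : ((∫ x, u x * ψ x : ℝ) : ℂ) =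
      ∫ w, 𝓕 (fun x => (u x : ℂ)) w * 𝓕 (testSchwartz h1 h2) (-w) := by
  rw [integral_ofReal_mul]
  exact integral_mul_schwartz (u := fun x => (u x : ℂ)) hu.ofReal (testSchwartz h1 h2)

theorem integral_mul_pdv {u ψ : Sp d → ℝ} (hu : Integrable u) (h1 : ContDiff ℝ ∞ ψ)
    (h2 : HasCompactSupport ψ) (j : Fin d) : ((∫ x, u x * pdv j ψ x : ℝ) : ℂ) =
      ∫ w, -(2 * Real.pi * Complex.I * w j) * 𝓕 (fun x => (u x : ℂ)) w *
        𝓕 (testSchwartz h1 h2) (-w) := by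
  rw [integral_ofReal_mul]
  simp only [← lineDeriv_testSchwartz h1 h2]
  rw [integral_mul_schwartz (u := fun x => (u x : ℂ)) hu.ofReal]
  congr 1
  ext w
  rw [fourier_lineDeriv_neg]
  ring

/-- `g` is the weak `j`-th partial derivative of `u`, both integrable. -/
structure WeakPartial (j : Fin d) (u g : Sp d → ℝ) : Prop where
  left : Integrable u
  right : Integrable g
  integral_eq : ∀ ψ : Sp d → ℝ, ContDiff ℝ ∞ ψ → HasCompactSupport ψ →
    ∫ x, u x * pdv j ψ x = -∫ x, g x * ψ x

theorem weakPartial_of_fourier {j : Fin d} {u g : Sp d → ℝ} (hu : Integrable u)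
    (hg : Integrable g) (h : ∀ᵐ w : Sp d, 𝓕 (fun x => (g x : ℂ)) w =
      2 * Real.pi * Complex.I * w j * 𝓕 (fun x => (u x : ℂ)) w) : WeakPartial j u g := by
  refine ⟨hu, hg, fun ψ h1 h2 => ?_⟩
  have e : ((∫ x, u x * pdv j ψ x : ℝ) : ℂ) = ((-∫ x, g x * ψ x : ℝ) : ℂ) := by
    rw [Complex.ofReal_neg, integral_mul_pdv hu h1 h2, integral_mul_test hg h1 h2, ← integral_neg]
    refine integral_congr_ae ?_
    filter_upwards [h] with w hw
    rw [hw]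
    ring
  exact_mod_cast e

theorem ae_eq_zero_of_fourier {u : Sp d → ℝ} (hu : Integrable u)
    (h : ∀ᵐ w : Sp d, 𝓕 (fun x => (u x : ℂ)) w = 0) : u =ᵐ[volume] 0 := by
  refine ae_eq_zero_of_integral_contDiff_smul_eq_zero hu.locallyIntegrable fun ψ h1 h2 => ?_
  have e : ((∫ x, ψ x • u x : ℝ) : ℂ) = 0 := by
    simp only [smul_eq_mul, mul_comm (ψ _)]
    rw [integral_mul_test hu h1 h2]
    refine integral_eq_zero_of_ae ?_
    filter_upwards [h] with w hw
    rw [hw]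
    simp
  exact_mod_cast e

theorem integrable_mul_test {u ψ : Sp d → ℝ} (hu : LocallyIntegrable u) (h1 : Continuous ψ)
    (h2 : HasCompactSupport ψ) : Integrable fun x => u x * ψ x := by
  have := hu.integrable_smul_left_of_hasCompactSupport h1 h2
  simp only [smul_eq_mul] at this
  simpa only [mul_comm] using this

/-- On the Fourier side the identity is (1 + 4π²|w|²) b(w) = 1 for the Bessel multiplier b; the term
4π²|w|² is the sum over j of the two factors 2πi w_j. -/
theorem resolvent_of_fourier {u φ : Sp d → ℝ} {g : Fin d → Sp d → ℝ} (hu : Integrable u)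
    (hφ : Integrable φ) (hg : ∀ j, Integrable (g j))
    (h : ∀ᵐ w : Sp d, 𝓕 (fun x => (φ x : ℂ)) w = besselMult w * 𝓕 (fun x => (u x : ℂ)) w)
    (h' : ∀ j, ∀ᵐ w : Sp d, 𝓕 (fun x => (g j x : ℂ)) w =
      2 * Real.pi * Complex.I * w j * 𝓕 (fun x => (φ x : ℂ)) w) {ψ : Sp d → ℝ}
    (h1 : ContDiff ℝ ∞ ψ) (h2 : HasCompactSupport ψ) :
    (∫ x, φ x * ψ x) + ∑ j, ∫ x, g j x * pdv j ψ x = ∫ x, u x * ψ x := by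
  have hbd : ∀ v : Sp d → ℝ, Integrable v → ∀ f : SchwartzMap (Sp d) ℂ,
      Integrable fun w => 𝓕 (fun x => (v x : ℂ)) w * 𝓕 f (-w) := by
    intro v hv f
    refine Integrable.bdd_mul (c := ∫ x, ‖(v x : ℂ)‖) ((𝓕 f).integrable.comp_neg) ?_
      (Filter.Eventually.of_forall fun w => ?_)
    · exact (VectorFourier.fourierIntegral_continuous Real.continuous_fourierChar
        (by simpa using continuous_inner) hv.ofReal).aestronglyMeasurable
    · exact VectorFourier.norm_fourierIntegral_le_integral_norm _ _ _ _ _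
  have hi : ∀ j, Integrable fun w : Sp d => -(2 * Real.pi * Complex.I * w j) *
      𝓕 (fun x => (g j x : ℂ)) w * 𝓕 (testSchwartz h1 h2) (-w) := by
    intro j
    refine (hbd (g j) (hg j)
      (LineDeriv.lineDerivOp (EuclideanSpace.single j (1 : ℝ)) (testSchwartz h1 h2))).congr
      (Filter.Eventually.of_forall fun w => ?_)
    simp only
    rw [fourier_lineDeriv_neg]
    ring
  have e : (((∫ x, φ x * ψ x) + ∑ j, ∫ x, g j x * pdv j ψ x : ℝ) : ℂ) =
      ((∫ x, u x * ψ x : ℝ) : ℂ) := by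
    rw [Complex.ofReal_add, Complex.ofReal_sum]
    simp only [integral_mul_pdv (hg _) h1 h2]
    rw [integral_mul_test hφ h1 h2, integral_mul_test hu h1 h2, ← integral_finsetSum _ fun j _ => hi j,
      ← integral_add (hbd φ hφ _) (integrable_finsetSum _ fun j _ => hi j)]
    refine integral_congr_ae ?_
    filter_upwards [h, Filter.eventually_all.2 h'] with w hw hw'
    simp only [hw', hw]
    have hs : ∑ j, -(2 * (Real.pi : ℂ) * Complex.I * w j) *
        (2 * Real.pi * Complex.I * w j * (besselMult w * 𝓕 (fun x => (u x : ℂ)) w)) *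
          𝓕 (testSchwartz h1 h2) (-w) = (4 * Real.pi ^ 2 * ‖w‖ ^ 2 : ℝ) *
            (besselMult w * 𝓕 (fun x => (u x : ℂ)) w) * 𝓕 (testSchwartz h1 h2) (-w) := by
      rw [Complex.ofReal_mul, ofReal_norm_sq, Finset.mul_sum, Finset.sum_mul, Finset.sum_mul]
      refine Finset.sum_congr rfl fun j _ => ?_
      push_cast
      linear_combination (-4 * (Real.pi : ℂ) ^ 2 * w j ^ 2 * besselMult w *
        𝓕 (fun x => (u x : ℂ)) w * 𝓕 (testSchwartz h1 h2) (-w)) * Complex.I_sq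
    rw [hs]
    have hb : (1 + (4 * Real.pi ^ 2 * ‖w‖ ^ 2 : ℝ) : ℂ) * (besselMult w : ℂ) = 1 := by
      rw [besselMult, ← Complex.ofReal_one, ← Complex.ofReal_add, ← Complex.ofReal_mul,
        mul_inv_cancel₀ (by positivity)]
    linear_combination (𝓕 (fun x => (u x : ℂ)) w * 𝓕 (testSchwartz h1 h2) (-w)) * hb
  exact_mod_cast e

/-- The vector field with components `g j`. -/
def vecField (g : Fin d → Sp d → ℝ) (x : Sp d) : Sp d := WithLp.toLp 2 fun j => g j x

theorem integral_coord {f : Sp d → Sp d} (hf : Integrable f) (j : Fin d) :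
    (∫ x, f x) j = ∫ x, f x j :=
  ((EuclideanSpace.proj j : Sp d →L[ℝ] ℝ).integral_comp_comm hf).symm

theorem integrable_vecField {g : Fin d → Sp d → ℝ} (hg : ∀ j, Integrable (g j)) :
    Integrable (vecField g) := by
  have h1 := Integrable.of_eval (f := fun x j => g j x) hg
  exact (PiLp.continuousLinearEquiv 2 ℝ (fun _ : Fin d => ℝ)).symm.toContinuousLinearMap.integrable_comp
    h1

theorem WeakPartial.isWeakGradient {u : Sp d → ℝ} {g : Fin d → Sp d → ℝ} (hu : Integrable u)
    (h : ∀ j, WeakPartial j u (g j)) : IsWeakGradient u (vecField g) := by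
  have hg := integrable_vecField fun j => (h j).right
  refine ⟨hu.locallyIntegrable, hg.locallyIntegrable, fun ψ h1 h2 => ?_⟩
  have hgc : Continuous (gradient ψ) := (contDiff_gradient h1).continuous
  have hgs : HasCompactSupport (gradient ψ) :=
    (h2.fderiv (𝕜 := ℝ)).comp_left (map_zero (InnerProductSpace.toDual ℝ (Sp d)).symm)
  ext j
  rw [integral_coord (hu.locallyIntegrable.integrable_smul_right_of_hasCompactSupport hgc hgs),
    PiLp.neg_apply, integral_coord (hg.locallyIntegrable.integrable_smul_left_of_hasCompactSupport
      h1.continuous h2)]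
  simp only [PiLp.smul_apply, gradient_coord, smul_eq_mul, vecField]
  rw [(h j).integral_eq ψ h1 h2]
  simp only [mul_comm]

theorem IsWeakGradient.integral_pdv {u : Sp d → ℝ} {g : Sp d → Sp d} (h : IsWeakGradient u g)
    {ψ : Sp d → ℝ} (h1 : ContDiff ℝ ∞ ψ) (h2 : HasCompactSupport ψ) (j : Fin d) :
    ∫ x, u x * pdv j ψ x = -∫ x, g x j * ψ x := by
  have hgc : Continuous (gradient ψ) := (contDiff_gradient h1).continuous
  have hgs : HasCompactSupport (gradient ψ) :=
    (h2.fderiv (𝕜 := ℝ)).comp_left (map_zero (InnerProductSpace.toDual ℝ (Sp d)).symm)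
  have e := congrArg (fun v : Sp d => v j) (h.integral_eq ψ h1 h2)
  simp only [PiLp.neg_apply] at e
  rw [integral_coord (h.locallyIntegrable.integrable_smul_right_of_hasCompactSupport hgc hgs),
    integral_coord (h.locallyIntegrable_grad.integrable_smul_left_of_hasCompactSupport
      h1.continuous h2)] at e
  simpa only [PiLp.smul_apply, gradient_coord, smul_eq_mul, mul_comm] using e

theorem WeakPartial.add {j : Fin d} {u₁ u₂ g₁ g₂ : Sp d → ℝ} (h₁ : WeakPartial j u₁ g₁)
    (h₂ : WeakPartial j u₂ g₂) : WeakPartial j (u₁ + u₂) (g₁ + g₂) := by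
  refine ⟨h₁.left.add h₂.left, h₁.right.add h₂.right, fun ψ h1 h2 => ?_⟩
  have hc := (contDiff_pdv h1 j).continuous
  have hs := hasCompactSupport_pdv h2 j
  simp only [Pi.add_apply, add_mul]
  rw [integral_add (integrable_mul_test h₁.left.locallyIntegrable hc hs)
    (integrable_mul_test h₂.left.locallyIntegrable hc hs),
    integral_add (integrable_mul_test h₁.right.locallyIntegrable h1.continuous h2)
    (integrable_mul_test h₂.right.locallyIntegrable h1.continuous h2),
    h₁.integral_eq ψ h1 h2, h₂.integral_eq ψ h1 h2]
  ring

end WeakDerivative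

/-! ### Fourier transforms of parameter integrals -/

section FourierIntegral

variable {α : Type*} [MeasurableSpace α] {ν : Measure α}

theorem fourier_integral [SFinite ν] {F : α × Sp d → ℂ} (hF : Integrable F (ν.prod volume)) :
    Integrable (fun x => ∫ q, F (q, x) ∂ν) ∧
      ∀ w, 𝓕 (fun x => ∫ q, F (q, x) ∂ν) w = ∫ q, 𝓕 (fun x => F (q, x)) w ∂ν := by
  refine ⟨hF.integral_prod_right, fun w => ?_⟩
  simp only [Real.fourier_eq, Circle.smul_def, smul_eq_mul]
  have hch : Continuous fun x : Sp d => (Real.fourierChar (-inner ℝ x w) : ℂ) := by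
    have := Real.continuous_fourierChar
    fun_prop
  have hG : Integrable (fun z : α × Sp d => (Real.fourierChar (-inner ℝ z.2 w) : ℂ) * F z)
      (ν.prod volume) := by
    refine hF.bdd_mul (c := 1) ?_ (Filter.Eventually.of_forall fun z => (Circle.norm_coe _).le)
    exact (hch.measurable.comp measurable_snd).aestronglyMeasurable
  simp only [← integral_const_mul]
  exact (integral_integral_swap (f := fun (q : α) (x : Sp d) =>
    (Real.fourierChar (-inner ℝ x w) : ℂ) * F (q, x)) hG).symm

theorem fourier_integral_real [SFinite ν] {F : α × Sp d → ℝ} (hF : Integrable F (ν.prod volume)) :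
    Integrable (fun x => ∫ q, F (q, x) ∂ν) ∧
      ∀ w, 𝓕 (fun x => ((∫ q, F (q, x) ∂ν : ℝ) : ℂ)) w =
        ∫ q, 𝓕 (fun x => (F (q, x) : ℂ)) w ∂ν := by
  refine ⟨hF.integral_prod_right, fun w => ?_⟩
  simp only [← integral_complex_ofReal]
  exact (fourier_integral hF.ofReal).2 w

theorem integrable_prod_of_bound {F : α × Sp d → ℝ}
    (hm : AEStronglyMeasurable F (ν.prod volume)) {B : α → ℝ} (hB : Integrable B ν)
    (h : ∀ᵐ q ∂ν, Integrable (fun x => F (q, x)) ∧ ∫ x, ‖F (q, x)‖ ≤ B q) :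
    Integrable F (ν.prod volume) := by
  rw [integrable_prod_iff hm]
  refine ⟨h.mono fun q hq => hq.1, ?_⟩
  refine hB.mono' hm.norm.integral_prod_right' (h.mono fun q hq => ?_)
  rw [Real.norm_of_nonneg (integral_nonneg fun _ => norm_nonneg _)]
  exact hq.2

end FourierIntegral

/-! ### The heat kernel -/

section Heat

/-- The heat kernel. -/
def heat (r : ℝ) (x : Sp d) : ℝ :=
  ((4 * Real.pi * r) ^ ((d : ℝ) / 2))⁻¹ * Real.exp (-(4 * r)⁻¹ * ‖x‖ ^ 2)

/-- The `j`-th derivative of the heat kernel. -/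
def dHeat (j : Fin d) (r : ℝ) (x : Sp d) : ℝ := -(2 * r)⁻¹ * x j * heat r x

theorem measurable_heat : Measurable fun z : ℝ × Sp d => heat z.1 z.2 := by
  unfold heat
  fun_prop

theorem measurable_dHeat (j : Fin d) : Measurable fun z : ℝ × Sp d => dHeat j z.1 z.2 := by
  have := measurable_heat (d := d)
  unfold dHeat
  fun_prop

theorem heat_nonneg {r : ℝ} (hr : 0 < r) (x : Sp d) : 0 ≤ heat r x := by
  unfold heat
  positivity

theorem heat_integral {r : ℝ} (hr : 0 < r) :
    Integrable (heat (d := d) r) ∧ ∫ x : Sp d, heat r x = 1 := by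
  have h := GaussianFourier.integral_rexp_neg_mul_sq_norm (V := Sp d) (b := (4 * r)⁻¹)
    (by positivity)
  have e : Real.pi / (4 * r)⁻¹ = 4 * Real.pi * r := by field_simp
  rw [e, finrank_euclideanSpace_fin] at h
  have hp : 0 < (4 * Real.pi * r) ^ ((d : ℝ) / 2) := by positivity
  refine ⟨?_, ?_⟩
  · refine Integrable.const_mul ?_ _
    by_contra hn
    rw [integral_undef hn] at h
    exact hp.ne h
  · simp only [heat]
    rw [integral_const_mul, h, inv_mul_cancel₀ hp.ne']

theorem fourier_heat {r : ℝ} (hr : 0 < r) (w : Sp d) :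
    𝓕 (fun x => (heat r x : ℂ)) w = (Real.exp (-(4 * Real.pi ^ 2 * ‖w‖ ^ 2) * r) : ℂ) := by
  have h := fourier_gaussian_innerProductSpace (V := Sp d) (b := (((4 * r)⁻¹ : ℝ) : ℂ))
    (by rw [Complex.ofReal_re]; positivity) w
  have hp : 0 < (4 * Real.pi * r) ^ ((d : ℝ) / 2) := by positivity
  have e1 : (fun x : Sp d => (heat r x : ℂ)) = fun x =>
      (((4 * Real.pi * r) ^ ((d : ℝ) / 2) : ℝ) : ℂ)⁻¹ *
        Complex.exp (-(((4 * r)⁻¹ : ℝ) : ℂ) * (‖x‖ : ℂ) ^ 2) := by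
    ext x
    simp only [heat]
    push_cast
    rfl
  have e2 : ((Real.pi : ℂ) / (((4 * r)⁻¹ : ℝ) : ℂ)) ^ ((Module.finrank ℝ (Sp d) : ℂ) / 2) =
      (((4 * Real.pi * r) ^ ((d : ℝ) / 2) : ℝ) : ℂ) := by
    rw [finrank_euclideanSpace_fin, Complex.ofReal_cpow (by positivity)]
    congr 1
    · push_cast
      field_simp
    · push_cast
      rfl
  rw [e2] at h
  rw [e1]
  have e3 : 𝓕 (fun x : Sp d => (((4 * Real.pi * r) ^ ((d : ℝ) / 2) : ℝ) : ℂ)⁻¹ *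
        Complex.exp (-(((4 * r)⁻¹ : ℝ) : ℂ) * (‖x‖ : ℂ) ^ 2)) w =
      (((4 * Real.pi * r) ^ ((d : ℝ) / 2) : ℝ) : ℂ)⁻¹ *
        𝓕 (fun x : Sp d => Complex.exp (-(((4 * r)⁻¹ : ℝ) : ℂ) * (‖x‖ : ℂ) ^ 2)) w := by
    simp only [Real.fourier_eq, Circle.smul_def, smul_eq_mul]
    rw [← integral_const_mul]
    congr 1
    ext x
    ring
  rw [e3, h, ← mul_assoc, inv_mul_cancel₀ (by exact_mod_cast hp.ne'), one_mul, Complex.ofReal_exp]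
  congr 1
  push_cast
  field_simp

/-- Half of the Gaussian exponent absorbs |x|/(2r), at the cost of r^{-1/2}; the other half is the
heat kernel at time 2r up to the factor 2^{d/2}. -/
theorem heat_bound {r : ℝ} (hr : 0 < r) (x : Sp d) :
    (2 * r)⁻¹ * ‖x‖ * heat r x ≤ (2 : ℝ) ^ ((d : ℝ) / 2) * r ^ ((1 : ℝ) / 2 - 1) * heat (2 * r) x := by
  have hy := norm_nonneg x
  set y := ‖x‖ with hyd
  have e1 : ((4 * Real.pi * r) ^ ((d : ℝ) / 2))⁻¹ =
      (2 : ℝ) ^ ((d : ℝ) / 2) * ((4 * Real.pi * (2 * r)) ^ ((d : ℝ) / 2))⁻¹ := by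
    rw [show 4 * Real.pi * (2 * r) = 2 * (4 * Real.pi * r) by ring,
      Real.mul_rpow (x := 2) (y := 4 * Real.pi * r) (by norm_num) (by positivity), mul_inv, ← mul_assoc,
      mul_inv_cancel₀ (by positivity), one_mul]
  have e2 : Real.exp (-(4 * r)⁻¹ * y ^ 2) =
      Real.exp (-(4 * (2 * r))⁻¹ * y ^ 2) * Real.exp (-(4 * (2 * r))⁻¹ * y ^ 2) := by
    rw [← Real.exp_add]
    congr 1
    field_simp
    ring
  have e3 : (2 * r)⁻¹ * y * Real.exp (-(4 * (2 * r))⁻¹ * y ^ 2) ≤ r ^ ((1 : ℝ) / 2 - 1) := by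
    rw [neg_mul, Real.exp_neg, ← div_eq_mul_inv, div_le_iff₀ (Real.exp_pos _)]
    have hq : r = (Real.sqrt r) ^ 2 := (Real.sq_sqrt hr.le).symm
    have hq0 : 0 < Real.sqrt r := Real.sqrt_pos.2 hr
    have e4 : r ^ ((1 : ℝ) / 2 - 1) = (Real.sqrt r)⁻¹ := by
      rw [show (1 : ℝ) / 2 - 1 = -(1 / 2) by norm_num, Real.rpow_neg hr.le, ← Real.sqrt_eq_rpow]
    rw [e4]
    -- The elementary bound e^u ≥ 1 + u is enough: with q = √r the remaining difference completes to
    -- a square plus a positive term.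
    have e5 : (4 * (2 * r))⁻¹ * y ^ 2 + 1 ≤ Real.exp ((4 * (2 * r))⁻¹ * y ^ 2) := Real.add_one_le_exp _
    refine le_trans ?_ (mul_le_mul_of_nonneg_left e5 (inv_nonneg.2 hq0.le))
    set q := Real.sqrt r
    rw [hq, ← sub_nonneg]
    have : q⁻¹ * ((4 * (2 * q ^ 2))⁻¹ * y ^ 2 + 1) - (2 * q ^ 2)⁻¹ * y =
        q⁻¹ * (((y / q) / 2 - 1) ^ 2 + (y / q) ^ 2 / 4) * 2⁻¹ + q⁻¹ * 2⁻¹ - q⁻¹ * (y / q) ^ 2 / 8 := by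
      field_simp
      ring
    rw [this]
    have h6 : q⁻¹ * (((y / q) / 2 - 1) ^ 2 + (y / q) ^ 2 / 4) * 2⁻¹ + q⁻¹ * 2⁻¹ -
        q⁻¹ * (y / q) ^ 2 / 8 = q⁻¹ * (((y / q) / 2 - 1) ^ 2 + 1) * 2⁻¹ := by ring
    rw [h6]
    positivity
  have hp : 0 ≤ (2 : ℝ) ^ ((d : ℝ) / 2) * ((4 * Real.pi * (2 * r)) ^ ((d : ℝ) / 2))⁻¹ *
      Real.exp (-(4 * (2 * r))⁻¹ * y ^ 2) := by positivity
  calc (2 * r)⁻¹ * y * heat r x = ((2 * r)⁻¹ * y * Real.exp (-(4 * (2 * r))⁻¹ * y ^ 2)) *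
        ((2 : ℝ) ^ ((d : ℝ) / 2) * ((4 * Real.pi * (2 * r)) ^ ((d : ℝ) / 2))⁻¹ *
      Real.exp (-(4 * (2 * r))⁻¹ * y ^ 2)) := by
        rw [heat, e1, ← hyd, e2]
        ring
    _ ≤ r ^ ((1 : ℝ) / 2 - 1) * ((2 : ℝ) ^ ((d : ℝ) / 2) *
        ((4 * Real.pi * (2 * r)) ^ ((d : ℝ) / 2))⁻¹ * Real.exp (-(4 * (2 * r))⁻¹ * y ^ 2)) :=
      mul_le_mul_of_nonneg_right e3 hp
    _ = _ := by
      rw [heat, ← hyd]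
      ring

theorem dHeat_integral {r : ℝ} (hr : 0 < r) (j : Fin d) : Integrable (dHeat j r) ∧
    ∫ x : Sp d, ‖dHeat j r x‖ ≤ (2 : ℝ) ^ ((d : ℝ) / 2) * r ^ ((1 : ℝ) / 2 - 1) := by
  obtain ⟨h1, h2⟩ := heat_integral (d := d) (r := 2 * r) (by positivity)
  have hb : ∀ x : Sp d, ‖dHeat j r x‖ ≤
      (2 : ℝ) ^ ((d : ℝ) / 2) * r ^ ((1 : ℝ) / 2 - 1) * heat (2 * r) x := by
    intro x
    refine le_trans ?_ (heat_bound hr x)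
    rw [dHeat, norm_mul, norm_mul, norm_neg, Real.norm_of_nonneg (heat_nonneg hr x),
      Real.norm_of_nonneg (by positivity : 0 ≤ (2 * r)⁻¹)]
    have := heat_nonneg hr x
    gcongr
    exact PiLp.norm_apply_le x j
  have hm : Measurable (dHeat j r) := (measurable_dHeat j).comp measurable_prodMk_left
  have hi : Integrable (dHeat j r) := (h1.const_mul _).mono' hm.aestronglyMeasurable
    (Filter.Eventually.of_forall hb)
  refine ⟨hi, (integral_mono hi.norm (h1.const_mul _) hb).trans_eq ?_⟩
  rw [integral_const_mul, h2, mul_one]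

theorem fourier_dHeat {r : ℝ} (hr : 0 < r) (j : Fin d) (w : Sp d) :
    𝓕 (fun x => (dHeat j r x : ℂ)) w =
      2 * Real.pi * Complex.I * w j * 𝓕 (fun x => (heat r x : ℂ)) w := by
  have hd : ∀ x : Sp d, HasFDerivAt (fun x => (heat r x : ℂ)) (Complex.ofRealCLM ∘L
      ((-(2 * r)⁻¹ * heat r x) • innerForm d x)) x := by
    intro x
    refine Complex.ofRealCLM.hasFDerivAt.comp x ?_
    have h1 := ((hasStrictFDerivAt_norm_sq x).hasFDerivAt.const_mul (-(4 * r)⁻¹)).exp.const_mul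
      ((4 * Real.pi * r) ^ ((d : ℝ) / 2))⁻¹
    refine h1.congr_fderiv ?_
    ext v
    simp only [smul_apply, smul_eq_mul, heat, innerForm_apply, innerSL_apply_apply]
    field_simp
    ring
  have hfd : ∀ x : Sp d, fderiv ℝ (fun x : Sp d => (heat r x : ℂ)) x = Complex.ofRealCLM ∘L
      ((-(2 * r)⁻¹ * heat r x) • innerForm d x) := fun x => (hd x).fderiv
  have hi : Integrable (fderiv ℝ (fun x : Sp d => (heat r x : ℂ))) := by
    refine Integrable.mono' (((heat_integral (d := d) (r := 2 * r) (by positivity)).1.const_mul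
      ((2 : ℝ) ^ ((d : ℝ) / 2) * r ^ ((1 : ℝ) / 2 - 1)))) ?_ ?_
    · exact (measurable_fderiv ℝ _).aestronglyMeasurable
    · refine Filter.Eventually.of_forall fun x => (le_trans ?_ (heat_bound hr x))
      rw [hfd x]
      refine (ContinuousLinearMap.opNorm_comp_le _ _).trans ?_
      rw [Complex.ofRealCLM_norm, one_mul, norm_smul, norm_mul, norm_neg,
        Real.norm_of_nonneg (heat_nonneg hr x), Real.norm_of_nonneg (by positivity : 0 ≤ (2 * r)⁻¹)]
      have h3 : ‖innerForm d x‖ = ‖x‖ := innerSL_apply_norm (𝕜 := ℝ) x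
      rw [h3]
      exact le_of_eq (by ring)
  have h := congrFun (Real.fourier_fderiv (heat_integral hr).1.ofReal
    (fun x => (hd x).differentiableAt) hi) w
  have h2 := congrArg (fun L : Sp d →L[ℝ] ℂ => L (EuclideanSpace.single j 1)) h
  simp only [VectorFourier.fourierSMulRight_apply] at h2
  rw [Real.fourier_eq, ContinuousLinearMap.integral_apply
    ((Real.fourierIntegral_convergent_iff w).2 hi)] at h2
  have e1 : ∀ x : Sp d, (Real.fourierChar (-inner ℝ x w) •
      fderiv ℝ (fun x : Sp d => (heat r x : ℂ)) x) (EuclideanSpace.single j 1) =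
      Real.fourierChar (-inner ℝ x w) • (dHeat j r x : ℂ) := by
    intro x
    rw [hfd x, Circle.smul_def, Circle.smul_def, smul_apply]
    congr 1
    simp only [ContinuousLinearMap.comp_apply, smul_apply, innerForm_apply,
      EuclideanSpace.inner_single_right, dHeat, Complex.ofRealCLM_apply]
    simp
    ring
  simp only [e1] at h2
  have e2 : (-innerSL ℝ) w (EuclideanSpace.single j (1 : ℝ)) = -w j := by
    change -inner ℝ w (EuclideanSpace.single j (1 : ℝ)) = _
    rw [EuclideanSpace.inner_single_right]
    simp
  rw [Real.fourier_eq, h2, e2]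
  simp only [Complex.real_smul, smul_eq_mul, Complex.ofReal_neg]
  ring

/-! ### The kernel of (1 - Δ)⁻¹ by subordination to the heat kernel -/

section Bessel

/-- The kernel of `(1 - Δ)⁻¹`. -/
def besselKernel (x : Sp d) : ℝ := ∫ r in Set.Ioi (0 : ℝ), Real.exp (-r) * heat r x

/-- The kernel of `∂_j (1 - Δ)⁻¹`. -/
def dBesselKernel (j : Fin d) (x : Sp d) : ℝ := ∫ r in Set.Ioi (0 : ℝ), Real.exp (-r) * dHeat j r x

theorem fourier_const_mul (c : ℝ) (f : Sp d → ℝ) (w : Sp d) :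
    𝓕 (fun x => ((c * f x : ℝ) : ℂ)) w = c * 𝓕 (fun x => (f x : ℂ)) w := by
  simp only [Real.fourier_eq, Circle.smul_def, smul_eq_mul]
  rw [← integral_const_mul]
  congr 1
  ext x
  push_cast
  ring

theorem integrable_exp_mul_heat : Integrable (fun z : ℝ × Sp d => Real.exp (-z.1) * heat z.1 z.2)
    ((volume.restrict (Set.Ioi 0)).prod volume) := by
  have hm := measurable_heat (d := d)
  refine integrable_prod_of_bound (B := fun r => Real.exp (-1 * r))
    (Measurable.aestronglyMeasurable (by fun_prop)) (integrableOn_exp_mul_Ioi (by norm_num) 0) ?_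
  filter_upwards [ae_restrict_mem measurableSet_Ioi] with r hr
  obtain ⟨h1, h2⟩ := heat_integral (d := d) hr
  refine ⟨h1.const_mul _, le_of_eq ?_⟩
  simp only [norm_mul, Real.norm_of_nonneg (heat_nonneg hr _), Real.norm_of_nonneg (Real.exp_pos _).le]
  rw [integral_const_mul, h2, mul_one, neg_one_mul]

/-- Heat kernels have mass one, so e^{-r} controls the r-integral, and 1/(1+a) = ∫₀^∞ e^{-(1+a)r} dr
with a = 4π²|w|². -/
theorem integrable_besselKernel : Integrable (besselKernel (d := d)) ∧ ∀ w : Sp d,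
    𝓕 (fun x => (besselKernel x : ℂ)) w = besselMult w := by
  obtain ⟨h1, h2⟩ := fourier_integral_real (integrable_exp_mul_heat (d := d))
  refine ⟨h1, fun w => (h2 w).trans ?_⟩
  simp only [fourier_const_mul]
  have e : ∫ r in Set.Ioi (0 : ℝ), (Real.exp (-r) : ℂ) * 𝓕 (fun x => (heat r x : ℂ)) w =
      ∫ r in Set.Ioi (0 : ℝ), ((Real.exp (-(1 + 4 * Real.pi ^ 2 * ‖w‖ ^ 2) * r) : ℝ) : ℂ) := by
    refine setIntegral_congr_fun measurableSet_Ioi fun r hr => ?_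
    rw [fourier_heat hr, ← Complex.ofReal_mul, ← Real.exp_add]
    congr 2
    ring
  have hp : 0 < 1 + 4 * Real.pi ^ 2 * ‖w‖ ^ 2 := by positivity
  rw [e, integral_complex_ofReal, integral_exp_mul_Ioi (by linarith), besselMult]
  congr 1
  rw [mul_zero, Real.exp_zero, neg_div_neg_eq, one_div]

/-- The L¹ norm of the derivative of the heat kernel is O(r^{-1/2}), so the mass is bounded by the
convergent Gamma integral at 1/2. -/
theorem integrable_dBesselKernel (j : Fin d) : Integrable (dBesselKernel j) ∧ ∀ w : Sp d,
    𝓕 (fun x => (dBesselKernel j x : ℂ)) w = 2 * Real.pi * Complex.I * w j * besselMult w := by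
  have hm := measurable_dHeat (d := d) j
  have hF : Integrable (fun z : ℝ × Sp d => Real.exp (-z.1) * dHeat j z.1 z.2)
      ((volume.restrict (Set.Ioi 0)).prod volume) := by
    refine integrable_prod_of_bound
      (B := fun r => (2 : ℝ) ^ ((d : ℝ) / 2) * (Real.exp (-r) * r ^ ((1 : ℝ) / 2 - 1)))
      (Measurable.aestronglyMeasurable (by fun_prop))
      ((Real.GammaIntegral_convergent (by norm_num)).const_mul _) ?_
    filter_upwards [ae_restrict_mem measurableSet_Ioi] with r hr
    obtain ⟨h1, h2⟩ := dHeat_integral hr j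
    refine ⟨h1.const_mul _, ?_⟩
    simp only [norm_mul, Real.norm_of_nonneg (Real.exp_pos _).le]
    rw [integral_const_mul]
    calc _ ≤ Real.exp (-r) * ((2 : ℝ) ^ ((d : ℝ) / 2) * r ^ ((1 : ℝ) / 2 - 1)) := by gcongr
      _ = _ := by ring
  obtain ⟨h1, h2⟩ := fourier_integral_real hF
  refine ⟨h1, fun w => (h2 w).trans ?_⟩
  rw [← integrable_besselKernel.2 w]
  rw [show 𝓕 (fun x : Sp d => (besselKernel x : ℂ)) w = _ from (fourier_integral_real integrable_exp_mul_heat).2 w,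
    ← integral_const_mul]
  refine setIntegral_congr_fun measurableSet_Ioi fun r hr => ?_
  simp only [fourier_const_mul]
  rw [fourier_dHeat hr]
  ring

end Bessel

end Heat

/-! ### Fourier transforms of weak derivatives -/

section Mollify

theorem pdv_comp_sub {η : Sp d → ℝ} (h : ContDiff ℝ ∞ η) (j : Fin d) (x y : Sp d) :
    pdv j (fun y => η (x - y)) y = -pdv j η (x - y) := by
  have h1 : HasFDerivAt (fun y => η (x - y))
      ((fderiv ℝ η (x - y)).comp (-ContinuousLinearMap.id ℝ (Sp d))) y :=
    HasFDerivAt.comp y ((h.differentiable (by simp)) (x - y)).hasFDerivAt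
      ((hasFDerivAt_id y).const_sub x)
  rw [pdv, pdv, h1.fderiv]
  simp

theorem IsWeakGradient.integral_mollify {u : Sp d → ℝ} {g : Sp d → Sp d} (h : IsWeakGradient u g)
    {η : Sp d → ℝ} (h1 : ContDiff ℝ ∞ η) (h2 : HasCompactSupport η) (j : Fin d) (x : Sp d) :
    ∫ y, u y * pdv j η (x - y) = ∫ y, g y j * η (x - y) := by
  have h3 := h.integral_pdv (ψ := fun y => η (x - y)) (by fun_prop)
    (h2.comp_homeomorph (Homeomorph.subLeft x)) j
  simp only [pdv_comp_sub h1, mul_neg, integral_neg, neg_inj] at h3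
  exact h3

theorem WeakPartial.integral_mollify {j : Fin d} {u g : Sp d → ℝ} (h : WeakPartial j u g)
    {η : Sp d → ℝ} (h1 : ContDiff ℝ ∞ η) (h2 : HasCompactSupport η) (x : Sp d) :
    ∫ y, u y * pdv j η (x - y) = ∫ y, g y * η (x - y) := by
  have h3 := h.integral_eq (fun y => η (x - y)) (by fun_prop)
    (h2.comp_homeomorph (Homeomorph.subLeft x))
  simp only [pdv_comp_sub h1, mul_neg, integral_neg, neg_inj] at h3
  exact h3

theorem fourier_spatial_convolution {f g : Sp d → ℝ} (hf : Integrable f) (hg : Integrable g)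
    (w : Sp d) : 𝓕 (fun x => ((∫ y, f y * g (x - y) : ℝ) : ℂ)) w =
      𝓕 (fun x => (f x : ℂ)) w * 𝓕 (fun x => (g x : ℂ)) w := by
  rw [← Real.fourier_mul_convolution_eq (f₁ := fun x => (f x : ℂ)) (f₂ := fun x => (g x : ℂ))
    hf.ofReal hg.ofReal]
  refine congrFun (congrArg 𝓕 (funext fun x => ?_)) w
  rw [integral_ofReal_mul, convolution]
  rfl

/-- A bump times cos(2π x·w): the real part of its transform at w is the integral of the bump times
cos², which is positive. -/
theorem exists_test_fourier_ne_zero (w : Sp d) : ∃ η : Sp d → ℝ, ContDiff ℝ ∞ η ∧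
    HasCompactSupport η ∧ 𝓕 (fun x => (η x : ℂ)) w ≠ 0 := by
  set η : Sp d → ℝ := fun x => cutoff x * Real.cos (2 * Real.pi * inner ℝ x w) with hη
  have h1 : ContDiff ℝ ∞ η := contDiff_cutoff.mul (Real.contDiff_cos.comp
    (contDiff_const.mul (contDiff_id.inner ℝ contDiff_const)))
  have h2 : HasCompactSupport η := hasCompactSupport_cutoff.mul_right
  refine ⟨η, h1, h2, fun h0 => ?_⟩
  have hi : Integrable fun x => (η x : ℂ) := (h1.continuous.integrable_of_hasCompactSupport h2).ofReal
  have h3 : (𝓕 (fun x => (η x : ℂ)) w).re = ∫ x, cutoff x * Real.cos (2 * Real.pi * inner ℝ x w) ^ 2 := by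
    rw [Real.fourier_eq', ← RCLike.re_eq_complex_re, ← integral_re]
    · congr 1
      ext x
      rw [RCLike.re_eq_complex_re, smul_eq_mul, Complex.re_mul_ofReal, Complex.exp_ofReal_mul_I_re,
        hη, show -2 * Real.pi * inner ℝ x w = -(2 * Real.pi * inner ℝ x w) by ring, Real.cos_neg]
      ring
    · have := (Real.fourierIntegral_convergent_iff w).2 hi
      refine this.congr (Filter.Eventually.of_forall fun x => ?_)
      simp only
      rw [Circle.smul_def, Real.fourierChar_apply]
      congr 3
      push_cast
      ring
  rw [h0, Complex.zero_re] at h3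
  have hcc : Continuous (cutoff (d := d)) := contDiff_cutoff.continuous
  have h4 : 0 < ∫ x, cutoff x * Real.cos (2 * Real.pi * inner ℝ x w) ^ 2 := by
    refine Continuous.integral_pos_of_hasCompactSupport_nonneg_nonzero (x := 0) (by fun_prop)
      hasCompactSupport_cutoff.mul_right
      (fun x => mul_nonneg (cutoff_nonneg _) (sq_nonneg _)) ?_
    rw [cutoff_eq_one (by simp)]
    simp
  exact h4.ne h3

theorem fourier_pdv {η : Sp d → ℝ} (h1 : ContDiff ℝ ∞ η) (h2 : HasCompactSupport η) (j : Fin d)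
    (w : Sp d) : 𝓕 (fun x => (pdv j η x : ℂ)) w =
      2 * Real.pi * Complex.I * w j * 𝓕 (fun x => (η x : ℂ)) w := by
  have h := fourier_lineDeriv_neg (testSchwartz h1 h2) j (-w)
  rw [neg_neg, SchwartzMap.fourier_coe, SchwartzMap.fourier_coe] at h
  have e : ⇑(LineDeriv.lineDerivOp (EuclideanSpace.single j (1 : ℝ)) (testSchwartz h1 h2)) =
      fun x => (pdv j η x : ℂ) := funext (lineDeriv_testSchwartz h1 h2 j)
  rw [e] at h
  rw [h]
  simp only [PiLp.neg_apply, Complex.ofReal_neg, mul_neg, neg_mul, neg_neg]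
  rfl

/-- Testing against translates of η gives u * ∂_jη = g * η. Taking transforms and cancelling η̂(w) ≠
0 gives the symbol relation at every w. -/
theorem WeakPartial.fourier {j : Fin d} {u g : Sp d → ℝ} (h : WeakPartial j u g) (w : Sp d) :
    𝓕 (fun x => (g x : ℂ)) w = 2 * Real.pi * Complex.I * w j * 𝓕 (fun x => (u x : ℂ)) w := by
  obtain ⟨η, h1, h2, h3⟩ := exists_test_fourier_ne_zero w
  have hi := h1.continuous.integrable_of_hasCompactSupport (μ := volume) h2
  have hi' := (contDiff_pdv h1 j).continuous.integrable_of_hasCompactSupport (μ := volume)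
    (hasCompactSupport_pdv h2 j)
  have e1 := fourier_spatial_convolution h.left hi' w
  simp only [h.integral_mollify h1 h2] at e1
  rw [fourier_spatial_convolution h.right hi, fourier_pdv h1 h2] at e1
  refine mul_right_cancel₀ h3 (e1.trans ?_)
  ring

end Mollify

/-! ### Space-time convolutions -/

section Spacetime

theorem fourier_comp_sub (f : Sp d → ℂ) (y w : Sp d) :
    𝓕 (fun x => f (x - y)) w = Real.fourierChar (-inner ℝ y w) * 𝓕 f w := by
  simp only [Real.fourier_eq, Circle.smul_def, smul_eq_mul]
  rw [← integral_const_mul, ← integral_add_right_eq_self _ y]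
  congr 1
  ext x
  rw [add_sub_cancel_right, inner_add_left, ← mul_assoc, ← Circle.coe_mul, ← AddChar.map_add_eq_mul]
  congr 3
  ring

/-- Space-time convolution of a kernel with a density. -/
def stConv (A B : ℝ → Sp d → ℝ) (t : ℝ) (x : Sp d) : ℝ :=
  ∫ q : ℝ × Sp d, A (t - q.1) (x - q.2) * B q.1 q.2

theorem aestronglyMeasurable_shift {A B : ℝ → Sp d → ℝ}
    (hA : Measurable fun z : ℝ × Sp d => A z.1 z.2)
    (hB : AEStronglyMeasurable (fun z : ℝ × Sp d => B z.1 z.2) volume) (t : ℝ) :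
    AEStronglyMeasurable (fun z : (ℝ × Sp d) × Sp d =>
      A (t - z.1.1) (z.2 - z.1.2) * B z.1.1 z.1.2)
      ((volume : Measure (ℝ × Sp d)).prod (volume : Measure (Sp d))) := by
  refine AEStronglyMeasurable.mul ?_ hB.comp_fst
  exact (hA.comp (by fun_prop : Measurable fun z : (ℝ × Sp d) × Sp d =>
    (t - z.1.1, z.2 - z.1.2))).aestronglyMeasurable

theorem aestronglyMeasurable_stConv {A B : ℝ → Sp d → ℝ}
    (hA : Measurable fun z : ℝ × Sp d => A z.1 z.2)
    (hB : AEStronglyMeasurable (fun z : ℝ × Sp d => B z.1 z.2) volume) :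
    AEStronglyMeasurable (fun z : ℝ × Sp d => stConv A B z.1 z.2) volume := by
  refine AEStronglyMeasurable.integral_prod_right' (f := fun z : (ℝ × Sp d) × (ℝ × Sp d) =>
    A (z.1.1 - z.2.1) (z.1.2 - z.2.2) * B z.2.1 z.2.2) (AEStronglyMeasurable.mul ?_ hB.comp_snd)
  exact (hA.comp (by fun_prop : Measurable fun z : (ℝ × Sp d) × (ℝ × Sp d) =>
    (z.1.1 - z.2.1, z.1.2 - z.2.2))).aestronglyMeasurable

theorem lintegral_shift {A B : ℝ → Sp d → ℝ} (hA : Measurable fun z : ℝ × Sp d => A z.1 z.2)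
    (hB : AEStronglyMeasurable (fun z : ℝ × Sp d => B z.1 z.2) volume) (t : ℝ) :
    ∫⁻ z : (ℝ × Sp d) × Sp d, ‖A (t - z.1.1) (z.2 - z.1.2) * B z.1.1 z.1.2‖ₑ
      ∂((volume : Measure (ℝ × Sp d)).prod (volume : Measure (Sp d))) =
      ∫⁻ s : ℝ, (∫⁻ x, ‖A (t - s) x‖ₑ) * ∫⁻ y, ‖B s y‖ₑ := by
  rw [lintegral_prod _ (aestronglyMeasurable_shift hA hB t).enorm]
  have e : ∀ q : ℝ × Sp d, ∫⁻ x, ‖A (t - q.1) (x - q.2) * B q.1 q.2‖ₑ =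
      (∫⁻ x, ‖A (t - q.1) x‖ₑ) * ‖B q.1 q.2‖ₑ := by
    intro q
    simp only [enorm_mul]
    rw [lintegral_mul_const, lintegral_sub_right_eq_self (fun x => ‖A (t - q.1) x‖ₑ)]
    have : Measurable fun x : Sp d => A (t - q.1) (x - q.2) :=
      hA.comp (by fun_prop : Measurable fun x : Sp d => (t - q.1, x - q.2))
    fun_prop
  have hA1 : Measurable fun s : ℝ => ∫⁻ x, ‖A (t - s) x‖ₑ := by
    have : Measurable fun z : ℝ × Sp d => ‖A (t - z.1) z.2‖ₑ :=
      (hA.comp (by fun_prop : Measurable fun z : ℝ × Sp d => (t - z.1, z.2))).enorm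
    exact this.lintegral_prod_right'
  rw [lintegral_congr e, Measure.volume_eq_prod, lintegral_prod]
  · refine lintegral_congr_ae ?_
    rw [Measure.volume_eq_prod] at hB
    filter_upwards [hB.prodMk_left] with s hs
    exact lintegral_const_mul'' _ hs.enorm
  · exact (hA1.comp measurable_fst).aemeasurable.mul hB.enorm

/-- Fubini over (s, y) and x: the translation by y becomes a character, and integration in y
produces the transform of B(s). Finiteness of the time integral of the products of L¹ norms is
exactly integrability of the full integrand. -/
theorem stConv_spec {A B : ℝ → Sp d → ℝ} (hA : Measurable fun z : ℝ × Sp d => A z.1 z.2)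
    (hB : AEStronglyMeasurable (fun z : ℝ × Sp d => B z.1 z.2) volume) {t : ℝ}
    (h : ∫⁻ s : ℝ, (∫⁻ x, ‖A (t - s) x‖ₑ) * ∫⁻ y, ‖B s y‖ₑ < ⊤) :
    Integrable (stConv A B t) ∧
    ∀ w, 𝓕 (fun x => (stConv A B t x : ℂ)) w =
      ∫ s, 𝓕 (fun x => (A (t - s) x : ℂ)) w * 𝓕 (fun x => (B s x : ℂ)) w := by
  have hF : Integrable (fun z : (ℝ × Sp d) × Sp d => A (t - z.1.1) (z.2 - z.1.2) * B z.1.1 z.1.2)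
      ((volume : Measure (ℝ × Sp d)).prod (volume : Measure (Sp d))) :=
    ⟨aestronglyMeasurable_shift hA hB t, by
      rw [HasFiniteIntegral, lintegral_shift hA hB]; exact h⟩
  obtain ⟨h1, h2⟩ := fourier_integral_real hF
  refine ⟨h1, fun w => (h2 w).trans ?_⟩
  have e : ∀ q : ℝ × Sp d, 𝓕 (fun x => ((A (t - q.1) (x - q.2) * B q.1 q.2 : ℝ) : ℂ)) w =
      𝓕 (fun x => (A (t - q.1) x : ℂ)) w *
        (Real.fourierChar (-inner ℝ q.2 w) * (B q.1 q.2 : ℂ)) := by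
    intro q
    have := fourier_const_mul (B q.1 q.2) (fun x => A (t - q.1) (x - q.2)) w
    simp only [mul_comm (A _ _)]
    rw [this, fourier_comp_sub (fun x => (A (t - q.1) x : ℂ))]
    ring
  have hi : Integrable fun q : ℝ × Sp d => 𝓕 (fun x => (A (t - q.1) x : ℂ)) w *
        (Real.fourierChar (-inner ℝ q.2 w) * (B q.1 q.2 : ℂ)) := by
    have hch : Continuous fun z : (ℝ × Sp d) × Sp d => (Real.fourierChar (-inner ℝ z.2 w) : ℂ) := by
      have := Real.continuous_fourierChar
      fun_prop
    have h3 := (hF.ofReal (𝕜 := ℂ)).bdd_mul (c := 1) hch.aestronglyMeasurable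
      (Filter.Eventually.of_forall fun z => (Circle.norm_coe _).le)
    refine h3.integral_prod_left.congr (Filter.Eventually.of_forall fun q => ?_)
    refine Eq.trans ?_ (e q)
    rw [Real.fourier_eq]
    rfl
  simp only [e]
  rw [Measure.volume_eq_prod] at hi ⊢
  rw [integral_prod _ hi]
  congr 1
  ext s
  simp only
  rw [integral_const_mul, Real.fourier_eq]
  rfl

theorem lintegral_stConv_le {A B : ℝ → Sp d → ℝ} (hA : Measurable fun z : ℝ × Sp d => A z.1 z.2)
    (hB : AEStronglyMeasurable (fun z : ℝ × Sp d => B z.1 z.2) volume) (t : ℝ) :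
    ∫⁻ x, ‖stConv A B t x‖ₑ ≤ ∫⁻ s : ℝ, (∫⁻ x, ‖A (t - s) x‖ₑ) * ∫⁻ y, ‖B s y‖ₑ := by
  rw [← lintegral_shift hA hB t, lintegral_prod_symm _ (aestronglyMeasurable_shift hA hB t).enorm]
  exact lintegral_mono fun x => enorm_integral_le_lintegral_enorm _

theorem weakPartial_stConv {A A' B B' : ℝ → Sp d → ℝ} {j : Fin d}
    (hA : Measurable fun z : ℝ × Sp d => A z.1 z.2) (hA' : Measurable fun z : ℝ × Sp d => A' z.1 z.2)
    (hB : AEStronglyMeasurable (fun z : ℝ × Sp d => B z.1 z.2) volume)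
    (hB' : AEStronglyMeasurable (fun z : ℝ × Sp d => B' z.1 z.2) volume) {t : ℝ}
    (h : ∫⁻ s : ℝ, (∫⁻ x, ‖A (t - s) x‖ₑ) * ∫⁻ y, ‖B s y‖ₑ < ⊤)
    (h' : ∫⁻ s : ℝ, (∫⁻ x, ‖A' (t - s) x‖ₑ) * ∫⁻ y, ‖B' s y‖ₑ < ⊤)
    (hrel : ∀ w : Sp d, w ≠ 0 → ∀ᵐ s, 𝓕 (fun x => (A' (t - s) x : ℂ)) w * 𝓕 (fun x => (B' s x : ℂ)) w =
      2 * Real.pi * Complex.I * w j *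
        (𝓕 (fun x => (A (t - s) x : ℂ)) w * 𝓕 (fun x => (B s x : ℂ)) w)) (hd : 0 < d) :
    WeakPartial j (stConv A B t) (stConv A' B' t) := by
  obtain ⟨h1, h2⟩ := stConv_spec hA hB h
  obtain ⟨h3, h4⟩ := stConv_spec hA' hB' h'
  refine weakPartial_of_fourier h1 h3 ?_
  filter_upwards [ae_ne_zero hd] with w hw
  rw [h2, h4, ← integral_const_mul]
  exact integral_congr_ae (hrel w hw)

end Spacetime

/-! ### Minkowski's inequality and measurability of slice norms -/

section Minkowski

variable {α β : Type*} [MeasurableSpace α] [MeasurableSpace β] {ν : Measure α} {κ : Measure β}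

theorem eLpNorm_two_eq {ε : Type*} [ENorm ε] (f : β → ε) :
    eLpNorm f 2 κ = (∫⁻ x, ‖f x‖ₑ ^ (2 : ℝ) ∂κ) ^ (1 / 2 : ℝ) := by
  rw [eLpNorm_eq_lintegral_rpow_enorm_toReal (by norm_num) (by norm_num)]
  simp

/-- Expand the square of the inner integral as a double integral over (q, q') and apply
Cauchy-Schwarz in x to each pair; the double integral then factorises. -/
theorem eLpNorm_lintegral_le_of_measurable [SFinite ν] [SFinite κ] {f : α × β → ℝ≥0∞}
    (hf : Measurable f) : eLpNorm (fun x => ∫⁻ q, f (q, x) ∂ν) 2 κ ≤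
      ∫⁻ q, eLpNorm (fun x => f (q, x)) 2 κ ∂ν := by
  set n : α → ℝ≥0∞ := fun q => eLpNorm (fun x => f (q, x)) 2 κ with hn
  have hnm : Measurable n := by
    simp only [hn, eLpNorm_two_eq]
    exact ((hf.enorm.pow_const 2).lintegral_prod_right').pow_const _
  have hpair : ∀ q q', ∫⁻ x, f (q, x) * f (q', x) ∂κ ≤ n q * n q' := by
    intro q q'
    have h := ENNReal.lintegral_mul_le_Lp_mul_Lq κ (Real.HolderConjugate.two_two)
      (f := fun x => f (q, x)) (g := fun x => f (q', x)) (by fun_prop) (by fun_prop)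
    simpa [hn, eLpNorm_two_eq] using h
  have h1 : ∫⁻ x, (∫⁻ q, f (q, x) ∂ν) ^ (2 : ℝ) ∂κ ≤ (∫⁻ q, n q ∂ν) ^ (2 : ℝ) := by
    have hG : Measurable fun x => ∫⁻ q, f (q, x) ∂ν := hf.lintegral_prod_left'
    have e1 : ∀ x, (∫⁻ q, f (q, x) ∂ν) ^ (2 : ℝ) = ∫⁻ q, f (q, x) * ∫⁻ q', f (q', x) ∂ν ∂ν := by
      intro x
      rw [lintegral_mul_const _ (by fun_prop), ENNReal.rpow_two, sq]
    simp only [e1]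
    rw [lintegral_lintegral_swap (by
      exact (((hf.comp measurable_swap)).mul (hG.comp measurable_fst)).aemeasurable)]
    have e2 : ∀ q, ∫⁻ x, f (q, x) * ∫⁻ q', f (q', x) ∂ν ∂κ ≤ n q * ∫⁻ q', n q' ∂ν := by
      intro q
      have e3 : ∀ x, f (q, x) * ∫⁻ q', f (q', x) ∂ν = ∫⁻ q', f (q, x) * f (q', x) ∂ν :=
        fun x => (lintegral_const_mul _ (by fun_prop)).symm
      simp only [e3]
      rw [lintegral_lintegral_swap (by
        exact ((hf.comp (by fun_prop : Measurable fun z : β × α => (q, z.1))).mul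
          (hf.comp measurable_swap)).aemeasurable), ← lintegral_const_mul _ hnm]
      exact lintegral_mono fun q' => hpair q q'
    calc _ ≤ ∫⁻ q, n q * ∫⁻ q', n q' ∂ν ∂ν := lintegral_mono e2
      _ = _ := by rw [lintegral_mul_const _ hnm, ENNReal.rpow_two, sq]
  rw [eLpNorm_two_eq]
  simp only [enorm_eq_self]
  calc _ ≤ ((∫⁻ q, n q ∂ν) ^ (2 : ℝ)) ^ (1 / 2 : ℝ) := ENNReal.rpow_le_rpow h1 (by norm_num)
    _ = _ := by rw [← ENNReal.rpow_mul]; norm_num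

/-- Minkowski's integral inequality in `L²`. -/
theorem eLpNorm_lintegral_le [SFinite ν] [SFinite κ] {f : α × β → ℝ≥0∞}
    (hf : AEMeasurable f (ν.prod κ)) : eLpNorm (fun x => ∫⁻ q, f (q, x) ∂ν) 2 κ ≤
      ∫⁻ q, eLpNorm (fun x => f (q, x)) 2 κ ∂ν := by
  have h1 : ∀ᵐ q ∂ν, ∀ᵐ x ∂κ, f (q, x) = hf.mk f (q, x) := Measure.ae_ae_of_ae_prod hf.ae_eq_mk
  have h2 : ∀ᵐ x ∂κ, ∀ᵐ q ∂ν, f (q, x) = hf.mk f (q, x) := by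
    refine Measure.ae_ae_of_ae_prod (p := fun z : β × α => f z.swap = hf.mk f z.swap) ?_
    exact (Measure.measurePreserving_swap (μ := κ) (ν := ν)).quasiMeasurePreserving.ae hf.ae_eq_mk
  have e1 : (fun x => ∫⁻ q, f (q, x) ∂ν) =ᵐ[κ] fun x => ∫⁻ q, hf.mk f (q, x) ∂ν := by
    filter_upwards [h2] with x hx using lintegral_congr_ae hx
  rw [eLpNorm_congr_ae e1]
  refine (eLpNorm_lintegral_le_of_measurable hf.measurable_mk).trans_eq (lintegral_congr_ae ?_)
  filter_upwards [h1] with q hq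
  exact (eLpNorm_congr_ae hq).symm

/-- Since ‖f‖₂² ≤ ‖f‖₁ ‖f‖_∞ ≤ (‖f‖₁ + ‖f‖_∞)². -/
theorem eLpNorm_two_le_add (f : β → ℝ) : eLpNorm f 2 κ ≤ eLpNorm f 1 κ + eLpNorm f ∞ κ := by
  rcases eq_or_ne (eLpNorm f ∞ κ) ∞ with h0 | h0
  · simp [h0]
  have h : ∫⁻ x, ‖f x‖ₑ ^ (2 : ℝ) ∂κ ≤ eLpNorm f 1 κ * eLpNorm f ∞ κ := by
    rw [eLpNorm_one_eq_lintegral_enorm]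
    rw [← lintegral_mul_const' _ _ h0]
    refine lintegral_mono_ae ?_
    filter_upwards [ae_le_eLpNormEssSup (f := f) (μ := κ)] with x hx
    rw [ENNReal.rpow_two, sq, eLpNorm_exponent_top]
    gcongr
  rw [eLpNorm_two_eq]
  calc _ ≤ ((eLpNorm f 1 κ + eLpNorm f ∞ κ) ^ (2 : ℝ)) ^ (1 / 2 : ℝ) := by
        refine ENNReal.rpow_le_rpow (h.trans ?_) (by norm_num)
        rw [ENNReal.rpow_two, sq]
        gcongr
        · exact le_self_add
        · exact le_add_self
    _ = _ := by rw [← ENNReal.rpow_mul]; norm_num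

/-- An essential supremum is at most c exactly when the slice of {c < |f|} is null, and measures of
slices depend measurably on the parameter. -/
theorem measurable_eLpNorm_top [SFinite κ] {f : α × β → ℝ} (hf : Measurable f) :
    Measurable fun q => eLpNorm (fun x => f (q, x)) ∞ κ := by
  refine measurable_of_Iic fun c => ?_
  have e : (fun q => eLpNorm (fun x => f (q, x)) ∞ κ) ⁻¹' Set.Iic c =
      {q | κ (Prod.mk q ⁻¹' {z | c < ‖f z‖ₑ}) = 0} := by
    ext q
    simp only [Set.mem_preimage, Set.mem_Iic, eLpNorm_exponent_top, Set.mem_ofPred_eq]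
    have h : eLpNormEssSup (fun x => f (q, x)) κ ≤ c ↔ ∀ᵐ x ∂κ, ‖f (q, x)‖ₑ ≤ c :=
      ⟨fun h => (ae_le_eLpNormEssSup (f := fun x => f (q, x))).mono fun x hx => hx.trans h,
        fun h => essSup_le_of_ae_le c h⟩
    rw [h, ae_iff]
    simp only [not_le]
    rfl
  rw [e]
  exact measurable_measure_prodMk_left (measurableSet_lt measurable_const hf.enorm)
    (measurableSet_singleton 0)

theorem aemeasurable_eLpNorm_top [SFinite ν] [SFinite κ] {f : α × β → ℝ}
    (hf : AEStronglyMeasurable f (ν.prod κ)) :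
    AEMeasurable (fun q => eLpNorm (fun x => f (q, x)) ∞ κ) ν := by
  refine ⟨_, measurable_eLpNorm_top (κ := κ) hf.stronglyMeasurable_mk.measurable, ?_⟩
  filter_upwards [Measure.ae_ae_of_ae_prod hf.ae_eq_mk] with q hq using eLpNorm_congr_ae hq

theorem aemeasurable_eLpNorm_one [SFinite ν] [SFinite κ] {ε : Type*} [NormedAddCommGroup ε]
    {f : α × β → ε} (hf : AEStronglyMeasurable f (ν.prod κ)) :
    AEMeasurable (fun q => eLpNorm (fun x => f (q, x)) 1 κ) ν := by
  simp only [eLpNorm_one_eq_lintegral_enorm]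
  exact hf.enorm.lintegral_prod_right'

theorem aemeasurable_eLpNorm_two [SFinite ν] [SFinite κ] {ε : Type*} [NormedAddCommGroup ε]
    {f : α × β → ε} (hf : AEStronglyMeasurable f (ν.prod κ)) :
    AEMeasurable (fun q => eLpNorm (fun x => f (q, x)) 2 κ) ν := by
  simp only [eLpNorm_two_eq]
  exact ((hf.enorm.pow_const 2).lintegral_prod_right').pow_const _

end Minkowski

/-! ### Shears along characteristics preserve null sets -/

section Shift

theorem quasiMeasurePreserving_shift {a : ℝ × Sp d → Sp d} (ha : Measurable a) :
    Measure.QuasiMeasurePreserving (fun z : (ℝ × Sp d) × Sp d => (z.1.1, z.2 - a z.1))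
      ((volume : Measure (ℝ × Sp d)).prod (volume : Measure (Sp d)))
      (volume : Measure (ℝ × Sp d)) := by
  have hmeas : Measurable fun z : (ℝ × Sp d) × Sp d => (z.1.1, z.2 - a z.1) := by fun_prop
  refine ⟨hmeas, Measure.AbsolutelyContinuous.mk fun N hN h0 => ?_⟩
  rw [Measure.map_apply hmeas hN, Measure.measure_prod_null (hmeas hN)]
  rw [Measure.volume_eq_prod, Measure.measure_prod_null hN] at h0
  have h1 : ∀ᵐ q : ℝ × Sp d, (volume : Measure (Sp d)) (Prod.mk q.1 ⁻¹' N) = 0 := by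
    rw [Measure.volume_eq_prod]
    exact Measure.quasiMeasurePreserving_fst.ae h0
  filter_upwards [h1] with q hq
  have e : Prod.mk q ⁻¹' ((fun z : (ℝ × Sp d) × Sp d => (z.1.1, z.2 - a z.1)) ⁻¹' N) =
      (fun x => x - a q) ⁻¹' (Prod.mk q.1 ⁻¹' N) := rfl
  simp only [Pi.zero_apply]
  rw [e]
  simp only [sub_eq_add_neg]
  rw [measure_preimage_add_right]
  exact hq

end Shift

/-! ### Enlarging the class of test functions -/

section CutoffExtension

theorem pdv_mul {ψ χ : Sp d → ℝ} (h1 : ContDiff ℝ ∞ ψ) (h2 : ContDiff ℝ ∞ χ) (j : Fin d)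
    (x : Sp d) : pdv j (fun x => ψ x * χ x) x = pdv j ψ x * χ x + ψ x * pdv j χ x := by
  have h := ((h1.differentiable (by simp)) x).hasFDerivAt.mul
    ((h2.differentiable (by simp)) x).hasFDerivAt
  have e : fderiv ℝ (fun x => ψ x * χ x) x = _ := h.fderiv
  rw [pdv, e, pdv, pdv]
  simp
  ring

theorem pdv_comp_smul {χ : Sp d → ℝ} (h : ContDiff ℝ ∞ χ) (c : ℝ) (j : Fin d)
    (x : Sp d) : pdv j (fun x => χ (c • x)) x = c * pdv j χ (c • x) := by
  have h1 : HasFDerivAt (fun x : Sp d => χ (c • x))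
      ((fderiv ℝ χ (c • x)).comp (c • ContinuousLinearMap.id ℝ (Sp d))) x :=
    HasFDerivAt.comp x ((h.differentiable (by simp)) (c • x)).hasFDerivAt
      ((hasFDerivAt_id x).const_smul c)
  rw [pdv, pdv, h1.fderiv]
  simp

/-- A weak identity between `L²` functions holds for all square integrable smooth test functions
with square integrable gradient. -/
theorem weak_identity_extend {a : Sp d → ℝ} {b : Fin d → Sp d → ℝ} (ha : MemLp a 2)
    (hb : ∀ i, MemLp (b i) 2)
    (h : ∀ ψ : Sp d → ℝ, ContDiff ℝ ∞ ψ → HasCompactSupport ψ →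
      (∫ x, a x * ψ x) + ∑ i, ∫ x, b i x * pdv i ψ x = 0)
    {ψ : Sp d → ℝ} (h1 : ContDiff ℝ ∞ ψ) (h2 : MemLp ψ 2) (h3 : ∀ i, MemLp (pdv i ψ) 2) :
    (∫ x, a x * ψ x) + ∑ i, ∫ x, b i x * pdv i ψ x = 0 := by
  set c : ℕ → ℝ := fun n => ((n : ℝ) + 1)⁻¹ with hc
  have hc0 : ∀ n, 0 < c n := fun n => by positivity
  have hc1 : ∀ n, c n ≤ 1 := fun n => inv_le_one_of_one_le₀ (by simp)
  have hclim : Filter.Tendsto c Filter.atTop (nhds 0) := tendsto_inv_atTop_nhds_zero_nat.comp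
    (Filter.tendsto_add_atTop_nat 1) |>.congr fun n => by simp [hc]
  have hχ : ContDiff ℝ ∞ (cutoff (d := d)) := contDiff_cutoff
  have hsc : ∀ n, ContDiff ℝ ∞ fun x : Sp d => cutoff (c n • x) := fun n => by
    exact hχ.comp (contDiff_const_smul (c n))
  have hss : ∀ n, HasCompactSupport fun x : Sp d => cutoff (c n • x) := fun n =>
    hasCompactSupport_cutoff.comp_homeomorph (Homeomorph.smulOfNeZero (c n) (hc0 n).ne')
  have hlim : ∀ x : Sp d, Filter.Tendsto (fun n => c n • x) Filter.atTop (nhds 0) := fun x => by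
    simpa using hclim.smul_const x
  have hint : ∀ {f g : Sp d → ℝ}, MemLp f 2 → MemLp g 2 → Integrable fun x => f x * g x :=
    fun hf hg => hf.integrable_mul hg
  obtain ⟨D, hD⟩ : ∃ D, ∀ i, ∀ x : Sp d, ‖pdv i cutoff x‖ ≤ D := by
    have : ∀ i, ∃ D, ∀ x : Sp d, ‖pdv i cutoff x‖ ≤ D := fun i =>
      (hasCompactSupport_pdv hasCompactSupport_cutoff i).exists_bound_of_continuous
        (contDiff_pdv hχ i).continuous
    choose D hD using this
    exact ⟨∑ i, |D i|, fun i x => (hD i x).trans ((le_abs_self _).trans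
      (Finset.single_le_sum (f := fun i => |D i|) (fun _ _ => abs_nonneg _) (Finset.mem_univ i)))⟩
  have hcut1 : ∀ x : Sp d, ‖cutoff x‖ ≤ 1 := fun x => by
    rw [Real.norm_of_nonneg (cutoff_nonneg x)]; exact cutoff_le_one x
  -- One limit statement for both kinds of terms: with k = 1 and the cutoff itself the limit is the
  -- full integral, with k = c and a derivative of the cutoff the factor c n from the chain rule
  -- makes it vanish.
  have key : ∀ {f g : Sp d → ℝ} (χ : Sp d → ℝ) (B : ℝ) (L : ℝ) (_ : Integrable fun x => f x * g x)
      (_ : Continuous χ) (_ : ∀ x, ‖χ x‖ ≤ B) (k : ℕ → ℝ) (_ : ∀ n, ‖k n‖ ≤ 1)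
      (_ : Filter.Tendsto (fun n => k n * χ 0) Filter.atTop (nhds L))
      (_ : ∃ k0, Filter.Tendsto k Filter.atTop (nhds k0)),
      Filter.Tendsto (fun n => ∫ x, f x * (g x * (k n * χ (c n • x)))) Filter.atTop
        (nhds (∫ x, f x * g x * L)) := by
    intro f g χ B L hfg hχc hB k hk hL ⟨k0, hk0⟩
    refine tendsto_integral_of_dominated_convergence (fun x => ‖f x * g x‖ * B) (fun n => ?_)
      (hfg.norm.mul_const B) (fun n => Filter.Eventually.of_forall fun x => ?_)
      (Filter.Eventually.of_forall fun x => ?_)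
    · simp only [← mul_assoc]
      have : Continuous fun x : Sp d => χ (c n • x) := by fun_prop
      exact (hfg.aestronglyMeasurable.mul aestronglyMeasurable_const).mul this.aestronglyMeasurable
    · rw [← mul_assoc, norm_mul]
      refine mul_le_mul_of_nonneg_left ?_ (norm_nonneg _)
      rw [norm_mul]
      calc _ ≤ 1 * ‖χ (c n • x)‖ := mul_le_mul_of_nonneg_right (hk n) (norm_nonneg _)
        _ ≤ B := by rw [one_mul]; exact hB _
    · have e : L = k0 * χ 0 := tendsto_nhds_unique hL (hk0.mul_const _)
      rw [e]
      simp only [← mul_assoc]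
      have := (hk0.const_mul (f x * g x)).mul ((hχc.tendsto 0).comp (hlim x))
      simpa only [Function.comp_def, mul_assoc] using this
  have hz : cutoff (0 : Sp d) = 1 := cutoff_eq_one (by simp)
  have t1 := key (f := a) (g := ψ) cutoff 1 1 (hint ha h2) hχ.continuous hcut1 (fun _ => 1)
    (by simp) (by simp [hz]) ⟨1, tendsto_const_nhds⟩
  have t2 : ∀ i, _ := fun i => key (f := b i) (g := pdv i ψ) cutoff 1 1 (hint (hb i) (h3 i))
    hχ.continuous hcut1 (fun _ => 1) (by simp) (by simp [hz]) ⟨1, tendsto_const_nhds⟩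
  have t3 : ∀ i, _ := fun i => key (f := b i) (g := ψ) (pdv i cutoff) D 0 (hint (hb i) h2)
    (contDiff_pdv hχ i).continuous (hD i) c (fun n => by
      rw [Real.norm_of_nonneg (hc0 n).le]; exact hc1 n) (by simpa using hclim.mul_const _) ⟨0, hclim⟩
  have t := t1.add (tendsto_finsetSum Finset.univ fun i _ => (t2 i).add (t3 i))
  simp only [mul_one, mul_zero, integral_zero, add_zero, one_mul] at t
  refine tendsto_nhds_unique t (tendsto_const_nhds.congr fun n => ?_)
  rw [← h (fun x => ψ x * cutoff (c n • x)) (h1.mul (hsc n)) (hss n).mul_left]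
  congr 1
  refine Finset.sum_congr rfl fun i _ => ?_
  have e : ∀ x, b i x * pdv i (fun x => ψ x * cutoff (c n • x)) x =
      b i x * (pdv i ψ x * cutoff (c n • x)) + b i x * (ψ x * (c n * pdv i cutoff (c n • x))) := by
    intro x
    rw [pdv_mul h1 (hsc n), pdv_comp_smul hχ]
    ring
  simp only [e]
  rw [integral_add]
  · simp only [← mul_assoc]
    refine (hint (hb i) (h3 i)).mul_bdd (c := 1) (hsc n).continuous.aestronglyMeasurable
      (Filter.Eventually.of_forall fun x => hcut1 _)
  · simp only [← mul_assoc]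
    have hcc : Continuous (pdv i (cutoff (d := d))) := (contDiff_pdv hχ i).continuous
    refine ((hint (hb i) h2).mul_const (c n)).mul_bdd (c := D) (by
      exact (hcc.comp (continuous_const_smul (c n))).aestronglyMeasurable)
      (Filter.Eventually.of_forall fun x => hD i _)

end CutoffExtension

/-! ### The L² bound for weak solutions of the screened Poisson equation -/

section EllipticEstimate

open scoped SchwartzMap

theorem fourier_lineDeriv (f : 𝓢(Sp d, ℂ)) (j : Fin d) (w : Sp d) :
    𝓕 (LineDeriv.lineDerivOp (EuclideanSpace.single j (1 : ℝ)) f) w =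
      2 * Real.pi * Complex.I * w j * 𝓕 f w := by
  have h := fourier_lineDeriv_neg f j (-w)
  simpa using h

theorem eLpNorm_schwartz_ne_top (f : 𝓢(Sp d, ℂ)) : eLpNorm f 2 volume ≠ ⊤ :=
  (f.memLp 2 volume).2.ne

theorem eLpNorm_fourier (f : 𝓢(Sp d, ℂ)) :
    eLpNorm (𝓕 f : 𝓢(Sp d, ℂ)) 2 volume = eLpNorm f 2 volume := by
  have h := SchwartzMap.norm_fourier_toL2_eq f
  rw [SchwartzMap.norm_toLp, SchwartzMap.norm_toLp] at h
  exact (ENNReal.toReal_eq_toReal_iff' (eLpNorm_schwartz_ne_top _) (eLpNorm_schwartz_ne_top _)).1 h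

theorem hasTemperateGrowth_besselMult : (besselMult (d := d)).HasTemperateGrowth := by
  have h : (fun w : Sp d => (1 + ‖(2 * Real.pi) • w‖ ^ 2) ^ (-1 : ℝ)).HasTemperateGrowth :=
    (Function.hasTemperateGrowth_one_add_norm_sq_rpow (Sp d) (-1)).comp
      (((2 * Real.pi) • ContinuousLinearMap.id ℝ (Sp d)).hasTemperateGrowth)
  convert h using 2 with w
  rw [norm_smul, Real.norm_of_nonneg (by positivity), Real.rpow_neg_one, besselMult]
  ring_nf

/-- The solution operator of `f - Δ f = u` on Schwartz functions. -/
def besselSchwartz (u : 𝓢(Sp d, ℂ)) : 𝓢(Sp d, ℂ) :=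
  SchwartzMap.fourierMultiplierCLM ℂ (besselMult (d := d)) u

theorem fourier_besselSchwartz (u : 𝓢(Sp d, ℂ)) (w : Sp d) :
    𝓕 (besselSchwartz u) w = besselMult w * 𝓕 u w := by
  rw [besselSchwartz, SchwartzMap.fourierMultiplierCLM_apply, FourierTransform.fourier_fourierInv_eq,
    SchwartzMap.smulLeftCLM_apply_apply hasTemperateGrowth_besselMult]
  simp

theorem besselSchwartz_sub_laplacian (u : 𝓢(Sp d, ℂ)) :
    besselSchwartz u - ∑ i : Fin d, LineDeriv.lineDerivOp (EuclideanSpace.single i (1 : ℝ))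
      (LineDeriv.lineDerivOp (EuclideanSpace.single i (1 : ℝ)) (besselSchwartz u)) = u := by
  have h : ∀ f g : 𝓢(Sp d, ℂ), (∀ w, 𝓕 f w = 𝓕 g w) → f = g := fun f g h => by
    have e : (𝓕 f : 𝓢(Sp d, ℂ)) = 𝓕 g := SchwartzMap.ext h
    have e' : 𝓕⁻ (𝓕 f : 𝓢(Sp d, ℂ)) = 𝓕⁻ (𝓕 g : 𝓢(Sp d, ℂ)) := by rw [e]
    rwa [FourierTransform.fourierInv_fourier_eq, FourierTransform.fourierInv_fourier_eq] at e'
  refine h _ _ fun w => ?_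
  have e : 𝓕 (besselSchwartz u - ∑ i : Fin d, LineDeriv.lineDerivOp (EuclideanSpace.single i (1 : ℝ))
      (LineDeriv.lineDerivOp (EuclideanSpace.single i (1 : ℝ)) (besselSchwartz u))) =
      𝓕 (besselSchwartz u) - ∑ i : Fin d, 𝓕 (LineDeriv.lineDerivOp (EuclideanSpace.single i (1 : ℝ))
      (LineDeriv.lineDerivOp (EuclideanSpace.single i (1 : ℝ)) (besselSchwartz u))) := by
    simp only [← FourierTransform.fourierCLM_apply (R := ℂ), map_sub, map_sum]
  rw [e, sub_apply, sum_apply]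
  simp only [fourier_lineDeriv, fourier_besselSchwartz]
  have hs : ∑ i, 2 * (Real.pi : ℂ) * Complex.I * w i * (2 * Real.pi * Complex.I * w i *
      (besselMult w * 𝓕 u w)) = -(4 * Real.pi ^ 2 * ‖w‖ ^ 2 : ℝ) * (besselMult w * 𝓕 u w) := by
    rw [Complex.ofReal_mul, ofReal_norm_sq, Finset.mul_sum, ← Finset.sum_neg_distrib, Finset.sum_mul]
    refine Finset.sum_congr rfl fun j _ => ?_
    push_cast
    linear_combination (4 * (Real.pi : ℂ) ^ 2 * w j ^ 2 * besselMult w * 𝓕 u w) * Complex.I_sq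
  rw [hs]
  have hb : (1 + (4 * Real.pi ^ 2 * ‖w‖ ^ 2 : ℝ) : ℂ) * (besselMult w : ℂ) = 1 := by
    rw [besselMult, ← Complex.ofReal_one, ← Complex.ofReal_add, ← Complex.ofReal_mul,
      mul_inv_cancel₀ (by positivity)]
  linear_combination (𝓕 u w) * hb

/-- Plancherel, with the multiplier bound 2π|w_j| ≤ 1 + 4π²|w|². -/
theorem eLpNorm_besselSchwartz_lineDeriv_le (u : 𝓢(Sp d, ℂ)) (j : Fin d) :
    eLpNorm (besselSchwartz (LineDeriv.lineDerivOp (EuclideanSpace.single j (1 : ℝ)) u)) 2 ≤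
      eLpNorm u 2 := by
  rw [← eLpNorm_fourier, ← eLpNorm_fourier u]
  refine eLpNorm_mono fun w => ?_
  rw [fourier_besselSchwartz, fourier_lineDeriv, ← mul_assoc, norm_mul]
  refine mul_le_of_le_one_left (norm_nonneg _) ?_
  rw [norm_mul, norm_mul, norm_mul, norm_mul, Complex.norm_I, Complex.norm_ofNat, Complex.norm_real,
    Complex.norm_real, Complex.norm_real, Real.norm_of_nonneg (besselMult_pos w).le,
    Real.norm_of_nonneg Real.pi_pos.le, mul_one, besselMult]
  have h1 : ‖w j‖ ≤ ‖w‖ := PiLp.norm_apply_le w j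
  rw [inv_mul_le_one₀ (by positivity)]
  nlinarith [sq_nonneg (1 - 2 * Real.pi * ‖w‖), Real.pi_pos, norm_nonneg w,
    mul_le_mul_of_nonneg_left h1 (by positivity : 0 ≤ 2 * Real.pi)]

theorem contDiff_re (f : 𝓢(Sp d, ℂ)) : ContDiff ℝ ∞ fun x => (f x).re :=
  Complex.reCLM.contDiff.comp (f.smooth _)

theorem pdv_re (f : 𝓢(Sp d, ℂ)) (j : Fin d) (x : Sp d) : pdv j (fun x => (f x).re) x =
    (LineDeriv.lineDerivOp (EuclideanSpace.single j (1 : ℝ)) f x).re := by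
  rw [SchwartzMap.lineDerivOp_apply_eq_fderiv]
  have h : HasFDerivAt (fun x => (f x).re) (Complex.reCLM ∘L fderiv ℝ f x) x :=
    Complex.reCLM.hasFDerivAt.comp x (f.differentiableAt).hasFDerivAt
  rw [pdv, h.fderiv]
  rfl

theorem memLp_re (f : 𝓢(Sp d, ℂ)) : MemLp (fun x => (f x).re) 2 := (f.memLp 2).re

/-- Duality. Let f = (1-Δ)⁻¹∂_jη, a Schwartz function. Then ∫ g_j η = -∫ φ ∂_jη = -∫ φ (1-Δ)f = -∫ u
f, where the last equality tests the equation for φ with f. As f is not compactly supported,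
`weak_identity_extend` is required. -/
theorem gradResolvent_pairing {u : Sp d → ℝ} {g : Sp d → Sp d} (h : IsGradResolvent u g)
    {η : Sp d → ℝ} (h1 : ContDiff ℝ ∞ η) (h2 : HasCompactSupport η) (j : Fin d) :
    ∫ x, g x j * η x = -∫ x, u x * (besselSchwartz (LineDeriv.lineDerivOp
      (EuclideanSpace.single j (1 : ℝ)) (testSchwartz h1 h2)) x).re := by
  obtain ⟨hu, φ, hφ, hg, hw, heq⟩ := h
  have hgj : ∀ i, MemLp (fun x => g x i) 2 := fun i =>
    (EuclideanSpace.proj i : Sp d →L[ℝ] ℝ).comp_memLp' hg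
  set f := besselSchwartz (LineDeriv.lineDerivOp
      (EuclideanSpace.single j (1 : ℝ)) (testSchwartz h1 h2)) with hf
  have hE := besselSchwartz_sub_laplacian (LineDeriv.lineDerivOp
      (EuclideanSpace.single j (1 : ℝ)) (testSchwartz h1 h2))
  rw [← hf] at hE
  set ψ : Sp d → ℝ := fun x => (f x).re with hψ
  have hψd : ∀ i, pdv i ψ = fun x =>
      (LineDeriv.lineDerivOp (EuclideanSpace.single i (1 : ℝ)) f x).re := fun i => funext (pdv_re f i)
  have hint : ∀ {f g : Sp d → ℝ}, MemLp f 2 → MemLp g 2 → Integrable fun x => f x * g x :=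
    fun hf hg => hf.integrable_mul hg
  have i1 := weak_identity_extend (a := fun x => φ x - u x) (b := fun i x => g x i)
    (hφ.sub hu) hgj (fun θ hθ hθ' => by
      have e := heq θ hθ hθ'
      have e2 : ∀ x, inner ℝ (g x) (gradient θ x) = ∑ i, g x i * pdv i θ x := fun x => by
        rw [PiLp.inner_apply]
        refine Finset.sum_congr rfl fun i _ => ?_
        rw [gradient_coord, mul_comm]
        rfl
      simp only [e2] at e
      rw [integral_finsetSum _ fun i _ => integrable_mul_test
        ((hgj i).locallyIntegrable (by norm_num)) (contDiff_pdv hθ i).continuous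
        (hasCompactSupport_pdv hθ' i)] at e
      simp only [sub_mul]
      rw [integral_sub (integrable_mul_test (hφ.locallyIntegrable (by norm_num)) hθ.continuous hθ')
        (integrable_mul_test (hu.locallyIntegrable (by norm_num)) hθ.continuous hθ')]
      linarith) (contDiff_re f) (memLp_re f) (fun i => by rw [← hψ, hψd]; exact memLp_re _)
  -- The relation between φ and its i-th derivative is cast as a weak identity in which only the
  -- i-th flux is nonzero.
  have i2 : ∀ i, ∫ x, g x i * pdv i ψ x = -∫ x, φ x * pdv i (pdv i ψ) x := by
    intro i
    have := weak_identity_extend (a := fun x => g x i) (b := fun k x => if k = i then φ x else 0)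
      (hgj i) (fun k => by
        split_ifs
        · exact hφ
        · exact MemLp.zero') (fun θ hθ hθ' => by
        have e := hw.integral_pdv hθ hθ' i
        rw [Finset.sum_eq_single i (fun k _ hk => by simp [hk]) (by simp)]
        simp only [if_true]
        linarith) (ψ := pdv i ψ) (contDiff_pdv (contDiff_re f) i)
        (by rw [hψd]; exact memLp_re _) (fun k => by
          rw [hψd, funext (pdv_re _ k)]; exact memLp_re _)
    rw [Finset.sum_eq_single i (fun k _ hk => by simp [hk]) (by simp)] at this
    simp only [if_true] at this
    linarith
  have hmm : ∀ i, MemLp (pdv i (pdv i ψ)) 2 := fun i => by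
    rw [hψd, funext (pdv_re _ i)]; exact memLp_re _
  have e3 : ∀ x, φ x * ψ x + ∑ i, -(φ x * pdv i (pdv i ψ) x) = φ x * pdv j η x := by
    intro x
    have := congrArg (fun k : 𝓢(Sp d, ℂ) => (k x).re) hE
    simp only [sub_apply, sum_apply, Complex.sub_re, Complex.re_sum, lineDeriv_testSchwartz,
      Complex.ofReal_re] at this
    simp only [hψd, pdv_re]
    rw [← this, Finset.sum_neg_distrib, ← Finset.mul_sum]
    ring
  have e4 : (∫ x, φ x * ψ x) + ∑ i, -∫ x, φ x * pdv i (pdv i ψ) x = ∫ x, φ x * pdv j η x := by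
    have hn : ∀ i, Integrable fun x => -(φ x * pdv i (pdv i ψ) x) := fun i => (hint hφ (hmm i)).neg
    simp only [← integral_neg]
    rw [← integral_finsetSum _ fun i _ => hn i,
      ← integral_add (hint hφ (memLp_re f)) (integrable_finsetSum _ fun i _ => hn i)]
    exact congrArg _ (funext e3)
  rw [Finset.sum_congr rfl fun i _ => i2 i] at i1
  simp only [sub_mul] at i1
  rw [integral_sub (hint hφ (memLp_re f)) (hint hu (memLp_re f))] at i1
  have e5 := hw.integral_pdv h1 h2 j
  linarith

/-- For uniqueness the field is known only as the gradient of some weak solution, not as a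
convolution, so the bound comes from duality: approximate g_j in L² by a test function up to ε,
apply `gradResolvent_pairing` to it, and let ε → 0 to get ‖g_j‖² ≤ ‖u‖ ‖g_j‖. -/
theorem IsGradResolvent.eLpNorm_coord_le {u : Sp d → ℝ} {g : Sp d → Sp d} (h : IsGradResolvent u g)
    (j : Fin d) : eLpNorm (fun x => g x j) 2 ≤ eLpNorm u 2 := by
  have hu := h.1
  obtain ⟨-, φ, -, hg, -⟩ := id h
  have hgj : MemLp (fun x => g x j) 2 :=
    (EuclideanSpace.proj j : Sp d →L[ℝ] ℝ).comp_memLp' hg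
  set G := hgj.toLp with hG
  have hpair : ∀ {f k : Sp d → ℝ} (hf : MemLp f 2) (hk : MemLp k 2),
      inner ℝ hf.toLp hk.toLp = ∫ x, f x * k x := fun hf hk => by
    rw [L2.inner_def]
    refine integral_congr_ae ?_
    filter_upwards [hf.coeFn_toLp, hk.coeFn_toLp] with x h1 h2
    rw [h1, h2, mul_comm]
    rfl
  have hb : ∀ ε : ℝ, 0 < ε → ‖G‖ ^ 2 ≤ ‖G‖ * ε + ‖hu.toLp‖ * (‖G‖ + ε) := by
    intro ε hε
    obtain ⟨η, h2, h1, hη⟩ := MemLp.exist_eLpNorm_sub_le (by norm_num) (by norm_num) hgj hε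
    have hηL : MemLp η 2 := h1.continuous.memLp_of_hasCompactSupport h2
    set H := hηL.toLp with hH
    have hGH : ‖G - H‖ ≤ ε := by
      rw [hG, hH, ← MemLp.toLp_sub, Lp.norm_toLp]
      exact ENNReal.toReal_le_of_le_ofReal hε.le hη
    have hre := memLp_re (besselSchwartz (LineDeriv.lineDerivOp
      (EuclideanSpace.single j (1 : ℝ)) (testSchwartz h1 h2)))
    have hreH : ‖hre.toLp‖ ≤ ‖H‖ := by
      rw [Lp.norm_toLp, hH, Lp.norm_toLp]
      refine ENNReal.toReal_mono hηL.2.ne ?_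
      refine (eLpNorm_mono (g := besselSchwartz (LineDeriv.lineDerivOp
        (EuclideanSpace.single j (1 : ℝ)) (testSchwartz h1 h2))) fun x => ?_).trans
        ((eLpNorm_besselSchwartz_lineDeriv_le _ j).trans (eLpNorm_mono fun x => ?_))
      · exact Complex.abs_re_le_norm _
      · rw [testSchwartz_apply, Complex.norm_real]
    have e := gradResolvent_pairing h h1 h2 j
    rw [← hpair hgj hηL, ← hpair hu hre] at e
    have n1 := real_inner_le_norm G (G - H)
    have n2 := neg_le_of_abs_le (abs_real_inner_le_norm hu.toLp hre.toLp)
    have n3 : ‖H‖ ≤ ‖G‖ + ε := by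
      have := norm_sub_norm_le H G
      rw [norm_sub_rev] at this
      linarith
    rw [inner_sub_right, real_inner_self_eq_norm_sq] at n1
    have n4 := mul_le_mul_of_nonneg_left hGH (norm_nonneg G)
    have n5 := mul_le_mul_of_nonneg_left (hreH.trans n3) (norm_nonneg hu.toLp)
    linarith
  have hlim : ‖G‖ ^ 2 ≤ ‖hu.toLp‖ * ‖G‖ := by
    have ht : Filter.Tendsto (fun ε : ℝ => ‖G‖ * ε + ‖hu.toLp‖ * (‖G‖ + ε))
        (nhdsWithin 0 (Set.Ioi 0)) (nhds (‖G‖ * 0 + ‖hu.toLp‖ * (‖G‖ + 0))) := by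
      refine Filter.Tendsto.mono_left (Continuous.tendsto (by fun_prop) 0) nhdsWithin_le_nhds
    have := ge_of_tendsto ht (eventually_nhdsWithin_of_forall fun ε hε => hb ε hε)
    simpa using this
  have hfin : ‖G‖ ≤ ‖hu.toLp‖ := by
    rcases (norm_nonneg G).eq_or_lt with h0 | h0
    · rw [← h0]; exact norm_nonneg _
    · refine le_of_mul_le_mul_right ?_ h0
      rw [← sq]
      exact hlim
  rw [hG, Lp.norm_toLp, Lp.norm_toLp] at hfin
  exact (ENNReal.toReal_le_toReal hgj.2.ne hu.2.ne).1 hfin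

theorem IsGradResolvent.eLpNorm_le {u : Sp d → ℝ} {g : Sp d → Sp d} (h : IsGradResolvent u g) :
    eLpNorm g 2 ≤ d * eLpNorm u 2 := by
  obtain ⟨-, φ, -, hg, -⟩ := id h
  have h1 : eLpNorm g 2 ≤ eLpNorm (∑ j : Fin d, fun x => ‖g x j‖) 2 := by
    refine eLpNorm_mono fun x => ?_
    rw [Finset.sum_apply, Real.norm_of_nonneg (Finset.sum_nonneg fun _ _ => norm_nonneg _)]
    have e := (EuclideanSpace.basisFun (Fin d) ℝ).sum_repr (g x)
    conv_lhs => rw [← e]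
    refine (norm_sum_le _ _).trans (Finset.sum_le_sum fun j _ => ?_)
    rw [norm_smul]
    simp
  refine h1.trans ((eLpNorm_sum_le (fun j _ => ?_) (by norm_num)).trans ?_)
  · exact ((EuclideanSpace.proj j : Sp d →L[ℝ] ℝ).comp_memLp' hg).1.norm
  · calc _ ≤ ∑ j : Fin d, eLpNorm u 2 := Finset.sum_le_sum fun j _ => by
          rw [eLpNorm_norm]; exact h.eLpNorm_coord_le j
      _ = _ := by simp

theorem IsWeakGradient.sub {u v : Sp d → ℝ} {g k : Sp d → Sp d} (h : IsWeakGradient u g)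
    (h' : IsWeakGradient v k) : IsWeakGradient (u - v) (g - k) := by
  refine ⟨h.locallyIntegrable.sub h'.locallyIntegrable,
    h.locallyIntegrable_grad.sub h'.locallyIntegrable_grad, fun ψ h1 h2 => ?_⟩
  have hgc : Continuous (gradient ψ) := (contDiff_gradient h1).continuous
  have hgs : HasCompactSupport (gradient ψ) :=
    (h2.fderiv (𝕜 := ℝ)).comp_left (map_zero (InnerProductSpace.toDual ℝ (Sp d)).symm)
  simp only [Pi.sub_apply, sub_smul, smul_sub]
  rw [integral_sub (h.locallyIntegrable.integrable_smul_right_of_hasCompactSupport hgc hgs)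
    (h'.locallyIntegrable.integrable_smul_right_of_hasCompactSupport hgc hgs),
    integral_sub (h.locallyIntegrable_grad.integrable_smul_left_of_hasCompactSupport h1.continuous h2)
    (h'.locallyIntegrable_grad.integrable_smul_left_of_hasCompactSupport h1.continuous h2),
    h.integral_eq ψ h1 h2, h'.integral_eq ψ h1 h2]
  abel

theorem IsGradResolvent.sub {u v : Sp d → ℝ} {g k : Sp d → Sp d} (h : IsGradResolvent u g)
    (h' : IsGradResolvent v k) : IsGradResolvent (u - v) (g - k) := by
  obtain ⟨hu, φ, hφ, hg, hw, he⟩ := h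
  obtain ⟨hv, χ, hχ, hk, hw', he'⟩ := h'
  refine ⟨hu.sub hv, φ - χ, hφ.sub hχ, hg.sub hk, hw.sub hw', fun ψ h1 h2 => ?_⟩
  have hψ : MemLp ψ 2 := h1.continuous.memLp_of_hasCompactSupport h2
  have hψ' : MemLp (gradient ψ) 2 := (contDiff_gradient h1).continuous.memLp_of_hasCompactSupport
    ((h2.fderiv (𝕜 := ℝ)).comp_left (map_zero (InnerProductSpace.toDual ℝ (Sp d)).symm))
  have hint : ∀ {f g : Sp d → ℝ}, MemLp f 2 → MemLp g 2 → Integrable fun x => f x * g x :=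
    fun hf hg => hf.integrable_mul hg
  have hint' : ∀ {f g : Sp d → Sp d}, MemLp f 2 → MemLp g 2 →
      Integrable fun x => (inner ℝ (f x) (g x) : ℝ) := fun {f g} hf hg => by
    exact (memLp_one_iff_integrable.1 (MemLp.of_bilin (r := 1) (fun x y => (inner ℝ x y : ℝ)) 1 hf hg
      (hf.1.inner hg.1) (Filter.Eventually.of_forall fun x => by
        simpa using nnnorm_inner_le_nnnorm (𝕜 := ℝ) (f x) (g x))))
  simp only [Pi.sub_apply, sub_mul, inner_sub_left]
  rw [integral_sub (hint hφ hψ) (hint hχ hψ), integral_sub (hint hu hψ) (hint hv hψ),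
    integral_sub (hint' hg hψ') (hint' hk hψ')]
  linarith [he ψ h1 h2, he' ψ h1 h2]

end EllipticEstimate

/-! ### The gradient of the potential as a convolution -/

section Potential

theorem vecField_eq_sum (g : Fin d → Sp d → ℝ) (x : Sp d) :
    vecField g x = ∑ j, g j x • EuclideanSpace.single j (1 : ℝ) := by
  ext i
  rw [WithLp.ofLp_sum, Finset.sum_apply]
  simp [vecField]

theorem memLp_vecField {g : Fin d → Sp d → ℝ} {p : ℝ≥0∞} (h : ∀ j, MemLp (g j) p) :
    MemLp (vecField g) p := by
  have e : vecField g = fun x => ∑ j, g j x • EuclideanSpace.single j (1 : ℝ) :=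
    funext (vecField_eq_sum g)
  rw [e]
  exact memLp_finsetSum _ fun j _ => (ContinuousLinearMap.toSpanSingleton ℝ
    (EuclideanSpace.single j (1 : ℝ) : Sp d)).comp_memLp' (h j)

theorem enorm_vecField_le (g : Fin d → Sp d → ℝ) (x : Sp d) : ‖vecField g x‖ₑ ≤ ∑ j, ‖g j x‖ₑ := by
  rw [vecField_eq_sum]
  refine (enorm_sum_le _ _).trans (Finset.sum_le_sum fun j _ => ?_)
  rw [enorm_smul, ← ofReal_norm (EuclideanSpace.single j (1 : ℝ))]
  simp

theorem measurable_dBesselKernel (j : Fin d) : Measurable (dBesselKernel j) := by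
  have hm := measurable_dHeat (d := d) j
  have h : Measurable fun z : Sp d × ℝ => Real.exp (-z.2) * dHeat j z.2 z.1 :=
    (Real.measurable_exp.comp measurable_snd.neg).mul (hm.comp measurable_swap)
  exact h.stronglyMeasurable.integral_prod_right'.measurable

theorem integrable_spatial_convolution {f g : Sp d → ℝ} (hf : Integrable f) (hg : Integrable g) :
    Integrable fun x => ∫ y, f y * g (x - y) :=
  hf.integrable_convolution (ContinuousLinearMap.mul ℝ ℝ) hg

theorem eLpNorm_top_convolution_le {f g : Sp d → ℝ} (hf : eLpNorm f ∞ ≠ ⊤) :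
    eLpNorm (fun x => ∫ y, f y * g (x - y)) ∞ ≤ eLpNorm f ∞ * eLpNorm g 1 := by
  rw [eLpNorm_exponent_top]
  refine essSup_le_of_ae_le _ (Filter.Eventually.of_forall fun x => ?_)
  refine (enorm_integral_le_lintegral_enorm _).trans ?_
  rw [eLpNorm_one_eq_lintegral_enorm, ← lintegral_sub_left_eq_self (fun y => ‖g y‖ₑ) x,
    ← lintegral_const_mul' _ _ hf]
  refine lintegral_mono_ae ?_
  filter_upwards [ae_le_eLpNormEssSup (f := f) (μ := volume)] with y hy
  rw [enorm_mul]
  gcongr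
  exact hy

theorem eLpNorm_one_convolution_le {f g : Sp d → ℝ} (hf : AEStronglyMeasurable f)
    (hg : Measurable g) :
    eLpNorm (fun x => ∫ y, f y * g (x - y)) 1 ≤ eLpNorm f 1 * eLpNorm g 1 := by
  simp only [eLpNorm_one_eq_lintegral_enorm]
  calc _ ≤ ∫⁻ x, ∫⁻ y, ‖f y‖ₑ * ‖g (x - y)‖ₑ := lintegral_mono fun x =>
        (enorm_integral_le_lintegral_enorm _).trans_eq (by simp only [enorm_mul])
    _ = ∫⁻ y, ∫⁻ x, ‖f y‖ₑ * ‖g (x - y)‖ₑ := by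
        refine lintegral_lintegral_swap (hf.enorm.comp_snd.mul ?_)
        exact ((hg.comp (by fun_prop : Measurable fun z : Sp d × Sp d => z.1 - z.2)).enorm).aemeasurable
    _ = ∫⁻ y, ‖f y‖ₑ * ∫⁻ x, ‖g x‖ₑ := by
        refine lintegral_congr fun y => ?_
        rw [lintegral_const_mul' _ _ enorm_ne_top, lintegral_sub_right_eq_self (fun x => ‖g x‖ₑ)]
    _ = _ := lintegral_mul_const'' _ hf.enorm

theorem memLp_two_of_one_top {f : Sp d → ℝ} (h1 : Integrable f) (h2 : eLpNorm f ∞ ≠ ⊤) :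
    MemLp f 2 :=
  ⟨h1.1, (eLpNorm_two_le_add f).trans_lt
    (ENNReal.add_lt_top.2 ⟨(memLp_one_iff_integrable.2 h1).2, lt_top_iff_ne_top.2 h2⟩)⟩

theorem inner_gradient_eq (v : Sp d) (ψ : Sp d → ℝ) (x : Sp d) :
    inner ℝ v (gradient ψ x) = ∑ i, v i * pdv i ψ x := by
  rw [PiLp.inner_apply]
  refine Finset.sum_congr rfl fun i _ => ?_
  rw [gradient_coord, mul_comm]
  rfl

/-- The `j`-th component of `∇(1-Δ)⁻¹ u`. -/
def gradPotential (j : Fin d) (u : Sp d → ℝ) (x : Sp d) : ℝ := ∫ y, u y * dBesselKernel j (x - y)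

theorem fourier_gradPotential (j : Fin d) {u : Sp d → ℝ} (hu : Integrable u) (w : Sp d) :
    𝓕 (fun x => (gradPotential j u x : ℂ)) w =
      2 * Real.pi * Complex.I * w j * (besselMult w * 𝓕 (fun x => (u x : ℂ)) w) := by
  refine (fourier_spatial_convolution hu (integrable_dBesselKernel j).1 w).trans ?_
  rw [(integrable_dBesselKernel j).2 w]
  ring

theorem integrable_gradPotential (j : Fin d) {u : Sp d → ℝ} (hu : Integrable u) :
    Integrable (gradPotential j u) :=
  integrable_spatial_convolution hu (integrable_dBesselKernel j).1

/-- Young's inequality with the integrable Bessel kernels keeps everything in L¹ ∩ L^∞, hence in L²;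
the weak equations hold because they hold for the Fourier transforms. -/
theorem isGradResolvent_gradPotential {u : Sp d → ℝ} (hu : Integrable u) (hu' : eLpNorm u ∞ ≠ ⊤) :
    IsGradResolvent u (vecField fun j => gradPotential j u) := by
  set φ : Sp d → ℝ := fun x => ∫ y, u y * besselKernel (x - y) with hφ
  have hφi : Integrable φ := integrable_spatial_convolution hu integrable_besselKernel.1
  have hgi := fun j => integrable_gradPotential j hu
  have hfin : ∀ {g : Sp d → ℝ}, Integrable g → MemLp (fun x => ∫ y, u y * g (x - y)) 2 := fun hg =>
    memLp_two_of_one_top (integrable_spatial_convolution hu hg)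
      ((eLpNorm_top_convolution_le hu').trans_lt (ENNReal.mul_lt_top (lt_top_iff_ne_top.2 hu')
        (memLp_one_iff_integrable.2 hg).2)).ne
  have hφF : ∀ w, 𝓕 (fun x => (φ x : ℂ)) w = besselMult w * 𝓕 (fun x => (u x : ℂ)) w := fun w => by
    refine (fourier_spatial_convolution hu integrable_besselKernel.1 w).trans ?_
    rw [integrable_besselKernel.2 w, mul_comm]
  have hgF : ∀ j w, 𝓕 (fun x => (gradPotential j u x : ℂ)) w =
      2 * Real.pi * Complex.I * w j * 𝓕 (fun x => (φ x : ℂ)) w := fun j w => by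
    rw [fourier_gradPotential j hu, hφF]
  refine ⟨memLp_two_of_one_top hu hu', φ, hfin integrable_besselKernel.1,
    memLp_vecField fun j => hfin (integrable_dBesselKernel j).1,
    WeakPartial.isWeakGradient hφi fun j => weakPartial_of_fourier hφi (hgi j)
      (Filter.Eventually.of_forall (hgF j)), fun ψ h1 h2 => ?_⟩
  simp only [inner_gradient_eq]
  rw [integral_finsetSum]
  · exact resolvent_of_fourier hu hφi hgi (Filter.Eventually.of_forall hφF)
      (fun j => Filter.Eventually.of_forall (hgF j)) h1 h2
  · intro j _
    exact integrable_mul_test (hgi j).locallyIntegrable (contDiff_pdv h1 j).continuous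
      (hasCompactSupport_pdv h2 j)

theorem aestronglyMeasurable_gradPotential {ρ : ℝ → Sp d → ℝ}
    (hρ : AEStronglyMeasurable (fun z : ℝ × Sp d => ρ z.1 z.2) volume) (j : Fin d) :
    AEStronglyMeasurable (fun z : ℝ × Sp d => gradPotential j (ρ z.1) z.2) volume := by
  refine AEStronglyMeasurable.integral_prod_right' (ν := volume)
    (f := fun z : (ℝ × Sp d) × Sp d => ρ z.1.1 z.2 * dBesselKernel j (z.1.2 - z.2)) ?_
  refine AEStronglyMeasurable.mul ?_ ((measurable_dBesselKernel j).comp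
    (by fun_prop : Measurable fun z : (ℝ × Sp d) × Sp d => z.1.2 - z.2)).aestronglyMeasurable
  have h := hρ.comp_quasiMeasurePreserving
    (quasiMeasurePreserving_shift (a := fun _ : ℝ × Sp d => 0) measurable_const)
  simpa [Function.comp_def] using h

theorem aestronglyMeasurable_vecField {g : Fin d → ℝ → Sp d → ℝ}
    (h : ∀ j, AEStronglyMeasurable (fun z : ℝ × Sp d => g j z.1 z.2) volume) :
    AEStronglyMeasurable (fun z : ℝ × Sp d => vecField (fun j => g j z.1) z.2) volume := by
  simp only [vecField_eq_sum]
  exact Finset.aestronglyMeasurable_fun_sum _ fun j _ => (h j).smul_const _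

end Potential

/-! ### The transport term as an integral over times and velocities -/

section Transport

/-- The integrand of the transport term. -/
def transport (F : ℝ → Sp d → Sp d) (b : Sp d → Sp d) (t : ℝ) (z : (ℝ × Sp d) × Sp d) : ℝ :=
  inner ℝ (F z.1.1 (z.2 - (t - z.1.1) • z.1.2)) (b z.1.2)

/-- Lebesgue measure on `(0,t] × ℝ^d`. -/
def strip (d : ℕ) (t : ℝ) : Measure (ℝ × Sp d) :=
  ((volume : Measure ℝ).restrict (Set.Ioc 0 t)).prod (volume : Measure (Sp d))

instance (t : ℝ) : SFinite (strip d t) := by unfold strip; infer_instance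

theorem strip_prod_absolutelyContinuous (t : ℝ) : (strip d t).prod (volume : Measure (Sp d)) ≪
    (volume : Measure (ℝ × Sp d)).prod (volume : Measure (Sp d)) :=
  (Measure.restrict_le_self.absolutelyContinuous.prod
    Measure.AbsolutelyContinuous.rfl).prod Measure.AbsolutelyContinuous.rfl

variable {F : ℝ → Sp d → Sp d} {b : Sp d → Sp d}

theorem aestronglyMeasurable_transport
    (hF : AEStronglyMeasurable (fun z : ℝ × Sp d => F z.1 z.2) volume) (hb : Continuous b) (t : ℝ) :
    AEStronglyMeasurable (transport F b t) ((strip d t).prod volume) := by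
  refine AEStronglyMeasurable.mono_ac (strip_prod_absolutelyContinuous t) ?_
  refine AEStronglyMeasurable.inner ?_ (by fun_prop)
  exact hF.comp_quasiMeasurePreserving (quasiMeasurePreserving_shift
    (a := fun q : ℝ × Sp d => (t - q.1) • q.2) (by fun_prop))

theorem enorm_transport_le (t : ℝ) (z : (ℝ × Sp d) × Sp d) :
    ‖transport F b t z‖ₑ ≤ ‖F z.1.1 (z.2 - (t - z.1.1) • z.1.2)‖ₑ * ‖b z.1.2‖ₑ := by
  rw [transport, ← ofReal_norm, ← ofReal_norm, ← ofReal_norm, ← ENNReal.ofReal_mul (norm_nonneg _)]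
  exact ENNReal.ofReal_le_ofReal (norm_inner_le_norm _ _)

theorem aestronglyMeasurable_restrict_prod {ε : Type*} [TopologicalSpace ε] {f : ℝ × Sp d → ε} (hf : AEStronglyMeasurable f volume)
    (A : Set ℝ) : AEStronglyMeasurable f
      (((volume : Measure ℝ).restrict A).prod (volume : Measure (Sp d))) :=
  hf.mono_ac (Measure.restrict_le_self.absolutelyContinuous.prod
    Measure.AbsolutelyContinuous.rfl)

theorem lintegral_transport_le (hF : AEStronglyMeasurable (fun z : ℝ × Sp d => F z.1 z.2) volume)
    (hb : Continuous b) (t : ℝ) :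
    ∫⁻ z, ‖transport F b t z‖ₑ ∂((strip d t).prod volume) ≤
      (∫⁻ s in Set.Ioc 0 t, eLpNorm (F s) 1) * ∫⁻ v, ‖b v‖ₑ := by
  rw [lintegral_prod _ (aestronglyMeasurable_transport hF hb t).enorm, strip,
    ← lintegral_prod_mul (aemeasurable_eLpNorm_one
      (aestronglyMeasurable_restrict_prod hF _)) hb.enorm.aemeasurable]
  refine lintegral_mono fun q => ?_
  refine (lintegral_mono fun x => enorm_transport_le t (q, x)).trans_eq ?_
  simp only
  rw [lintegral_mul_const' _ _ enorm_ne_top, lintegral_sub_right_eq_self (fun x => ‖F q.1 x‖ₑ),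
    eLpNorm_one_eq_lintegral_enorm]

/-- Minkowski over (s, v): for each (s, v) the dependence on x is a translate of F(s), whose L² norm
does not see the shift. -/
theorem eLpNorm_transport_le (hF : AEStronglyMeasurable (fun z : ℝ × Sp d => F z.1 z.2) volume)
    (hb : Continuous b) (t : ℝ) :
    eLpNorm (fun x => ∫⁻ q, ‖transport F b t (q, x)‖ₑ ∂(strip d t)) 2 ≤
      (∫⁻ s in Set.Ioc 0 t, eLpNorm (F s) 2) * ∫⁻ v, ‖b v‖ₑ := by
  refine (eLpNorm_lintegral_le (aestronglyMeasurable_transport hF hb t).enorm).trans ?_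
  rw [strip, ← lintegral_prod_mul (aemeasurable_eLpNorm_two
      (aestronglyMeasurable_restrict_prod hF _)) hb.enorm.aemeasurable]
  refine lintegral_mono fun q => ?_
  simp only [eLpNorm_two_eq, enorm_eq_self]
  calc _ ≤ (∫⁻ x, (‖F q.1 (x - (t - q.1) • q.2)‖ₑ * ‖b q.2‖ₑ) ^ (2 : ℝ)) ^ (1 / 2 : ℝ) := by
        refine ENNReal.rpow_le_rpow (lintegral_mono fun x => ?_) (by norm_num)
        exact ENNReal.rpow_le_rpow (enorm_transport_le t (q, x)) (by norm_num)
    _ = _ := by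
        have hne : ‖b q.2‖ₑ ^ (2 : ℝ) ≠ ⊤ := ENNReal.rpow_ne_top_of_nonneg (by norm_num) enorm_ne_top
        simp only [ENNReal.mul_rpow_of_nonneg _ _ (by norm_num : (0 : ℝ) ≤ 2)]
        rw [lintegral_mul_const' _ _ hne,
          lintegral_sub_right_eq_self (fun x => ‖F q.1 x‖ₑ ^ (2 : ℝ)),
          ENNReal.mul_rpow_of_nonneg _ _ (by norm_num), ← ENNReal.rpow_mul ‖b q.2‖ₑ]
        norm_num

theorem ae_integrable_transport (hF : AEStronglyMeasurable (fun z : ℝ × Sp d => F z.1 z.2) volume)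
    (hb : Continuous b) (hbi : Integrable b) {t : ℝ}
    (h : ∫⁻ s in Set.Ioc 0 t, eLpNorm (F s) 2 < ⊤) :
    ∀ᵐ x, Integrable (fun q => transport F b t (q, x)) (strip d t) := by
  have hm := aestronglyMeasurable_transport hF hb t
  have h1 := (eLpNorm_transport_le hF hb t).trans_lt (ENNReal.mul_lt_top h hbi.2)
  have hms : AEMeasurable fun x => ∫⁻ q, ‖transport F b t (q, x)‖ₑ ∂(strip d t) :=
    hm.enorm.lintegral_prod_left'
  have h2 : ∀ᵐ x, ∫⁻ q, ‖transport F b t (q, x)‖ₑ ∂(strip d t) < ⊤ := by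
    rw [eLpNorm_two_eq] at h1
    have h3 := ENNReal.rpow_lt_top_iff_of_pos (by norm_num) |>.1 h1
    filter_upwards [ae_lt_top' (by simpa using hms.pow_const 2) h3.ne] with x hx
    have := ENNReal.rpow_lt_top_iff_of_pos (by norm_num) |>.1 hx
    simpa using this
  have h4 : ∀ᵐ x, AEStronglyMeasurable (fun q => transport F b t (q, x)) (strip d t) :=
    hm.prod_swap.prodMk_left
  filter_upwards [h2, h4] with x hx hx' using ⟨hx', hx⟩

theorem transport_integral_eq {t : ℝ} (ht : 0 ≤ t) {x : Sp d}
    (h : Integrable (fun q => transport F b t (q, x)) (strip d t)) :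
    (∫ s in (0 : ℝ)..t, ∫ v, inner ℝ (F s (x - (t - s) • v)) (b v)) =
      ∫ q, transport F b t (q, x) ∂(strip d t) := by
  rw [intervalIntegral.integral_of_le ht, strip, integral_prod _ h]
  rfl

end Transport

/-! ### The transport term on the Fourier side -/

section TransportFourier

theorem integrable_gradient {μ : Sp d → ℝ} (h : HypH1 μ) : Integrable (gradient μ) :=
  integrable_vecField (g := fun j v => gradient μ v j) fun j => (integrable_gradC h j).re

theorem fourier_finsetSum {f : Fin d → Sp d → ℝ} (h : ∀ j, Integrable (f j)) (w : Sp d) :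
    𝓕 (fun x => ((∑ j, f j x : ℝ) : ℂ)) w = ∑ j, 𝓕 (fun x => (f j x : ℂ)) w := by
  simp only [Real.fourier_eq, Complex.ofReal_sum, Finset.smul_sum]
  exact integral_finsetSum _ fun j _ => (Real.fourierIntegral_convergent_iff w).2 (h j).ofReal

theorem fourier_section_integrable {α : Type*} [MeasurableSpace α] {ν : Measure α} [SFinite ν]
    {F : α × Sp d → ℝ} (hF : Integrable F (ν.prod volume)) (w : Sp d) :
    Integrable (fun q => 𝓕 (fun x => (F (q, x) : ℂ)) w) ν := by
  have hch : Continuous fun x : Sp d => (Real.fourierChar (-inner ℝ x w) : ℂ) := by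
    have := Real.continuous_fourierChar
    fun_prop
  have h3 := (hF.ofReal (𝕜 := ℂ)).bdd_mul (c := 1)
    (f := fun z : α × Sp d => (Real.fourierChar (-inner ℝ z.2 w) : ℂ))
    (hch.measurable.comp measurable_snd).aestronglyMeasurable
    (Filter.Eventually.of_forall fun z => (Circle.norm_coe _).le)
  refine h3.integral_prod_left.congr (Filter.Eventually.of_forall fun q => ?_)
  refine Eq.trans ?_ (Real.fourier_eq (fun x => (F (q, x) : ℂ)) w).symm
  rfl

theorem fourier_gradC_shift {μ : Sp d → ℝ} (h : HypH1 μ) (j : Fin d) (r : ℝ) (w : Sp d) :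
    Integrable (fun v : Sp d => (Real.fourierChar (-inner ℝ (r • v) w) : ℂ) * gradC μ j v) ∧
    ∫ v : Sp d, (Real.fourierChar (-inner ℝ (r • v) w) : ℂ) * gradC μ j v =
      gradHat μ j (r • w) := by
  constructor
  · have hch : Continuous fun v : Sp d => (Real.fourierChar (-inner ℝ (r • v) w) : ℂ) := by
      have := Real.continuous_fourierChar
      fun_prop
    exact (integrable_gradC h j).bdd_mul (c := 1) hch.aestronglyMeasurable
      (Filter.Eventually.of_forall fun z => (Circle.norm_coe _).le)
  · rw [gradHat, Real.fourier_eq]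
    congr 1
    ext v
    rw [Circle.smul_def, smul_eq_mul, real_inner_smul_left, real_inner_smul_right]

variable {μ : Sp d → ℝ} {ρ : ℝ → Sp d → ℝ}

theorem eLpNorm_one_gradPotential_le {u : Sp d → ℝ} (hu : Integrable u) :
    eLpNorm (vecField fun j => gradPotential j u) 1 ≤
      eLpNorm u 1 * ∑ j : Fin d, eLpNorm (dBesselKernel j) 1 := by
  calc _ ≤ ∫⁻ x, ∑ j, ‖gradPotential j u x‖ₑ := by
        rw [eLpNorm_one_eq_lintegral_enorm]
        exact lintegral_mono fun x => enorm_vecField_le (fun j => gradPotential j u) x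
    _ = ∑ j, ∫⁻ x, ‖gradPotential j u x‖ₑ :=
        lintegral_finsetSum' _ fun j _ => (integrable_gradPotential j hu).1.enorm
    _ ≤ _ := by
        rw [Finset.mul_sum]
        refine Finset.sum_le_sum fun j _ => ?_
        rw [← eLpNorm_one_eq_lintegral_enorm]
        exact eLpNorm_one_convolution_le hu.1 (measurable_dBesselKernel j)

/-- The shift by (t-s)v contributes a character in v; integrating it against ∇μ evaluates the
transform of ∇μ at (t-s)w, and the symbol of ∇(1-Δ)⁻¹ completes the Volterra kernel. -/
theorem fourier_transport (h1 : HypH1 μ)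
    (hρ : AEStronglyMeasurable (fun z : ℝ × Sp d => ρ z.1 z.2) volume) {t : ℝ}
    (hfin : ∫⁻ s in Set.Ioc 0 t, eLpNorm (ρ s) 1 < ⊤) :
    Integrable (fun x => ∫ q, transport (fun s => vecField fun j => gradPotential j (ρ s))
      (gradient μ) t (q, x) ∂(strip d t)) ∧
    ∀ w, 𝓕 (fun x => ((∫ q, transport (fun s => vecField fun j => gradPotential j (ρ s))
      (gradient μ) t (q, x) ∂(strip d t) : ℝ) : ℂ)) w =
        ∫ s in Set.Ioc 0 t, volterraHat μ (t - s) w * 𝓕 (fun x => (ρ s x : ℂ)) w := by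
  set F : ℝ → Sp d → Sp d := fun s => vecField fun j => gradPotential j (ρ s) with hF
  have hFm : AEStronglyMeasurable (fun z : ℝ × Sp d => F z.1 z.2) volume :=
    aestronglyMeasurable_vecField (g := fun j s => gradPotential j (ρ s))
      fun j => aestronglyMeasurable_gradPotential hρ j
  have hb : Continuous (gradient μ) := (contDiff_gradient h1.smooth).continuous
  have hρs : ∀ᵐ s ∂((volume : Measure ℝ).restrict (Set.Ioc 0 t)), Integrable (ρ s) := by
    have hm1 := aemeasurable_eLpNorm_one (aestronglyMeasurable_restrict_prod hρ (Set.Ioc 0 t))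
    filter_upwards [ae_lt_top' hm1 hfin.ne,
      (aestronglyMeasurable_restrict_prod hρ (Set.Ioc 0 t)).prodMk_left] with s hs hs'
    exact memLp_one_iff_integrable.1 ⟨hs', hs⟩
  have hF1 : ∀ᵐ s ∂((volume : Measure ℝ).restrict (Set.Ioc 0 t)), eLpNorm (F s) 1 ≤
      eLpNorm (ρ s) 1 * ∑ j : Fin d, eLpNorm (dBesselKernel j) 1 := by
    filter_upwards [hρs] with s hs using eLpNorm_one_gradPotential_le hs
  have hfinF : ∫⁻ s in Set.Ioc 0 t, eLpNorm (F s) 1 < ⊤ := by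
    refine (lintegral_mono_ae hF1).trans_lt ?_
    have hne : ∑ j : Fin d, eLpNorm (dBesselKernel j) 1 ≠ ⊤ :=
      (ENNReal.sum_lt_top.2 fun j _ => (memLp_one_iff_integrable.2 (integrable_dBesselKernel j).1).2).ne
    rw [lintegral_mul_const' _ _ hne]
    exact ENNReal.mul_lt_top hfin (lt_top_iff_ne_top.2 hne)
  have hI : Integrable (transport F (gradient μ) t) ((strip d t).prod volume) :=
    ⟨aestronglyMeasurable_transport hFm hb t, (lintegral_transport_le hFm hb t).trans_lt
      (ENNReal.mul_lt_top hfinF (integrable_gradient h1).2)⟩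
  obtain ⟨r1, r2⟩ := fourier_integral_real hI
  refine ⟨r1, fun w => (r2 w).trans ?_⟩
  have hsec := fourier_section_integrable hI w
  rw [strip] at hsec ⊢
  rw [integral_prod _ hsec]
  refine integral_congr_ae ?_
  filter_upwards [hρs, ae_restrict_mem measurableSet_Ioc] with s hs hst
  have e1 : ∀ v, 𝓕 (fun x => (transport F (gradient μ) t ((s, v), x) : ℂ)) w =
      ∑ j, 𝓕 (fun x => (gradPotential j (ρ s) x : ℂ)) w *
        ((Real.fourierChar (-inner ℝ ((t - s) • v) w) : ℂ) * gradC μ j v) := by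
    intro v
    have e2 : ∀ x, transport F (gradient μ) t ((s, v), x) =
        ∑ j, gradient μ v j * gradPotential j (ρ s) (x - (t - s) • v) := fun x => by
      rw [transport, PiLp.inner_apply]
      rfl
    simp only [e2]
    rw [fourier_finsetSum fun j => ((integrable_gradPotential j hs).comp_sub_right _).const_mul _]
    refine Finset.sum_congr rfl fun j _ => ?_
    rw [fourier_const_mul (gradient μ v j) (fun x => gradPotential j (ρ s) (x - (t - s) • v)),
      fourier_comp_sub (fun x => (gradPotential j (ρ s) x : ℂ)), gradC]
    ring
  simp only [e1]
  rw [integral_finsetSum _ fun j _ => (fourier_gradC_shift h1 j (t - s) w).1.const_mul _]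
  simp only [integral_const_mul, (fourier_gradC_shift h1 _ (t - s) w).2, fourier_gradPotential _ hs]
  rw [volterraHat, max_eq_left (by linarith [hst.2]), Finset.mul_sum, Finset.sum_mul]
  refine Finset.sum_congr rfl fun j _ => ?_
  ring

end TransportFourier

/-! ### Causal Young and Grönwall inequalities -/

section Young

/-- Young's inequality for causal convolutions on `(-∞, T]`. -/
theorem lintegral_causal_convolution_le {α β : ℝ → ℝ≥0∞} (hα : Measurable α)
    (hβ : AEMeasurable β) (hβ0 : ∀ s < 0, β s = 0) (T : ℝ) :
    ∫⁻ t in Set.Iic T, ∫⁻ s, α (t - s) * β s ≤ (∫⁻ t in Set.Iic T, α t) * ∫⁻ s, β s := by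
  rw [lintegral_lintegral_swap]
  · rw [← lintegral_const_mul'' _ hβ]
    refine lintegral_mono fun s => ?_
    rcases lt_or_ge s 0 with hs | hs
    · simp [hβ0 s hs]
    simp only
    rw [lintegral_mul_const _ (by fun_prop)]
    refine mul_le_mul_left ?_ _
    rw [← lintegral_indicator measurableSet_Iic, ← lintegral_indicator measurableSet_Iic,
      ← lintegral_sub_right_eq_self (fun t => (Set.Iic T).indicator α t) s]
    refine lintegral_mono fun t => ?_
    by_cases h : t ∈ Set.Iic T
    · rw [Set.indicator_of_mem h, Set.indicator_of_mem]
      exact (sub_le_self t hs).trans h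
    · rw [Set.indicator_of_notMem h]
      exact zero_le
  · refine AEMeasurable.mul ?_ hβ.comp_snd
    exact (hα.comp (by fun_prop : Measurable fun z : ℝ × ℝ => z.1 - z.2)).aemeasurable

/-- A linear Volterra inequality with zero forcing has only the zero solution. -/
theorem ae_eq_zero_of_volterra_le {X : ℝ → ℝ≥0∞} (hX : AEMeasurable X) (hX0 : ∀ s < 0, X s = 0)
    (hfin : ∀ T, ∫⁻ s in Set.Iic T, X s < ⊤) {C : ℝ} (hC : 0 < C)
    (h : ∀ᵐ t : ℝ, 0 ≤ t → X t ≤ ENNReal.ofReal C * ∫⁻ s in Set.Iic t, X s) : X =ᵐ[volume] 0 := by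
  have hle : ∀ᵐ t : ℝ, X t ≤ ENNReal.ofReal C * ∫⁻ s in Set.Iic t, X s := by
    filter_upwards [h] with t ht
    rcases lt_or_ge t 0 with h0 | h0
    · simp [hX0 t h0]
    · exact ht h0
  -- With the weight e^{-2Ct} Tonelli gives C ∫_s^∞ e^{-2Ct} dt = e^{-2Cs}/2, so the weighted
  -- integral of X over (-∞, T] is at most half of itself; being finite, it is zero.
  set e : ℝ → ℝ≥0∞ := fun t => ENNReal.ofReal (Real.exp (-(2 * C) * t)) with he
  have hem : Measurable e := by fun_prop
  have key : ∀ T, ∫⁻ t in Set.Iic T, e t * X t ≤ 2⁻¹ * ∫⁻ t in Set.Iic T, e t * X t := by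
    intro T
    have hs : ∀ s, ∫⁻ t in Set.Ici s, e t = ENNReal.ofReal (2 * C)⁻¹ * e s := by
      intro s
      rw [he, setLIntegral_congr Ioi_ae_eq_Ici.symm, ← ofReal_integral_eq_lintegral_ofReal
        (integrableOn_exp_mul_Ioi (by linarith) s) (Filter.Eventually.of_forall fun x => (Real.exp_pos _).le),
        integral_exp_mul_Ioi (by linarith), ← ENNReal.ofReal_mul (by positivity)]
      congr 1
      field_simp
    calc ∫⁻ t in Set.Iic T, e t * X t
        ≤ ∫⁻ t in Set.Iic T, e t * (ENNReal.ofReal C * ∫⁻ s in Set.Iic t, X s) := by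
          refine lintegral_mono_ae ((ae_restrict_of_ae hle).mono fun t ht => ?_)
          gcongr
      _ ≤ ∫⁻ t, ∫⁻ s, ENNReal.ofReal C * ((Set.Ici s).indicator e t * (Set.Iic T).indicator X s) := by
          rw [← lintegral_indicator measurableSet_Iic]
          refine lintegral_mono fun t => ?_
          by_cases ht : t ∈ Set.Iic T
          · rw [Set.indicator_of_mem ht, ← lintegral_indicator measurableSet_Iic, mul_left_comm,
              ← lintegral_const_mul' _ _ ENNReal.ofReal_ne_top,
              ← lintegral_const_mul' _ _ ENNReal.ofReal_ne_top]
            refine lintegral_mono fun s => ?_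
            by_cases hs : s ∈ Set.Iic t
            · rw [Set.indicator_of_mem hs, Set.indicator_of_mem (show t ∈ Set.Ici s from hs),
                Set.indicator_of_mem (show s ∈ Set.Iic T from Set.mem_Iic.2 (le_trans (Set.mem_Iic.1 hs) (Set.mem_Iic.1 ht)))]
            · simp [Set.indicator_of_notMem hs]
          · rw [Set.indicator_of_notMem ht]
            exact zero_le
      _ = ∫⁻ s, ENNReal.ofReal C * ((ENNReal.ofReal (2 * C)⁻¹ * e s) * (Set.Iic T).indicator X s) := by
          rw [lintegral_lintegral_swap]
          · refine lintegral_congr fun s => ?_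
            have hm : Measurable fun t => (Set.Ici s).indicator e t := hem.indicator measurableSet_Ici
            rw [lintegral_const_mul' _ _ ENNReal.ofReal_ne_top, lintegral_mul_const _ hm,
              lintegral_indicator measurableSet_Ici, hs]
          · refine AEMeasurable.const_mul (AEMeasurable.mul ?_
              (hX.indicator measurableSet_Iic).comp_snd) _
            have : Measurable fun z : ℝ × ℝ => {z : ℝ × ℝ | z.2 ≤ z.1}.indicator (fun z => e z.1) z :=
              (hem.comp measurable_fst).indicator (measurableSet_le measurable_snd measurable_fst)
            exact this.aemeasurable
      _ = _ := by
          have e1 : ∀ s, ENNReal.ofReal C * ((ENNReal.ofReal (2 * C)⁻¹ * e s) *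
              (Set.Iic T).indicator X s) = 2⁻¹ * (Set.Iic T).indicator (fun s => e s * X s) s := by
            intro s
            rw [mul_assoc, ← mul_assoc, ← ENNReal.ofReal_mul hC.le]
            have : C * (2 * C)⁻¹ = 2⁻¹ := by field_simp
            rw [this, ENNReal.ofReal_inv_of_pos (by norm_num), ENNReal.ofReal_ofNat]
            by_cases hs : s ∈ Set.Iic T
            · simp only [Set.indicator_of_mem hs]
            · simp only [Set.indicator_of_notMem hs, mul_zero]
          simp only [e1]
          rw [lintegral_const_mul' _ _ (by norm_num), lintegral_indicator measurableSet_Iic]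
  have hz : ∀ T, ∫⁻ t in Set.Iic T, e t * X t = 0 := by
    intro T
    have hf : ∫⁻ t in Set.Iic T, e t * X t ≠ ⊤ := by
      refine ((lintegral_mono fun t => ?_).trans_lt (hfin T)).ne
      rcases lt_or_ge t 0 with h0 | h0
      · simp [hX0 t h0]
      · refine mul_le_of_le_one_left zero_le ?_
        rw [he]
        simp only [ENNReal.ofReal_le_one, Real.exp_le_one_iff]
        nlinarith
    have hk := key T
    by_contra hne
    have h2 : 2⁻¹ * ∫⁻ t in Set.Iic T, e t * X t < ∫⁻ t in Set.Iic T, e t * X t := by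
      rw [mul_comm, ← div_eq_mul_inv]
      exact ENNReal.half_lt_self hne hf
    exact absurd hk (not_le.2 h2)
  have hall : ∀ n : ℕ, ∀ᵐ t : ℝ, t ∈ Set.Iic (n : ℝ) → X t = 0 := by
    intro n
    have h3 := (lintegral_eq_zero_iff' ((hem.aemeasurable.mul hX).restrict)).1 (hz n)
    rw [Filter.EventuallyEq, ae_restrict_iff' measurableSet_Iic] at h3
    filter_upwards [h3] with t ht hmem
    have h4 := ht hmem
    refine (mul_eq_zero.1 h4).resolve_left ?_
    simp [he, Real.exp_pos]
  filter_upwards [ae_all_iff.2 hall] with t ht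
  obtain ⟨n, hn⟩ := exists_nat_ge t
  exact ht n hn

end Young

/-! ### Pointwise bounds for space-time convolutions -/

section StConvBounds

variable {A B : ℝ → Sp d → ℝ}

theorem enorm_stConv_le (hA : Measurable fun z : ℝ × Sp d => A z.1 z.2)
    (hB : AEStronglyMeasurable (fun z : ℝ × Sp d => B z.1 z.2) volume) (t : ℝ) (x : Sp d) :
    ‖stConv A B t x‖ₑ ≤ ∫⁻ s, ∫⁻ y, ‖A (t - s) (x - y)‖ₑ * ‖B s y‖ₑ := by
  refine (enorm_integral_le_lintegral_enorm _).trans_eq ?_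
  simp only [enorm_mul]
  rw [Measure.volume_eq_prod] at hB ⊢
  refine lintegral_prod _ (AEMeasurable.mul ?_ hB.enorm)
  exact (hA.comp (by fun_prop : Measurable fun z : ℝ × Sp d =>
    (t - z.1, x - z.2))).enorm.aemeasurable

theorem enorm_stConv_le_top (hA : Measurable fun z : ℝ × Sp d => A z.1 z.2)
    (hB : AEStronglyMeasurable (fun z : ℝ × Sp d => B z.1 z.2) volume)
    (hBt : ∀ᵐ s, eLpNorm (B s) ∞ ≠ ⊤) (t : ℝ) (x : Sp d) :
    ‖stConv A B t x‖ₑ ≤ ∫⁻ s, (∫⁻ x, ‖A (t - s) x‖ₑ) * eLpNorm (B s) ∞ := by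
  refine (enorm_stConv_le hA hB t x).trans (lintegral_mono_ae ?_)
  filter_upwards [hBt] with s hs
  rw [← lintegral_sub_left_eq_self (fun y => ‖A (t - s) y‖ₑ) x, ← lintegral_mul_const' _ _ hs]
  refine lintegral_mono_ae ?_
  filter_upwards [ae_le_eLpNormEssSup (f := B s) (μ := volume)] with y hy
  gcongr
  exact hy

theorem enorm_stConv_le_one (hA : Measurable fun z : ℝ × Sp d => A z.1 z.2)
    (hB : AEStronglyMeasurable (fun z : ℝ × Sp d => B z.1 z.2) volume) {κ : ℝ → ℝ≥0∞}
    (hκ : ∀ s x, ‖A s x‖ₑ ≤ κ s) (hκt : ∀ s, κ s ≠ ⊤) (t : ℝ) (x : Sp d) :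
    ‖stConv A B t x‖ₑ ≤ ∫⁻ s, κ (t - s) * ∫⁻ y, ‖B s y‖ₑ := by
  refine (enorm_stConv_le hA hB t x).trans (lintegral_mono fun s => ?_)
  rw [← lintegral_const_mul' _ _ (hκt _)]
  refine lintegral_mono fun y => ?_
  gcongr
  exact hκ _ _

theorem measurable_lintegral_kernel (hA : Measurable fun z : ℝ × Sp d => A z.1 z.2) :
    Measurable fun t => ∫⁻ x, ‖A t x‖ₑ :=
  Measurable.lintegral_prod_right' (f := fun z : ℝ × Sp d => ‖A z.1 z.2‖ₑ) hA.enorm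

end StConvBounds

/-! ### Solving the Volterra equation at fixed frequency -/

section VolterraIdentity

/-- Associativity of convolution: V * (g + G * g) = (V + V * G) * g = G * g. So g + G * g solves the
Volterra equation with forcing g. -/
theorem volterra_identity {V G g : ℝ → ℂ} (hV : Continuous V) {c : ℝ} (hVb : ∀ t, ‖V t‖ ≤ c)
    (hG : Integrable G) (hg : Integrable g) (h : ∀ t, G t = V t + ∫ s, V (t - s) * G s) (t : ℝ) :
    ∫ s, V (t - s) * (g s + ∫ r, G (s - r) * g r) = ∫ r, G (t - r) * g r := by
  have h1 : Integrable fun z : ℝ × ℝ => G (z.1 - z.2) * g z.2 := by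
    have := hg.convolution_integrand (ContinuousLinearMap.mul ℝ ℂ) hG
    refine this.congr (Filter.Eventually.of_forall fun z => ?_)
    simp [mul_comm]
  have hVt : Continuous fun s => V (t - s) := by fun_prop
  have h2 : Integrable fun z : ℝ × ℝ => V (t - z.1) * (G (z.1 - z.2) * g z.2) :=
    h1.bdd_mul (c := c) (hVt.comp continuous_fst).aestronglyMeasurable
      (Filter.Eventually.of_forall fun z => hVb _)
  have i1 : Integrable fun s => V (t - s) * g s :=
    hg.bdd_mul (c := c) hVt.aestronglyMeasurable (Filter.Eventually.of_forall fun z => hVb _)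
  have i2 : Integrable fun s => V (t - s) * ∫ r, G (s - r) * g r := by
    refine h2.integral_prod_left.congr (Filter.Eventually.of_forall fun s => ?_)
    exact integral_const_mul (V (t - s)) (fun r => G (s - r) * g r)
  have e1 : ∫ s, V (t - s) * ∫ r, G (s - r) * g r =
      ∫ r, (G (t - r) - V (t - r)) * g r := by
    simp only [← integral_const_mul]
    rw [integral_integral_swap h2]
    congr 1
    ext r
    simp only [← mul_assoc]
    rw [integral_mul_const, h (t - r), add_sub_cancel_left,
      ← integral_add_right_eq_self (fun s => V (t - s) * G (s - r)) r]
    congr 2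
    ext s
    rw [add_sub_cancel_right, sub_sub, add_comm]
  have i3 : Integrable fun r => (G (t - r) - V (t - r)) * g r := by
    have i4 := h2.integral_prod_right
    refine i4.congr (Filter.Eventually.of_forall fun r => ?_)
    simp only [← mul_assoc]
    rw [integral_mul_const, h (t - r), add_sub_cancel_left,
      ← integral_add_right_eq_self (fun s => V (t - s) * G (s - r)) r]
    congr 2
    ext s
    rw [add_sub_cancel_right, sub_sub, add_comm]
  simp only [mul_add]
  rw [integral_add i1 i2, e1, ← integral_add i1 i3]
  congr 1
  ext r
  ring

end VolterraIdentity

/-! ### Uniqueness in L² -/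

section Uniqueness

theorem eLpNorm_two_mono_ae {f : Sp d → ℝ} {g : Sp d → ℝ≥0∞} (h : ∀ᵐ x, ‖f x‖ₑ ≤ g x) :
    eLpNorm f 2 ≤ eLpNorm g 2 := by
  rw [eLpNorm_two_eq, eLpNorm_two_eq]
  refine ENNReal.rpow_le_rpow (lintegral_mono_ae ?_) (by norm_num)
  filter_upwards [h] with x hx
  exact ENNReal.rpow_le_rpow hx (by norm_num)

variable {μ : Sp d → ℝ} {S ρ ρ' : ℝ → Sp d → ℝ}

theorem setLIntegral_Iic_eq_of_neg {X : ℝ → ℝ≥0∞} (h : ∀ s < 0, X s = 0) {T : ℝ} :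
    ∫⁻ s in Set.Iic T, X s = ∫⁻ s in Set.Ioc 0 T, X s := by
  rw [← lintegral_indicator measurableSet_Iic, ← lintegral_indicator measurableSet_Ioc]
  refine lintegral_congr_ae ?_
  have h0 : ∀ᵐ s : ℝ, s ≠ 0 := by simp [ae_iff]
  filter_upwards [h0] with s hs
  rcases hs.lt_or_gt with hs | hs
  · rw [Set.indicator_of_notMem (s := Set.Ioc 0 T) fun h => absurd h.1 hs.le.not_gt]
    by_cases hT : s ∈ Set.Iic T
    · rw [Set.indicator_of_mem hT, h s hs]
    · rw [Set.indicator_of_notMem hT]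
  · simp [Set.indicator, hs]

theorem ae_aestronglyMeasurable_section {f : ℝ → Sp d → ℝ}
    (h : AEStronglyMeasurable (fun z : ℝ × Sp d => f z.1 z.2) volume) :
    ∀ᵐ s, AEStronglyMeasurable (f s) volume := by
  rw [Measure.volume_eq_prod] at h
  exact h.prodMk_left

theorem lintegral_Ioc_gradResolvent_lt_top {F : ℝ → Sp d → Sp d} {T : ℝ}
    (h : ∀ᵐ s : ℝ, IsGradResolvent (ρ s) (F s)) (hfin : ∫⁻ s in Set.Ioc 0 T, eLpNorm (ρ s) 2 < ⊤) :
    ∫⁻ s in Set.Ioc 0 T, eLpNorm (F s) 2 < ⊤ := by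
  refine (lintegral_mono_ae ((ae_restrict_of_ae h).mono fun s hs => hs.eLpNorm_le)).trans_lt ?_
  rw [lintegral_const_mul' _ _ (ENNReal.natCast_ne_top d)]
  exact ENNReal.mul_lt_top (ENNReal.natCast_lt_top d) hfin

theorem IsSolution.lintegral_Ioc_lt_top (h : IsSolution μ S ρ) (T : ℝ) :
    ∫⁻ s in Set.Ioc 0 T, eLpNorm (ρ s) 2 < ⊤ := by
  refine (lintegral_mono_set fun s hs => ?_).trans_lt (h.locallyIntegrable |T|)
  exact ⟨(neg_nonpos.2 (abs_nonneg T)).trans hs.1.le, hs.2.trans (le_abs_self T)⟩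

/-- The source cancels in the difference D of two solutions. Minkowski and the elliptic bound give
‖D(t)‖₂ ≤ K ∫₀ᵗ ‖D(s)‖₂ ds with K = d ‖∇μ‖_{L¹}, and `ae_eq_zero_of_volterra_le` concludes. -/
theorem IsSolution.unique (h1 : HypH1 μ) (h : IsSolution μ S ρ) (h' : IsSolution μ S ρ') :
    ∀ᵐ t : ℝ, ρ' t =ᵐ[volume] ρ t := by
  obtain ⟨F, hF, hFr, hFe⟩ := h.equation
  obtain ⟨F', hF', hFr', hFe'⟩ := h'.equation
  have hb : Continuous (gradient μ) := (contDiff_gradient h1.smooth).continuous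
  have hbi := integrable_gradient h1
  set D : ℝ → Sp d → ℝ := fun t x => ρ' t x - ρ t x with hD
  set E : ℝ → Sp d → Sp d := fun t x => F' t x - F t x with hE
  have hDm : AEStronglyMeasurable (fun z : ℝ × Sp d => D z.1 z.2) volume :=
    h'.measurable.sub h.measurable
  have hEm : AEStronglyMeasurable (fun z : ℝ × Sp d => E z.1 z.2) volume := hF'.sub hF
  have hEr : ∀ᵐ s, IsGradResolvent (D s) (E s) := by
    filter_upwards [hFr, hFr'] with s hs hs' using hs'.sub hs
  set X : ℝ → ℝ≥0∞ := fun t => eLpNorm (D t) 2 with hX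
  have hX0 : ∀ s < 0, X s = 0 := fun s hs => by
    have : D s = 0 := by
      ext x
      simp [hD, h.eq_zero_of_neg s hs, h'.eq_zero_of_neg s hs]
    simp [hX, this]
  have hXm : AEMeasurable X := by
    rw [Measure.volume_eq_prod] at hDm
    exact aemeasurable_eLpNorm_two (f := fun z : ℝ × Sp d => D z.1 z.2) hDm
  have hXfin : ∀ T, ∫⁻ s in Set.Iic T, X s < ⊤ := by
    intro T
    rw [setLIntegral_Iic_eq_of_neg hX0]
    have hm : AEMeasurable (fun s => eLpNorm (ρ' s) 2) ((volume : Measure ℝ).restrict (Set.Ioc 0 T)) :=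
      aemeasurable_eLpNorm_two (f := fun z : ℝ × Sp d => ρ' z.1 z.2)
        (aestronglyMeasurable_restrict_prod h'.measurable _)
    calc _ ≤ ∫⁻ s in Set.Ioc 0 T, (eLpNorm (ρ' s) 2 + eLpNorm (ρ s) 2) := by
          refine lintegral_mono_ae (ae_restrict_of_ae ?_)
          filter_upwards [ae_aestronglyMeasurable_section h.measurable,
            ae_aestronglyMeasurable_section h'.measurable] with s hs hs'
          exact eLpNorm_sub_le hs' hs (by norm_num)
      _ < ⊤ := by
          rw [lintegral_add_left' hm]
          exact ENNReal.add_lt_top.2 ⟨h'.lintegral_Ioc_lt_top T, h.lintegral_Ioc_lt_top T⟩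
  obtain ⟨K, hK⟩ : ∃ K : ℝ≥0∞, K = d * ∫⁻ v, ‖gradient μ v‖ₑ := ⟨_, rfl⟩
  have hKt : K ≠ ⊤ := hK ▸ ENNReal.mul_ne_top (ENNReal.natCast_ne_top d) hbi.2.ne
  -- Adding 1 secures the positive constant that the Grönwall argument asks for, even if ∇μ
  -- vanishes.
  have hKle : K ≤ ENNReal.ofReal (K.toReal + 1) :=
    (ENNReal.ofReal_toReal hKt).symm.le.trans (ENNReal.ofReal_le_ofReal (by linarith))
  have hXle : ∀ᵐ t : ℝ, 0 ≤ t → X t ≤ ENNReal.ofReal (K.toReal + 1) * ∫⁻ s in Set.Iic t, X s := by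
    filter_upwards [hFe, hFe'] with t ht ht' h0
    have a1 := ae_integrable_transport hF hb hbi
      (lintegral_Ioc_gradResolvent_lt_top hFr (h.lintegral_Ioc_lt_top t))
    have a2 := ae_integrable_transport hF' hb hbi
      (lintegral_Ioc_gradResolvent_lt_top hFr' (h'.lintegral_Ioc_lt_top t))
    have a3 : ∀ᵐ x, ‖D t x‖ₑ ≤ ∫⁻ q, ‖transport E (gradient μ) t (q, x)‖ₑ ∂(strip d t) := by
      filter_upwards [a1, a2, ht h0, ht' h0] with x x1 x2 x3 x4
      have e : D t x = ∫ q, transport E (gradient μ) t (q, x) ∂(strip d t) := by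
        rw [transport_integral_eq h0 x1] at x3
        rw [transport_integral_eq h0 x2] at x4
        have e2 : ∀ q, transport E (gradient μ) t (q, x) =
            transport F' (gradient μ) t (q, x) - transport F (gradient μ) t (q, x) := fun q => by
          simp only [transport, hE, inner_sub_left]
        simp only [e2]
        rw [integral_sub x2 x1, hD]
        simp only [x3, x4]
        ring
      rw [e]
      exact enorm_integral_le_lintegral_enorm _
    have s1 : X t ≤ eLpNorm (fun x => ∫⁻ q, ‖transport E (gradient μ) t (q, x)‖ₑ ∂(strip d t)) 2 :=
      eLpNorm_two_mono_ae a3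
    have s2 : ∫⁻ s in Set.Ioc 0 t, eLpNorm (E s) 2 ≤ d * ∫⁻ s in Set.Ioc 0 t, X s := by
      rw [← lintegral_const_mul' _ _ (ENNReal.natCast_ne_top d)]
      exact lintegral_mono_ae ((ae_restrict_of_ae hEr).mono fun s hs => hs.eLpNorm_le)
    refine s1.trans ((eLpNorm_transport_le hEm hb t).trans ?_)
    rw [setLIntegral_Iic_eq_of_neg hX0]
    refine (mul_le_mul' s2 le_rfl).trans (le_trans (le_of_eq ?_) (mul_le_mul' hKle le_rfl))
    rw [hK]
    ring
  have hz := ae_eq_zero_of_volterra_le hXm hX0 hXfin (by positivity) hXle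
  filter_upwards [hz, ae_aestronglyMeasurable_section hDm] with t ht htm
  have h3 := (eLpNorm_eq_zero_iff htm (by norm_num)).1 ht
  filter_upwards [h3] with x hx
  have : ρ' t x - ρ t x = 0 := hx
  linarith

end Uniqueness

/-! ### The Duhamel formula solves the equation -/

section Existence

variable {μ : Sp d → ℝ} {S : ℝ → Sp d → ℝ}

theorem fourier_real_add {u v : Sp d → ℝ} (hu : Integrable u) (hv : Integrable v) (w : Sp d) :
    𝓕 (fun x => ((u x + v x : ℝ) : ℂ)) w = 𝓕 (fun x => (u x : ℂ)) w + 𝓕 (fun x => (v x : ℂ)) w := by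
  simp only [Real.fourier_eq, Complex.ofReal_add, smul_add]
  exact integral_add ((Real.fourierIntegral_convergent_iff w).2 hu.ofReal)
    ((Real.fourierIntegral_convergent_iff w).2 hv.ofReal)

theorem fourier_real_sub {u v : Sp d → ℝ} (hu : Integrable u) (hv : Integrable v) (w : Sp d) :
    𝓕 (fun x => ((u x - v x : ℝ) : ℂ)) w = 𝓕 (fun x => (u x : ℂ)) w - 𝓕 (fun x => (v x : ℂ)) w := by
  simp only [Real.fourier_eq, Complex.ofReal_sub, smul_sub]
  exact integral_sub ((Real.fourierIntegral_convergent_iff w).2 hu.ofReal)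
    ((Real.fourierIntegral_convergent_iff w).2 hv.ofReal)

/-- The Duhamel representation of the solution. -/
def duhamel (μ : Sp d → ℝ) (S : ℝ → Sp d → ℝ) (t : ℝ) (x : Sp d) : ℝ :=
  S t x + stConv (green μ) S t x

/-- The sum of the `L¹` and the `L^∞` norm. -/
def sumNorm (u : Sp d → ℝ) : ℝ≥0∞ := eLpNorm u 1 + eLpNorm u ∞

theorem aemeasurable_sumNorm {f : ℝ → Sp d → ℝ}
    (h : AEStronglyMeasurable (fun z : ℝ × Sp d => f z.1 z.2) volume) :
    AEMeasurable fun s => sumNorm (f s) := by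
  rw [Measure.volume_eq_prod] at h
  exact (aemeasurable_eLpNorm_one (f := fun z : ℝ × Sp d => f z.1 z.2) h).add
    (aemeasurable_eLpNorm_top (f := fun z : ℝ × Sp d => f z.1 z.2) h)

theorem sumNorm_zero : sumNorm (0 : Sp d → ℝ) = 0 := by simp [sumNorm]

theorem sumNorm_add_le {u v : Sp d → ℝ} (hu : AEStronglyMeasurable u) (hv : AEStronglyMeasurable v) :
    sumNorm (u + v) ≤ sumNorm u + sumNorm v := by
  refine (add_le_add (eLpNorm_add_le hu hv le_rfl) (eLpNorm_add_le hu hv le_top)).trans_eq ?_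
  rw [sumNorm, sumNorm]
  abel

theorem ae_sumNorm_lt_top {f : ℝ → Sp d → ℝ}
    (h : AEStronglyMeasurable (fun z : ℝ × Sp d => f z.1 z.2) volume)
    (hfin : ∀ T, ∫⁻ t in Set.Iic T, sumNorm (f t) < ⊤) :
    ∀ᵐ t, Integrable (f t) ∧ eLpNorm (f t) ∞ ≠ ⊤ := by
  have h1 : ∀ n : ℕ, ∀ᵐ t : ℝ, t ∈ Set.Iic (n : ℝ) → sumNorm (f t) < ⊤ := fun n =>
    (ae_restrict_iff' measurableSet_Iic).1 (ae_lt_top' (aemeasurable_sumNorm h).restrict (hfin n).ne)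
  filter_upwards [ae_all_iff.2 h1, ae_aestronglyMeasurable_section h] with t ht htm
  obtain ⟨n, hn⟩ := exists_nat_ge t
  have h2 := ENNReal.add_lt_top.1 (ht n hn)
  exact ⟨memLp_one_iff_integrable.1 ⟨htm, h2.1⟩, h2.2.ne⟩

theorem IsSource.lintegral_sumNorm (hS : IsSource S) : ∫⁻ t, sumNorm (S t) < ⊤ := hS.integrable

theorem IsSource.sumNorm_of_neg (hS : IsSource S) : ∀ s < 0, sumNorm (S s) = 0 := fun s hs => by
  rw [hS.eq_zero_of_neg s hs, sumNorm_zero]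

theorem IsSource.ae_finite (hS : IsSource S) :
    ∀ᵐ t, Integrable (S t) ∧ eLpNorm (S t) ∞ ≠ ⊤ :=
  ae_sumNorm_lt_top hS.measurable fun _ =>
    (setLIntegral_le_lintegral _ _).trans_lt hS.lintegral_sumNorm

theorem IsSource.integrable_prod (hS : IsSource S) :
    Integrable (fun z : ℝ × Sp d => S z.1 z.2) ((volume : Measure ℝ).prod volume) := by
  have hm := hS.measurable
  rw [Measure.volume_eq_prod] at hm
  refine ⟨hm, ?_⟩
  rw [HasFiniteIntegral, lintegral_prod _ hm.enorm]
  refine (lintegral_mono fun t => ?_).trans_lt hS.lintegral_sumNorm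
  rw [← eLpNorm_one_eq_lintegral_enorm]
  exact le_self_add

theorem measurable_green (hd : 0 < d) (h1 : HypH1 μ) (h2 : HypH2 μ) :
    Measurable fun z : ℝ × Sp d => green μ z.1 z.2 := by
  obtain ⟨C, hC, -⟩ := green_kernelBound hd h1 h2
  exact hC.measurable

theorem green_of_nonpos (hd : 0 < d) (h1 : HypH1 μ) (h2 : HypH2 μ) {t : ℝ} (ht : t ≤ 0) (x : Sp d) :
    green μ t x = 0 := by
  obtain ⟨C, hC, -⟩ := green_kernelBound hd h1 h2
  exact hC.of_nonpos t ht x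

theorem lintegral_green_lt_top (hd : 0 < d) (h1 : HypH1 μ) (h2 : HypH2 μ) (T : ℝ) :
    ∫⁻ t in Set.Iic T, ∫⁻ x, ‖green μ t x‖ₑ < ⊤ := by
  obtain ⟨C, hC, hC'⟩ := green_kernelBound hd h1 h2
  rw [setLIntegral_Iic_eq_of_neg fun s hs => by simp [hC.of_nonpos s hs.le]]
  calc _ ≤ ∫⁻ t in Set.Ioc 0 T, ENNReal.ofReal (C * t ^ (-(1 / 2) : ℝ)) :=
        setLIntegral_mono' measurableSet_Ioc fun t ht => hC' t ht.1
    _ < ⊤ := by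
        have hi : IntervalIntegrable (fun t : ℝ => C * t ^ (-(1 / 2) : ℝ)) volume 0 T :=
          (intervalIntegral.intervalIntegrable_rpow' (by norm_num)).const_mul C
        exact (hi.1.integrable.lintegral_lt_top)

/-- The convolution in time of the norms of the kernel and of the source. -/
def normConv (μ : Sp d → ℝ) (S : ℝ → Sp d → ℝ) (t : ℝ) : ℝ≥0∞ :=
  ∫⁻ s, (∫⁻ x, ‖green μ (t - s) x‖ₑ) * sumNorm (S s)

theorem lintegral_normConv_lt_top (hd : 0 < d) (h1 : HypH1 μ) (h2 : HypH2 μ) (hS : IsSource S)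
    (T : ℝ) : ∫⁻ t in Set.Iic T, normConv μ S t < ⊤ :=
  (lintegral_causal_convolution_le (measurable_lintegral_kernel (measurable_green hd h1 h2))
    (aemeasurable_sumNorm hS.measurable) hS.sumNorm_of_neg T).trans_lt
    (ENNReal.mul_lt_top (lintegral_green_lt_top hd h1 h2 T) hS.lintegral_sumNorm)

/-- Young's inequality controls only the integral in t, so the convolution converges absolutely for
almost every t. The pointwise-in-time statements about the solution are made off this null set. -/
theorem ae_normConv_lt_top (hd : 0 < d) (h1 : HypH1 μ) (h2 : HypH2 μ) (hS : IsSource S) :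
    ∀ᵐ t, normConv μ S t < ⊤ := by
  have hm : AEMeasurable (normConv μ S) := by
    refine AEMeasurable.lintegral_prod_right' (f := fun z : ℝ × ℝ =>
      (∫⁻ x, ‖green μ (z.1 - z.2) x‖ₑ) * sumNorm (S z.2)) ?_
    refine AEMeasurable.mul ?_ (aemeasurable_sumNorm hS.measurable).comp_snd
    exact ((measurable_lintegral_kernel (measurable_green hd h1 h2)).comp
      (by fun_prop : Measurable fun z : ℝ × ℝ => z.1 - z.2)).aemeasurable
  have h : ∀ n : ℕ, ∀ᵐ t : ℝ, t ∈ Set.Iic (n : ℝ) → normConv μ S t < ⊤ := fun n =>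
    (ae_restrict_iff' measurableSet_Iic).1
      (ae_lt_top' hm.restrict (lintegral_normConv_lt_top hd h1 h2 hS n).ne)
  filter_upwards [ae_all_iff.2 h] with t ht
  obtain ⟨n, hn⟩ := exists_nat_ge t
  exact ht n hn

theorem lintegral_green_mul_lt_top {t : ℝ} (h : normConv μ S t < ⊤) :
    ∫⁻ s, (∫⁻ x, ‖green μ (t - s) x‖ₑ) * ∫⁻ y, ‖S s y‖ₑ < ⊤ := by
  refine (lintegral_mono fun s => ?_).trans_lt h
  refine mul_le_mul' le_rfl ?_
  rw [← eLpNorm_one_eq_lintegral_enorm]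
  exact le_self_add

theorem sumNorm_stConv_le (hd : 0 < d) (h1 : HypH1 μ) (h2 : HypH2 μ) (hS : IsSource S) (t : ℝ) :
    sumNorm (stConv (green μ) S t) ≤ normConv μ S t := by
  have hG := measurable_green hd h1 h2
  have e1 : eLpNorm (stConv (green μ) S t) 1 ≤
      ∫⁻ s, (∫⁻ x, ‖green μ (t - s) x‖ₑ) * eLpNorm (S s) 1 := by
    simp only [eLpNorm_one_eq_lintegral_enorm]
    exact lintegral_stConv_le hG hS.measurable t
  have e2 : eLpNorm (stConv (green μ) S t) ∞ ≤
      ∫⁻ s, (∫⁻ x, ‖green μ (t - s) x‖ₑ) * eLpNorm (S s) ∞ := by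
    rw [eLpNorm_exponent_top]
    exact essSup_le_of_ae_le _ (Filter.Eventually.of_forall fun x =>
      enorm_stConv_le_top hG hS.measurable (hS.ae_finite.mono fun s hs => hs.2) t x)
  refine (add_le_add e1 e2).trans_eq ?_
  rw [normConv, ← lintegral_add_left']
  · simp only [sumNorm, mul_add]
  · have hm := hS.measurable
    rw [Measure.volume_eq_prod] at hm
    exact ((measurable_lintegral_kernel hG).comp
      (by fun_prop : Measurable fun s : ℝ => t - s)).aemeasurable.mul
        (aemeasurable_eLpNorm_one (f := fun z : ℝ × Sp d => S z.1 z.2) hm)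

theorem aestronglyMeasurable_duhamel (hd : 0 < d) (h1 : HypH1 μ) (h2 : HypH2 μ) (hS : IsSource S) :
    AEStronglyMeasurable (fun z : ℝ × Sp d => duhamel μ S z.1 z.2) volume :=
  hS.measurable.add (aestronglyMeasurable_stConv (measurable_green hd h1 h2) hS.measurable)

theorem duhamel_of_neg (hd : 0 < d) (h1 : HypH1 μ) (h2 : HypH2 μ) (hS : IsSource S) :
    ∀ t < 0, duhamel μ S t = 0 := by
  intro t ht
  ext x
  rw [duhamel, hS.eq_zero_of_neg t ht, stConv]
  have e : ∀ q : ℝ × Sp d, green μ (t - q.1) (x - q.2) * S q.1 q.2 = 0 := by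
    intro q
    rcases lt_or_ge q.1 0 with hq | hq
    · rw [hS.eq_zero_of_neg _ hq]
      simp
    · rw [green_of_nonpos hd h1 h2 (by linarith), zero_mul]
  simp [e]

theorem lintegral_sumNorm_duhamel_lt_top (hd : 0 < d) (h1 : HypH1 μ) (h2 : HypH2 μ)
    (hS : IsSource S) (T : ℝ) : ∫⁻ t in Set.Iic T, sumNorm (duhamel μ S t) < ⊤ := by
  have hle : ∀ᵐ t, sumNorm (duhamel μ S t) ≤ sumNorm (S t) + normConv μ S t := by
    filter_upwards [ae_aestronglyMeasurable_section hS.measurable, ae_aestronglyMeasurable_section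
      (aestronglyMeasurable_stConv (measurable_green hd h1 h2) hS.measurable)] with t m1 m2
    exact (sumNorm_add_le m1 m2).trans (add_le_add le_rfl (sumNorm_stConv_le hd h1 h2 hS t))
  refine (lintegral_mono_ae (ae_restrict_of_ae hle)).trans_lt ?_
  rw [lintegral_add_left' (aemeasurable_sumNorm hS.measurable).restrict]
  exact ENNReal.add_lt_top.2 ⟨(setLIntegral_le_lintegral _ _).trans_lt hS.lintegral_sumNorm,
    lintegral_normConv_lt_top hd h1 h2 hS T⟩

theorem integrable_fourier_source (hS : IsSource S) (w : Sp d) :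
    Integrable fun s => 𝓕 (fun x => (S s x : ℂ)) w :=
  fourier_section_integrable hS.integrable_prod w

theorem fourier_duhamel (hd : 0 < d) (h1 : HypH1 μ) (h2 : HypH2 μ) (hS : IsSource S) :
    ∀ᵐ t, ∀ w : Sp d, w ≠ 0 → 𝓕 (fun x => (duhamel μ S t x : ℂ)) w =
      𝓕 (fun x => (S t x : ℂ)) w + ∫ s, greenHat μ (t - s) w * 𝓕 (fun x => (S s x : ℂ)) w := by
  filter_upwards [ae_normConv_lt_top hd h1 h2 hS, hS.ae_finite] with t ht hSt w hw
  obtain ⟨i1, i2⟩ := stConv_spec (measurable_green hd h1 h2) hS.measurable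
    (lintegral_green_mul_lt_top ht)
  refine (fourier_real_add hSt.1 i1 w).trans ?_
  rw [i2 w]
  simp only [fourier_green hd h1 h2 _ hw]

/-- Both sides are integrable in x, so it suffices to compare Fourier transforms at w ≠ 0, and there
the claim is `volterra_identity` with forcing Ŝ. -/
theorem stConv_eq_transport (hd : 0 < d) (h1 : HypH1 μ) (h2 : HypH2 μ) (hS : IsSource S) :
    ∀ᵐ t, stConv (green μ) S t =ᵐ[volume] fun x =>
      ∫ q, transport (fun s => vecField fun j => gradPotential j (duhamel μ S s))
        (gradient μ) t (q, x) ∂(strip d t) := by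
  filter_upwards [ae_normConv_lt_top hd h1 h2 hS] with t ht
  obtain ⟨i1, i2⟩ := stConv_spec (measurable_green hd h1 h2) hS.measurable
    (lintegral_green_mul_lt_top ht)
  have hfin : ∫⁻ s in Set.Ioc 0 t, eLpNorm (duhamel μ S s) 1 < ⊤ :=
    ((lintegral_mono fun s => le_self_add).trans (lintegral_mono_set Set.Ioc_subset_Iic_self)).trans_lt
      (lintegral_sumNorm_duhamel_lt_top hd h1 h2 hS t)
  obtain ⟨i3, i4⟩ := fourier_transport h1 (aestronglyMeasurable_duhamel hd h1 h2 hS) hfin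
  have key := ae_eq_zero_of_fourier (i1.sub i3) (by
    filter_upwards [ae_ne_zero hd] with w hw
    refine (fourier_real_sub i1 i3 w).trans ?_
    rw [i4 w, i2 w, sub_eq_zero]
    simp only [fourier_green hd h1 h2 _ hw]
    obtain ⟨c, hc⟩ := bdd_volterraHat h1 w
    have hid := volterra_identity (continuous_volterraHat_time h1 w)
      (fun t => hc ⟨t, rfl⟩) (integrable_greenHat h1 h2 hw).2.1
      (integrable_fourier_source hS w) (fun t => greenHat_eq h1 h2 hw t) t
    -- The time integral extends to the whole line: the Volterra kernel vanishes for s > t and the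
    -- solution for s < 0. The single time s = 0 is negligible.
    have hset : ∫ s in Set.Ioc 0 t, volterraHat μ (t - s) w * 𝓕 (fun x => (duhamel μ S s x : ℂ)) w =
        ∫ s, volterraHat μ (t - s) w * 𝓕 (fun x => (duhamel μ S s x : ℂ)) w := by
      refine setIntegral_eq_integral_of_ae_compl_eq_zero ?_
      have h0 : ∀ᵐ s : ℝ, s ≠ 0 := by simp [ae_iff]
      filter_upwards [h0] with s hs0 hs
      rcases lt_or_ge t s with hts | hts
      · rw [volterraHat_of_nonpos h1 (by linarith), zero_mul]
      · have : s < 0 := lt_of_le_of_ne (not_lt.1 fun h => hs ⟨h, hts⟩) hs0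
        rw [duhamel_of_neg hd h1 h2 hS s this]
        simp [Real.fourier_eq']
    have hae : ∫ s, volterraHat μ (t - s) w * 𝓕 (fun x => (duhamel μ S s x : ℂ)) w =
        ∫ s, volterraHat μ (t - s) w * (𝓕 (fun x => (S s x : ℂ)) w +
          ∫ r, greenHat μ (s - r) w * 𝓕 (fun x => (S r x : ℂ)) w) := by
      refine integral_congr_ae ?_
      filter_upwards [fourier_duhamel hd h1 h2 hS] with s hs
      rw [hs w hw]
    rw [hset, hae, hid])
  filter_upwards [key] with x hx
  have h0 : stConv (green μ) S t x - _ = 0 := hx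
  exact sub_eq_zero.1 h0

theorem isSolution_duhamel (hd : 0 < d) (h1 : HypH1 μ) (h2 : HypH2 μ) (hS : IsSource S) :
    IsSolution μ S (duhamel μ S) := by
  have hm := aestronglyMeasurable_duhamel hd h1 h2 hS
  have hfin := lintegral_sumNorm_duhamel_lt_top hd h1 h2 hS
  have h2le : ∀ t, eLpNorm (duhamel μ S t) 2 ≤ sumNorm (duhamel μ S t) :=
    fun t => eLpNorm_two_le_add _
  have hFm : AEStronglyMeasurable (fun z : ℝ × Sp d =>
      vecField (fun j => gradPotential j (duhamel μ S z.1)) z.2) volume :=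
    aestronglyMeasurable_vecField (g := fun j s => gradPotential j (duhamel μ S s))
      fun j => aestronglyMeasurable_gradPotential hm j
  have hres : ∀ᵐ s : ℝ, IsGradResolvent (duhamel μ S s)
      (vecField fun j => gradPotential j (duhamel μ S s)) := by
    filter_upwards [ae_sumNorm_lt_top hm hfin] with s hs
    exact isGradResolvent_gradPotential hs.1 hs.2
  refine ⟨hm, fun T => ?_, duhamel_of_neg hd h1 h2 hS,
    fun s => vecField fun j => gradPotential j (duhamel μ S s), hFm, hres, ?_⟩
  · exact ((lintegral_mono h2le).trans (lintegral_mono_set Set.Icc_subset_Iic_self)).trans_lt (hfin T)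
  · filter_upwards [stConv_eq_transport hd h1 h2 hS] with t ht h0
    have hI := ae_integrable_transport hFm (contDiff_gradient h1.smooth).continuous
      (integrable_gradient h1) (t := t) (lintegral_Ioc_gradResolvent_lt_top hres
        (((lintegral_mono h2le).trans (lintegral_mono_set Set.Ioc_subset_Iic_self)).trans_lt (hfin t)))
    filter_upwards [ht, hI] with x hx hx'
    rw [transport_integral_eq h0 hx', duhamel, hx, add_comm]

end Existence

/-! ### Almost every time is seen by the running essential supremum -/

section EssSup

/-- The estimates at time t contain S(t) itself, which an essential supremum could miss. For
rational q let A q be the set of t with m(t) < q < f(t). If y lies in A q, then f exceeds m(y) at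
all earlier points of A q, and these form a null set by the definition of m(y). So A q is locally
null, hence null. -/
theorem ae_le_essSup_Icc (f : ℝ → ℝ≥0∞) :
    ∀ᵐ t : ℝ, 0 ≤ t → f t ≤ essSup f (volume.restrict (Set.Icc 0 t)) := by
  set m : ℝ → ℝ≥0∞ := fun t => essSup f (volume.restrict (Set.Icc 0 t)) with hm
  set A : ℚ → Set ℝ := fun q => {t | 0 ≤ t ∧ m t < ENNReal.ofReal q ∧ ENNReal.ofReal q < f t} with hA
  have hnull : ∀ q, volume (A q) = 0 := by
    intro q
    have h1 : ∀ y ∈ A q, volume (A q ∩ Set.Iic y) = 0 := by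
      intro y hy
      have h2 : ∀ᵐ s ∂(volume.restrict (Set.Icc 0 y)), f s ≤ m y := ENNReal.ae_le_essSup f
      rw [ae_restrict_iff' measurableSet_Icc, ae_iff] at h2
      refine measure_mono_null (fun s hs => ?_) h2
      simp only [Set.mem_ofPred_eq, Classical.not_imp, not_le]
      exact ⟨⟨hs.1.1, hs.2⟩, hy.2.1.trans hs.1.2.2⟩
    refine measure_null_of_locally_null _ fun x hx => ?_
    by_cases h : ∃ y ∈ A q, x < y
    · obtain ⟨y, hy, hxy⟩ := h
      refine ⟨A q ∩ Set.Iic y, ?_, h1 y hy⟩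
      exact inter_mem_nhdsWithin _ (Iic_mem_nhds hxy)
    · push Not at h
      refine ⟨A q, self_mem_nhdsWithin, ?_⟩
      rw [← Set.inter_eq_left.2 (show A q ⊆ Set.Iic x from fun y hy => h y hy)]
      exact h1 x hx
  have hall : ∀ᵐ t : ℝ, ∀ q, t ∉ A q := ae_all_iff.2 fun q => measure_eq_zero_iff_ae_notMem.1 (hnull q)
  filter_upwards [hall] with t ht h0
  by_contra hlt
  obtain ⟨q, -, h1, h2⟩ := ENNReal.lt_iff_exists_rat_btwn.1 (not_le.1 hlt)
  exact ht q ⟨h0, h1, h2⟩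

end EssSup

/-! ### Uniqueness and joint measurability of weak gradients -/

section MeasurableGradient

/-- An approximate identity of smooth bump functions. -/
def bump (d n : ℕ) : ContDiffBump (0 : Sp d) where
  rIn := 1 / ((n : ℝ) + 1)
  rOut := 2 * (1 / ((n : ℝ) + 1))
  rIn_pos := by positivity
  rIn_lt_rOut := by linarith [show (0 : ℝ) < 1 / ((n : ℝ) + 1) by positivity]

/-- The mollifier at scale `1/n`. -/
def mollifier (d n : ℕ) : Sp d → ℝ := (bump d n).normed volume

theorem contDiff_mollifier (n : ℕ) : ContDiff ℝ ∞ (mollifier d n) := (bump d n).contDiff_normed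

theorem hasCompactSupport_mollifier (n : ℕ) : HasCompactSupport (mollifier d n) :=
  (bump d n).hasCompactSupport_normed

theorem ae_tendsto_mollify {g : Sp d → ℝ} (hg : LocallyIntegrable g) :
    ∀ᵐ x, Filter.Tendsto (fun n => ∫ y, g y * mollifier d n (x - y)) Filter.atTop (nhds (g x)) := by
  have hr : Filter.Tendsto (fun n => (bump d n).rOut) Filter.atTop (nhds 0) := by
    have := (tendsto_one_div_add_atTop_nhds_zero_nat (𝕜 := ℝ)).const_mul 2
    simpa [bump] using this
  have h := ContDiffBump.ae_convolution_tendsto_right_of_locallyIntegrable (K := 2) hr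
    (Filter.Eventually.of_forall fun n => le_rfl) hg (μ := volume)
  filter_upwards [h] with x hx
  refine hx.congr fun n => ?_
  rw [convolution_eq_swap]
  refine integral_congr_ae (Filter.Eventually.of_forall fun y => ?_)
  simp [mollifier, mul_comm]

theorem locallyIntegrable_coord {g : Sp d → Sp d} (hg : LocallyIntegrable g) (j : Fin d) :
    LocallyIntegrable fun x => g x j := fun x => by
  obtain ⟨s, hs, hi⟩ := hg x
  exact ⟨s, hs, (EuclideanSpace.proj j : Sp d →L[ℝ] ℝ).integrable_comp hi⟩

theorem IsWeakGradient.ae_tendsto {u : Sp d → ℝ} {g : Sp d → Sp d} (h : IsWeakGradient u g)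
    (j : Fin d) : ∀ᵐ x, Filter.Tendsto (fun n => ∫ y, u y * pdv j (mollifier d n) (x - y))
      Filter.atTop (nhds (g x j)) := by
  filter_upwards [ae_tendsto_mollify (locallyIntegrable_coord h.locallyIntegrable_grad j)] with x hx
  refine hx.congr fun n => ?_
  exact (h.integral_mollify (contDiff_mollifier n) (hasCompactSupport_mollifier n) j x).symm

/-- Any weak gradient is the almost everywhere limit of mollifications in which the derivative sits
on the mollifier, hence of expressions that depend on u alone. -/
theorem IsWeakGradient.ae_eq {u : Sp d → ℝ} {g k : Sp d → Sp d} (h : IsWeakGradient u g)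
    (h' : IsWeakGradient u k) : g =ᵐ[volume] k := by
  filter_upwards [ae_all_iff.2 h.ae_tendsto, ae_all_iff.2 h'.ae_tendsto] with x hx hx'
  ext j
  exact tendsto_nhds_unique (hx j) (hx' j)

theorem IsWeakGradient.gradNorm_eq {u : Sp d → ℝ} {g : Sp d → Sp d} (h : IsWeakGradient u g)
    (p : ℝ≥0∞) : gradNorm u p = eLpNorm g p volume :=
  le_antisymm (iInf₂_le g h) (le_iInf₂ fun _ hk => (eLpNorm_congr_ae (h.ae_eq hk)).le)

theorem exists_isWeakGradient {u : Sp d → ℝ} {p : ℝ≥0∞} (h : gradNorm u p < ⊤) :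
    ∃ g, IsWeakGradient u g := by
  obtain ⟨g, hg⟩ := iInf_lt_iff.1 h
  obtain ⟨hg', -⟩ := iInf_lt_iff.1 hg
  exact ⟨g, hg'⟩

theorem aestronglyMeasurable_mollify {S : ℝ → Sp d → ℝ}
    (hS : AEStronglyMeasurable (fun z : ℝ × Sp d => S z.1 z.2) volume) {η : Sp d → ℝ}
    (hη : Continuous η) :
    AEStronglyMeasurable (fun z : ℝ × Sp d => ∫ y, S z.1 y * η (z.2 - y)) volume := by
  refine AEStronglyMeasurable.integral_prod_right' (ν := volume)
    (f := fun z : (ℝ × Sp d) × Sp d => S z.1.1 z.2 * η (z.1.2 - z.2)) ?_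
  refine AEStronglyMeasurable.mul ?_ (by fun_prop)
  have h := hS.comp_quasiMeasurePreserving
    (quasiMeasurePreserving_shift (a := fun _ : ℝ × Sp d => 0) measurable_const)
  simpa [Function.comp_def] using h

/-- The weak partial derivatives of a measurable family can be chosen jointly measurable. -/
theorem exists_measurable_weakPartial {S : ℝ → Sp d → ℝ}
    (hS : AEStronglyMeasurable (fun z : ℝ × Sp d => S z.1 z.2) volume) (j : Fin d) :
    ∃ H : ℝ → Sp d → ℝ, AEStronglyMeasurable (fun z : ℝ × Sp d => H z.1 z.2) volume ∧
      ∀ᵐ s, ∀ g, IsWeakGradient (S s) g → (fun x => g x j) =ᵐ[volume] H s := by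
  have hm := fun n => aestronglyMeasurable_mollify hS
    (contDiff_pdv (contDiff_mollifier (d := d) n) j).continuous
  -- The mollified derivatives are jointly measurable in time and space and make no choice of
  -- gradient at each time; their limit in n is the desired representative.
  set f : ℕ → ℝ × Sp d → ℝ := fun n => (hm n).mk _ with hf
  have hfm : ∀ n, StronglyMeasurable (f n) := fun n => (hm n).stronglyMeasurable_mk
  refine ⟨fun s x => Filter.limUnder Filter.atTop fun n => f n (s, x),
    (StronglyMeasurable.limUnder (l := Filter.atTop) hfm).aestronglyMeasurable, ?_⟩
  have hae : ∀ᵐ z : ℝ × Sp d, ∀ n, ∫ y, S z.1 y * pdv j (mollifier d n) (z.2 - y) = f n z :=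
    ae_all_iff.2 fun n => (hm n).ae_eq_mk
  rw [Measure.volume_eq_prod] at hae
  filter_upwards [Measure.ae_ae_of_ae_prod hae] with s hs g hg
  filter_upwards [hs, hg.ae_tendsto j] with x hx hx'
  exact ((hx'.congr hx).limUnder_eq).symm

end MeasurableGradient

/-! ### Splitting the time convolution at t/2 -/

section Splitting

variable {A B : ℝ → Sp d → ℝ}

theorem indicator_apply_eq (E : Set ℝ) (B : ℝ → Sp d → ℝ) (z : ℝ × Sp d) :
    E.indicator B z.1 z.2 = (Prod.fst ⁻¹' E).indicator (fun z : ℝ × Sp d => B z.1 z.2) z := by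
  by_cases h : z.1 ∈ E
  · rw [Set.indicator_of_mem h, Set.indicator_of_mem (by exact h)]
  · rw [Set.indicator_of_notMem h, Set.indicator_of_notMem (by exact h)]
    rfl

theorem aestronglyMeasurable_indicator {E : Set ℝ} (hE : MeasurableSet E)
    (hB : AEStronglyMeasurable (fun z : ℝ × Sp d => B z.1 z.2) volume) :
    AEStronglyMeasurable (fun z : ℝ × Sp d => E.indicator B z.1 z.2) volume := by
  simp only [indicator_apply_eq]
  exact hB.indicator (measurable_fst hE)

/-- Times s > t drop out because the kernel vanishes there. The identity holds for almost every x
only, namely where the integrand is integrable and its integral may be split. -/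
theorem stConv_split (hA : Measurable fun z : ℝ × Sp d => A z.1 z.2)
    (hA0 : ∀ t ≤ 0, ∀ x, A t x = 0)
    (hB : AEStronglyMeasurable (fun z : ℝ × Sp d => B z.1 z.2) volume) {t : ℝ}
    (h : ∫⁻ s : ℝ, (∫⁻ x, ‖A (t - s) x‖ₑ) * ∫⁻ y, ‖B s y‖ₑ < ⊤) :
    stConv A B t =ᵐ[volume] stConv A ((Set.Iio (t / 2)).indicator B) t +
      stConv A ((Set.Icc (t / 2) t).indicator B) t := by
  have hF : Integrable (fun z : (ℝ × Sp d) × Sp d => A (t - z.1.1) (z.2 - z.1.2) * B z.1.1 z.1.2)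
      ((volume : Measure (ℝ × Sp d)).prod (volume : Measure (Sp d))) :=
    ⟨aestronglyMeasurable_shift hA hB t, by
      rw [HasFiniteIntegral, lintegral_shift hA hB]; exact h⟩
  filter_upwards [hF.prod_left_ae] with x hx
  have hi : ∀ E : Set ℝ, MeasurableSet E → Integrable fun q : ℝ × Sp d =>
      A (t - q.1) (x - q.2) * E.indicator B q.1 q.2 := by
    intro E hE
    refine (hx.indicator (measurable_fst hE)).congr (Filter.Eventually.of_forall fun q => ?_)
    simp only [indicator_apply_eq]
    by_cases hq : q ∈ (Prod.fst ⁻¹' E : Set (ℝ × Sp d))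
    · simp [Set.indicator_of_mem hq]
    · simp [Set.indicator_of_notMem hq]
  rw [Pi.add_apply, stConv, stConv, stConv,
    ← integral_add (hi _ measurableSet_Iio) (hi _ measurableSet_Icc)]
  congr 1
  ext q
  rcases lt_or_ge q.1 (t / 2) with h1 | h1
  · rw [Set.indicator_of_mem (show q.1 ∈ Set.Iio (t / 2) from h1), Set.indicator_of_notMem
      (s := Set.Icc (t / 2) t) fun hh => absurd hh.1 (not_le.2 h1)]
    simp
  · rw [Set.indicator_of_notMem (s := Set.Iio (t / 2)) (not_lt.2 h1)]
    rcases le_or_gt q.1 t with h2 | h2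
    · rw [Set.indicator_of_mem (show q.1 ∈ Set.Icc (t / 2) t from ⟨h1, h2⟩)]
      simp
    · rw [hA0 _ (by linarith)]
      simp

theorem lintegral_conv_le {φ β : ℝ → ℝ≥0∞} (hφ : Measurable φ) (hφ0 : ∀ u ≤ 0, φ u = 0) {t : ℝ}
    {N : ℝ≥0∞} (hβ : ∀ᵐ s : ℝ, s ≤ t → β s ≤ (Set.Ici 0).indicator (fun _ => N) s) :
    ∫⁻ s, φ (t - s) * β s ≤ (∫⁻ u in Set.Iic t, φ u) * N := by
  have hm : Measurable fun s => (Set.Iic t).indicator φ (t - s) :=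
    (hφ.indicator measurableSet_Iic).comp (by fun_prop)
  rw [← lintegral_indicator measurableSet_Iic,
    ← lintegral_sub_left_eq_self (fun u => (Set.Iic t).indicator φ u) t, ← lintegral_mul_const _ hm]
  refine lintegral_mono_ae ?_
  filter_upwards [hβ] with s hs
  rcases le_or_gt t s with h | h
  · rw [hφ0 _ (by linarith), zero_mul]
    exact zero_le
  · refine (mul_le_mul' le_rfl (hs h.le)).trans ?_
    by_cases h0 : s ∈ Set.Ici (0 : ℝ)
    · rw [Set.indicator_of_mem h0, Set.indicator_of_mem (show t - s ∈ Set.Iic t from sub_le_self t h0)]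
    · rw [Set.indicator_of_notMem h0]
      simp

theorem lintegral_conv_early_le {φ β : ℝ → ℝ≥0∞} {t c : ℝ} {N : ℝ≥0∞} (ht : 0 ≤ t)
    (hφ : ∀ u, t / 2 < u → φ u ≤ ENNReal.ofReal c)
    (hβ : ∀ᵐ s : ℝ, β s ≤ (Set.Ico 0 (t / 2)).indicator (fun _ => N) s) :
    ∫⁻ s, φ (t - s) * β s ≤ ENNReal.ofReal (t * c) * N := by
  calc _ ≤ ∫⁻ s, (Set.Ico 0 (t / 2)).indicator (fun _ => ENNReal.ofReal c * N) s := by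
        refine lintegral_mono_ae ?_
        filter_upwards [hβ] with s hs
        refine (mul_le_mul' le_rfl hs).trans ?_
        by_cases h : s ∈ Set.Ico 0 (t / 2)
        · rw [Set.indicator_of_mem h, Set.indicator_of_mem h]
          exact mul_le_mul' (hφ _ (by linarith [h.2])) le_rfl
        · rw [Set.indicator_of_notMem h, Set.indicator_of_notMem h, mul_zero]
    _ = ENNReal.ofReal c * N * ENNReal.ofReal (t / 2) := by
        rw [lintegral_indicator measurableSet_Ico, setLIntegral_const, Real.volume_Ico, sub_zero]
    _ ≤ ENNReal.ofReal c * N * ENNReal.ofReal t := by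
        gcongr
        linarith
    _ = _ := by rw [ENNReal.ofReal_mul ht]; ring

end Splitting

/-! ### Early and late contributions in L¹ and L^∞ -/

section KernelEstimates

variable {A B : ℝ → Sp d → ℝ} {m : ℕ} {C t : ℝ} {N : ℝ≥0∞}

theorem enorm_indicator_apply (E : Set ℝ) (B : ℝ → Sp d → ℝ) (p : ℝ≥0∞) (s : ℝ) :
    eLpNorm (E.indicator B s) p = E.indicator (fun s => eLpNorm (B s) p) s := by
  by_cases h : s ∈ E
  · rw [Set.indicator_of_mem h, Set.indicator_of_mem h]
  · rw [Set.indicator_of_notMem h, Set.indicator_of_notMem h, eLpNorm_zero]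

theorem early_indicator_le (hB0 : ∀ s < 0, B s = 0)
    (hB : ∀ᵐ s : ℝ, s ∈ Set.Icc 0 t → eLpNorm (B s) 1 ≤ N) (ht : 0 < t) :
    ∀ᵐ s : ℝ, eLpNorm ((Set.Iio (t / 2)).indicator B s) 1 ≤
      (Set.Ico 0 (t / 2)).indicator (fun _ => N) s := by
  filter_upwards [hB] with s hs
  rw [enorm_indicator_apply]
  by_cases h : s ∈ Set.Iio (t / 2)
  · rw [Set.indicator_of_mem h]
    have h' : s < t / 2 := h
    rcases lt_or_ge s 0 with h0 | h0
    · rw [hB0 s h0, eLpNorm_zero]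
      exact zero_le
    · rw [Set.indicator_of_mem (show s ∈ Set.Ico 0 (t / 2) from ⟨h0, h⟩)]
      exact hs ⟨h0, by linarith⟩
  · rw [Set.indicator_of_notMem h]
    exact zero_le

theorem lintegral_early_le (hA : KernelBound m C A) (hB0 : ∀ s < 0, B s = 0)
    (hB : ∀ᵐ s : ℝ, s ∈ Set.Icc 0 t → eLpNorm (B s) 1 ≤ N) (ht : 0 < t) :
    ∫⁻ s, (∫⁻ x, ‖A (t - s) x‖ₑ) * ∫⁻ y, ‖(Set.Iio (t / 2)).indicator B s y‖ₑ ≤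
      ENNReal.ofReal (t * (C * ((t / 2) ^ m)⁻¹)) * N := by
  simp only [← eLpNorm_one_eq_lintegral_enorm (f := (Set.Iio (t / 2)).indicator B _)]
  refine lintegral_conv_early_le (φ := fun u => ∫⁻ x, ‖A u x‖ₑ) ht.le (fun u hu => ?_)
    (early_indicator_le hB0 hB ht)
  have hC := hA.nonneg
  refine (hA.lintegral_le u (by linarith)).trans (ENNReal.ofReal_le_ofReal ?_)
  gcongr

theorem eLpNorm_one_early_le (hA : KernelBound m C A)
    (hBm : AEStronglyMeasurable (fun z : ℝ × Sp d => B z.1 z.2) volume) (hB0 : ∀ s < 0, B s = 0)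
    (hB : ∀ᵐ s : ℝ, s ∈ Set.Icc 0 t → eLpNorm (B s) 1 ≤ N) (ht : 0 < t) :
    eLpNorm (stConv A ((Set.Iio (t / 2)).indicator B) t) 1 ≤
      ENNReal.ofReal (t * (C * ((t / 2) ^ m)⁻¹)) * N := by
  rw [eLpNorm_one_eq_lintegral_enorm]
  exact (lintegral_stConv_le hA.measurable (aestronglyMeasurable_indicator measurableSet_Iio hBm) t).trans
    (lintegral_early_le hA hB0 hB ht)

/-- For s < t/2 the kernel runs at times larger than t/2: its supremum there multiplies the L¹ norm
of B(s), and the length of the time interval is bounded by t. -/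
theorem eLpNorm_top_early_le (hA : KernelBound m C A)
    (hBm : AEStronglyMeasurable (fun z : ℝ × Sp d => B z.1 z.2) volume) (hB0 : ∀ s < 0, B s = 0)
    (hB : ∀ᵐ s : ℝ, s ∈ Set.Icc 0 t → eLpNorm (B s) 1 ≤ N) (ht : 0 < t) :
    eLpNorm (stConv A ((Set.Iio (t / 2)).indicator B) t) ∞ ≤
      ENNReal.ofReal (t * (C * ((t / 2) ^ (d + m))⁻¹)) * N := by
  have hC := hA.nonneg
  set κ : ℝ → ℝ≥0∞ := fun u => if 0 < u then ENNReal.ofReal (C * (u ^ (d + m))⁻¹) else 0 with hκ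
  rw [eLpNorm_exponent_top]
  refine essSup_le_of_ae_le _ (Filter.Eventually.of_forall fun x => ?_)
  refine (enorm_stConv_le_one hA.measurable (aestronglyMeasurable_indicator measurableSet_Iio hBm)
    (κ := κ) (fun s x => ?_) (fun s => ?_) t x).trans ?_
  · rw [hκ]
    simp only
    split_ifs with hs
    · rw [← ofReal_norm]
      exact ENNReal.ofReal_le_ofReal (hA.norm_le s hs x)
    · rw [hA.of_nonpos s (not_lt.1 hs) x]
      simp
  · rw [hκ]
    simp only
    split_ifs
    · exact ENNReal.ofReal_ne_top
    · exact ENNReal.zero_ne_top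
  · simp only [← eLpNorm_one_eq_lintegral_enorm (f := (Set.Iio (t / 2)).indicator B _)]
    refine lintegral_conv_early_le ht.le (fun u hu => ?_) (early_indicator_le hB0 hB ht)
    rw [hκ]
    simp only
    rw [if_pos (by linarith)]
    refine ENNReal.ofReal_le_ofReal ?_
    gcongr

theorem late_indicator_le {p : ℝ≥0∞} (hB : ∀ᵐ s : ℝ, s ∈ Set.Icc (t / 2) t → eLpNorm (B s) p ≤ N)
    (ht : 0 < t) : ∀ᵐ s : ℝ, eLpNorm ((Set.Icc (t / 2) t).indicator B s) p ≤
      (Set.Ici 0).indicator (fun _ => N) s := by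
  filter_upwards [hB] with s hs
  rw [enorm_indicator_apply]
  by_cases h : s ∈ Set.Icc (t / 2) t
  · rw [Set.indicator_of_mem h, Set.indicator_of_mem (show s ∈ Set.Ici (0 : ℝ) from
      le_trans (by linarith) h.1)]
    exact hs h
  · rw [Set.indicator_of_notMem h]
    exact zero_le

theorem lintegral_late_le (hA : KernelBound m C A)
    (hB : ∀ᵐ s : ℝ, s ∈ Set.Icc (t / 2) t → eLpNorm (B s) 1 ≤ N) (ht : 0 < t) :
    ∫⁻ s, (∫⁻ x, ‖A (t - s) x‖ₑ) * ∫⁻ y, ‖(Set.Icc (t / 2) t).indicator B s y‖ₑ ≤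
      (∫⁻ u in Set.Iic t, ∫⁻ x, ‖A u x‖ₑ) * N := by
  simp only [← eLpNorm_one_eq_lintegral_enorm (f := (Set.Icc (t / 2) t).indicator B _)]
  exact lintegral_conv_le (measurable_lintegral_kernel hA.measurable)
    (fun u hu => by simp [hA.of_nonpos u hu]) ((late_indicator_le hB ht).mono fun s hs _ => hs)

theorem eLpNorm_one_late_le (hA : KernelBound m C A)
    (hBm : AEStronglyMeasurable (fun z : ℝ × Sp d => B z.1 z.2) volume)
    (hB : ∀ᵐ s : ℝ, s ∈ Set.Icc (t / 2) t → eLpNorm (B s) 1 ≤ N) (ht : 0 < t) :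
    eLpNorm (stConv A ((Set.Icc (t / 2) t).indicator B) t) 1 ≤
      (∫⁻ u in Set.Iic t, ∫⁻ x, ‖A u x‖ₑ) * N := by
  rw [eLpNorm_one_eq_lintegral_enorm]
  exact (lintegral_stConv_le hA.measurable (aestronglyMeasurable_indicator measurableSet_Icc hBm) t).trans
    (lintegral_late_le hA hB ht)

/-- For s ≥ t/2 the kernel may be singular, so it enters through its time-integrated L¹ norm while
B(s) enters through its L^∞ norm. -/
theorem eLpNorm_top_late_le (hA : KernelBound m C A)
    (hBm : AEStronglyMeasurable (fun z : ℝ × Sp d => B z.1 z.2) volume) (hN : N ≠ ⊤)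
    (hB : ∀ᵐ s : ℝ, s ∈ Set.Icc (t / 2) t → eLpNorm (B s) ∞ ≤ N) (ht : 0 < t) :
    eLpNorm (stConv A ((Set.Icc (t / 2) t).indicator B) t) ∞ ≤
      (∫⁻ u in Set.Iic t, ∫⁻ x, ‖A u x‖ₑ) * N := by
  have hle := late_indicator_le hB ht
  rw [eLpNorm_exponent_top]
  refine essSup_le_of_ae_le _ (Filter.Eventually.of_forall fun x => ?_)
  refine (enorm_stConv_le_top hA.measurable (aestronglyMeasurable_indicator measurableSet_Icc hBm)
    (hle.mono fun s hs => ne_top_of_le_ne_top hN (hs.trans (Set.indicator_le_self _ _ _))) t x).trans ?_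
  exact lintegral_conv_le (measurable_lintegral_kernel hA.measurable)
    (fun u hu => by simp [hA.of_nonpos u hu]) (hle.mono fun s hs _ => hs)

theorem one_le_two_mul_log (ht : 1 ≤ t) : 1 ≤ 2 * Real.log (1 + t) := by
  have h1 : Real.log 2 ≤ Real.log (1 + t) := Real.log_le_log (by norm_num) (by linarith)
  linarith [Real.log_two_gt_d9]

/-- The rate t^{-1/2} on (0,1] contributes 2C and the rate 1/t on (1,t] contributes C log t. As 1 ≤
2 log(1+t) for t ≥ 1, the first is at most 4C log(1+t), for a total constant 5C. -/
theorem lintegral_green_le {μ : Sp d → ℝ} (hC : KernelBound 1 C (green μ))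
    (hC' : ∀ t > 0, ∫⁻ x, ‖green μ t x‖ₑ ≤ ENNReal.ofReal (C * t ^ (-(1 / 2) : ℝ))) (ht : 1 ≤ t) :
    ∫⁻ u in Set.Iic t, ∫⁻ x, ‖green μ u x‖ₑ ≤ ENNReal.ofReal (5 * C * Real.log (1 + t)) := by
  have h0 := hC.nonneg
  rw [setLIntegral_Iic_eq_of_neg fun s hs => by simp [hC.of_nonpos s hs.le],
    ← Set.Ioc_union_Ioc_eq_Ioc zero_le_one ht]
  have e1 : ∫⁻ u in Set.Ioc 0 1, ENNReal.ofReal (C * u ^ (-(1 / 2) : ℝ)) = ENNReal.ofReal (C * 2) := by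
    have hi : IntervalIntegrable (fun u : ℝ => C * u ^ (-(1 / 2) : ℝ)) volume 0 1 :=
      (intervalIntegral.intervalIntegrable_rpow' (by norm_num)).const_mul C
    rw [← ofReal_integral_eq_lintegral_ofReal hi.1, ← intervalIntegral.integral_of_le zero_le_one,
      intervalIntegral.integral_const_mul, integral_rpow (Or.inl (by norm_num))]
    · norm_num
    · filter_upwards [ae_restrict_mem measurableSet_Ioc] with u hu
      have := hu.1
      positivity
  have e2 : ∫⁻ u in Set.Ioc 1 t, ENNReal.ofReal (C * (u ^ 1)⁻¹) =
      ENNReal.ofReal (C * Real.log t) := by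
    have hi : IntervalIntegrable (fun u : ℝ => C * (u ^ 1)⁻¹) volume 1 t := by
      refine ContinuousOn.intervalIntegrable ?_
      rw [Set.uIcc_of_le ht]
      refine continuousOn_const.mul (ContinuousOn.inv₀ (by fun_prop) fun u hu => ?_)
      have := hu.1
      positivity
    rw [← ofReal_integral_eq_lintegral_ofReal hi.1, ← intervalIntegral.integral_of_le ht,
      intervalIntegral.integral_const_mul]
    · simp only [pow_one]
      rw [integral_inv_of_pos (by norm_num) (by linarith), div_one]
    · filter_upwards [ae_restrict_mem measurableSet_Ioc] with u hu
      have := hu.1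
      positivity
  calc _ ≤ (∫⁻ u in Set.Ioc 0 1, ∫⁻ x, ‖green μ u x‖ₑ) + ∫⁻ u in Set.Ioc 1 t, ∫⁻ x, ‖green μ u x‖ₑ :=
        lintegral_union_le _ _ _
    _ ≤ ENNReal.ofReal (C * 2) + ENNReal.ofReal (C * Real.log t) := by
        rw [← e1, ← e2]
        refine add_le_add (setLIntegral_mono' measurableSet_Ioc fun u hu => hC' u hu.1)
          (setLIntegral_mono' measurableSet_Ioc fun u hu => hC.lintegral_le u ?_)
        linarith [hu.1]
    _ ≤ _ := by
        have hl := Real.log_nonneg ht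
        have hl' : Real.log t ≤ Real.log (1 + t) := Real.log_le_log (by linarith) (by linarith)
        rw [← ENNReal.ofReal_add (by positivity) (by positivity)]
        refine ENNReal.ofReal_le_ofReal ?_
        nlinarith [one_le_two_mul_log ht]

end KernelEstimates

/-! ### Bookkeeping of powers of t -/

section Rescaling

theorem le_inv_mul_of_mul_le {a : ℝ} (ha : 0 < a) {x N : ℝ≥0∞} (h : ENNReal.ofReal a * x ≤ N) :
    x ≤ ENNReal.ofReal a⁻¹ * N := by
  rw [ENNReal.ofReal_inv_of_pos ha, ← ENNReal.div_eq_inv_mul,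
    ENNReal.le_div_iff_mul_le (Or.inl (by simpa using ha)) (Or.inl ENNReal.ofReal_ne_top), mul_comm]
  exact h

theorem rescale_early {t : ℝ} (C : ℝ) (ht : 0 < t) (n : ℕ) (N : ℝ≥0∞) :
    ENNReal.ofReal (t ^ n) * (ENNReal.ofReal (t * (C * ((t / 2) ^ (n + 1))⁻¹)) * N) =
      ENNReal.ofReal (C * 2 ^ (n + 1)) * N := by
  have e : t ^ n * (t * (C * ((t / 2) ^ (n + 1))⁻¹)) = C * 2 ^ (n + 1) := by
    rw [div_pow]
    field_simp
    ring
  rw [← mul_assoc, ← ENNReal.ofReal_mul (by positivity), e]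

theorem rescale_late {a t : ℝ} (ha : 0 ≤ a) (ht : 0 < t) (n : ℕ) (N : ℝ≥0∞) :
    ENNReal.ofReal (t ^ n) * (ENNReal.ofReal a * (ENNReal.ofReal ((t / 2) ^ n)⁻¹ * N)) =
      ENNReal.ofReal (a * 2 ^ n) * N := by
  have e : t ^ n * a * ((t / 2) ^ n)⁻¹ = a * 2 ^ n := by
    rw [div_pow]
    field_simp
  rw [← mul_assoc, ← mul_assoc, ← ENNReal.ofReal_mul (by positivity),
    ← ENNReal.ofReal_mul (by positivity), e]

theorem eLpNorm_top_add_le {u v : Sp d → ℝ} : eLpNorm (u + v) ∞ ≤ eLpNorm u ∞ + eLpNorm v ∞ := by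
  simp only [eLpNorm_exponent_top]
  exact eLpNormEssSup_add_le

end Rescaling

/-! ### Decay of the density -/

section DensityEstimate

variable {μ : Sp d → ℝ} {S : ℝ → Sp d → ℝ} {C L t : ℝ} {N : ℝ≥0∞}

/-- In L¹ no splitting is needed: the norm of S(s) carries no decay in s, and only the
time-integrated L¹ norm of the kernel matters. -/
theorem eLpNorm_one_stConv_green_le (hC : KernelBound 1 C (green μ)) (hS : IsSource S)
    (hI : ∫⁻ u in Set.Iic t, ∫⁻ x, ‖green μ u x‖ₑ ≤ ENNReal.ofReal L)
    (hB : ∀ᵐ s : ℝ, s ∈ Set.Icc 0 t → eLpNorm (S s) 1 ≤ N) :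
    eLpNorm (stConv (green μ) S t) 1 ≤ ENNReal.ofReal L * N := by
  refine le_trans ?_ (mul_le_mul' hI le_rfl)
  rw [eLpNorm_one_eq_lintegral_enorm]
  refine (lintegral_stConv_le hC.measurable hS.measurable t).trans ?_
  simp only [← eLpNorm_one_eq_lintegral_enorm (f := S _)]
  refine lintegral_conv_le (measurable_lintegral_kernel hC.measurable)
    (fun u hu => by simp [hC.of_nonpos u hu]) (hB.mono fun s hs hst => ?_)
  rcases lt_or_ge s 0 with h0 | h0
  · rw [hS.eq_zero_of_neg s h0, eLpNorm_zero]
    exact zero_le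
  · rw [Set.indicator_of_mem (show s ∈ Set.Ici (0 : ℝ) from h0)]
    exact hs ⟨h0, hst⟩

theorem eLpNorm_top_stConv_green_le (hC : KernelBound 1 C (green μ)) (hS : IsSource S)
    (hI : ∫⁻ u in Set.Iic t, ∫⁻ x, ‖green μ u x‖ₑ ≤ ENNReal.ofReal L) (hN : N ≠ ⊤) (ht : 0 < t)
    (hconv : normConv μ S t < ⊤) (hB : ∀ᵐ s : ℝ, s ∈ Set.Icc 0 t → eLpNorm (S s) 1 ≤ N)
    (hBt : ∀ᵐ s : ℝ, s ∈ Set.Icc (t / 2) t →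
      eLpNorm (S s) ∞ ≤ ENNReal.ofReal ((t / 2) ^ d)⁻¹ * N) :
    eLpNorm (stConv (green μ) S t) ∞ ≤
      ENNReal.ofReal (t * (C * ((t / 2) ^ (d + 1))⁻¹)) * N +
        ENNReal.ofReal L * (ENNReal.ofReal ((t / 2) ^ d)⁻¹ * N) := by
  have e1 := eLpNorm_top_early_le hC hS.measurable hS.eq_zero_of_neg hB ht
  have e2 := eLpNorm_top_late_le hC hS.measurable (ENNReal.mul_ne_top ENNReal.ofReal_ne_top hN) hBt ht
  rw [eLpNorm_congr_ae (stConv_split hC.measurable hC.of_nonpos hS.measurable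
    (lintegral_green_mul_lt_top hconv))]
  exact eLpNorm_top_add_le.trans (add_le_add e1 (e2.trans (mul_le_mul' hI le_rfl)))

theorem density_estimate_at (hC : KernelBound 1 C (green μ)) (hS : IsSource S) (hL : 0 ≤ L)
    (hI : ∫⁻ u in Set.Iic t, ∫⁻ x, ‖green μ u x‖ₑ ≤ ENNReal.ofReal L) (hN : N ≠ ⊤) (ht : 0 < t)
    (hconv : normConv μ S t < ⊤) (hSt : Integrable (S t))
    (hNt : eLpNorm (S t) 1 + ENNReal.ofReal ((1 + t) ^ d) * eLpNorm (S t) ∞ ≤ N)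
    (hae : ∀ᵐ s : ℝ, s ∈ Set.Icc 0 t →
      eLpNorm (S s) 1 + ENNReal.ofReal ((1 + s) ^ d) * eLpNorm (S s) ∞ ≤ N) :
    eLpNorm (duhamel μ S t) 1 + ENNReal.ofReal (t ^ d) * eLpNorm (duhamel μ S t) ∞ ≤
      ENNReal.ofReal (1 + L + C * 2 ^ (d + 1) + L * 2 ^ d) * N := by
  have hC0 := hC.nonneg
  have b1 : ∀ᵐ s : ℝ, s ∈ Set.Icc 0 t → eLpNorm (S s) 1 ≤ N :=
    hae.mono fun s hs hst => le_self_add.trans (hs hst)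
  have binf : ∀ᵐ s : ℝ, s ∈ Set.Icc (t / 2) t →
      eLpNorm (S s) ∞ ≤ ENNReal.ofReal ((t / 2) ^ d)⁻¹ * N := by
    filter_upwards [hae] with s hs hst
    have hs0 : 0 ≤ s := le_trans (by linarith) hst.1
    refine le_inv_mul_of_mul_le (by positivity) (le_trans ?_ (le_add_self.trans (hs ⟨hs0, hst.2⟩)))
    gcongr
    linarith [hst.1]
  obtain ⟨i1, -⟩ := stConv_spec hC.measurable hS.measurable (lintegral_green_mul_lt_top hconv)
  have n1 := eLpNorm_one_stConv_green_le hC hS hI b1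
  have ninf := eLpNorm_top_stConv_green_le hC hS hI hN ht hconv b1 binf
  have a1 : eLpNorm (duhamel μ S t) 1 ≤ eLpNorm (S t) 1 + eLpNorm (stConv (green μ) S t) 1 :=
    eLpNorm_add_le hSt.1 i1.1 le_rfl
  have ainf : eLpNorm (duhamel μ S t) ∞ ≤ eLpNorm (S t) ∞ + eLpNorm (stConv (green μ) S t) ∞ :=
    eLpNorm_top_add_le
  generalize eLpNorm (stConv (green μ) S t) 1 = c1 at *
  generalize eLpNorm (stConv (green μ) S t) ∞ = cinf at *
  generalize eLpNorm (duhamel μ S t) 1 = r1 at *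
  generalize eLpNorm (duhamel μ S t) ∞ = rinf at *
  have w1 := rescale_early C ht d N
  have w2 := rescale_late hL ht d N
  have hw : ENNReal.ofReal (t ^ d) * cinf ≤
      ENNReal.ofReal (C * 2 ^ (d + 1)) * N + ENNReal.ofReal (L * 2 ^ d) * N := by
    rw [← w1, ← w2, ← mul_add]
    exact mul_le_mul' le_rfl ninf
  have w3 : eLpNorm (S t) 1 + ENNReal.ofReal (t ^ d) * eLpNorm (S t) ∞ ≤ ENNReal.ofReal 1 * N := by
    rw [ENNReal.ofReal_one, one_mul]
    refine le_trans ?_ hNt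
    gcongr
    linarith
  generalize eLpNorm (S t) 1 = s1 at *
  generalize eLpNorm (S t) ∞ = sinf at *
  rw [ENNReal.ofReal_add (by positivity) (by positivity),
    ENNReal.ofReal_add (by positivity) (by positivity), ENNReal.ofReal_add (by positivity) hL,
    add_mul, add_mul, add_mul]
  have h1 : ENNReal.ofReal (t ^ d) * rinf ≤ ENNReal.ofReal (t ^ d) * sinf + ENNReal.ofReal (t ^ d) * cinf := by
    rw [← mul_add]
    exact mul_le_mul' le_rfl ainf
  have h2 := add_le_add (add_le_add w3 n1) hw
  refine (add_le_add a1 h1).trans (le_of_eq_of_le ?_ (h2.trans_eq ?_))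
  · ring
  · ring

theorem density_estimate (hd : 0 < d) (h1 : HypH1 μ) (h2 : HypH2 μ) :
    ∃ M : ℝ, 0 < M ∧ ∀ S : ℝ → Sp d → ℝ, IsSource S → ∀ᵐ t : ℝ, 1 ≤ t →
      eLpNorm (duhamel μ S t) 1 volume + ENNReal.ofReal (t ^ d) * eLpNorm (duhamel μ S t) ∞ volume ≤
        ENNReal.ofReal (M * Real.log (1 + t)) * normY0 S t := by
  obtain ⟨C, hC, hC'⟩ := green_kernelBound hd h1 h2
  have hC0 := hC.nonneg
  -- The bound at fixed t has constant 1 + L' + C 2^(d+1) + L' 2^d with L' = 5C log(1+t). The two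
  -- terms without logarithm are multiplied by 2 log(1+t) ≥ 1, which produces 2 and C 2^(d+2).
  refine ⟨2 + C * 2 ^ (d + 2) + 5 * C + 5 * C * 2 ^ d, by positivity, fun S hS => ?_⟩
  filter_upwards [ae_le_essSup_Icc (fun s : ℝ => eLpNorm (S s) 1 volume +
    ENNReal.ofReal ((1 + s) ^ d) * eLpNorm (S s) ∞ volume), ae_normConv_lt_top hd h1 h2 hS,
    hS.ae_finite] with t hself hconv hSt ht
  have hL := one_le_two_mul_log ht
  have hI := lintegral_green_le hC hC' ht
  have hae : ∀ᵐ s : ℝ, s ∈ Set.Icc 0 t → eLpNorm (S s) 1 volume +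
      ENNReal.ofReal ((1 + s) ^ d) * eLpNorm (S s) ∞ volume ≤ normY0 S t :=
    (ae_restrict_iff' measurableSet_Icc).1 (ENNReal.ae_le_essSup _)
  have hN := hself (by linarith)
  change _ ≤ normY0 S t at hN
  generalize normY0 S t = N at hN hae
  generalize Real.log (1 + t) = L at hL hI
  have hLpos : 0 < L := by linarith
  rcases eq_or_ne N ⊤ with hNt | hNt
  · rw [hNt, ENNReal.mul_top]
    · exact le_top
    · simp only [ne_eq, ENNReal.ofReal_eq_zero, not_le]
      positivity
  refine (density_estimate_at hC hS (by positivity) hI hNt (by linarith) hconv hSt.1 hN hae).trans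
    (mul_le_mul' (ENNReal.ofReal_le_ofReal ?_) le_rfl)
  have hp : 0 ≤ C * 2 ^ (d + 1) := by positivity
  rw [pow_succ 2 (d + 1)]
  nlinarith [mul_le_mul_of_nonneg_left hL hp]

end DensityEstimate

/-! ### Weak derivatives of the Duhamel formula -/

section GradientEstimate

variable {μ : Sp d → ℝ} {S H : ℝ → Sp d → ℝ} {C D L t : ℝ} {N K : ℝ≥0∞} {j : Fin d}

theorem weakPartial_of_isWeakGradient {u h : Sp d → ℝ} {g : Sp d → Sp d} (hu : Integrable u)
    (hg : IsWeakGradient u g) (hh : (fun x => g x j) =ᵐ[volume] h) :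
    (∀ p, eLpNorm h p ≤ gradNorm u p) ∧ (gradNorm u 1 < ⊤ → WeakPartial j u h) := by
  have hle : ∀ p, eLpNorm h p ≤ gradNorm u p := fun p => by
    rw [hg.gradNorm_eq, ← eLpNorm_congr_ae hh]
    exact eLpNorm_mono fun x => PiLp.norm_apply_le (g x) j
  refine ⟨hle, fun h1 => ⟨hu, ?_, fun ψ hψ hψ' => ?_⟩⟩
  · refine memLp_one_iff_integrable.1 ⟨?_, (hle 1).trans_lt h1⟩
    exact ((locallyIntegrable_coord hg.locallyIntegrable_grad j).aestronglyMeasurable).congr hh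
  · rw [hg.integral_pdv hψ hψ' j, integral_congr_ae]
    filter_upwards [hh] with x hx
    rw [← hx]

theorem eLpNorm_vecField_le {g : Fin d → Sp d → ℝ} {p : ℝ≥0∞} (hp : 1 ≤ p)
    (hg : ∀ j, AEStronglyMeasurable (g j)) : eLpNorm (vecField g) p ≤ ∑ j, eLpNorm (g j) p := by
  have e : vecField g = ∑ j, fun x => g j x • EuclideanSpace.single j (1 : ℝ) := by
    funext x
    rw [vecField_eq_sum, Finset.sum_apply]
  rw [e]
  refine (eLpNorm_sum_le (fun j _ => (hg j).smul_const _) hp).trans (Finset.sum_le_sum fun j _ => ?_)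
  refine eLpNorm_mono fun x => ?_
  rw [norm_smul]
  simp

/-- The derivative of the convolution is placed where it gains decay in time: on the Green function
for s < t/2, on the source for s ≥ t/2. Thus H has to be a derivative of S only on the late half of
the interval. Both placements are verified on the Fourier side. -/
theorem weakPartial_duhamel (hd : 0 < d) (h1 : HypH1 μ) (h2 : HypH2 μ)
    (hC : KernelBound 1 C (green μ)) (hD : KernelBound 2 D (dGreen μ j)) (hS : IsSource S)
    (hHm : AEStronglyMeasurable (fun z : ℝ × Sp d => H z.1 z.2) volume)
    (hI : ∫⁻ u in Set.Iic t, ∫⁻ x, ‖green μ u x‖ₑ ≤ ENNReal.ofReal L) (ht : 0 < t)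
    (hconv : normConv μ S t < ⊤) (hN : N ≠ ⊤) (hK : K ≠ ⊤)
    (hB : ∀ᵐ s : ℝ, s ∈ Set.Icc 0 t → eLpNorm (S s) 1 ≤ N)
    (hH : ∀ᵐ s : ℝ, s ∈ Set.Icc (t / 2) t → eLpNorm (H s) 1 ≤ K)
    (hW : ∀ᵐ s : ℝ, s ∈ Set.Icc (t / 2) t → WeakPartial j (S s) (H s))
    (hWt : WeakPartial j (S t) (H t)) :
    WeakPartial j (duhamel μ S t) (H t + (stConv (dGreen μ j) ((Set.Iio (t / 2)).indicator S) t +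
      stConv (green μ) ((Set.Icc (t / 2) t).indicator H) t)) := by
  have hS1 := lintegral_green_mul_lt_top hconv
  have hind : ∀ E : Set ℝ, ∫⁻ s, (∫⁻ x, ‖green μ (t - s) x‖ₑ) * ∫⁻ y, ‖E.indicator S s y‖ₑ < ⊤ := by
    refine fun E => (lintegral_mono fun s => mul_le_mul' le_rfl ?_).trans_lt hS1
    by_cases h : s ∈ E
    · rw [Set.indicator_of_mem h]
    · rw [Set.indicator_of_notMem h]
      simp
  have hearly : WeakPartial j (stConv (green μ) ((Set.Iio (t / 2)).indicator S) t)
      (stConv (dGreen μ j) ((Set.Iio (t / 2)).indicator S) t) := by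
    have hm := aestronglyMeasurable_indicator (measurableSet_Iio (a := t / 2)) hS.measurable
    refine weakPartial_stConv hC.measurable hD.measurable hm hm (hind _)
      ((lintegral_early_le hD hS.eq_zero_of_neg hB ht).trans_lt
        (ENNReal.mul_lt_top ENNReal.ofReal_lt_top hN.lt_top)) (fun w hw => ?_) hd
    refine Filter.Eventually.of_forall fun s => ?_
    rw [fourier_dGreen hd h1 h2 j _ hw]
    ring
  have hlate : WeakPartial j (stConv (green μ) ((Set.Icc (t / 2) t).indicator S) t)
      (stConv (green μ) ((Set.Icc (t / 2) t).indicator H) t) := by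
    refine weakPartial_stConv hC.measurable hC.measurable
      (aestronglyMeasurable_indicator measurableSet_Icc hS.measurable)
      (aestronglyMeasurable_indicator measurableSet_Icc hHm) (hind _)
      ((lintegral_late_le hC hH ht).trans_lt
        (ENNReal.mul_lt_top (hI.trans_lt ENNReal.ofReal_lt_top) hK.lt_top)) (fun w hw => ?_) hd
    filter_upwards [hW] with s hs
    by_cases h : s ∈ Set.Icc (t / 2) t
    · rw [Set.indicator_of_mem h, Set.indicator_of_mem h, (hs h).fourier w]
      ring
    · rw [Set.indicator_of_notMem h, Set.indicator_of_notMem h]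
      simp [Real.fourier_eq']
  have hsplit := stConv_split hC.measurable hC.of_nonpos hS.measurable hS1
  have hsum := hWt.add (hearly.add hlate)
  have hae : S t + (stConv (green μ) ((Set.Iio (t / 2)).indicator S) t +
      stConv (green μ) ((Set.Icc (t / 2) t).indicator S) t) =ᵐ[volume] duhamel μ S t := by
    filter_upwards [hsplit] with x hx
    rw [duhamel, hx]
    rfl
  refine ⟨hsum.left.congr hae, hsum.right, fun ψ hψ hψ' => ?_⟩
  rw [← hsum.integral_eq ψ hψ hψ']
  refine integral_congr_ae ?_
  filter_upwards [hae] with x hx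
  rw [hx]

/-- The decay of a weak partial derivative of the density at a fixed time. -/
theorem partial_estimate_at (hC : KernelBound 1 C (green μ)) (hD : KernelBound 2 D (dGreen μ j))
    (hS : IsSource S) (hHm : AEStronglyMeasurable (fun z : ℝ × Sp d => H z.1 z.2) volume)
    (hL : 0 ≤ L) (hI : ∫⁻ u in Set.Iic t, ∫⁻ x, ‖green μ u x‖ₑ ≤ ENNReal.ofReal L) (ht : 0 < t)
    (hN : N ≠ ⊤) (hHt : AEStronglyMeasurable (H t))
    (hB : ∀ᵐ s : ℝ, s ∈ Set.Icc 0 t → eLpNorm (S s) 1 ≤ N)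
    (hH : ∀ᵐ s : ℝ, s ∈ Set.Icc (t / 2) t → eLpNorm (H s) 1 ≤ ENNReal.ofReal ((t / 2) ^ 1)⁻¹ * N)
    (hH' : ∀ᵐ s : ℝ, s ∈ Set.Icc (t / 2) t →
      eLpNorm (H s) ∞ ≤ ENNReal.ofReal ((t / 2) ^ (d + 1))⁻¹ * N)
    (hNt : ENNReal.ofReal (t ^ 1) * eLpNorm (H t) 1 +
      ENNReal.ofReal (t ^ (d + 1)) * eLpNorm (H t) ∞ ≤ N) {R : Sp d → ℝ}
    (hR : R = H t + (stConv (dGreen μ j) ((Set.Iio (t / 2)).indicator S) t +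
      stConv (green μ) ((Set.Icc (t / 2) t).indicator H) t)) :
    ENNReal.ofReal (t ^ 1) * eLpNorm R 1 + ENNReal.ofReal (t ^ (d + 1)) * eLpNorm R ∞ ≤
      ENNReal.ofReal (1 + (D * 2 ^ 2 + L * 2 ^ 1) + (D * 2 ^ (d + 2) + L * 2 ^ (d + 1))) * N := by
  have hD0 := hD.nonneg
  obtain ⟨⟨hm1, -⟩, -⟩ := stConv_spec hD.measurable
    (aestronglyMeasurable_indicator (measurableSet_Iio (a := t / 2)) hS.measurable)
    ((lintegral_early_le hD hS.eq_zero_of_neg hB ht).trans_lt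
      (ENNReal.mul_lt_top ENNReal.ofReal_lt_top hN.lt_top))
  obtain ⟨⟨hm2, -⟩, -⟩ := stConv_spec hC.measurable
    (aestronglyMeasurable_indicator (measurableSet_Icc (a := t / 2) (b := t)) hHm)
    ((lintegral_late_le hC hH ht).trans_lt (ENNReal.mul_lt_top (hI.trans_lt ENNReal.ofReal_lt_top)
      (ENNReal.mul_lt_top ENNReal.ofReal_lt_top hN.lt_top)))
  have e1 := eLpNorm_one_early_le hD hS.measurable hS.eq_zero_of_neg hB ht
  have e2 := eLpNorm_top_early_le hD hS.measurable hS.eq_zero_of_neg hB ht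
  have l1 := (eLpNorm_one_late_le hC hHm hH ht).trans (mul_le_mul' hI le_rfl)
  have l2 := (eLpNorm_top_late_le hC hHm (ENNReal.mul_ne_top ENNReal.ofReal_ne_top hN) hH' ht).trans
    (mul_le_mul' hI le_rfl)
  have a1 := (eLpNorm_add_le hHt (hm1.add hm2) le_rfl).trans
    (add_le_add le_rfl ((eLpNorm_add_le hm1 hm2 le_rfl).trans (add_le_add e1 l1)))
  have a2 := (eLpNorm_top_add_le (u := H t)).trans
    (add_le_add le_rfl (eLpNorm_top_add_le.trans (add_le_add e2 l2)))
  rw [← hR] at a1 a2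
  have w1 := rescale_early D ht 1 N
  have w2 := rescale_late hL ht 1 N
  have w3 := rescale_early D ht (d + 1) N
  have w4 := rescale_late hL ht (d + 1) N
  clear e1 e2 l1 l2 hH hH' hB
  generalize eLpNorm R 1 = r1 at *
  generalize eLpNorm R ∞ = r2 at *
  generalize eLpNorm (H t) 1 = s1 at *
  generalize eLpNorm (H t) ∞ = s2 at *
  refine (add_le_add (mul_le_mul' le_rfl a1) (mul_le_mul' le_rfl a2)).trans ?_
  rw [mul_add, mul_add, mul_add, mul_add, w1, w2, w3, w4,
    ENNReal.ofReal_add (by positivity) (by positivity),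
    ENNReal.ofReal_add (by positivity) (by positivity),
    ENNReal.ofReal_add (by positivity) (by positivity),
    ENNReal.ofReal_add (by positivity) (by positivity), ENNReal.ofReal_one,
    add_mul, add_mul, add_mul, add_mul, one_mul]
  have key : ∀ a b c e x y : ℝ≥0∞, x + y ≤ N → x + (a + b) + (y + (c + e)) ≤ N + (a + b) + (c + e) := by
    intro a b c e x y h
    calc x + (a + b) + (y + (c + e)) = x + y + ((a + b) + (c + e)) := by ring
      _ ≤ N + ((a + b) + (c + e)) := add_le_add h le_rfl
      _ = _ := by ring
  exact key _ _ _ _ _ _ hNt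

end GradientEstimate

/-! ### Decay of the gradient of the density -/

section GradientEstimate

variable {μ : Sp d → ℝ} {S : ℝ → Sp d → ℝ} {C D L t : ℝ} {N : ℝ≥0∞} {j : Fin d}

theorem exists_partial_estimate (hd : 0 < d) (h1 : HypH1 μ) (h2 : HypH2 μ)
    (hC : KernelBound 1 C (green μ)) (hD : KernelBound 2 D (dGreen μ j)) (hS : IsSource S)
    {H : ℝ → Sp d → ℝ} (hHm : AEStronglyMeasurable (fun z : ℝ × Sp d => H z.1 z.2) volume)
    (hW : ∀ᵐ s : ℝ, ∀ g, IsWeakGradient (S s) g → (fun x => g x j) =ᵐ[volume] H s)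
    (hWt : ∀ g, IsWeakGradient (S t) g → (fun x => g x j) =ᵐ[volume] H t)
    (hL : 0 ≤ L) (hI : ∫⁻ u in Set.Iic t, ∫⁻ x, ‖green μ u x‖ₑ ≤ ENNReal.ofReal L) (hN : N ≠ ⊤)
    (ht : 0 < t) (hconv : normConv μ S t < ⊤) (hSt : Integrable (S t))
    (hNt : eLpNorm (S t) 1 + ENNReal.ofReal (1 + t) * gradNorm (S t) 1 +
      ENNReal.ofReal ((1 + t) ^ (d + 1)) * gradNorm (S t) ∞ ≤ N)
    (hae : ∀ᵐ s : ℝ, s ∈ Set.Icc 0 t → eLpNorm (S s) 1 + ENNReal.ofReal (1 + s) * gradNorm (S s) 1 +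
      ENNReal.ofReal ((1 + s) ^ (d + 1)) * gradNorm (S s) ∞ ≤ N) :
    ∃ R, WeakPartial j (duhamel μ S t) R ∧
      ENNReal.ofReal (t ^ 1) * eLpNorm R 1 + ENNReal.ofReal (t ^ (d + 1)) * eLpNorm R ∞ ≤
        ENNReal.ofReal (1 + (D * 2 ^ 2 + L * 2 ^ 1) + (D * 2 ^ (d + 2) + L * 2 ^ (d + 1))) * N := by
  -- For s ≥ t/2 one has 1 + s ≥ t/2, so the weights of the source norm become powers of t/2. In
  -- particular the gradient norms are finite there, which provides the weak gradient.
  have hgrad : ∀ s, t / 2 ≤ s → eLpNorm (S s) 1 + ENNReal.ofReal (1 + s) * gradNorm (S s) 1 +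
      ENNReal.ofReal ((1 + s) ^ (d + 1)) * gradNorm (S s) ∞ ≤ N →
      gradNorm (S s) 1 ≤ ENNReal.ofReal ((t / 2) ^ 1)⁻¹ * N ∧
        gradNorm (S s) ∞ ≤ ENNReal.ofReal ((t / 2) ^ (d + 1))⁻¹ * N := by
    intro s hs hsN
    refine ⟨le_inv_mul_of_mul_le (by positivity) ?_, le_inv_mul_of_mul_le (by positivity) ?_⟩
    · refine le_trans ?_ ((le_add_self.trans le_self_add).trans hsN)
      rw [pow_one]
      exact mul_le_mul' (ENNReal.ofReal_le_ofReal (by linarith)) le_rfl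
    · refine le_trans ?_ (le_add_self.trans hsN)
      exact mul_le_mul' (ENNReal.ofReal_le_ofReal
        (pow_le_pow_left₀ (by positivity) (by linarith) _)) le_rfl
  have hfin : ∀ a : ℝ, ENNReal.ofReal a * N < ⊤ := fun a =>
    ENNReal.mul_lt_top ENNReal.ofReal_lt_top hN.lt_top
  have hB : ∀ᵐ s : ℝ, s ∈ Set.Icc 0 t → eLpNorm (S s) 1 ≤ N :=
    hae.mono fun s hs hst => (le_self_add.trans le_self_add).trans (hs hst)
  have hlate : ∀ᵐ s : ℝ, s ∈ Set.Icc (t / 2) t → WeakPartial j (S s) (H s) ∧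
      eLpNorm (H s) 1 ≤ ENNReal.ofReal ((t / 2) ^ 1)⁻¹ * N ∧
      eLpNorm (H s) ∞ ≤ ENNReal.ofReal ((t / 2) ^ (d + 1))⁻¹ * N := by
    filter_upwards [hae, hW, hS.ae_finite] with s hs hsW hsi hst
    obtain ⟨g1, g2⟩ := hgrad s hst.1 (hs ⟨le_trans (by linarith) hst.1, hst.2⟩)
    obtain ⟨g, hg⟩ := exists_isWeakGradient (g1.trans_lt (hfin _))
    obtain ⟨k1, k2⟩ := weakPartial_of_isWeakGradient hsi.1 hg (hsW g hg)
    exact ⟨k2 (g1.trans_lt (hfin _)), (k1 _).trans g1, (k1 _).trans g2⟩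
  obtain ⟨t1, -⟩ := hgrad t (by linarith) hNt
  obtain ⟨g, hg⟩ := exists_isWeakGradient (t1.trans_lt (hfin _))
  obtain ⟨k1, k2⟩ := weakPartial_of_isWeakGradient hSt hg (hWt g hg)
  have hWt' := k2 (t1.trans_lt (hfin _))
  have hHt : ENNReal.ofReal (t ^ 1) * eLpNorm (H t) 1 +
      ENNReal.ofReal (t ^ (d + 1)) * eLpNorm (H t) ∞ ≤ N := by
    refine le_trans ?_ (le_trans (add_le_add le_add_self le_rfl) hNt)
    refine add_le_add (mul_le_mul' (ENNReal.ofReal_le_ofReal ?_) (k1 1))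
      (mul_le_mul' (ENNReal.ofReal_le_ofReal ?_) (k1 ∞))
    · linarith [pow_one t]
    · exact pow_le_pow_left₀ ht.le (by linarith) _
  have hR := weakPartial_duhamel hd h1 h2 hC hD hS hHm hI ht hconv hN (hfin _).ne hB
    (hlate.mono fun s hs hst => (hs hst).2.1) (hlate.mono fun s hs hst => (hs hst).1) hWt'
  exact ⟨_, hR, partial_estimate_at hC hD hS hHm hL hI ht hN hWt'.right.1 hB
    (hlate.mono fun s hs hst => (hs hst).2.1) (hlate.mono fun s hs hst => (hs hst).2.2) hHt rfl⟩

theorem gradNorm_le_sum {u : Sp d → ℝ} {R : Fin d → Sp d → ℝ} (hu : Integrable u)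
    (hR : ∀ j, WeakPartial j u (R j)) {p : ℝ≥0∞} (hp : 1 ≤ p) :
    gradNorm u p ≤ ∑ j, eLpNorm (R j) p :=
  (iInf₂_le _ (WeakPartial.isWeakGradient hu hR)).trans
    (eLpNorm_vecField_le hp fun j => (hR j).right.1)

theorem gradient_estimate (hd : 0 < d) (h1 : HypH1 μ) (h2 : HypH2 μ) :
    ∃ M : ℝ, 0 < M ∧ ∀ S : ℝ → Sp d → ℝ, IsSource S → ∀ᵐ t : ℝ, 1 ≤ t →
      ENNReal.ofReal t * gradNorm (duhamel μ S t) 1 +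
        ENNReal.ofReal (t ^ (d + 1)) * gradNorm (duhamel μ S t) ∞ ≤
        ENNReal.ofReal (M * Real.log (1 + t)) * normY1 S t := by
  obtain ⟨C, hC, hC'⟩ := green_kernelBound hd h1 h2
  choose D hD using fun j => dGreen_kernelBound (j := j) hd h1 h2
  have hC0 := hC.nonneg
  have hD0 := fun j => (hD j).nonneg
  have : Nonempty (Fin d) := ⟨⟨0, hd⟩⟩
  -- One summand per partial derivative: the terms without logarithm are multiplied by 2 log(1+t) ≥
  -- 1, and 5C comes from the time-integrated L¹ norm of the Green function.
  refine ⟨∑ j, (2 * (1 + D j * 2 ^ 2 + D j * 2 ^ (d + 2)) + 5 * C * (2 ^ 1 + 2 ^ (d + 1))),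
    Finset.sum_pos (fun j _ => by have := hD0 j; positivity) Finset.univ_nonempty, fun S hS => ?_⟩
  choose H hHm hW using fun j => exists_measurable_weakPartial hS.measurable j
  filter_upwards [ae_le_essSup_Icc (fun s : ℝ => eLpNorm (S s) 1 volume +
    ENNReal.ofReal (1 + s) * gradNorm (S s) 1 +
    ENNReal.ofReal ((1 + s) ^ (d + 1)) * gradNorm (S s) ∞), ae_normConv_lt_top hd h1 h2 hS,
    hS.ae_finite, ae_all_iff.2 hW] with t hself hconv hSt hWt ht
  have hL := one_le_two_mul_log ht
  have hI := lintegral_green_le hC hC' ht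
  have hae : ∀ᵐ s : ℝ, s ∈ Set.Icc 0 t → eLpNorm (S s) 1 volume +
      ENNReal.ofReal (1 + s) * gradNorm (S s) 1 +
      ENNReal.ofReal ((1 + s) ^ (d + 1)) * gradNorm (S s) ∞ ≤ normY1 S t :=
    (ae_restrict_iff' measurableSet_Icc).1 (ENNReal.ae_le_essSup _)
  have hN := hself (by linarith)
  change _ ≤ normY1 S t at hN
  generalize normY1 S t = N at hN hae
  generalize Real.log (1 + t) = L at hL hI
  have hLpos : 0 < L := by linarith
  -- If the source norm is infinite so is the right-hand side, because its other factor is positive.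
  rcases eq_or_ne N ⊤ with hNt | hNt
  · rw [hNt, ENNReal.mul_top]
    · exact le_top
    · simp only [ne_eq, ENNReal.ofReal_eq_zero, not_le]
      exact mul_pos (Finset.sum_pos (fun j _ => by have := hD0 j; positivity) Finset.univ_nonempty) hLpos
  choose R hR hRle using fun j => exists_partial_estimate hd h1 h2 hC (hD j) hS (hHm j) (hW j)
    (hWt j) (by positivity) hI hNt (by linarith) hconv hSt.1 hN hae
  have hu := (hR ⟨0, hd⟩).left
  have g1 := gradNorm_le_sum hu hR le_rfl
  have g2 := gradNorm_le_sum hu hR (p := ∞) le_top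
  have hle : ENNReal.ofReal t * gradNorm (duhamel μ S t) 1 +
      ENNReal.ofReal (t ^ (d + 1)) * gradNorm (duhamel μ S t) ∞ ≤
      ∑ j, (ENNReal.ofReal (t ^ 1) * eLpNorm (R j) 1 +
        ENNReal.ofReal (t ^ (d + 1)) * eLpNorm (R j) ∞) := by
    rw [Finset.sum_add_distrib, ← Finset.mul_sum, ← Finset.mul_sum, pow_one]
    exact add_le_add (mul_le_mul' le_rfl g1) (mul_le_mul' le_rfl g2)
  refine (hle.trans (Finset.sum_le_sum fun j _ => hRle j)).trans ?_
  rw [← Finset.sum_mul, ← ENNReal.ofReal_sum_of_nonneg fun j _ => by have := hD0 j; positivity,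
    Finset.sum_mul]
  refine mul_le_mul' (ENNReal.ofReal_le_ofReal (Finset.sum_le_sum fun j _ => ?_)) le_rfl
  have hq : 0 ≤ 1 + D j * 2 ^ 2 + D j * 2 ^ (d + 2) := by have := hD0 j; positivity
  linarith [mul_le_mul_of_nonneg_left hL hq]

end GradientEstimate

end ScreenedVlasov

end

theorem corollary2p2 (d : ℕ) (hd : 3 ≤ d) (μ : ScreenedVlasov.Sp d → ℝ)
    (h1 : ScreenedVlasov.HypH1 μ) (h2 : ScreenedVlasov.HypH2 μ) :
    ∃ M : ℝ, 0 < M ∧ ∀ S : ℝ → ScreenedVlasov.Sp d → ℝ, ScreenedVlasov.IsSource S →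
      ∃ ρ : ℝ → ScreenedVlasov.Sp d → ℝ, ScreenedVlasov.IsSolution μ S ρ ∧
        (∀ ρ' : ℝ → ScreenedVlasov.Sp d → ℝ, ScreenedVlasov.IsSolution μ S ρ' →
          ∀ᵐ t : ℝ, ρ' t =ᵐ[volume] ρ t) ∧
        ∀ᵐ t : ℝ, 1 ≤ t →
          eLpNorm (ρ t) 1 volume + ENNReal.ofReal (t ^ d) * eLpNorm (ρ t) ∞ volume ≤
              ENNReal.ofReal (M * Real.log (1 + t)) * ScreenedVlasov.normY0 S t ∧
          ENNReal.ofReal t * ScreenedVlasov.gradNorm (ρ t) 1 +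
              ENNReal.ofReal (t ^ (d + 1)) * ScreenedVlasov.gradNorm (ρ t) ∞ ≤
              ENNReal.ofReal (M * Real.log (1 + t)) * ScreenedVlasov.normY1 S t := by
  have hd' : 0 < d := by omega
  obtain ⟨M₀, hM₀, hdens⟩ := ScreenedVlasov.density_estimate hd' h1 h2
  obtain ⟨M₁, hM₁, hgrad⟩ := ScreenedVlasov.gradient_estimate hd' h1 h2
  refine ⟨M₀ + M₁, by positivity, fun S hS => ?_⟩
  have hsol := ScreenedVlasov.isSolution_duhamel hd' h1 h2 hS
  refine ⟨ScreenedVlasov.duhamel μ S, hsol, fun ρ' h' => hsol.unique h1 h', ?_⟩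
  filter_upwards [hdens S hS, hgrad S hS] with t ht₀ ht₁ ht
  have hlog : 0 ≤ Real.log (1 + t) := Real.log_nonneg (by linarith)
  exact ⟨(ht₀ ht).trans (mul_le_mul' (ENNReal.ofReal_le_ofReal (by nlinarith)) le_rfl),
    (ht₁ ht).trans (mul_le_mul' (ENNReal.ofReal_le_ofReal (by nlinarith)) le_rfl)⟩
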